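/- Let $\mathcal C$ and $\mathcal D$ be rigid C*-tensor categories (semisimple C*-tensor categories with duals and simple tensor unit), and let $\mathcal C*\mathcal D$ be their free product. It is the projection category of the category $\mathcal{NCP}$ whose objects are words $\sigma$ with letters in $\mathrm{Obj}\,\mathcal C\sqcup\mathrm{Obj}\,\mathcal D$ and whose morphism space from $\sigma$ to $\tau$ is the subspace of $\mathcal C(t(\sigma_{\mathcal C}),t(\tau_{\mathcal C}))\otimes\mathcal D(t(\sigma_{\mathcal D}),t(\tau_{\mathcal D}))$ spanned by the morphisms $Z_T$ of labelled non-crossing partitions $T$, each block of which has letters from one of the two categories only and is labelled by a morphism of that category; here $t(\sigma_{\mathcal C})$, $t(\sigma_{\mathcal D})$ are the tensor products of the letters of $\sigma$ from $\mathcal C$, respectively from $\mathcal D$. Let $\mathbf I_{\mathcal C}$ and $\mathbf I_{\mathcal D}$ be sets of representatives of the isomorphism classes of simple objects, other than the class of the tensor unit, in $\mathcal C$ and in $\mathcal D$. Take the words with letters alternatingly from $\mathbf I_{\mathcal C}$ and $\mathbf I_{\mathcal D}$ (including the empty word $\emptyset$, the tensor unit) as the set $\mathrm{Irr}(\mathcal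 C*\mathcal D)$ of representatives of the simple objects. Let $\mathbf W$ be the set of those words that have strictly positive even length and first letter in $\mathbf I_{\mathcal C}$, and let $\Lambda=\{\emptyset\}\cup\mathbf I_{\mathcal C}\cup\mathbf I_{\mathcal D}\cup\mathbf W$. For a set $\mathbf V$ of objects of $\mathcal C*\mathcal D$, the annular algebra with weight set $\mathbf V$ is $$\mathcal A\mathbf V=\bigoplus_{b,c\in\mathbf V,\ a\in\mathrm{Irr}(\mathcal C*\mathcal D)}(\mathcal C*\mathcal D)(a\otimes b,\,c\otimes a).$$ The product of $f\in(\mathcal C*\mathcal D)(a_1\otimes b_1,b_2\otimes a_1)$ and $g\in(\mathcal C*\mathcal D)(a_2\otimes b_3,b_4\otimes a_2)$ is $$f\cdot g=\delta_{b_1=b_4}\sum_{e\in\mathrm{Irr}(\mathcal C*\mathcal D)}\ \sum_{u}(1_{b_2}\otimes u^*)(f\otimes 1_{a_2})(1_{a_1}\otimes g)(u\otimes 1_{b_3}),$$ where $u$ runs over an orthonormal basis of $(\mathcal C*\mathcal D)(e,a_1\otimes a_2)$ for the inner product $v^*u=\langle u,v\rangle 1_e$, and the term of index $e$ lies in $(\mathcal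 C*\mathcal D)(e\otimes b_3,b_2\otimes e)$. The involution is $$f^\#=(R_a^*\otimes1_b\otimes1_{\bar a})(1_{\bar a}\otimes f^*\otimes1_{\bar a})(1_{\bar a}\otimes1_c\otimes\bar R_a)\qquad\text{for } f\in(\mathcal C*\mathcal D)(a\otimes b,c\otimes a),$$ where $\bar a\in\mathrm{Irr}(\mathcal C*\mathcal D)$ and $(R_a,\bar R_a)$ is a standard solution of the duality equations for $(a,\bar a)$. For $w_1,w_2\in\mathbf W$ write $w_1\sim w_2$ if $w_1=uv$ and $w_2=vu$ for some (possibly empty) words $u,v$. This is an equivalence relation; let $\mathbf W_0=\mathbf W/{\sim}$, and let $|[w]|$ be the number of elements of the class $[w]$. Then such orthonormal bases and standard solutions exist, and for every choice of them the following holds. The inclusion $\mathbf W\subset\Lambda$ identifies $\mathcal A\mathbf W$ with a direct summand of the $*$-algebra $\mathcal A\Lambda$, that is, with a two-sided $*$-ideal that has a complementary two-sided $*$-ideal. Moreover, as $*$-algebras, $$\mathcal A\mathbf W\;\cong\;\bigoplus_{[w]\in\mathbf W_0}M_{|[w]|}(\mathbb C)\otimes\mathbb C[\mathbb Z],$$ where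 the right-hand side is the algebraic direct sum and the involution of $\mathbb C[\mathbb Z]$ is given by $g^*=g^{-1}$. -/

import Mathlib

open CategoryTheory MonoidalCategory
open scoped TensorProduct DirectSum ComplexConjugate

universe v₁ v₂ u₁ u₂ v u w w'

set_option linter.unusedSectionVars false
set_option linter.unusedSimpArgs false

noncomputable section

namespace FreeTube

/-! ## Rigid C*-tensor categories -/

/-- A `ℂ`-linear `*`-category: a conjugate linear involutive contravariant functor `f ↦ f†` that
fixes objects, here on a monoidal category, compatible with `⊗`, and such that the associators
and the unitors are unitary. -/
class DaggerMonoidal (C : Type u) [Category.{v} C] [Preadditive C] [Linear ℂ C]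
    [MonoidalCategory C] where
  dag : ∀ {X Y : C}, (X ⟶ Y) → (Y ⟶ X)
  dag_dag : ∀ {X Y : C} (f : X ⟶ Y), dag (dag f) = f
  dag_comp : ∀ {X Y Z : C} (f : X ⟶ Y) (g : Y ⟶ Z), dag (f ≫ g) = dag g ≫ dag f
  dag_add : ∀ {X Y : C} (f g : X ⟶ Y), dag (f + g) = dag f + dag g
  dag_smul : ∀ {X Y : C} (c : ℂ) (f : X ⟶ Y), dag (c • f) = conj c • dag f
  dag_tensor : ∀ {X Y X' Y' : C} (f : X ⟶ Y) (g : X' ⟶ Y'), dag (f ⊗ₘ g) = dag f ⊗ₘ dag g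
  dag_associator : ∀ X Y Z : C, dag (α_ X Y Z).hom = (α_ X Y Z).inv
  dag_leftUnitor : ∀ X : C, dag (λ_ X).hom = (λ_ X).inv
  dag_rightUnitor : ∀ X : C, dag (ρ_ X).hom = (ρ_ X).inv

postfix:max "†" => DaggerMonoidal.dag

section Basic

variable {C : Type u} [Category.{v} C] [Preadditive C] [Linear ℂ C] [MonoidalCategory C]
  [DaggerMonoidal C]

theorem dag_id (X : C) : (𝟙 X)† = 𝟙 X := by
  have h := DaggerMonoidal.dag_comp ((𝟙 X)†) (𝟙 X)
  rw [Category.comp_id, DaggerMonoidal.dag_dag, Category.comp_id] at h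
  exact h.symm

theorem dag_associator_inv (X Y Z : C) : (α_ X Y Z).inv† = (α_ X Y Z).hom := by
  rw [← DaggerMonoidal.dag_associator, DaggerMonoidal.dag_dag]

theorem dag_leftUnitor_inv (X : C) : (λ_ X).inv† = (λ_ X).hom := by
  rw [← DaggerMonoidal.dag_leftUnitor, DaggerMonoidal.dag_dag]

theorem dag_rightUnitor_inv (X : C) : (ρ_ X).inv† = (ρ_ X).hom := by
  rw [← DaggerMonoidal.dag_rightUnitor, DaggerMonoidal.dag_dag]

/-- The dagger as a conjugate linear map. -/
def dagₛₗ (X Y : C) : (X ⟶ Y) →ₛₗ[starRingEnd ℂ] (Y ⟶ X) where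
  toFun f := f†
  map_add' := DaggerMonoidal.dag_add
  map_smul' := DaggerMonoidal.dag_smul

/-- `X` is simple: `C(X, X) = ℂ 1_X`, and `X` is not a zero object. -/
def IsSimpleObj (X : C) : Prop :=
  𝟙 X ≠ 0 ∧ ∀ f : X ⟶ X, ∃ c : ℂ, f = c • 𝟙 X

/-- `R : 1 ⟶ X̄ ⊗ X` and `R̄ : 1 ⟶ X ⊗ X̄` solve the duality (conjugate) equations for `X`. -/
structure IsConjugateSolution (X Xbar : C) (R : 𝟙_ C ⟶ Xbar ⊗ X) (Rbar : 𝟙_ C ⟶ X ⊗ Xbar) :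
    Prop where
  left : (λ_ X).inv ≫ Rbar ▷ X ≫ (α_ X Xbar X).hom ≫ X ◁ R† ≫ (ρ_ X).hom = 𝟙 X
  right : (ρ_ Xbar).inv ≫ Xbar ◁ Rbar ≫ (α_ Xbar X Xbar).inv ≫ R† ▷ Xbar ≫ (λ_ Xbar).hom
    = 𝟙 Xbar

variable (C)

/-- The C*-condition on a `*`-category: complete norms on the morphism spaces, submultiplicative,
with the C*-identity, and such that `f* f` is positive in the C*-algebra `C(X, X)`. -/
def IsCStarCategory : Prop :=
  ∃ N : ∀ X Y : C, (X ⟶ Y) → ℝ,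
    (∀ (X Y : C) (f : X ⟶ Y), N X Y f = 0 → f = 0) ∧
    (∀ (X Y : C) (f g : X ⟶ Y), N X Y (f + g) ≤ N X Y f + N X Y g) ∧
    (∀ (X Y : C) (c : ℂ) (f : X ⟶ Y), N X Y (c • f) = ‖c‖ * N X Y f) ∧
    (∀ (X Y : C) (s : ℕ → (X ⟶ Y)),
      (∀ ε > 0, ∃ n₀, ∀ m ≥ n₀, ∀ n ≥ n₀, N X Y (s m - s n) < ε) →
        ∃ f : X ⟶ Y, ∀ ε > 0, ∃ n₀, ∀ n ≥ n₀, N X Y (s n - f) < ε) ∧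
    (∀ (X Y Z : C) (f : X ⟶ Y) (g : Y ⟶ Z), N X Z (f ≫ g) ≤ N X Y f * N Y Z g) ∧
    (∀ (X Y : C) (f : X ⟶ Y), N X X (f ≫ f†) = N X Y f ^ 2) ∧
    (∀ (X Y : C) (f : X ⟶ Y), ∃ g : X ⟶ X, f ≫ f† = g ≫ g†)

/-- Semisimplicity: (unitary) direct sums, subobjects of (self-adjoint) projections, and every
object is a finite direct sum of simple objects. -/
structure IsSemisimpleStar : Prop where
  directSum : ∀ X Y : C, ∃ (Z : C) (s : X ⟶ Z) (t : Y ⟶ Z),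
    s ≫ s† = 𝟙 X ∧ t ≫ t† = 𝟙 Y ∧ s ≫ t† = 0 ∧ s† ≫ s + t† ≫ t = 𝟙 Z
  subobject : ∀ (X : C) (p : X ⟶ X), p ≫ p = p → p† = p →
    ∃ (Y : C) (s : Y ⟶ X), s ≫ s† = 𝟙 Y ∧ s† ≫ s = p
  decomp : ∀ X : C, ∃ (n : ℕ) (S : Fin n → C) (s : ∀ i, S i ⟶ X),
    (∀ i, IsSimpleObj (S i)) ∧ (∀ i, s i ≫ (s i)† = 𝟙 (S i)) ∧
    (∀ i j, i ≠ j → s i ≫ (s j)† = 0) ∧ ∑ i, (s i)† ≫ s i = 𝟙 X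

/-- A rigid C*-tensor category: a semisimple C*-tensor category with duals and simple unit. -/
structure IsRigidCStarTensor : Prop where
  cstar : IsCStarCategory C
  semisimple : IsSemisimpleStar C
  duals : ∀ X : C, ∃ (Xbar : C) (R : 𝟙_ C ⟶ Xbar ⊗ X) (Rbar : 𝟙_ C ⟶ X ⊗ Xbar),
    IsConjugateSolution X Xbar R Rbar
  simple_unit : IsSimpleObj (𝟙_ C)

variable {C}

/-- `I` is a set of representatives of the isomorphism classes of the simple objects that are
not isomorphic to the tensor unit. -/
structure IsNonunitIrr (I : Set C) : Prop where
  simple : ∀ a ∈ I, IsSimpleObj a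
  nonunit : ∀ a ∈ I, IsEmpty (a ≅ 𝟙_ C)
  unique : ∀ a ∈ I, ∀ b ∈ I, Nonempty (a ≅ b) → a = b
  exhaust : ∀ x : C, IsSimpleObj x → IsEmpty (x ≅ 𝟙_ C) → ∃ a ∈ I, Nonempty (x ≅ a)

end Basic

/-! ## The category with morphism spaces `C(X, Y) ⊗ D(X', Y')` -/

/-- Pairs of objects; the morphism space from `(X, X')` to `(Y, Y')` is `C(X, Y) ⊗ D(X', Y')`. -/
structure Box (C : Type u₁) (D : Type u₂) where
  fst : C
  snd : D

namespace Box

variable {C : Type u₁} [Category.{v₁} C] [Preadditive C] [Linear ℂ C]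
  {D : Type u₂} [Category.{v₂} D] [Preadditive D] [Linear ℂ D]

/-- Composition, determined by `(f ⊗ g) ≫ (f' ⊗ g') = (f ≫ f') ⊗ (g ≫ g')`. -/
def compₗ (X Y Z : Box C D) :
    (X.fst ⟶ Y.fst) ⊗[ℂ] (X.snd ⟶ Y.snd) →ₗ[ℂ] (Y.fst ⟶ Z.fst) ⊗[ℂ] (Y.snd ⟶ Z.snd) →ₗ[ℂ]
      (X.fst ⟶ Z.fst) ⊗[ℂ] (X.snd ⟶ Z.snd) :=
  TensorProduct.map₂ (Linear.comp X.fst Y.fst Z.fst) (Linear.comp X.snd Y.snd Z.snd)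

instance : Category.{max v₁ v₂} (Box C D) where
  Hom X Y := (X.fst ⟶ Y.fst) ⊗[ℂ] (X.snd ⟶ Y.snd)
  id X := 𝟙 X.fst ⊗ₜ 𝟙 X.snd
  comp {X Y Z} f g := compₗ X Y Z f g
  id_comp {X Y} f := by
    induction f using TensorProduct.induction_on with
    | zero => simp
    | tmul a b => simp [compₗ]
    | add a b ha hb => rw [map_add, ha, hb]
  comp_id {X Y} f := by
    induction f using TensorProduct.induction_on with
    | zero => simp
    | tmul a b => simp [compₗ]
    | add a b ha hb => rw [map_add, LinearMap.add_apply, ha, hb]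
  assoc {W X Y Z} f g h := by
    induction f using TensorProduct.induction_on with
    | zero => simp
    | add a b ha hb => simp only [map_add, LinearMap.add_apply, ha, hb]
    | tmul a b =>
      induction g using TensorProduct.induction_on with
      | zero => simp
      | add a b ha hb => simp only [map_add, LinearMap.add_apply, ha, hb]
      | tmul a' b' =>
        induction h using TensorProduct.induction_on with
        | zero => simp
        | add a b ha hb => simp only [map_add, ha, hb]
        | tmul a'' b'' => simp [compₗ]

/-- The morphism `f ⊗ g`. -/
def tmulHom {X Y : Box C D} (f : X.fst ⟶ Y.fst) (g : X.snd ⟶ Y.snd) : X ⟶ Y :=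
  f ⊗ₜ[ℂ] g

instance (X Y : Box C D) : AddCommGroup (X ⟶ Y) :=
  inferInstanceAs (AddCommGroup ((X.fst ⟶ Y.fst) ⊗[ℂ] (X.snd ⟶ Y.snd)))

instance (X Y : Box C D) : Module ℂ (X ⟶ Y) :=
  inferInstanceAs (Module ℂ ((X.fst ⟶ Y.fst) ⊗[ℂ] (X.snd ⟶ Y.snd)))

instance : Preadditive (Box C D) where
  add_comp X Y Z f f' g := by
    change compₗ X Y Z (f + f') g = compₗ X Y Z f g + compₗ X Y Z f' g
    rw [map_add]; rfl
  comp_add X Y Z f g g' := by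
    change compₗ X Y Z f (g + g') = compₗ X Y Z f g + compₗ X Y Z f g'
    rw [map_add]

instance : Linear ℂ (Box C D) where
  smul_comp X Y Z r f g := by
    change compₗ X Y Z (r • f) g = r • compₗ X Y Z f g
    rw [map_smul]; rfl
  comp_smul X Y Z f r g := by
    change compₗ X Y Z f (r • g) = r • compₗ X Y Z f g
    rw [map_smul]

theorem tmulHom_comp {X Y Z : Box C D} (f : X.fst ⟶ Y.fst) (g : X.snd ⟶ Y.snd)
    (f' : Y.fst ⟶ Z.fst) (g' : Y.snd ⟶ Z.snd) :
    (tmulHom f g : X ⟶ Y) ≫ (tmulHom f' g' : Y ⟶ Z) = tmulHom (f ≫ f') (g ≫ g') :=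
  rfl

theorem id_eq (X : Box C D) : 𝟙 X = tmulHom (𝟙 X.fst) (𝟙 X.snd) := rfl

theorem hom_induction {X Y : Box C D} {P : (X ⟶ Y) → Prop} (f : X ⟶ Y) (zero : P 0)
    (tmul : ∀ (a : X.fst ⟶ Y.fst) (b : X.snd ⟶ Y.snd), P (tmulHom a b))
    (add : ∀ f g, P f → P g → P (f + g)) : P f :=
  TensorProduct.induction_on (motive := P) f zero tmul add

variable [MonoidalCategory C] [MonoidalPreadditive C] [MonoidalLinear ℂ C]
  [MonoidalCategory D] [MonoidalPreadditive D] [MonoidalLinear ℂ D]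

/-- The tensor product of morphisms as a bilinear map. -/
def homTensorₗ {E : Type u} [Category.{v} E] [Preadditive E] [Linear ℂ E] [MonoidalCategory E]
    [MonoidalPreadditive E] [MonoidalLinear ℂ E] (X Y X' Y' : E) :
    (X ⟶ Y) →ₗ[ℂ] (X' ⟶ Y') →ₗ[ℂ] (X ⊗ X' ⟶ Y ⊗ Y') :=
  LinearMap.mk₂ ℂ (fun f g => f ⊗ₘ g)
    (by intros; simp [MonoidalCategory.tensorHom_def]) (by intros; simp [MonoidalCategory.tensorHom_def])
    (by intros; simp [MonoidalCategory.tensorHom_def]) (by intros; simp [MonoidalCategory.tensorHom_def])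

/-- The tensor product of morphisms, determined by
`(f ⊗ g) ⊗ (f' ⊗ g') = (f ⊗ f') ⊗ (g ⊗ g')`. -/
def tensorₗ (X Y X' Y' : Box C D) :
    (X.fst ⟶ Y.fst) ⊗[ℂ] (X.snd ⟶ Y.snd) →ₗ[ℂ] (X'.fst ⟶ Y'.fst) ⊗[ℂ] (X'.snd ⟶ Y'.snd) →ₗ[ℂ]
      (X.fst ⊗ X'.fst ⟶ Y.fst ⊗ Y'.fst) ⊗[ℂ] (X.snd ⊗ X'.snd ⟶ Y.snd ⊗ Y'.snd) :=
  TensorProduct.map₂ (homTensorₗ X.fst Y.fst X'.fst Y'.fst)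
    (homTensorₗ X.snd Y.snd X'.snd Y'.snd)

/-- A pair of isomorphisms. -/
def isoMk {X Y : Box C D} (e : X.fst ≅ Y.fst) (e' : X.snd ≅ Y.snd) : X ≅ Y where
  hom := tmulHom e.hom e'.hom
  inv := tmulHom e.inv e'.inv
  hom_inv_id := by rw [tmulHom_comp, e.hom_inv_id, e'.hom_inv_id]; rfl
  inv_hom_id := by rw [tmulHom_comp, e.inv_hom_id, e'.inv_hom_id]; rfl

instance : MonoidalCategoryStruct (Box C D) where
  tensorObj X Y := ⟨X.fst ⊗ Y.fst, X.snd ⊗ Y.snd⟩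
  tensorHom {X Y X' Y'} f g := tensorₗ X Y X' Y' f g
  whiskerLeft X {Y Y'} f := tensorₗ X X Y Y' (𝟙 X) f
  whiskerRight {X X'} f Y := tensorₗ X X' Y Y f (𝟙 Y)
  tensorUnit := ⟨𝟙_ C, 𝟙_ D⟩
  associator X Y Z := isoMk (α_ X.fst Y.fst Z.fst) (α_ X.snd Y.snd Z.snd)
  leftUnitor X := isoMk (λ_ X.fst) (λ_ X.snd)
  rightUnitor X := isoMk (ρ_ X.fst) (ρ_ X.snd)

theorem tmulHom_tensor {X Y X' Y' : Box C D} (f : X.fst ⟶ Y.fst) (g : X.snd ⟶ Y.snd)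
    (f' : X'.fst ⟶ Y'.fst) (g' : X'.snd ⟶ Y'.snd) :
    ((tmulHom f g : X ⟶ Y) ⊗ₘ (tmulHom f' g' : X' ⟶ Y')) =
      (tmulHom (f ⊗ₘ f') (g ⊗ₘ g') : X ⊗ X' ⟶ Y ⊗ Y') :=
  rfl

theorem tensor_add {X Y X' Y' : Box C D} (f : X ⟶ Y) (g g' : X' ⟶ Y') :
    f ⊗ₘ (g + g') = f ⊗ₘ g + f ⊗ₘ g' := (tensorₗ X Y X' Y' f).map_add g g'

theorem add_tensor {X Y X' Y' : Box C D} (f f' : X ⟶ Y) (g : X' ⟶ Y') :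
    (f + f') ⊗ₘ g = f ⊗ₘ g + f' ⊗ₘ g := (tensorₗ X Y X' Y').map_add₂ f f' g

theorem tensor_smul {X Y X' Y' : Box C D} (f : X ⟶ Y) (c : ℂ) (g : X' ⟶ Y') :
    f ⊗ₘ (c • g) = c • (f ⊗ₘ g) := (tensorₗ X Y X' Y' f).map_smul c g

theorem smul_tensor {X Y X' Y' : Box C D} (c : ℂ) (f : X ⟶ Y) (g : X' ⟶ Y') :
    (c • f) ⊗ₘ g = c • (f ⊗ₘ g) := (tensorₗ X Y X' Y').map_smul₂ c f g

theorem tensor_zero {X Y X' Y' : Box C D} (f : X ⟶ Y) :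
    f ⊗ₘ (0 : X' ⟶ Y') = 0 := (tensorₗ X Y X' Y' f).map_zero

theorem zero_tensor {X Y X' Y' : Box C D} (g : X' ⟶ Y') :
    (0 : X ⟶ Y) ⊗ₘ g = 0 := (tensorₗ X Y X' Y').map_zero₂ g

theorem leftUnitor_nat {E : Type u} [Category.{v} E] [MonoidalCategory E] {X Y : E} (f : X ⟶ Y) :
    (𝟙 (𝟙_ E) ⊗ₘ f) ≫ (λ_ Y).hom = (λ_ X).hom ≫ f := by simp

theorem rightUnitor_nat {E : Type u} [Category.{v} E] [MonoidalCategory E] {X Y : E}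
    (f : X ⟶ Y) : (f ⊗ₘ 𝟙 (𝟙_ E)) ≫ (ρ_ Y).hom = (ρ_ X).hom ≫ f := by simp

theorem pentagon_t {E : Type u} [Category.{v} E] [MonoidalCategory E] (W X Y Z : E) :
    ((α_ W X Y).hom ⊗ₘ 𝟙 Z) ≫ (α_ W (X ⊗ Y) Z).hom ≫ (𝟙 W ⊗ₘ (α_ X Y Z).hom) =
      (α_ (W ⊗ X) Y Z).hom ≫ (α_ W X (Y ⊗ Z)).hom := by simp

theorem triangle_t {E : Type u} [Category.{v} E] [MonoidalCategory E] (X Y : E) :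
    (α_ X (𝟙_ E) Y).hom ≫ (𝟙 X ⊗ₘ (λ_ Y).hom) = (ρ_ X).hom ⊗ₘ 𝟙 Y := by simp

instance : MonoidalCategory (Box C D) :=
  MonoidalCategory.ofTensorHom
    (id_tensorHom_id := fun X Y => by
      simp only [id_eq, tmulHom_tensor, id_tensorHom_id]; rfl)
    (id_tensorHom := fun X _ _ f => rfl)
    (tensorHom_id := fun f Y => rfl)
    (tensorHom_comp_tensorHom := fun {X₁ Y₁ Z₁ X₂ Y₂ Z₂} f₁ f₂ g₁ g₂ => by
      induction f₁ using hom_induction with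
      | zero => simp only [zero_tensor, Limits.zero_comp]
      | add f g hf hg => simp only [add_tensor, Preadditive.add_comp, hf, hg]
      | tmul a b =>
      induction f₂ using hom_induction with
      | zero => simp only [tensor_zero, Limits.zero_comp]
      | add f g hf hg => simp only [tensor_add, Preadditive.add_comp, hf, hg]
      | tmul a b =>
      induction g₁ using hom_induction with
      | zero => simp only [zero_tensor, Limits.comp_zero]
      | add f g hf hg => simp only [add_tensor, Preadditive.comp_add, hf, hg]
      | tmul a b =>
      induction g₂ using hom_induction with
      | zero => simp only [tensor_zero, Limits.comp_zero]
      | add f g hf hg => simp only [tensor_add, Preadditive.comp_add, hf, hg]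
      | tmul a b =>
        simp only [tmulHom_tensor]
        erw [tmulHom_comp]
        simp only [tensorHom_comp_tensorHom]
        rfl)
    (associator_naturality := fun f₁ f₂ f₃ => by
      induction f₁ using hom_induction with
      | zero => simp only [zero_tensor, Limits.zero_comp, Limits.comp_zero]
      | add f g hf hg => simp only [add_tensor, Preadditive.add_comp, Preadditive.comp_add, hf, hg]
      | tmul a b =>
      induction f₂ using hom_induction with
      | zero => simp only [tensor_zero, zero_tensor, Limits.zero_comp, Limits.comp_zero]
      | add f g hf hg =>
        simp only [tensor_add, add_tensor, Preadditive.add_comp, Preadditive.comp_add, hf, hg]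
      | tmul a b =>
      induction f₃ using hom_induction with
      | zero => simp only [tensor_zero, Limits.zero_comp, Limits.comp_zero]
      | add f g hf hg => simp only [tensor_add, Preadditive.add_comp, Preadditive.comp_add, hf, hg]
      | tmul a b =>
        exact congrArg₂ tmulHom (associator_naturality _ _ _) (associator_naturality _ _ _))
    (leftUnitor_naturality := fun f => by
      induction f using hom_induction with
      | zero => simp only [tensor_zero, Limits.zero_comp, Limits.comp_zero]
      | add f g hf hg => simp only [tensor_add, Preadditive.add_comp, Preadditive.comp_add, hf, hg]
      | tmul a b =>
        exact congrArg₂ tmulHom (leftUnitor_nat a) (leftUnitor_nat b))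
    (rightUnitor_naturality := fun f => by
      induction f using hom_induction with
      | zero => simp only [zero_tensor, Limits.zero_comp, Limits.comp_zero]
      | add f g hf hg => simp only [add_tensor, Preadditive.add_comp, Preadditive.comp_add, hf, hg]
      | tmul a b =>
        exact congrArg₂ tmulHom (rightUnitor_nat a) (rightUnitor_nat b))
    (pentagon := fun _ _ _ _ => congrArg₂ tmulHom (pentagon_t _ _ _ _) (pentagon_t _ _ _ _))
    (triangle := fun _ _ => congrArg₂ tmulHom (triangle_t _ _) (triangle_t _ _))

instance : MonoidalPreadditive (Box C D) where
  whiskerLeft_zero := tensor_zero _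
  zero_whiskerRight := zero_tensor _
  whiskerLeft_add := tensor_add _
  add_whiskerRight f g := add_tensor f g _

instance : MonoidalLinear ℂ (Box C D) where
  whiskerLeft_smul _ _ _ := tensor_smul _
  smul_whiskerRight c _ _ f _ := smul_tensor c f _

variable [DaggerMonoidal C] [DaggerMonoidal D]

/-- The dagger, determined by `(f ⊗ g)† = f† ⊗ g†`. -/
def boxDagₛₗ (X Y : Box C D) :
    (X.fst ⟶ Y.fst) ⊗[ℂ] (X.snd ⟶ Y.snd) →ₛₗ[starRingEnd ℂ]
      (Y.fst ⟶ X.fst) ⊗[ℂ] (Y.snd ⟶ X.snd) :=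
  TensorProduct.map (dagₛₗ X.fst Y.fst) (dagₛₗ X.snd Y.snd)

/-- The dagger as a function on morphisms. -/
def boxDag {X Y : Box C D} (f : X ⟶ Y) : Y ⟶ X := boxDagₛₗ X Y f

theorem boxDag_tmul {X Y : Box C D} (a : X.fst ⟶ Y.fst) (b : X.snd ⟶ Y.snd) :
    boxDag (tmulHom a b : X ⟶ Y) = (tmulHom a† b† : Y ⟶ X) := rfl

theorem boxDag_zero {X Y : Box C D} : boxDag (0 : X ⟶ Y) = 0 := map_zero (boxDagₛₗ X Y)

theorem boxDag_add {X Y : Box C D} (f g : X ⟶ Y) : boxDag (f + g) = boxDag f + boxDag g :=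
  map_add (boxDagₛₗ X Y) f g

instance : DaggerMonoidal (Box C D) where
  dag f := boxDag f
  dag_dag {X Y} f := by
    induction f using hom_induction with
    | zero => simp only [boxDag_zero]
    | add f g hf hg => simp only [boxDag_add, hf, hg]
    | tmul a b => simp only [boxDag_tmul, DaggerMonoidal.dag_dag]
  dag_add f g := boxDag_add f g
  dag_smul {X Y} c f := (boxDagₛₗ X Y).map_smulₛₗ c f
  dag_comp {X Y Z} f g := by
    induction f using hom_induction with
    | zero => simp only [boxDag_zero, Limits.zero_comp, Limits.comp_zero]
    | add f g hf hg => simp only [boxDag_add, Preadditive.add_comp, Preadditive.comp_add, hf, hg]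
    | tmul a b =>
    induction g using hom_induction with
    | zero => simp only [boxDag_zero, Limits.zero_comp, Limits.comp_zero]
    | add f g hf hg => simp only [boxDag_add, Preadditive.add_comp, Preadditive.comp_add, hf, hg]
    | tmul a b => simp only [tmulHom_comp, boxDag_tmul, DaggerMonoidal.dag_comp]
  dag_tensor {X Y X' Y'} f g := by
    induction f using hom_induction with
    | zero => simp only [boxDag_zero, zero_tensor]
    | add f g hf hg => simp only [boxDag_add, add_tensor, hf, hg]
    | tmul a b =>
    induction g using hom_induction with
    | zero => simp only [boxDag_zero, tensor_zero]
    | add f g hf hg => simp only [boxDag_add, tensor_add, hf, hg]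
    | tmul a' b' =>
      exact congrArg₂ tmulHom (DaggerMonoidal.dag_tensor a a') (DaggerMonoidal.dag_tensor b b')
  dag_associator X Y Z :=
    congrArg₂ tmulHom (DaggerMonoidal.dag_associator _ _ _) (DaggerMonoidal.dag_associator _ _ _)
  dag_leftUnitor X :=
    congrArg₂ tmulHom (DaggerMonoidal.dag_leftUnitor _) (DaggerMonoidal.dag_leftUnitor _)
  dag_rightUnitor X :=
    congrArg₂ tmulHom (DaggerMonoidal.dag_rightUnitor _) (DaggerMonoidal.dag_rightUnitor _)

end Box

/-! ## Words and non-crossing partitions -/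

/-- Bracketed words whose letters are objects of `C` or of `D`. (The categories are not assumed
to be strict, so a word comes with a bracketing; `empty` is the empty word and `append` is
concatenation.) -/
inductive Word (C : Type u₁) (D : Type u₂) where
  | empty : Word C D
  | letter : C ⊕ D → Word C D
  | append : Word C D → Word C D → Word C D

namespace Word

/-- All letters come from `C`. -/
def AllLeft {C : Type u₁} {D : Type u₂} : Word C D → Prop
  | empty => True
  | letter s => s.isLeft
  | append σ τ => σ.AllLeft ∧ τ.AllLeft

/-- All letters come from `D`. -/
def AllRight {C : Type u₁} {D : Type u₂} : Word C D → Prop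
  | empty => True
  | letter s => s.isRight
  | append σ τ => σ.AllRight ∧ τ.AllRight

/-- The word with the given list of letters. -/
def ofList {C : Type u₁} {D : Type u₂} (l : List (C ⊕ D)) : Word C D :=
  l.foldr (fun s σ => (Word.letter s).append σ) Word.empty

variable {C : Type u₁} [Category.{v₁} C] [Preadditive C] [Linear ℂ C]
  [MonoidalCategory C] [MonoidalPreadditive C] [MonoidalLinear ℂ C] [DaggerMonoidal C]
  {D : Type u₂} [Category.{v₂} D] [Preadditive D] [Linear ℂ D]
  [MonoidalCategory D] [MonoidalPreadditive D] [MonoidalLinear ℂ D] [DaggerMonoidal D]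

/-- The pair `(t(σ₊), t(σ₋))` of the tensor product in `C` of the letters of `σ` from `C` and the
tensor product in `D` of the letters of `σ` from `D`, in the order in which they occur. -/
def eval : Word C D → Box C D
  | empty => 𝟙_ (Box C D)
  | letter (Sum.inl a) => ⟨a, 𝟙_ D⟩
  | letter (Sum.inr b) => ⟨𝟙_ C, b⟩
  | append σ τ => σ.eval ⊗ τ.eval

/-- If all letters come from `C`, the `D`-component is a tensor product of units. -/
def unitRight : (σ : Word C D) → σ.AllLeft → (σ.eval.snd ≅ 𝟙_ D)
  | empty, _ => Iso.refl _
  | letter (Sum.inl _), _ => Iso.refl _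
  | letter (Sum.inr _), h => absurd h (by simp [AllLeft])
  | append σ τ, h => (σ.unitRight h.1 ⊗ᵢ τ.unitRight h.2) ≪≫ λ_ (𝟙_ D)

/-- If all letters come from `D`, the `C`-component is a tensor product of units. -/
def unitLeft : (σ : Word C D) → σ.AllRight → (σ.eval.fst ≅ 𝟙_ C)
  | empty, _ => Iso.refl _
  | letter (Sum.inl _), h => absurd h (by simp [AllRight])
  | letter (Sum.inr _), _ => Iso.refl _
  | append σ τ, h => (σ.unitLeft h.1 ⊗ᵢ τ.unitLeft h.2) ≪≫ λ_ (𝟙_ C)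

theorem dag_unitRight : ∀ (σ : Word C D) (h : σ.AllLeft),
    (σ.unitRight h).hom† = (σ.unitRight h).inv
  | empty, _ => dag_id _
  | letter (Sum.inl _), _ => dag_id _
  | letter (Sum.inr _), h => absurd h (by simp [AllLeft])
  | append σ τ, h => by
    simp only [unitRight, Iso.trans_hom, Iso.trans_inv, tensorIso_hom, tensorIso_inv]
    erw [DaggerMonoidal.dag_comp, DaggerMonoidal.dag_tensor, dag_unitRight σ h.1,
      dag_unitRight τ h.2, DaggerMonoidal.dag_leftUnitor]
    rfl

theorem dag_unitLeft : ∀ (σ : Word C D) (h : σ.AllRight),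
    (σ.unitLeft h).hom† = (σ.unitLeft h).inv
  | empty, _ => dag_id _
  | letter (Sum.inr _), _ => dag_id _
  | letter (Sum.inl _), h => absurd h (by simp [AllRight])
  | append σ τ, h => by
    simp only [unitLeft, Iso.trans_hom, Iso.trans_inv, tensorIso_hom, tensorIso_inv]
    erw [DaggerMonoidal.dag_comp, DaggerMonoidal.dag_tensor, dag_unitLeft σ h.1,
      dag_unitLeft τ h.2, DaggerMonoidal.dag_leftUnitor]
    rfl

end Word

/-- The objects of the category `NCP`: words, with morphism spaces `NCP(σ, τ)` (defined below). -/
structure NCPCat (C : Type u₁) (D : Type u₂) where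
  word : Word C D

section NCP

variable {C : Type u₁} [Category.{v₁} C] [Preadditive C] [Linear ℂ C]
  [MonoidalCategory C] [MonoidalPreadditive C] [MonoidalLinear ℂ C] [DaggerMonoidal C]
  {D : Type u₂} [Category.{v₂} D] [Preadditive D] [Linear ℂ D]
  [MonoidalCategory D] [MonoidalPreadditive D] [MonoidalLinear ℂ D] [DaggerMonoidal D]

/-- Labelled non-crossing partition diagrams in a rectangle, with the word `σ` along the bottom
and the word `τ` along the top. A diagram is built from single blocks by vertical stacking and
horizontal juxtaposition (every planar diagram can be sliced in this way). A single block has its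
letters from `C` only, or from `D` only, and is labelled by a morphism of that category from the
tensor product of its bottom letters to the tensor product of its top letters. The remaining
constructors are vertical strings, possibly with a change of bracketing. -/
inductive NCDiagram : Word C D → Word C D → Type (max u₁ u₂ v₁ v₂)
  | blockC (σ τ : Word C D) (hσ : σ.AllLeft) (hτ : τ.AllLeft) (f : σ.eval.fst ⟶ τ.eval.fst) :
      NCDiagram σ τ
  | blockD (σ τ : Word C D) (hσ : σ.AllRight) (hτ : τ.AllRight) (f : σ.eval.snd ⟶ τ.eval.snd) :
      NCDiagram σ τ
  | strings (σ : Word C D) : NCDiagram σ σ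
  | stack {σ τ κ : Word C D} : NCDiagram σ τ → NCDiagram τ κ → NCDiagram σ κ
  | juxtapose {σ τ σ' τ' : Word C D} : NCDiagram σ τ → NCDiagram σ' τ' →
      NCDiagram (σ.append σ') (τ.append τ')
  | assoc (σ τ κ : Word C D) : NCDiagram ((σ.append τ).append κ) (σ.append (τ.append κ))
  | assocInv (σ τ κ : Word C D) : NCDiagram (σ.append (τ.append κ)) ((σ.append τ).append κ)
  | unitL (σ : Word C D) : NCDiagram (Word.empty.append σ) σ
  | unitLInv (σ : Word C D) : NCDiagram σ (Word.empty.append σ)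
  | unitR (σ : Word C D) : NCDiagram (σ.append Word.empty) σ
  | unitRInv (σ : Word C D) : NCDiagram σ (σ.append Word.empty)

namespace NCDiagram

/-- The morphism `Z_T ∈ C(t(σ₊), t(τ₊)) ⊗ D(t(σ₋), t(τ₋))` of a diagram `T`. -/
def Z : {σ τ : Word C D} → NCDiagram σ τ → (σ.eval ⟶ τ.eval)
  | _, _, blockC σ τ hσ hτ f => Box.tmulHom f ((σ.unitRight hσ).hom ≫ (τ.unitRight hτ).inv)
  | _, _, blockD σ τ hσ hτ f => Box.tmulHom ((σ.unitLeft hσ).hom ≫ (τ.unitLeft hτ).inv) f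
  | _, _, strings σ => 𝟙 σ.eval
  | _, _, stack S T => S.Z ≫ T.Z
  | _, _, juxtapose S T => S.Z ⊗ₘ T.Z
  | _, _, assoc σ τ κ => (α_ σ.eval τ.eval κ.eval).hom
  | _, _, assocInv σ τ κ => (α_ σ.eval τ.eval κ.eval).inv
  | _, _, unitL σ => (λ_ σ.eval).hom
  | _, _, unitLInv σ => (λ_ σ.eval).inv
  | _, _, unitR σ => (ρ_ σ.eval).hom
  | _, _, unitRInv σ => (ρ_ σ.eval).inv

/-- Reflection in a horizontal line, the labels being replaced by their adjoints. -/
def reflect : {σ τ : Word C D} → NCDiagram σ τ → NCDiagram τ σ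
  | _, _, blockC σ τ hσ hτ f => blockC τ σ hτ hσ f†
  | _, _, blockD σ τ hσ hτ f => blockD τ σ hτ hσ f†
  | _, _, strings σ => strings σ
  | _, _, stack S T => stack T.reflect S.reflect
  | _, _, juxtapose S T => juxtapose S.reflect T.reflect
  | _, _, assoc σ τ κ => assocInv σ τ κ
  | _, _, assocInv σ τ κ => assoc σ τ κ
  | _, _, unitL σ => unitLInv σ
  | _, _, unitLInv σ => unitL σ
  | _, _, unitR σ => unitRInv σ
  | _, _, unitRInv σ => unitR σ

theorem Z_reflect : ∀ {σ τ : Word C D} (T : NCDiagram σ τ), T.reflect.Z = T.Z†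
  | _, _, blockC σ τ hσ hτ f => by
    have h : ((σ.unitRight hσ).hom ≫ (τ.unitRight hτ).inv)† =
        (τ.unitRight hτ).hom ≫ (σ.unitRight hσ).inv := by
      rw [DaggerMonoidal.dag_comp, Word.dag_unitRight, ← Word.dag_unitRight τ,
        DaggerMonoidal.dag_dag]
    exact congrArg (fun g => Box.tmulHom f† g) h.symm
  | _, _, blockD σ τ hσ hτ f => by
    have h : ((σ.unitLeft hσ).hom ≫ (τ.unitLeft hτ).inv)† =
        (τ.unitLeft hτ).hom ≫ (σ.unitLeft hσ).inv := by
      rw [DaggerMonoidal.dag_comp, Word.dag_unitLeft, ← Word.dag_unitLeft τ,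
        DaggerMonoidal.dag_dag]
    exact congrArg (fun g => Box.tmulHom g f†) h.symm
  | _, _, strings σ => (dag_id _).symm
  | _, _, stack S T => by
    simp only [reflect, Z, Z_reflect S, Z_reflect T, DaggerMonoidal.dag_comp]
  | _, _, juxtapose S T => by
    simp only [reflect, Z, Z_reflect S, Z_reflect T]
    exact (DaggerMonoidal.dag_tensor _ _).symm
  | _, _, assoc σ τ κ => (DaggerMonoidal.dag_associator _ _ _).symm
  | _, _, assocInv σ τ κ => (dag_associator_inv _ _ _).symm
  | _, _, unitL σ => (DaggerMonoidal.dag_leftUnitor _).symm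
  | _, _, unitLInv σ => (dag_leftUnitor_inv _).symm
  | _, _, unitR σ => (DaggerMonoidal.dag_rightUnitor _).symm
  | _, _, unitRInv σ => (dag_rightUnitor_inv _).symm

end NCDiagram

/-- `NCP(σ, τ) = span {Z_T}`. -/
def ncpHom (σ τ : Word C D) : Submodule ℂ (σ.eval ⟶ τ.eval) :=
  Submodule.span ℂ (Set.range fun T : NCDiagram σ τ => T.Z)

theorem ncpHom_Z {σ τ : Word C D} (T : NCDiagram σ τ) : T.Z ∈ ncpHom σ τ :=
  Submodule.subset_span ⟨T, rfl⟩

theorem ncpHom_comp {σ τ κ : Word C D} {f : σ.eval ⟶ τ.eval} {g : τ.eval ⟶ κ.eval}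
    (hf : f ∈ ncpHom σ τ) (hg : g ∈ ncpHom τ κ) : f ≫ g ∈ ncpHom σ κ := by
  induction hf using Submodule.span_induction with
  | zero => rw [Limits.zero_comp]; exact zero_mem _
  | add a b _ _ ha hb => rw [Preadditive.add_comp]; exact add_mem ha hb
  | smul c a _ ha => rw [Linear.smul_comp]; exact Submodule.smul_mem _ c ha
  | mem a h =>
    obtain ⟨S, rfl⟩ := h
    induction hg using Submodule.span_induction with
    | zero => rw [Limits.comp_zero]; exact zero_mem _
    | add a b _ _ ha hb => rw [Preadditive.comp_add]; exact add_mem ha hb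
    | smul c a _ ha => rw [Linear.comp_smul]; exact Submodule.smul_mem _ c ha
    | mem b h =>
      obtain ⟨T, rfl⟩ := h
      exact ncpHom_Z (S.stack T)

theorem ncpHom_tensor {σ τ σ' τ' : Word C D} {f : σ.eval ⟶ τ.eval} {g : σ'.eval ⟶ τ'.eval}
    (hf : f ∈ ncpHom σ τ) (hg : g ∈ ncpHom σ' τ') :
    (f ⊗ₘ g : (σ.append σ').eval ⟶ (τ.append τ').eval) ∈
      ncpHom (σ.append σ') (τ.append τ') := by
  induction hf using Submodule.span_induction with
  | zero => rw [Box.zero_tensor]; exact zero_mem _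
  | add a b _ _ ha hb => rw [Box.add_tensor]; exact add_mem ha hb
  | smul c a _ ha => rw [Box.smul_tensor]; exact Submodule.smul_mem _ c ha
  | mem a h =>
    obtain ⟨S, rfl⟩ := h
    induction hg using Submodule.span_induction with
    | zero => rw [Box.tensor_zero]; exact zero_mem _
    | add a b _ _ ha hb => rw [Box.tensor_add]; exact add_mem ha hb
    | smul c a _ ha => rw [Box.tensor_smul]; exact Submodule.smul_mem _ c ha
    | mem b h =>
      obtain ⟨T, rfl⟩ := h
      exact ncpHom_Z (S.juxtapose T)

theorem ncpHom_dag {σ τ : Word C D} {f : σ.eval ⟶ τ.eval} (hf : f ∈ ncpHom σ τ) :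
    f† ∈ ncpHom τ σ := by
  induction hf using Submodule.span_induction with
  | zero =>
    have h : (0 : σ.eval ⟶ τ.eval)† = 0 := map_zero (dagₛₗ σ.eval τ.eval)
    rw [h]; exact zero_mem _
  | add a b _ _ ha hb => rw [DaggerMonoidal.dag_add]; exact add_mem ha hb
  | smul c a _ ha => rw [DaggerMonoidal.dag_smul]; exact Submodule.smul_mem _ _ ha
  | mem a h =>
    obtain ⟨T, rfl⟩ := h
    change T.Z† ∈ _
    rw [← T.Z_reflect]; exact ncpHom_Z T.reflect

/-! ### The category `NCP` -/

namespace NCPCat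

instance : Category.{max v₁ v₂} (NCPCat C D) where
  Hom X Y := ncpHom X.word Y.word
  id X := ⟨𝟙 X.word.eval, ncpHom_Z (NCDiagram.strings X.word)⟩
  comp f g := ⟨f.1 ≫ g.1, ncpHom_comp f.2 g.2⟩
  id_comp f := Subtype.ext (Category.id_comp f.1)
  comp_id f := Subtype.ext (Category.comp_id f.1)
  assoc f g h := Subtype.ext (Category.assoc f.1 g.1 h.1)

instance (X Y : NCPCat C D) : AddCommGroup (X ⟶ Y) :=
  inferInstanceAs (AddCommGroup (ncpHom X.word Y.word))

instance (X Y : NCPCat C D) : Module ℂ (X ⟶ Y) :=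
  inferInstanceAs (Module ℂ (ncpHom X.word Y.word))

theorem comp_val {X Y Z : NCPCat C D} (f : X ⟶ Y) (g : Y ⟶ Z) : (f ≫ g).1 = f.1 ≫ g.1 := rfl

theorem add_val {X Y : NCPCat C D} (f g : X ⟶ Y) : (f + g).1 = f.1 + g.1 := rfl

theorem smul_val {X Y : NCPCat C D} (c : ℂ) (f : X ⟶ Y) : (c • f).1 = c • f.1 := rfl

instance : Preadditive (NCPCat C D) where
  add_comp X Y Z f f' g := Subtype.ext <| by
    rw [add_val, comp_val, comp_val, comp_val, add_val, Preadditive.add_comp]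
  comp_add X Y Z f g g' := Subtype.ext <| by
    rw [add_val, comp_val, comp_val, comp_val, add_val, Preadditive.comp_add]

instance : Linear ℂ (NCPCat C D) where
  smul_comp X Y Z r f g := Subtype.ext <| by
    rw [smul_val, comp_val, comp_val, smul_val, Linear.smul_comp]
  comp_smul X Y Z f r g := Subtype.ext <| by
    rw [smul_val, comp_val, comp_val, smul_val, Linear.comp_smul]

/-- The faithful functor from `NCP` to the category of pairs. -/
def toBox : NCPCat C D ⥤ Box C D where
  obj X := X.word.eval
  map f := f.1

instance : (toBox (C := C) (D := D)).Faithful where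
  map_injective h := Subtype.ext h

/-- Two mutually inverse diagrams give an isomorphism. -/
def isoOfDiagrams {X Y : NCPCat C D} (S : NCDiagram X.word Y.word) (T : NCDiagram Y.word X.word)
    (h : S.Z ≫ T.Z = 𝟙 _) (h' : T.Z ≫ S.Z = 𝟙 _) : X ≅ Y where
  hom := ⟨S.Z, ncpHom_Z S⟩
  inv := ⟨T.Z, ncpHom_Z T⟩
  hom_inv_id := Subtype.ext h
  inv_hom_id := Subtype.ext h'

instance : MonoidalCategoryStruct (NCPCat C D) where
  tensorObj X Y := ⟨X.word.append Y.word⟩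
  tensorHom f g := ⟨f.1 ⊗ₘ g.1, ncpHom_tensor f.2 g.2⟩
  whiskerLeft X {_ _} f := ⟨𝟙 X.word.eval ⊗ₘ f.1,
    ncpHom_tensor (ncpHom_Z (NCDiagram.strings X.word)) f.2⟩
  whiskerRight f Y := ⟨f.1 ⊗ₘ 𝟙 Y.word.eval,
    ncpHom_tensor f.2 (ncpHom_Z (NCDiagram.strings Y.word))⟩
  tensorUnit := ⟨Word.empty⟩
  associator X Y Z := isoOfDiagrams (.assoc X.word Y.word Z.word) (.assocInv X.word Y.word Z.word)
    (Iso.hom_inv_id _) (Iso.inv_hom_id _)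
  leftUnitor X := isoOfDiagrams (.unitL X.word) (.unitLInv X.word)
    (Iso.hom_inv_id _) (Iso.inv_hom_id _)
  rightUnitor X := isoOfDiagrams (.unitR X.word) (.unitRInv X.word)
    (Iso.hom_inv_id _) (Iso.inv_hom_id _)

instance : MonoidalCategory (NCPCat C D) :=
  MonoidalCategory.ofTensorHom
    (id_tensorHom_id := fun _ _ => Subtype.ext (MonoidalCategory.id_tensorHom_id _ _))
    (id_tensorHom := fun _ _ _ _ => rfl)
    (tensorHom_id := fun _ _ => rfl)
    (tensorHom_comp_tensorHom := fun f₁ f₂ g₁ g₂ =>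
      Subtype.ext (MonoidalCategory.tensorHom_comp_tensorHom f₁.1 f₂.1 g₁.1 g₂.1))
    (associator_naturality := fun f₁ f₂ f₃ =>
      Subtype.ext (MonoidalCategory.associator_naturality f₁.1 f₂.1 f₃.1))
    (leftUnitor_naturality := fun f => Subtype.ext (Box.leftUnitor_nat f.1))
    (rightUnitor_naturality := fun f => Subtype.ext (Box.rightUnitor_nat f.1))
    (pentagon := fun _ _ _ _ => Subtype.ext (Box.pentagon_t _ _ _ _))
    (triangle := fun _ _ => Subtype.ext (Box.triangle_t _ _))

instance : MonoidalPreadditive (NCPCat C D) where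
  whiskerLeft_zero := Subtype.ext (Box.tensor_zero _)
  zero_whiskerRight := Subtype.ext (Box.zero_tensor _)
  whiskerLeft_add f g := Subtype.ext (Box.tensor_add _ f.1 g.1)
  add_whiskerRight f g := Subtype.ext (Box.add_tensor f.1 g.1 _)

instance : MonoidalLinear ℂ (NCPCat C D) where
  whiskerLeft_smul _ _ _ c f := Subtype.ext (Box.tensor_smul _ c f.1)
  smul_whiskerRight c _ _ f _ := Subtype.ext (Box.smul_tensor c f.1 _)

instance : DaggerMonoidal (NCPCat C D) where
  dag f := ⟨f.1†, ncpHom_dag f.2⟩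
  dag_dag f := Subtype.ext (DaggerMonoidal.dag_dag f.1)
  dag_comp f g := Subtype.ext (DaggerMonoidal.dag_comp f.1 g.1)
  dag_add f g := Subtype.ext (DaggerMonoidal.dag_add f.1 g.1)
  dag_smul c f := Subtype.ext (DaggerMonoidal.dag_smul c f.1)
  dag_tensor f g := Subtype.ext (DaggerMonoidal.dag_tensor f.1 g.1)
  dag_associator _ _ _ := Subtype.ext (DaggerMonoidal.dag_associator _ _ _)
  dag_leftUnitor _ := Subtype.ext (DaggerMonoidal.dag_leftUnitor _)
  dag_rightUnitor _ := Subtype.ext (DaggerMonoidal.dag_rightUnitor _)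

end NCPCat

end NCP

/-! ## The projection category -/

/-- An object of the projection category of `E`: an object of `E` with a projection on it. -/
structure ProjCat (E : Type u) [Category.{v} E] [Preadditive E] [Linear ℂ E]
    [MonoidalCategory E] [DaggerMonoidal E] where
  obj : E
  p : obj ⟶ obj
  idem : p ≫ p = p
  selfadj : p† = p

namespace ProjCat

variable {E : Type u} [Category.{v} E] [Preadditive E] [Linear ℂ E] [MonoidalCategory E]
  [DaggerMonoidal E]

/-- The space `q ∘ E(X, Y) ∘ p` of morphisms from `(X, p)` to `(Y, q)`. -/
def homSub (X Y : ProjCat E) : Submodule ℂ (X.obj ⟶ Y.obj) where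
  carrier := {f | X.p ≫ f ≫ Y.p = f}
  zero_mem' := by simp
  add_mem' {f g} hf hg := by
    simp only [Set.mem_ofPred_eq, Preadditive.add_comp, Preadditive.comp_add] at hf hg ⊢
    rw [hf, hg]
  smul_mem' c f hf := by
    simp only [Set.mem_ofPred_eq, Linear.smul_comp, Linear.comp_smul] at hf ⊢
    rw [hf]

theorem mem_homSub {X Y : ProjCat E} {f : X.obj ⟶ Y.obj} :
    f ∈ homSub X Y ↔ X.p ≫ f ≫ Y.p = f := Iff.rfl

theorem p_comp {X Y : ProjCat E} {f : X.obj ⟶ Y.obj} (hf : f ∈ homSub X Y) : X.p ≫ f = f := by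
  rw [mem_homSub] at hf
  rw [← hf, ← Category.assoc, X.idem]

theorem comp_p {X Y : ProjCat E} {f : X.obj ⟶ Y.obj} (hf : f ∈ homSub X Y) : f ≫ Y.p = f := by
  rw [mem_homSub] at hf
  rw [← hf, Category.assoc, Category.assoc, Y.idem]

theorem mem_homSub_of {X Y : ProjCat E} {f : X.obj ⟶ Y.obj} (h : X.p ≫ f = f)
    (h' : f ≫ Y.p = f) : f ∈ homSub X Y := by
  rw [mem_homSub, h', h]

instance : Category.{v} (ProjCat E) where
  Hom X Y := homSub X Y
  id X := ⟨X.p, mem_homSub_of X.idem X.idem⟩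
  comp f g := ⟨f.1 ≫ g.1, mem_homSub_of (by rw [← Category.assoc, p_comp f.2])
    (by rw [Category.assoc, comp_p g.2])⟩
  id_comp f := Subtype.ext (p_comp f.2)
  comp_id f := Subtype.ext (comp_p f.2)
  assoc f g h := Subtype.ext (Category.assoc f.1 g.1 h.1)

instance (X Y : ProjCat E) : AddCommGroup (X ⟶ Y) := inferInstanceAs (AddCommGroup (homSub X Y))

instance (X Y : ProjCat E) : Module ℂ (X ⟶ Y) := inferInstanceAs (Module ℂ (homSub X Y))

instance : Preadditive (ProjCat E) where
  add_comp X Y Z f f' g := Subtype.ext (Preadditive.add_comp _ _ _ f.1 f'.1 g.1)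
  comp_add X Y Z f g g' := Subtype.ext (Preadditive.comp_add _ _ _ f.1 g.1 g'.1)

instance : Linear ℂ (ProjCat E) where
  smul_comp X Y Z r f g := Subtype.ext (Linear.smul_comp _ _ _ r f.1 g.1)
  comp_smul X Y Z f r g := Subtype.ext (Linear.comp_smul _ _ _ f.1 r g.1)

theorem tensor_mem {X Y X' Y' : ProjCat E} {f : X.obj ⟶ Y.obj} {g : X'.obj ⟶ Y'.obj}
    (hf : f ∈ homSub X Y) (hg : g ∈ homSub X' Y') :
    (X.p ⊗ₘ X'.p) ≫ (f ⊗ₘ g) = f ⊗ₘ g ∧ (f ⊗ₘ g) ≫ (Y.p ⊗ₘ Y'.p) = f ⊗ₘ g :=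
  ⟨by rw [MonoidalCategory.tensorHom_comp_tensorHom, p_comp hf, p_comp hg],
   by rw [MonoidalCategory.tensorHom_comp_tensorHom, comp_p hf, comp_p hg]⟩

/-- An isomorphism of `E` that intertwines the projections. -/
def isoMk {X Y : ProjCat E} (e : X.obj ≅ Y.obj) (h : X.p ≫ e.hom = e.hom ≫ Y.p) : X ≅ Y where
  hom := ⟨X.p ≫ e.hom, mem_homSub_of (by rw [← Category.assoc, X.idem])
    (by rw [h, Category.assoc, Y.idem])⟩
  inv := ⟨e.inv ≫ X.p, mem_homSub_of
    (by rw [← Category.assoc, ← e.inv_hom_id_assoc Y.p, ← h]; simp [X.idem])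
    (by rw [Category.assoc, X.idem])⟩
  hom_inv_id := Subtype.ext (by
    change (X.p ≫ e.hom) ≫ e.inv ≫ X.p = X.p
    simp [X.idem])
  inv_hom_id := Subtype.ext (by
    change (e.inv ≫ X.p) ≫ X.p ≫ e.hom = Y.p
    rw [Category.assoc, ← Category.assoc X.p, X.idem, h, e.inv_hom_id_assoc])

theorem absorb {U V W : E} {P : U ⟶ U} {θ : U ⟶ V} {Q : V ⟶ V} {φ : V ⟶ W}
    (hP : P ≫ P = P) (h : P ≫ θ = θ ≫ Q) : (P ≫ θ) ≫ (Q ≫ φ) = P ≫ (θ ≫ φ) := by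
  rw [Category.assoc, ← Category.assoc θ, ← h, Category.assoc, ← Category.assoc P, hP]

instance : MonoidalCategoryStruct (ProjCat E) where
  tensorObj X Y := ⟨X.obj ⊗ Y.obj, X.p ⊗ₘ Y.p,
    by rw [MonoidalCategory.tensorHom_comp_tensorHom, X.idem, Y.idem],
    by rw [DaggerMonoidal.dag_tensor, X.selfadj, Y.selfadj]⟩
  tensorHom f g := ⟨f.1 ⊗ₘ g.1, mem_homSub_of (tensor_mem f.2 g.2).1 (tensor_mem f.2 g.2).2⟩
  whiskerLeft X {Y Y'} f := ⟨X.p ⊗ₘ f.1,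
    mem_homSub_of (tensor_mem (𝟙 X : X ⟶ X).2 f.2).1 (tensor_mem (𝟙 X : X ⟶ X).2 f.2).2⟩
  whiskerRight f Y := ⟨f.1 ⊗ₘ Y.p,
    mem_homSub_of (tensor_mem f.2 (𝟙 Y : Y ⟶ Y).2).1 (tensor_mem f.2 (𝟙 Y : Y ⟶ Y).2).2⟩
  tensorUnit := ⟨𝟙_ E, 𝟙 _, Category.id_comp _, dag_id _⟩
  associator X Y Z := isoMk (α_ X.obj Y.obj Z.obj)
    (MonoidalCategory.associator_naturality X.p Y.p Z.p)
  leftUnitor X := isoMk (λ_ X.obj) (Box.leftUnitor_nat X.p)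
  rightUnitor X := isoMk (ρ_ X.obj) (Box.rightUnitor_nat X.p)

instance : MonoidalCategory (ProjCat E) :=
  MonoidalCategory.ofTensorHom
    (id_tensorHom_id := fun X Y => rfl)
    (id_tensorHom := fun _ _ _ _ => rfl)
    (tensorHom_id := fun _ _ => rfl)
    (tensorHom_comp_tensorHom := fun f₁ f₂ g₁ g₂ =>
      Subtype.ext (MonoidalCategory.tensorHom_comp_tensorHom f₁.1 f₂.1 g₁.1 g₂.1))
    (associator_naturality := fun {X₁ X₂ X₃ Y₁ Y₂ Y₃} f₁ f₂ f₃ => Subtype.ext (by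
      change ((f₁.1 ⊗ₘ f₂.1) ⊗ₘ f₃.1) ≫ ((Y₁.p ⊗ₘ Y₂.p) ⊗ₘ Y₃.p) ≫ (α_ _ _ _).hom =
        (((X₁.p ⊗ₘ X₂.p) ⊗ₘ X₃.p) ≫ (α_ _ _ _).hom) ≫ (f₁.1 ⊗ₘ f₂.1 ⊗ₘ f₃.1)
      rw [Category.assoc, ← MonoidalCategory.associator_naturality, ← Category.assoc,
        ← Category.assoc]
      simp only [MonoidalCategory.tensorHom_comp_tensorHom, p_comp f₁.2, p_comp f₂.2,
        p_comp f₃.2, comp_p f₁.2, comp_p f₂.2, comp_p f₃.2]))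
    (leftUnitor_naturality := fun {X Y} f => Subtype.ext (by
      change (𝟙 (𝟙_ E) ⊗ₘ f.1) ≫ (𝟙 (𝟙_ E) ⊗ₘ Y.p) ≫ (λ_ _).hom =
        ((𝟙 (𝟙_ E) ⊗ₘ X.p) ≫ (λ_ _).hom) ≫ f.1
      rw [Box.leftUnitor_nat, Box.leftUnitor_nat, ← Category.assoc, Box.leftUnitor_nat,
        Category.assoc, Category.assoc, p_comp f.2, comp_p f.2]))
    (rightUnitor_naturality := fun {X Y} f => Subtype.ext (by
      change (f.1 ⊗ₘ 𝟙 (𝟙_ E)) ≫ (Y.p ⊗ₘ 𝟙 (𝟙_ E)) ≫ (ρ_ _).hom =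
        ((X.p ⊗ₘ 𝟙 (𝟙_ E)) ≫ (ρ_ _).hom) ≫ f.1
      rw [Box.rightUnitor_nat, Box.rightUnitor_nat, ← Category.assoc, Box.rightUnitor_nat,
        Category.assoc, Category.assoc, p_comp f.2, comp_p f.2]))
    (pentagon := fun W X Y Z => Subtype.ext (by
      change (((((W.p ⊗ₘ X.p) ⊗ₘ Y.p) ≫ (α_ _ _ _).hom) ⊗ₘ Z.p) ≫
        (((W.p ⊗ₘ (X.p ⊗ₘ Y.p)) ⊗ₘ Z.p) ≫ (α_ _ _ _).hom) ≫
          (W.p ⊗ₘ (((X.p ⊗ₘ Y.p) ⊗ₘ Z.p) ≫ (α_ _ _ _).hom))) =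
        ((((W.p ⊗ₘ X.p) ⊗ₘ Y.p) ⊗ₘ Z.p) ≫ (α_ _ _ _).hom) ≫
          ((W.p ⊗ₘ X.p) ⊗ₘ (Y.p ⊗ₘ Z.p)) ≫ (α_ _ _ _).hom
      have e₁ : (((W.p ⊗ₘ X.p) ⊗ₘ Y.p) ≫ (α_ _ _ _).hom) ⊗ₘ Z.p =
          (((W.p ⊗ₘ X.p) ⊗ₘ Y.p) ⊗ₘ Z.p) ≫ ((α_ _ _ _).hom ⊗ₘ 𝟙 Z.obj) := by
        rw [MonoidalCategory.tensorHom_comp_tensorHom, Category.comp_id]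
      have e₂ : W.p ⊗ₘ (((X.p ⊗ₘ Y.p) ⊗ₘ Z.p) ≫ (α_ _ _ _).hom) =
          (W.p ⊗ₘ ((X.p ⊗ₘ Y.p) ⊗ₘ Z.p)) ≫ (𝟙 W.obj ⊗ₘ (α_ _ _ _).hom) := by
        rw [MonoidalCategory.tensorHom_comp_tensorHom, Category.comp_id]
      rw [e₁, e₂, absorb, absorb, absorb, Box.pentagon_t]
      all_goals simp only [MonoidalCategory.tensorHom_comp_tensorHom, W.idem, X.idem, Y.idem,
        Z.idem, MonoidalCategory.associator_naturality, Category.id_comp, Category.comp_id]))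
    (triangle := fun X Y => Subtype.ext (by
      change (((X.p ⊗ₘ 𝟙 (𝟙_ E)) ⊗ₘ Y.p) ≫ (α_ _ _ _).hom) ≫
        (X.p ⊗ₘ ((𝟙 (𝟙_ E) ⊗ₘ Y.p) ≫ (λ_ _).hom)) =
          ((X.p ⊗ₘ 𝟙 (𝟙_ E)) ≫ (ρ_ _).hom) ⊗ₘ Y.p
      have e₁ : X.p ⊗ₘ ((𝟙 (𝟙_ E) ⊗ₘ Y.p) ≫ (λ_ _).hom) =
          (X.p ⊗ₘ (𝟙 (𝟙_ E) ⊗ₘ Y.p)) ≫ (𝟙 X.obj ⊗ₘ (λ_ _).hom) := by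
        rw [MonoidalCategory.tensorHom_comp_tensorHom, Category.comp_id]
      have e₂ : ((X.p ⊗ₘ 𝟙 (𝟙_ E)) ≫ (ρ_ _).hom) ⊗ₘ Y.p =
          ((X.p ⊗ₘ 𝟙 (𝟙_ E)) ⊗ₘ Y.p) ≫ ((ρ_ _).hom ⊗ₘ 𝟙 Y.obj) := by
        rw [MonoidalCategory.tensorHom_comp_tensorHom, Category.comp_id]
      rw [e₁, e₂, absorb, Box.triangle_t]
      all_goals simp only [MonoidalCategory.tensorHom_comp_tensorHom, X.idem, Y.idem,
        MonoidalCategory.associator_naturality, Category.comp_id]))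

instance [MonoidalPreadditive E] : MonoidalPreadditive (ProjCat E) where
  whiskerLeft_zero {X _ _} := Subtype.ext (by change X.p ⊗ₘ 0 = 0; simp)
  zero_whiskerRight {X _ _} := Subtype.ext (by change 0 ⊗ₘ X.p = 0; simp)
  whiskerLeft_add f g := Subtype.ext (MonoidalPreadditive.tensor_add _ f.1 g.1)
  add_whiskerRight f g := Subtype.ext (MonoidalPreadditive.add_tensor f.1 g.1 _)

instance [MonoidalPreadditive E] [MonoidalLinear ℂ E] : MonoidalLinear ℂ (ProjCat E) where
  whiskerLeft_smul X _ _ c f := Subtype.ext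
    (by change X.p ⊗ₘ (c • f.1) = c • (X.p ⊗ₘ f.1); simp [MonoidalCategory.tensorHom_def])
  smul_whiskerRight c _ _ f X := Subtype.ext
    (by change (c • f.1) ⊗ₘ X.p = c • (f.1 ⊗ₘ X.p); simp [MonoidalCategory.tensorHom_def])

instance : DaggerMonoidal (ProjCat E) where
  dag {X Y} f := ⟨f.1†, mem_homSub_of (by rw [← Y.selfadj, ← DaggerMonoidal.dag_comp, comp_p f.2])
    (by rw [← X.selfadj, ← DaggerMonoidal.dag_comp, p_comp f.2])⟩
  dag_dag f := Subtype.ext (DaggerMonoidal.dag_dag f.1)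
  dag_comp f g := Subtype.ext (DaggerMonoidal.dag_comp f.1 g.1)
  dag_add f g := Subtype.ext (DaggerMonoidal.dag_add f.1 g.1)
  dag_smul c f := Subtype.ext (DaggerMonoidal.dag_smul c f.1)
  dag_tensor f g := Subtype.ext (DaggerMonoidal.dag_tensor f.1 g.1)
  dag_associator X Y Z := Subtype.ext (by
    change (((X.p ⊗ₘ Y.p) ⊗ₘ Z.p) ≫ (α_ _ _ _).hom)† = (α_ _ _ _).inv ≫ ((X.p ⊗ₘ Y.p) ⊗ₘ Z.p)
    simp only [DaggerMonoidal.dag_comp, DaggerMonoidal.dag_tensor, X.selfadj, Y.selfadj,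
      Z.selfadj, DaggerMonoidal.dag_associator])
  dag_leftUnitor X := Subtype.ext (by
    change ((𝟙 (𝟙_ E) ⊗ₘ X.p) ≫ (λ_ _).hom)† = (λ_ _).inv ≫ (𝟙 (𝟙_ E) ⊗ₘ X.p)
    simp only [DaggerMonoidal.dag_comp, DaggerMonoidal.dag_tensor, X.selfadj, dag_id,
      DaggerMonoidal.dag_leftUnitor])
  dag_rightUnitor X := Subtype.ext (by
    change ((X.p ⊗ₘ 𝟙 (𝟙_ E)) ≫ (ρ_ _).hom)† = (ρ_ _).inv ≫ (X.p ⊗ₘ 𝟙 (𝟙_ E))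
    simp only [DaggerMonoidal.dag_comp, DaggerMonoidal.dag_tensor, X.selfadj, dag_id,
      DaggerMonoidal.dag_rightUnitor])

end ProjCat

/-! ## Annular algebras -/

section Annular

variable {E : Type u} [Category.{v} E] [Preadditive E] [Linear ℂ E] [MonoidalCategory E]
  [MonoidalPreadditive E] [MonoidalLinear ℂ E] [DaggerMonoidal E] {ι : Type w}

/-- The auxiliary choices in the definition of the annular algebras of `E`, where the objects
`irr a`, `a : ι`, represent the isomorphism classes of simple objects: for all `a₁, a₂`, the
orthonormal bases of the spaces `E(irr e, irr a₁ ⊗ irr a₂)` with respect to the inner product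
`v* u = ⟨u, v⟩ 1` (put together for all `e`, only finitely many of these spaces being non-zero),
and for every `a` a standard solution of the duality equations for `irr a`. -/
structure AnnularChoice (irr : ι → E) where
  onb : ∀ a₁ a₂ : ι, Finset (Σ e : ι, irr e ⟶ irr a₁ ⊗ irr a₂)
  onb_norm : ∀ (a₁ a₂ e : ι) (s : irr e ⟶ irr a₁ ⊗ irr a₂), ⟨e, s⟩ ∈ onb a₁ a₂ →
    s ≫ s† = 𝟙 (irr e)
  onb_orth : ∀ (a₁ a₂ e : ι) (s t : irr e ⟶ irr a₁ ⊗ irr a₂), ⟨e, s⟩ ∈ onb a₁ a₂ →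
    ⟨e, t⟩ ∈ onb a₁ a₂ → s ≠ t → s ≫ t† = 0
  onb_span : ∀ a₁ a₂ e : ι,
    Submodule.span ℂ {s : irr e ⟶ irr a₁ ⊗ irr a₂ | ⟨e, s⟩ ∈ onb a₁ a₂} = ⊤
  bar : ι → ι
  R : ∀ a : ι, 𝟙_ E ⟶ irr (bar a) ⊗ irr a
  Rbar : ∀ a : ι, 𝟙_ E ⟶ irr a ⊗ irr (bar a)
  conj_eq : ∀ a : ι, IsConjugateSolution (irr a) (irr (bar a)) (R a) (Rbar a)
  standard : ∀ a : ι, R a ≫ (R a)† = Rbar a ≫ (Rbar a)†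

/-- `A_{b,c} = ⨁_a E(a ⊗ b, c ⊗ a)`, the sum being over the representatives `a` of the simple
objects. -/
abbrev TubeHom (irr : ι → E) (b c : E) : Type (max w v) :=
  ⨁ a : ι, (irr a ⊗ b ⟶ c ⊗ irr a)

variable {irr : ι → E}

namespace AnnularChoice

variable (T : AnnularChoice irr)

/-- `(1_d ⊗ s*) ∘ (f ⊗ 1_{a₂}) ∘ (1_{a₁} ⊗ g) ∘ (s ⊗ 1_b)` -/
def prodTerm {a₁ a₂ e b c d : E} (f : a₁ ⊗ c ⟶ d ⊗ a₁) (g : a₂ ⊗ b ⟶ c ⊗ a₂)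
    (s : e ⟶ a₁ ⊗ a₂) : e ⊗ b ⟶ d ⊗ e :=
  s ▷ b ≫ (α_ a₁ a₂ b).hom ≫ a₁ ◁ g ≫ (α_ a₁ c a₂).inv ≫ f ▷ a₂ ≫ (α_ d a₁ a₂).hom ≫ d ◁ s†

/-- The product of `f ∈ E(a₁ ⊗ c, d ⊗ a₁)` and `g ∈ E(a₂ ⊗ b, c ⊗ a₂)`, the sum over `e` and over
an orthonormal basis of `E(e, a₁ ⊗ a₂)` of the `prodTerm`s, each in the summand of index `e`. -/
def prodₗ [DecidableEq ι] (a₁ a₂ : ι) (b c d : E) :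
    (irr a₁ ⊗ c ⟶ d ⊗ irr a₁) →ₗ[ℂ] (irr a₂ ⊗ b ⟶ c ⊗ irr a₂) →ₗ[ℂ] TubeHom irr b d :=
  LinearMap.mk₂ ℂ
    (fun f g => ∑ s ∈ T.onb a₁ a₂,
      DirectSum.lof ℂ ι (fun a => (irr a ⊗ b ⟶ d ⊗ irr a)) s.1 (prodTerm f g s.2))
    (by intros; simp [prodTerm, Finset.sum_add_distrib])
    (by intros; simp [prodTerm, Finset.smul_sum])
    (by intros; simp [prodTerm, Finset.sum_add_distrib])
    (by intros; simp [prodTerm, Finset.smul_sum])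

/-- The composition `A_{c,d} × A_{b,c} → A_{b,d}`. -/
def compₗ [DecidableEq ι] (b c d : E) :
    TubeHom irr c d →ₗ[ℂ] TubeHom irr b c →ₗ[ℂ] TubeHom irr b d :=
  DirectSum.toModule ℂ ι _ fun a₁ => LinearMap.flip <|
    DirectSum.toModule ℂ ι _ fun a₂ => (T.prodₗ a₁ a₂ b c d).flip

/-- For `f ∈ E(a ⊗ b, c ⊗ a)`, the element
`f^# = (R_a* ⊗ 1_b ⊗ 1_ā) ∘ (1_ā ⊗ f* ⊗ 1_ā) ∘ (1_ā ⊗ 1_c ⊗ R̄_a)` of `E(ā ⊗ c, b ⊗ ā)`. -/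
def sharp (a : ι) (b c : E) (f : irr a ⊗ b ⟶ c ⊗ irr a) :
    irr (T.bar a) ⊗ c ⟶ b ⊗ irr (T.bar a) :=
  (ρ_ (irr (T.bar a) ⊗ c)).inv ≫ (irr (T.bar a) ⊗ c) ◁ T.Rbar a ≫
    (α_ (irr (T.bar a)) c (irr a ⊗ irr (T.bar a))).hom ≫
    irr (T.bar a) ◁ (α_ c (irr a) (irr (T.bar a))).inv ≫
    irr (T.bar a) ◁ (f† ▷ irr (T.bar a)) ≫
    irr (T.bar a) ◁ (α_ (irr a) b (irr (T.bar a))).hom ≫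
    (α_ (irr (T.bar a)) (irr a) (b ⊗ irr (T.bar a))).inv ≫
    (T.R a)† ▷ (b ⊗ irr (T.bar a)) ≫ (λ_ (b ⊗ irr (T.bar a))).hom

/-- The map `# : A_{b,c} → A_{c,b}`. -/
def sharpHom [DecidableEq ι] (b c : E) : TubeHom irr b c →+ TubeHom irr c b :=
  DirectSum.toAddMonoid fun a =>
    (DirectSum.of (fun a => (irr a ⊗ c ⟶ b ⊗ irr a)) (T.bar a)).comp
      (AddMonoidHom.mk' (T.sharp a b c) (by
        intros; simp [sharp, DaggerMonoidal.dag_add]))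

end AnnularChoice

/-- The annular algebra with weights `wt k`, `k : κ`: the direct sum of the spaces
`A_{b,c} = ⨁_a E(a ⊗ b, c ⊗ a)` over all weights `b`, `c`. -/
def Annular {κ : Type w'} (_T : AnnularChoice irr) (wt : κ → E) : Type (max w w' v) :=
  ⨁ p : κ × κ, TubeHom irr (wt p.1) (wt p.2)

namespace Annular

variable {κ : Type w'} (T : AnnularChoice irr) (wt : κ → E)

instance : AddCommGroup (Annular T wt) :=
  inferInstanceAs (AddCommGroup (⨁ p : κ × κ, TubeHom irr (wt p.1) (wt p.2)))

instance : Module ℂ (Annular T wt) :=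
  inferInstanceAs (Module ℂ (⨁ p : κ × κ, TubeHom irr (wt p.1) (wt p.2)))

open scoped Classical in
/-- The inclusion of `A_{b,c}`. -/
def block (b c : κ) : TubeHom irr (wt b) (wt c) →ₗ[ℂ] Annular T wt :=
  DirectSum.lof ℂ (κ × κ) (fun p => TubeHom irr (wt p.1) (wt p.2)) (b, c)

open scoped Classical in
/-- The product of an element of `A_{c',d}` and an element of `A_{b,c}`, which is zero unless
`c' = c`. -/
def blockMulₗ (b c c' d : κ) :
    TubeHom irr (wt c') (wt d) →ₗ[ℂ] TubeHom irr (wt b) (wt c) →ₗ[ℂ] Annular T wt :=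
  if h : c = c' then h ▸ (T.compₗ (wt b) (wt c) (wt d)).compr₂ (block T wt b d) else 0

open scoped Classical in
/-- The multiplication as a bilinear map. -/
def mulₗ : Annular T wt →ₗ[ℂ] Annular T wt →ₗ[ℂ] Annular T wt :=
  DirectSum.toModule ℂ (κ × κ) _ fun p => LinearMap.flip <|
    DirectSum.toModule ℂ (κ × κ) _ fun q => (blockMulₗ T wt q.1 q.2 p.1 p.2).flip

open scoped Classical in
/-- The involution `#`. -/
def starHom : Annular T wt →+ Annular T wt :=
  DirectSum.toAddMonoid fun p => (block T wt p.2 p.1).toAddMonoidHom.comp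
    (T.sharpHom (wt p.1) (wt p.2))

instance : Mul (Annular T wt) where
  mul x y := mulₗ T wt x y

instance : Star (Annular T wt) where
  star x := starHom T wt x

open scoped Classical in
/-- The map between annular algebras that is induced by an inclusion of weights. -/
def incl {κ' : Type w'} (φ : κ' → κ) : Annular T (fun k => wt (φ k)) →ₗ[ℂ] Annular T wt :=
  DirectSum.toModule ℂ (κ' × κ') _ fun p => block T wt (φ p.1) (φ p.2)

end Annular

/-- `i` identifies the `*`-algebra `A` with a direct summand of the `*`-algebra `B`: it is an
injective `*`-homomorphism, and `B` is the direct sum of the image of `A` and of a linear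
subspace `J`, both of which are two-sided `*`-ideals. -/
structure IsDirectSummand {A B : Type*} [AddCommGroup A] [Module ℂ A] [Mul A] [Star A]
    [AddCommGroup B] [Module ℂ B] [Mul B] [Star B] (i : A →ₗ[ℂ] B) : Prop where
  injective : Function.Injective i
  map_mul : ∀ x y, i (x * y) = i x * i y
  map_star : ∀ x, i (star x) = star (i x)
  mul_mem_range : ∀ (x : A) (y : B), i x * y ∈ LinearMap.range i ∧ y * i x ∈ LinearMap.range i
  exists_compl : ∃ J : Submodule ℂ B, IsCompl (LinearMap.range i) J ∧
    (∀ x ∈ J, ∀ y : B, x * y ∈ J ∧ y * x ∈ J) ∧ ∀ x ∈ J, star x ∈ J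

end Annular

/-! ## Direct sums of algebras `M_n(ℂ) ⊗ ℂ[ℤ]` -/

/-- The group algebra `ℂ[ℤ]`. -/
abbrev GroupAlgZ : Type := MonoidAlgebra ℂ (Multiplicative ℤ)

/-- The involution of `ℂ[ℤ]`: `(∑ c_g g)* = ∑ conj(c_g) g⁻¹`. -/
instance : StarAddMonoid GroupAlgZ where
  star x := .ofCoeff ((x.coeff.mapRange (starRingEnd ℂ) (map_zero _)).equivMapDomain
    (Equiv.inv (Multiplicative ℤ)))
  star_involutive x := by
    apply MonoidAlgebra.ext
    ext g
    simp
  star_add x y := by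
    apply MonoidAlgebra.ext
    ext g
    simp

instance : StarModule ℂ GroupAlgZ where
  star_smul c x := by
    apply MonoidAlgebra.ext
    ext g
    simp only [star]
    simp
    left
    rfl

/-- `M_n(ℂ) ⊗ ℂ[ℤ]` -/
abbrev MatZ (n : ℕ) : Type := Matrix (Fin n) (Fin n) ℂ ⊗[ℂ] GroupAlgZ

/-- The algebraic direct sum of the `*`-algebras `M_{n j}(ℂ) ⊗ ℂ[ℤ]`, with the componentwise
operations. -/
def MatZSum {J : Type w} (n : J → ℕ) : Type w := Π₀ j : J, MatZ (n j)

namespace MatZSum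

variable {J : Type w} (n : J → ℕ)

instance : AddCommGroup (MatZSum n) := inferInstanceAs (AddCommGroup (Π₀ j : J, MatZ (n j)))

instance : Module ℂ (MatZSum n) := inferInstanceAs (Module ℂ (Π₀ j : J, MatZ (n j)))

instance : Mul (MatZSum n) where
  mul x y := DFinsupp.zipWith (fun _ a b => a * b) (fun _ => mul_zero _) x y

instance : Star (MatZSum n) where
  star x := DFinsupp.mapRange (fun _ a => star a) (fun _ => star_zero _) x

end MatZSum

/-! ## Weights of the free product -/

section FreeProduct

/-- The free product `C * D`, the projection category of `NCP`. -/
abbrev FreeProduct (C : Type u₁) [Category.{v₁} C] [Preadditive C] [Linear ℂ C]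
    [MonoidalCategory C] [MonoidalPreadditive C] [MonoidalLinear ℂ C] [DaggerMonoidal C]
    (D : Type u₂) [Category.{v₂} D] [Preadditive D] [Linear ℂ D]
    [MonoidalCategory D] [MonoidalPreadditive D] [MonoidalLinear ℂ D] [DaggerMonoidal D] :=
  ProjCat (NCPCat C D)

/-- Words with letters coming alternatingly from `I` and from `I'`. -/
def AltWord {C : Type u₁} {D : Type u₂} (I : Set C) (I' : Set D) : Type (max u₁ u₂) :=
  {l : List (I ⊕ I') // l.IsChain fun s t => s.isLeft ≠ t.isLeft}

/-- The set `W` of alternating words of strictly positive even length with first letter in `I`. -/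
def weightW {C : Type u₁} {D : Type u₂} (I : Set C) (I' : Set D) : Set (AltWord I I') :=
  {l | Even l.1.length ∧ ∃ (a : I) (t : List (I ⊕ I')), l.1 = Sum.inl a :: t}

/-- The weight set `Λ = {∅} ∪ I ∪ I' ∪ W`. -/
def weightΛ {C : Type u₁} {D : Type u₂} (I : Set C) (I' : Set D) : Set (AltWord I I') :=
  {l | l.1 = [] ∨ l.1.length = 1} ∪ weightW I I'

/-- Cyclic equivalence on `W`: `w₁ = s t` and `w₂ = t s` for some subwords `s`, `t`. -/
def cyclicSetoid {C : Type u₁} {D : Type u₂} (I : Set C) (I' : Set D) :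
    Setoid (weightW I I') where
  r w₁ w₂ := ∃ s t : List (I ⊕ I'), w₁.1.1 = s ++ t ∧ w₂.1.1 = t ++ s
  iseqv := by
    have key : ∀ l l' : List (I ⊕ I'), (∃ s t, l = s ++ t ∧ l' = t ++ s) ↔ l.IsRotated l' := by
      intro l l'
      constructor
      · rintro ⟨s, t, rfl, rfl⟩
        exact List.isRotated_append
      · rw [List.isRotated_iff_mod]
        rintro ⟨k, hk, rfl⟩
        exact ⟨l.take k, l.drop k, (List.take_append_drop k l).symm,
          List.rotate_eq_drop_append_take hk⟩
    simp only [key]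
    exact ⟨fun _ => List.IsRotated.refl _, fun h => h.symm, fun h h' => h.trans h'⟩

/-- The number of elements of a cyclic equivalence class. -/
def classCard {C : Type u₁} {D : Type u₂} {I : Set C} {I' : Set D}
    (c : Quotient (cyclicSetoid I I')) : ℕ :=
  Nat.card {x : weightW I I' // Quotient.mk _ x = c}

variable {C : Type u₁} [Category.{v₁} C] [Preadditive C] [Linear ℂ C]
  [MonoidalCategory C] [MonoidalPreadditive C] [MonoidalLinear ℂ C] [DaggerMonoidal C]
  {D : Type u₂} [Category.{v₂} D] [Preadditive D] [Linear ℂ D]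
  [MonoidalCategory D] [MonoidalPreadditive D] [MonoidalLinear ℂ D] [DaggerMonoidal D]

/-- The simple object `(σ, 1_σ)` of `C * D` given by an alternating word `σ`. -/
def irrObj (I : Set C) (I' : Set D) (l : AltWord I I') : FreeProduct C D where
  obj := ⟨Word.ofList (l.1.map (Sum.map Subtype.val Subtype.val))⟩
  p := 𝟙 _
  idem := Category.id_comp _
  selfadj := dag_id _

theorem weightW_subset {I : Set C} {I' : Set D} : weightW I I' ⊆ weightΛ I I' :=
  Set.subset_union_right

/-- The annular algebra `AΛ`. -/
abbrev AnnularΛ {I : Set C} {I' : Set D} (T : AnnularChoice (irrObj I I')) :=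
  Annular T fun l : weightΛ I I' => irrObj I I' l.1

/-- The annular algebra `AW`. -/
abbrev AnnularW {I : Set C} {I' : Set D} (T : AnnularChoice (irrObj I I')) :=
  Annular T fun l : weightW I I' => irrObj I I' l.1

/-- The inclusion of `AW` in `AΛ`. -/
def inclW {I : Set C} {I' : Set D} (T : AnnularChoice (irrObj I I')) :
    AnnularW T →ₗ[ℂ] AnnularΛ T :=
  Annular.incl T (fun l : weightΛ I I' => irrObj I I' l.1) (Set.inclusion weightW_subset)

end FreeProduct

end FreeTube

end

noncomputable section

namespace FreeTube

/-! The whole structure is read off from words. Consider `f : a ⊗ b ⟶ c ⊗ a` with alternating words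
`a`, `b`, `c`. If `a` and `b` meet in letters of different types, the concatenation `ab` is
alternating, hence simple; the same holds for `ca`. When both are alternating, `f` vanishes unless
`ab = ca` as words, and if they are equal then `f` is a multiple of a fixed unitary.

A word is in `W` exactly if it begins with a letter from `C` and ends with a letter from `D`. For
`b`, `c` in `W` and `f ≠ 0` the favourable case can always be reached: if `a` ends in `C`, then
`f^#` lives over the conjugate word of `a`, which does not (`headType_ne`). In the favourable case
`a` is empty or in `W`, and `ab = ca` (`append_eq_append`). This equation says that `c` is a
rotation of `b` by the letters of `a`, and `b` together with the length of `a` determines `a` and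
`c` (`eq_of_append_eq_append`). So `AW` has a basis of arrows `(k, c)`, with `k : ℤ` and `c` in `W`:
the arrow rotates `c` by `2k` letters, and arrows with negative `k` are the images under `#` of
arrows with positive `k`. If only one of the weights is in `W` and the other is in `Λ \ W`, a
comparison of lengths kills all morphisms (`hom_eq_zero`), which gives the direct summand.

For the product, unitaries over `a` and `a'` multiply to a unitary over the simple word `aa'`. The
product of `f` and `f^#` is a trace over the summands of `a ⊗ ā`. A nontrivial summand begins and
ends in `C` (for `ā ⊗ a` it begins and ends in `D`), and no such word carries an annulus with
weights in `W` (`loop_eq_zero`, `loop_eq_zero'`). Only the tensor unit contributes, so `f^#` is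
inverse to `f`. Hence `(k, d) · (l, c)` is `(k + l, c)` if `d` is the end point of `(l, c)`, and
zero otherwise: `AW` is the convolution algebra of the action of `ℤ` on `W` by rotation by two
letters. The orbits are the cyclic classes. An orbit with `n` points has stabilizer `nℤ`, and its
arrows are matrix units times powers of a generator of `nℤ`, which yields `M_n(ℂ) ⊗ ℂ[ℤ]`.

Two inputs need work. The fusion rules have to be extracted from diagrams. Each of the categories
acts on the alternating words as on a free module. A word then acts through its letters, and every
diagram maps the space of morphisms given by its lower word into that given by its upper word
(`carries_Z`), because the letters of a block act through one category and its label is a morphism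
of that category. Applied to the empty word this bounds all morphism spaces out of simple words: it
gives Schur's lemma and `fuses_of_hom_ne_zero`. Existence of decompositions and conjugates comes
from explicit blocks. Secondly, the product is defined by chosen orthonormal bases; it is rewritten
as a trace of stacked annuli that may be computed in any decomposition (`tubeTrace_comm`,
`compₗ_tubeTrace`). -/

/-- Left whiskering as a linear map. -/
def whiskerLeftₗ {B : Type u₁} [Category.{v₁} B] [Preadditive B] [Linear ℂ B] [MonoidalCategory B]
    [MonoidalPreadditive B] [MonoidalLinear ℂ B] (X Y Z : B) : (Y ⟶ Z) →ₗ[ℂ] (X ⊗ Y ⟶ X ⊗ Z) where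
  toFun f := X ◁ f
  map_add' := by simp
  map_smul' := by simp

/-! ## Families of spaces of morphisms `obj w' ⟶ X ⊗ obj w` -/

section HomFamily

variable {B : Type u₁} [Category.{v₁} B] [Preadditive B] [Linear ℂ B] [MonoidalCategory B]
    [MonoidalPreadditive B] [MonoidalLinear ℂ B] {W : Type w} (obj : W → B)

/-- A family of spaces of morphisms `obj w' ⟶ X ⊗ obj w`. -/
abbrev HomFamily (X : B) : Type (max v₁ w) := ∀ w w' : W, Submodule ℂ (obj w' ⟶ X ⊗ obj w)

/-- The family spanned by the inverses of the unitors. -/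
def unitSpan : HomFamily obj (𝟙_ B) := fun w w' =>
  Submodule.span ℂ {s | ∃ h : w' = w, s = eqToHom (congrArg obj h) ≫ (λ_ (obj w)).inv}

variable {obj}

/-- The composites of the elements of two families. -/
def compSpan {X Y : B} (S : HomFamily obj X) (T : HomFamily obj Y) : HomFamily obj (X ⊗ Y) :=
  fun w w'' => Submodule.span ℂ {r | ∃ (w' : W), ∃ s ∈ S w' w'', ∃ t ∈ T w w',
    r = s ≫ X ◁ t ≫ (α_ _ _ _).inv}

theorem comp_mem_compSpan {X Y : B} {S : HomFamily obj X} {T : HomFamily obj Y} {w w' w'' : W}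
    {s : obj w'' ⟶ X ⊗ obj w'} {t : obj w' ⟶ Y ⊗ obj w} (hs : s ∈ S w' w'') (ht : t ∈ T w w') :
    s ≫ X ◁ t ≫ (α_ _ _ _).inv ∈ compSpan S T w w'' :=
  Submodule.subset_span ⟨w', s, hs, t, ht, rfl⟩

theorem leftUnitor_inv_mem_unitSpan (w : W) : (λ_ (obj w)).inv ∈ unitSpan obj w w :=
  Submodule.subset_span ⟨rfl, by rw [eqToHom_refl, Category.id_comp]⟩

/-- `f : X ⟶ Y` maps the family `S` into the family `T`. -/
def Carries {X Y : B} (S : HomFamily obj X) (T : HomFamily obj Y) (f : X ⟶ Y) : Prop :=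
  ∀ w w', ∀ s ∈ S w w', s ≫ f ▷ obj w ∈ T w w'

theorem Carries.id {X : B} (S : HomFamily obj X) : Carries S S (𝟙 X) := by
  intro w w' s hs
  rwa [id_whiskerRight, Category.comp_id]

theorem Carries.comp {X Y Z : B} {S : HomFamily obj X} {T : HomFamily obj Y}
    {U : HomFamily obj Z} {f : X ⟶ Y} {g : Y ⟶ Z} (hf : Carries S T f) (hg : Carries T U g) :
    Carries S U (f ≫ g) := by
  intro w w' s hs
  rw [comp_whiskerRight, ← Category.assoc]
  exact hg _ _ _ (hf _ _ _ hs)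

/-- The set of the morphisms that carry `S` into `T` as a subspace. -/
def carriesSub {X Y : B} (S : HomFamily obj X) (T : HomFamily obj Y) : Submodule ℂ (X ⟶ Y) where
  carrier := {f | Carries S T f}
  zero_mem' := by intro w w' s hs; simp
  add_mem' {f g} hf hg := by
    intro w w' s hs
    rw [MonoidalPreadditive.add_whiskerRight, Preadditive.comp_add]
    exact add_mem (hf w w' s hs) (hg w w' s hs)
  smul_mem' c f hf := by
    intro w w' s hs
    rw [MonoidalLinear.smul_whiskerRight, Linear.comp_smul]
    exact Submodule.smul_mem _ _ (hf w w' s hs)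

theorem carries_compSpan {X Y Z : B} {S : HomFamily obj X} {T : HomFamily obj Y}
    {U : HomFamily obj Z} {f : X ⊗ Y ⟶ Z}
    (h : ∀ (w w' w'' : W), ∀ s ∈ S w' w'', ∀ t ∈ T w w',
      s ≫ X ◁ t ≫ (α_ _ _ _).inv ≫ f ▷ obj w ∈ U w w'') : Carries (compSpan S T) U f := by
  intro w w'' r hr
  have : compSpan S T w w'' ≤ (U w w'').comap (Linear.rightComp ℂ _ (f ▷ obj w)) := by
    refine Submodule.span_le.2 ?_
    rintro _ ⟨w', s, hs, t, ht, rfl⟩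
    simpa using h w w' w'' s hs t ht
  exact this hr

/-- To map `s ∈ compSpan S T` linearly into a subspace, it suffices to consider composites. -/
theorem map_compSpan_le {X Y : B} {S : HomFamily obj X} {T : HomFamily obj Y} {w w'' : W}
    {V : Type*} [AddCommGroup V] [Module ℂ V] (φ : (obj w'' ⟶ (X ⊗ Y) ⊗ obj w) →ₗ[ℂ] V)
    {N : Submodule ℂ V} (h : ∀ w', ∀ s ∈ S w' w'', ∀ t ∈ T w w',
      φ (s ≫ X ◁ t ≫ (α_ _ _ _).inv) ∈ N) {r : obj w'' ⟶ (X ⊗ Y) ⊗ obj w}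
    (hr : r ∈ compSpan S T w w'') : φ r ∈ N := by
  have : compSpan S T w w'' ≤ N.comap φ := by
    refine Submodule.span_le.2 ?_
    rintro _ ⟨w', s, hs, t, ht, rfl⟩
    exact h w' s hs t ht
  exact this hr

theorem map_unitSpan_le {w w' : W}
    {V : Type*} [AddCommGroup V] [Module ℂ V] (φ : (obj w' ⟶ 𝟙_ B ⊗ obj w) →ₗ[ℂ] V)
    {N : Submodule ℂ V} (h : ∀ (h : w' = w), φ (eqToHom (congrArg obj h) ≫ (λ_ (obj w)).inv) ∈ N)
    {r : obj w' ⟶ 𝟙_ B ⊗ obj w}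
    (hr : r ∈ unitSpan obj w w') : φ r ∈ N := by
  have : unitSpan obj w w' ≤ N.comap φ := by
    refine Submodule.span_le.2 ?_
    rintro _ ⟨h', rfl⟩
    exact h h'
  exact this hr

/-- Exchange law: `f` touches only the outer factor of a composite and `f'` only the inner one, so a
composite goes to the composite of the images. -/
theorem Carries.tensor {X Y X' Y' : B} {S : HomFamily obj X} {T : HomFamily obj Y}
    {S' : HomFamily obj X'} {T' : HomFamily obj Y'} {f : X ⟶ Y} {f' : X' ⟶ Y'}
    (hf : Carries S T f) (hf' : Carries S' T' f') :
    Carries (compSpan S S') (compSpan T T') (f ⊗ₘ f') := by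
  apply carries_compSpan
  intro w w' w'' s hs t ht
  have h := comp_mem_compSpan (hf _ _ _ hs) (hf' _ _ _ ht)
  convert h using 1
  simp only [Category.assoc, MonoidalCategory.tensorHom_def', comp_whiskerRight,
    MonoidalCategory.whiskerLeft_comp, ← whisker_exchange_assoc]
  simp

variable {X Y Z : B} (S : HomFamily obj X) (T : HomFamily obj Y) (U : HomFamily obj Z)

/-- With the inverse and the four lemmas on unitors, this makes `compSpan` and `unitSpan` a monoidal
structure on families up to coherence, as needed for an induction over diagrams. -/
theorem carries_associator_hom :
    Carries (compSpan (compSpan S T) U) (compSpan S (compSpan T U)) (α_ X Y Z).hom := by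
  apply carries_compSpan
  intro w w' w'' r hr t ht
  refine map_compSpan_le (Linear.rightComp ℂ _ ((X ⊗ Y) ◁ t ≫ (α_ (X ⊗ Y) Z (obj w)).inv ≫
    (α_ X Y Z).hom ▷ obj w)) ?_ hr
  intro w₁ s hs s' hs'
  have h := comp_mem_compSpan hs (comp_mem_compSpan hs' ht)
  convert h using 1
  simp

theorem carries_associator_inv :
    Carries (compSpan S (compSpan T U)) (compSpan (compSpan S T) U) (α_ X Y Z).inv := by
  apply carries_compSpan
  intro w w' w'' s hs r hr
  refine map_compSpan_le ((Linear.leftComp ℂ _ s).comp ((Linear.rightComp ℂ _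
    ((α_ X (Y ⊗ Z) (obj w)).inv ≫ (α_ X Y Z).inv ▷ obj w)).comp
      (whiskerLeftₗ X _ _))) ?_ hr
  intro w₁ t ht t' ht'
  have h := comp_mem_compSpan (comp_mem_compSpan hs ht) ht'
  convert h using 1
  simp [whiskerLeftₗ]

theorem carries_leftUnitor_hom : Carries (compSpan (unitSpan obj) S) S (λ_ X).hom := by
  apply carries_compSpan
  intro w w' w'' r hr t ht
  refine map_unitSpan_le (Linear.rightComp ℂ _ (𝟙_ B ◁ t ≫ (α_ (𝟙_ B) X (obj w)).inv ≫
    (λ_ X).hom ▷ obj w)) ?_ hr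
  intro h
  cases h
  convert ht using 1
  simp

theorem carries_leftUnitor_inv : Carries S (compSpan (unitSpan obj) S) (λ_ X).inv := by
  intro w w' s hs
  have h := comp_mem_compSpan (leftUnitor_inv_mem_unitSpan w') hs
  convert h using 1
  simp

theorem carries_rightUnitor_hom : Carries (compSpan S (unitSpan obj)) S (ρ_ X).hom := by
  apply carries_compSpan
  intro w w' w'' s hs r hr
  refine map_unitSpan_le ((Linear.leftComp ℂ _ s).comp ((Linear.rightComp ℂ _
    ((α_ X (𝟙_ B) (obj w)).inv ≫ (ρ_ X).hom ▷ obj w)).comp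
      (whiskerLeftₗ X _ _))) ?_ hr
  intro h
  cases h
  convert hs using 1
  simp [whiskerLeftₗ]

theorem carries_rightUnitor_inv : Carries S (compSpan S (unitSpan obj)) (ρ_ X).inv := by
  intro w w' s hs
  have h := comp_mem_compSpan hs (leftUnitor_inv_mem_unitSpan w)
  convert h using 1
  simp

end HomFamily

/-! ## Free modules over a monoidal category -/

/-- A family of objects `obj w` of `B` on which the category `K` acts through the monoidal functor
`F` as on a direct sum, indexed by `Q`, of copies of itself: the simple objects of `K` are indexed
by `P`, and `obj (cons p q)` is the product of the simple object of index `p` with `base q`. -/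
structure FreeAction {B : Type u₁} [Category.{v₁} B] [MonoidalCategory B]
    {K : Type u₂} [Category.{v₂} K] [Preadditive K] [Linear ℂ K] [MonoidalCategory K]
    (F : K ⥤ B) {W : Type w} (obj : W → B) where
  P : Type u
  irr : P → K
  Q : Type w'
  base : Q → B
  cons : P → Q → W
  cons_inj : ∀ p q p' q', cons p q = cons p' q' → p = p' ∧ q = q'
  cons_surj : ∀ w, ∃ p q, cons p q = w
  κ : ∀ p q, F.obj (irr p) ⊗ base q ≅ obj (cons p q)
  one : P
  oneIso : irr one ≅ 𝟙_ K
  schur_ne : ∀ p p' (f : irr p ⟶ irr p'), p ≠ p' → f = 0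
  schur : ∀ p (f : irr p ⟶ irr p), ∃ c : ℂ, f = c • 𝟙 _
  complete : ∀ k : K, ∃ (n : ℕ) (p : Fin n → P) (s : ∀ i, irr (p i) ⟶ k)
    (t : ∀ i, k ⟶ irr (p i)), ∑ i, t i ≫ s i = 𝟙 k

namespace FreeAction

open Functor.LaxMonoidal Functor.OplaxMonoidal

variable {B : Type u₁} [Category.{v₁} B] [Preadditive B] [Linear ℂ B] [MonoidalCategory B]
    [MonoidalPreadditive B] [MonoidalLinear ℂ B]
    {K : Type u₂} [Category.{v₂} K] [Preadditive K] [Linear ℂ K] [MonoidalCategory K]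
    [MonoidalPreadditive K] [MonoidalLinear ℂ K]
    {F : K ⥤ B} [F.Monoidal] [F.Additive] [F.Linear ℂ] {W : Type w} {obj : W → B}
    (A : FreeAction.{v₁, v₂, u₁, u₂, u, w, w'} F obj)

/-- The morphism induced by `g : y ⟶ k ⊗ x`, where `X ≅ F k`. -/
def genBase {X : B} {k : K} (i : X ≅ F.obj k) {x y : K} (M : B) (g : y ⟶ k ⊗ x) :
    F.obj y ⊗ M ⟶ X ⊗ (F.obj x ⊗ M) :=
  (F.map g ≫ δ F k x) ▷ M ≫ (α_ _ _ _).hom ≫ i.inv ▷ _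

/-- The comparison `δ` of `F` is natural and coassociative, so acting by `l` and then by `k` is
acting by `k ⊗ l`. -/
theorem genBase_comp {X Y : B} {k l : K} (i : X ≅ F.obj k) (j : Y ≅ F.obj l) {x y z : K} (M : B)
    (g' : z ⟶ k ⊗ y) (g : y ⟶ l ⊗ x) :
    genBase i M g' ≫ X ◁ genBase j M g ≫ (α_ X Y _).inv =
      genBase ((i ⊗ᵢ j) ≪≫ Functor.Monoidal.μIso F k l) M (g' ≫ k ◁ g ≫ (α_ k l x).inv) := by
  -- Naturality of `δ` in the right variable, then coassociativity.
  have h : δ F k y ≫ F.obj k ◁ F.map g ≫ F.obj k ◁ δ F l x ≫ (α_ _ _ _).inv =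
      F.map (k ◁ g) ≫ F.map (α_ k l x).inv ≫ δ F (k ⊗ l) x ≫ δ F k l ▷ F.obj x := by
    rw [δ_natural_right_assoc, ← Functor.OplaxMonoidal.associativity_inv]
  simp only [genBase, Iso.trans_inv, tensorIso_inv, Functor.Monoidal.μIso_inv, comp_whiskerRight,
    F.map_comp, Category.assoc]
  rw [← whisker_exchange_assoc]
  have h' := congrArg (fun t => t ▷ M) h
  simp only [comp_whiskerRight, Category.assoc] at h'
  have h'' : ∀ {Z : B} (r : ((F.obj k ⊗ F.obj l) ⊗ F.obj x) ⊗ M ⟶ Z),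
      F.map (k ◁ g) ▷ M ≫ F.map (α_ k l x).inv ▷ M ≫ δ F (k ⊗ l) x ▷ M ≫
        δ F k l ▷ F.obj x ▷ M ≫ r = δ F k y ▷ M ≫ (F.obj k ◁ F.map g) ▷ M ≫
          (F.obj k ◁ δ F l x) ▷ M ≫ (α_ _ _ _).inv ▷ M ≫ r := by
    intro Z r
    simpa only [Category.assoc] using congrArg (· ≫ r) h'.symm
  rw [← associator_naturality_left_assoc (δ F k l), h'']
  simp [MonoidalCategory.tensorHom_def']

theorem genBase_add {X : B} {k : K} (i : X ≅ F.obj k) {x y : K} (M : B) (g g' : y ⟶ k ⊗ x) :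
    genBase i M (g + g') = genBase i M g + genBase i M g' := by
  simp [genBase, F.map_add]

theorem genBase_smul {X : B} {k : K} (i : X ≅ F.obj k) {x y : K} (M : B) (c : ℂ)
    (g : y ⟶ k ⊗ x) :
    genBase i M (c • g) = c • genBase i M g := by
  simp [genBase, F.map_smul]

theorem genBase_sum {X : B} {k : K} (i : X ≅ F.obj k) {x y : K} (M : B) {n : ℕ}
    (g : Fin n → (y ⟶ k ⊗ x)) :
    genBase i M (∑ j, g j) = ∑ j, genBase i M (g j) :=
  map_sum (AddMonoidHom.mk' (genBase i M) (genBase_add i M)) _ _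

theorem genBase_map {X Y : B} {k l : K} (i : X ≅ F.obj k) (j : Y ≅ F.obj l) {x y : K} (M : B)
    (g : y ⟶ k ⊗ x) (f : k ⟶ l) :
    genBase i M g ≫ (i.hom ≫ F.map f ≫ j.inv) ▷ _ = genBase j M (g ≫ f ▷ x) := by
  simp only [genBase, comp_whiskerRight, Category.assoc, inv_hom_whiskerRight_assoc, F.map_comp]
  rw [← associator_naturality_left_assoc, ← comp_whiskerRight_assoc (δ F k x), δ_natural_left]
  simp

/-- Counitality of `F`. It identifies the canonical morphism out of `x` times a free generator with
an identity (`actionL_genOne`, `actionR_genOne`). -/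
theorem genBase_rightUnitor (x : K) (M : B) :
    genBase (Iso.refl (F.obj x)) M (ρ_ x).inv ≫ F.obj x ◁ (η F ▷ M ≫ (λ_ M).hom) = 𝟙 _ := by
  have h : F.map (ρ_ x).inv ≫ δ F x (𝟙_ K) ≫ F.obj x ◁ η F = (ρ_ _).inv := by
    rw [← cancel_mono (ρ_ _).hom, Category.assoc, Category.assoc, right_unitality_hom,
      ← F.map_comp]
    simp
  have h' := congrArg (fun t => t ▷ M) h
  simp only [comp_whiskerRight] at h'
  simp only [genBase, comp_whiskerRight, Category.assoc, Iso.refl_inv, id_whiskerRight,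
    Category.id_comp, MonoidalCategory.whiskerLeft_comp]
  rw [← associator_naturality_middle_assoc, reassoc_of% h', triangle, ← comp_whiskerRight,
    Iso.inv_hom_id, id_whiskerRight]

/-- The morphism `obj (cons p' q) ⟶ X ⊗ obj (cons p q)` induced by `g : irr p' ⟶ k ⊗ irr p`. -/
def gen {X : B} {k : K} (i : X ≅ F.obj k) (p p' : A.P) (q : A.Q)
    (g : A.irr p' ⟶ k ⊗ A.irr p) : obj (A.cons p' q) ⟶ X ⊗ obj (A.cons p q) :=
  (A.κ p' q).inv ≫ genBase i (A.base q) g ≫ X ◁ (A.κ p q).hom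

/-- The space of morphisms `obj w' ⟶ X ⊗ obj w` that come from morphisms of `K`. -/
def act {X : B} {k : K} (i : X ≅ F.obj k) : HomFamily obj X := fun w w' =>
  Submodule.span ℂ {s | ∃ (p p' : A.P) (q : A.Q) (h : A.cons p q = w) (h' : A.cons p' q = w')
    (g : A.irr p' ⟶ k ⊗ A.irr p),
    s = eqToHom (congrArg obj h'.symm) ≫ A.gen i p p' q g ≫ X ◁ eqToHom (congrArg obj h)}

theorem gen_mem {X : B} {k : K} (i : X ≅ F.obj k) (p p' : A.P) (q : A.Q)
    (g : A.irr p' ⟶ k ⊗ A.irr p) : A.gen i p p' q g ∈ A.act i (A.cons p q) (A.cons p' q) :=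
  Submodule.subset_span ⟨p, p', q, rfl, rfl, g, by simp⟩

theorem act_le {X : B} {k : K} (i : X ≅ F.obj k) {S : HomFamily obj X}
    (h : ∀ (p p' : A.P) (q : A.Q) (g : A.irr p' ⟶ k ⊗ A.irr p), A.gen i p p' q g ∈ S (A.cons p q) (A.cons p' q)) (w w' : W) :
    A.act i w w' ≤ S w w' := by
  refine Submodule.span_le.2 ?_
  rintro s ⟨p, p', q, rfl, rfl, g, rfl⟩
  simpa using h p p' q g

/-- A morphism of `K` only changes the label of a generator, from `g` to `g ≫ f ▷ _`. This is why
single blocks respect the action. -/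
theorem act_map {X Y : B} {k l : K} (i : X ≅ F.obj k) (j : Y ≅ F.obj l) (f : k ⟶ l) :
    Carries (A.act i) (A.act j) (i.hom ≫ F.map f ≫ j.inv) := by
  intro w w' s hs
  let φ : ∀ w w', (obj w' ⟶ X ⊗ obj w) →ₗ[ℂ] (obj w' ⟶ Y ⊗ obj w) := fun w w' =>
    Linear.rightComp ℂ _ ((i.hom ≫ F.map f ≫ j.inv) ▷ obj w)
  refine A.act_le i (S := fun w w' => (A.act j w w').comap (φ w w')) ?_ w w' hs
  intro p p' q g
  change A.gen i p p' q g ≫ (i.hom ≫ F.map f ≫ j.inv) ▷ obj _ ∈ A.act j _ _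
  rw [gen, Category.assoc, Category.assoc, whisker_exchange, ← Category.assoc (genBase _ _ _),
    genBase_map]
  exact A.gen_mem j p p' q _

theorem gen_comp {X Y : B} {k l : K} (i : X ≅ F.obj k) (j : Y ≅ F.obj l) (p p' p'' : A.P)
    (q : A.Q) (g' : A.irr p'' ⟶ k ⊗ A.irr p') (g : A.irr p' ⟶ l ⊗ A.irr p) :
    A.gen i p' p'' q g' ≫ X ◁ A.gen j p p' q g ≫ (α_ _ _ _).inv =
      A.gen ((i ⊗ᵢ j) ≪≫ Functor.Monoidal.μIso F k l) p p'' q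
        (g' ≫ k ◁ g ≫ (α_ k l _).inv) := by
  simp only [gen, ← genBase_comp, Category.assoc, MonoidalCategory.whiskerLeft_comp,
    whiskerLeft_hom_inv_assoc]
  simp

/-- Composites of generators are generators by `gen_comp`. Conversely, semisimplicity of `K` factors
each label of a generator for `k ⊗ l` through the simple summands of `l ⊗ irr p`, which makes the
generator a sum of composites. -/
theorem act_tensor {X Y : B} {k l : K} (i : X ≅ F.obj k) (j : Y ≅ F.obj l) :
    compSpan (A.act i) (A.act j) = A.act ((i ⊗ᵢ j) ≪≫ Functor.Monoidal.μIso F k l) := by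
  funext w w''
  apply le_antisymm
  · refine Submodule.span_le.2 ?_
    rintro r ⟨w', s, hs, t, ht, rfl⟩
    let c := LinearMap.mk₂ ℂ (fun (s : obj w'' ⟶ X ⊗ obj w') (t : obj w' ⟶ Y ⊗ obj w) =>
      s ≫ X ◁ t ≫ (α_ _ _ _).inv) (by intros; simp) (by intros; simp)
        (by intros; simp) (by intros; simp)
    change c s t ∈ _
    unfold act at hs ht
    induction hs using Submodule.span_induction with
    | zero => rw [map_zero]; exact zero_mem _
    | add a b _ _ ha hb => rw [map_add]; exact add_mem ha hb
    | smul r a _ ha => rw [map_smul]; exact Submodule.smul_mem _ _ ha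
    | mem s hs =>
    induction ht using Submodule.span_induction with
    | zero => rw [map_zero]; exact zero_mem _
    | add a b _ _ ha hb => rw [map_add]; exact add_mem ha hb
    | smul r a _ ha => rw [map_smul]; exact Submodule.smul_mem _ _ ha
    | mem t ht =>
      obtain ⟨p', p'', q, rfl, rfl, g', rfl⟩ := hs
      obtain ⟨p, p₁, q₁, rfl, h, g, rfl⟩ := ht
      obtain ⟨rfl, rfl⟩ := A.cons_inj _ _ _ _ h
      simp only [eqToHom_refl, Category.id_comp, MonoidalCategory.whiskerLeft_id, Category.comp_id]
      change _ ≫ X ◁ _ ≫ _ ∈ _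
      rw [gen_comp]
      exact A.gen_mem _ _ _ _ _
  · refine A.act_le _ (S := compSpan (A.act i) (A.act j)) ?_ w w''
    intro p p'' q g
    -- The summands `irr (P a)` are the intermediate stations between the action of `l` and that of
    -- `k`.
    obtain ⟨n, P, s, t, hst⟩ := A.complete (l ⊗ A.irr p)
    have : g = ∑ a, (g ≫ (α_ _ _ _).hom ≫ k ◁ t a) ≫ k ◁ s a ≫ (α_ _ _ _).inv := by
      have h : ∑ a, k ◁ t a ≫ k ◁ s a = 𝟙 _ := by
        simp only [← MonoidalCategory.whiskerLeft_comp, ← whiskerLeft_sum, hst,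
          MonoidalCategory.whiskerLeft_id]
      calc g = g ≫ (α_ _ _ _).hom ≫ (∑ a, k ◁ t a ≫ k ◁ s a) ≫ (α_ _ _ _).inv := by
            rw [h]; simp
        _ = _ := by simp [Preadditive.sum_comp, Preadditive.comp_sum]
    rw [this]
    unfold gen
    rw [genBase_sum, Preadditive.sum_comp, Preadditive.comp_sum]
    refine Submodule.sum_mem _ fun a _ => ?_
    refine Submodule.subset_span ⟨A.cons (P a) q, A.gen i (P a) p'' q (g ≫ (α_ _ _ _).hom ≫ k ◁ t a),
      A.gen_mem i (P a) p'' q _, _, A.gen_mem j p (P a) q (s a), ?_⟩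
    rw [gen_comp]
    rfl

/-- Schur's lemma in `K`: a label `irr p' ⟶ 𝟙 ⊗ irr p` is zero for `p' ≠ p` and otherwise a multiple
of the inverse unitor. -/
theorem act_unit : A.act (Functor.Monoidal.εIso F) = unitSpan obj := by
  funext w w'
  have key : ∀ p q, A.gen (Functor.Monoidal.εIso F) p p q (λ_ _).inv = (λ_ _).inv := by
    intro p q
    have h : F.map (λ_ (A.irr p)).inv ≫ δ F (𝟙_ K) (A.irr p) ≫ η F ▷ F.obj (A.irr p) =
        (λ_ _).inv := by
      rw [← cancel_mono (λ_ _).hom, Category.assoc, Category.assoc, left_unitality_hom,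
        ← F.map_comp]
      simp
    have h' := congrArg (fun t => t ▷ A.base q) h
    simp only [comp_whiskerRight] at h'
    simp only [gen, genBase, comp_whiskerRight, Category.assoc, Functor.Monoidal.εIso_inv]
    rw [← associator_naturality_left_assoc, reassoc_of% h', leftUnitor_inv_whiskerRight,
      Category.assoc, Iso.inv_hom_id_assoc, ← leftUnitor_inv_naturality, Iso.inv_hom_id_assoc]
  apply le_antisymm
  · refine A.act_le _ (S := unitSpan obj) ?_ w w'
    intro p p' q g
    have hg : g = (g ≫ (λ_ _).hom) ≫ (λ_ _).inv := by simp
    by_cases h : p' = p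
    · subst h
      obtain ⟨c, hc⟩ := A.schur _ (g ≫ (λ_ _).hom)
      rw [hg, hc]
      have : A.gen (Functor.Monoidal.εIso F) p' p' q ((c • 𝟙 _) ≫ (λ_ _).inv) =
          c • (λ_ _).inv := by
        rw [← key, gen, Linear.smul_comp, genBase_smul, Category.id_comp]
        simp [gen]
      rw [this]
      exact Submodule.smul_mem _ _ (Submodule.subset_span ⟨rfl, by simp⟩)
    · rw [hg, A.schur_ne _ _ (g ≫ (λ_ _).hom) h]
      have : A.gen (Functor.Monoidal.εIso F) p p' q (0 ≫ (λ_ _).inv) = 0 := by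
        simp [gen, genBase]
      rw [this]
      exact zero_mem _
  · refine Submodule.span_le.2 ?_
    rintro s ⟨rfl, rfl⟩
    obtain ⟨p, q, rfl⟩ := A.cons_surj w'
    rw [eqToHom_refl, Category.id_comp, ← key]
    exact A.gen_mem _ p p q _

theorem gen_zero {X : B} {k : K} (i : X ≅ F.obj k) (p p' : A.P) (q : A.Q) :
    A.gen i p p' q 0 = 0 := by
  simp [gen, genBase]

theorem gen_smul {X : B} {k : K} (i : X ≅ F.obj k) (p p' : A.P) (q : A.Q) (c : ℂ)
    (g : A.irr p' ⟶ k ⊗ A.irr p) : A.gen i p p' q (c • g) = c • A.gen i p p' q g := by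
  simp [gen, genBase_smul]

/-- Cancelling `irr one ≅ 𝟙` turns `g` into a morphism between simple objects, and Schur's lemma
applies. -/
theorem eq_of_unit_ne_zero {x p' : A.P} (g : A.irr p' ⟶ A.irr x ⊗ A.irr A.one) :
    (p' ≠ x → g = 0) ∧ (∀ h : p' = x, ∃ c : ℂ,
      g = eqToHom (congrArg A.irr h) ≫ (c • ((ρ_ _).inv ≫ _ ◁ A.oneIso.inv))) := by
  have hg : g = (g ≫ _ ◁ A.oneIso.hom ≫ (ρ_ _).hom) ≫ (ρ_ _).inv ≫ _ ◁ A.oneIso.inv := by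
    simp
  constructor
  · intro h
    rw [hg, A.schur_ne _ _ (g ≫ _ ◁ A.oneIso.hom ≫ (ρ_ _).hom) h, Limits.zero_comp]
  · rintro rfl
    obtain ⟨c, hc⟩ := A.schur _ (g ≫ _ ◁ A.oneIso.hom ≫ (ρ_ _).hom)
    refine ⟨c, ?_⟩
    rw [hg, hc]
    simp

/-- If a simple object `x` maps `w` to `w'`, then `w` and `w'` have the same tail, and the head of
`w'` is `x` if `w` has no head. -/
theorem exists_of_act_ne_bot {X : B} {x : A.P} (i : X ≅ F.obj (A.irr x)) {w w' : W}
    (h : A.act i w w' ≠ ⊥) :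
    ∃ p p' q, A.cons p q = w ∧ A.cons p' q = w' ∧ (p = A.one → p' = x) := by
  contrapose! h
  rw [eq_bot_iff]
  refine Submodule.span_le.2 ?_
  rintro s ⟨p, p', q, rfl, rfl, g, rfl⟩
  obtain ⟨rfl, hp⟩ := h p p' q rfl rfl
  rw [(A.eq_of_unit_ne_zero g).1 hp, gen_zero, Limits.zero_comp, Limits.comp_zero]
  exact zero_mem _

/-- The canonical morphism `obj (cons x q) ⟶ X ⊗ obj (cons one q)`, where `X ≅ F x`. -/
def genOne {X : B} {x : A.P} (i : X ≅ F.obj (A.irr x)) (q : A.Q) :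
    obj (A.cons x q) ⟶ X ⊗ obj (A.cons A.one q) :=
  A.gen i A.one x q ((ρ_ _).inv ≫ _ ◁ A.oneIso.inv)

/-- The objects `cons one q` are the free generators of the module: nothing can fuse with the
trivial head, so `x` leads to `cons x q` only, and with multiplicity one. -/
theorem act_one_le {X : B} {x : A.P} (i : X ≅ F.obj (A.irr x)) (q : A.Q) (w' : W) :
    A.act i (A.cons A.one q) w' ≤ Submodule.span ℂ {s | ∃ h : w' = A.cons x q,
      s = eqToHom (congrArg obj h) ≫ A.genOne i q} := by
  refine Submodule.span_le.2 ?_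
  rintro s ⟨p, p', q', h, rfl, g, rfl⟩
  obtain ⟨rfl, rfl⟩ := A.cons_inj _ _ _ _ h
  by_cases hp : p' = x
  · subst hp
    obtain ⟨c, rfl⟩ := (A.eq_of_unit_ne_zero g).2 rfl
    simp only [eqToHom_refl, Category.id_comp, MonoidalCategory.whiskerLeft_id, Category.comp_id,
      gen_smul]
    exact Submodule.smul_mem _ _ (Submodule.subset_span ⟨trivial, by simp [genOne]⟩)
  · rw [(A.eq_of_unit_ne_zero g).1 hp, gen_zero, Limits.zero_comp, Limits.comp_zero]
    exact zero_mem _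

end FreeAction

open Functor.LaxMonoidal Functor.OplaxMonoidal

/-! ### The two categories as monoidal subcategories of the category of pairs. -/

section Inclusions

variable (C : Type u₁) [Category.{v₁} C] [Preadditive C] [Linear ℂ C]
  [MonoidalCategory C] [MonoidalPreadditive C] [MonoidalLinear ℂ C]
  (D : Type u₂) [Category.{v₂} D] [Preadditive D] [Linear ℂ D]
  [MonoidalCategory D] [MonoidalPreadditive D] [MonoidalLinear ℂ D]

/-- The inclusion of `C` in the category of pairs. -/
def boxL : C ⥤ Box C D where
  obj x := ⟨x, 𝟙_ D⟩
  map f := Box.tmulHom f (𝟙 _)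
  map_comp f g := by
    erw [Box.tmulHom_comp]; rw [Category.comp_id]

/-- The inclusion of `D` in the category of pairs. -/
def boxR : D ⥤ Box C D where
  obj x := ⟨𝟙_ C, x⟩
  map f := Box.tmulHom (𝟙 _) f
  map_comp f g := by
    erw [Box.tmulHom_comp]; rw [Category.comp_id]

instance : (boxL C D).Monoidal :=
  Functor.CoreMonoidal.toMonoidal
    { εIso := Iso.refl _
      μIso := fun X Y => Box.isoMk (Iso.refl _) (λ_ (𝟙_ D))
      μIso_hom_natural_left := fun f X' => congrArg₂ Box.tmulHom
        (show (f ⊗ₘ 𝟙 X') ≫ 𝟙 _ = 𝟙 _ ≫ f ▷ X' by simp)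
        (show (𝟙 (𝟙_ D) ⊗ₘ 𝟙 (𝟙_ D)) ≫ (λ_ (𝟙_ D)).hom = (λ_ _).hom ≫ 𝟙 _ by simp)
      μIso_hom_natural_right := fun X' f => congrArg₂ Box.tmulHom
        (show (𝟙 X' ⊗ₘ f) ≫ 𝟙 _ = 𝟙 _ ≫ X' ◁ f by simp)
        (show (𝟙 (𝟙_ D) ⊗ₘ 𝟙 (𝟙_ D)) ≫ (λ_ (𝟙_ D)).hom = (λ_ _).hom ≫ 𝟙 _ by simp)
      associativity := fun X Y Z => congrArg₂ Box.tmulHom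
        (show (𝟙 (X ⊗ Y) ⊗ₘ 𝟙 Z) ≫ 𝟙 _ ≫ (α_ X Y Z).hom = (α_ X Y Z).hom ≫ (𝟙 X ⊗ₘ 𝟙 (Y ⊗ Z)) ≫ 𝟙 _ by simp)
        (show ((λ_ (𝟙_ D)).hom ⊗ₘ 𝟙 (𝟙_ D)) ≫ (λ_ _).hom ≫ 𝟙 _ =
            (α_ _ _ _).hom ≫ (𝟙 _ ⊗ₘ (λ_ _).hom) ≫ (λ_ _).hom by monoidal_coherence)
      left_unitality := fun X => congrArg₂ Box.tmulHom
        (show (λ_ X).hom = (𝟙 _ ⊗ₘ 𝟙 X) ≫ 𝟙 _ ≫ (λ_ X).hom by simp)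
        (show (λ_ (𝟙_ D)).hom = (𝟙 _ ⊗ₘ 𝟙 _) ≫ (λ_ _).hom ≫ 𝟙 _ by simp)
      right_unitality := fun X => congrArg₂ Box.tmulHom
        (show (ρ_ X).hom = (𝟙 X ⊗ₘ 𝟙 _) ≫ 𝟙 _ ≫ (ρ_ X).hom by simp)
        (show (ρ_ (𝟙_ D)).hom = (𝟙 _ ⊗ₘ 𝟙 _) ≫ (λ_ _).hom ≫ 𝟙 _ by simp [unitors_equal]) }

instance : (boxR C D).Monoidal :=
  Functor.CoreMonoidal.toMonoidal
    { εIso := Iso.refl _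
      μIso := fun X Y => Box.isoMk (λ_ (𝟙_ C)) (Iso.refl _)
      μIso_hom_natural_left := fun f X' => congrArg₂ Box.tmulHom
        (show (𝟙 (𝟙_ C) ⊗ₘ 𝟙 (𝟙_ C)) ≫ (λ_ (𝟙_ C)).hom = (λ_ _).hom ≫ 𝟙 _ by simp)
        (show (f ⊗ₘ 𝟙 X') ≫ 𝟙 _ = 𝟙 _ ≫ f ▷ X' by simp)
      μIso_hom_natural_right := fun X' f => congrArg₂ Box.tmulHom
        (show (𝟙 (𝟙_ C) ⊗ₘ 𝟙 (𝟙_ C)) ≫ (λ_ (𝟙_ C)).hom = (λ_ _).hom ≫ 𝟙 _ by simp)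
        (show (𝟙 X' ⊗ₘ f) ≫ 𝟙 _ = 𝟙 _ ≫ X' ◁ f by simp)
      associativity := fun X Y Z => congrArg₂ Box.tmulHom
        (show ((λ_ (𝟙_ C)).hom ⊗ₘ 𝟙 (𝟙_ C)) ≫ (λ_ _).hom ≫ 𝟙 _ =
            (α_ _ _ _).hom ≫ (𝟙 _ ⊗ₘ (λ_ _).hom) ≫ (λ_ _).hom by monoidal_coherence)
        (show (𝟙 (X ⊗ Y) ⊗ₘ 𝟙 Z) ≫ 𝟙 _ ≫ (α_ X Y Z).hom = (α_ X Y Z).hom ≫ (𝟙 X ⊗ₘ 𝟙 (Y ⊗ Z)) ≫ 𝟙 _ by simp)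
      left_unitality := fun X => congrArg₂ Box.tmulHom
        (show (λ_ (𝟙_ C)).hom = (𝟙 _ ⊗ₘ 𝟙 _) ≫ (λ_ _).hom ≫ 𝟙 _ by simp)
        (show (λ_ X).hom = (𝟙 _ ⊗ₘ 𝟙 X) ≫ 𝟙 _ ≫ (λ_ X).hom by simp)
      right_unitality := fun X => congrArg₂ Box.tmulHom
        (show (ρ_ (𝟙_ C)).hom = (𝟙 _ ⊗ₘ 𝟙 _) ≫ (λ_ _).hom ≫ 𝟙 _ by simp [unitors_equal])
        (show (ρ_ X).hom = (𝟙 X ⊗ₘ 𝟙 _) ≫ 𝟙 _ ≫ (ρ_ X).hom by simp) }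

instance : (boxL C D).Additive where
  map_add {_ _ f g} := TensorProduct.add_tmul f g _

instance : (boxR C D).Additive where
  map_add {_ _ f g} := TensorProduct.tmul_add _ f g

instance : (boxL C D).Linear ℂ where
  map_smul f c := TensorProduct.smul_tmul' c f _

instance : (boxR C D).Linear ℂ where
  map_smul {X Y} f c :=
    (TensorProduct.mk ℂ ((⟨𝟙_ C, X⟩ : Box C D).fst ⟶ (⟨𝟙_ C, Y⟩ : Box C D).fst) (X ⟶ Y)
      (𝟙 _)).map_smul c f

end Inclusions

/-! ### The action of words on families, and its invariance under diagrams. -/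

namespace Word

variable {C : Type u₁} [Category.{v₁} C] [Preadditive C] [Linear ℂ C]
  [MonoidalCategory C] [MonoidalPreadditive C] [MonoidalLinear ℂ C] [DaggerMonoidal C]
  {D : Type u₂} [Category.{v₂} D] [Preadditive D] [Linear ℂ D]
  [MonoidalCategory D] [MonoidalPreadditive D] [MonoidalLinear ℂ D] [DaggerMonoidal D]

/-- A word with letters from `C` is in the image of `C`. -/
def leftIso (σ : Word C D) (h : σ.AllLeft) : σ.eval ≅ (boxL C D).obj σ.eval.fst :=
  Box.isoMk (Iso.refl _) (σ.unitRight h)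

/-- A word with letters from `D` is in the image of `D`. -/
def rightIso (σ : Word C D) (h : σ.AllRight) : σ.eval ≅ (boxR C D).obj σ.eval.snd :=
  Box.isoMk (σ.unitLeft h) (Iso.refl _)

variable {W : Type w} {obj : W → Box C D} (A : FreeAction (boxL C D) obj)
  (A' : FreeAction (boxR C D) obj)

/-- The space of those morphisms `obj w' ⟶ σ ⊗ obj w` that come from the actions of the letters
of `σ`. -/
def act : (σ : Word C D) → HomFamily obj σ.eval
  | empty => unitSpan obj
  | letter (Sum.inl a) => A.act (Iso.refl ((boxL C D).obj a))
  | letter (Sum.inr b) => A'.act (Iso.refl ((boxR C D).obj b))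
  | append σ τ => compSpan (act σ) (act τ)

/-- By `act_tensor` and `act_unit`, letters from `C` acting one after the other act as their tensor
product acts at once. Hence a block sees only one object of `C` below and one above. -/
theorem act_of_allLeft : ∀ (σ : Word C D) (h : σ.AllLeft),
    σ.act A A' = A.act (σ.leftIso h)
  | empty, _ => A.act_unit.symm
  | letter (Sum.inl a), _ => rfl
  | letter (Sum.inr _), h => absurd h (by simp [AllLeft])
  | append σ τ, h => by
    change compSpan (act A A' σ) (act A A' τ) = _
    rw [act_of_allLeft σ h.1, act_of_allLeft τ h.2, FreeAction.act_tensor]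
    -- It remains to compare two identifications of the evaluated word with an object from `C`; they
    -- agree componentwise.
    congr 1
    apply Iso.ext
    refine congrArg₂ Box.tmulHom ?_ ?_
    · exact (Category.comp_id _).trans (MonoidalCategory.id_tensorHom_id _ _)
    · rfl

theorem act_of_allRight : ∀ (σ : Word C D) (h : σ.AllRight),
    σ.act A A' = A'.act (σ.rightIso h)
  | empty, _ => A'.act_unit.symm
  | letter (Sum.inr a), _ => rfl
  | letter (Sum.inl _), h => absurd h (by simp [AllRight])
  | append σ τ, h => by
    change compSpan (act A A' σ) (act A A' τ) = _
    rw [act_of_allRight σ h.1, act_of_allRight τ h.2, FreeAction.act_tensor]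
    congr 1
    apply Iso.ext
    refine congrArg₂ Box.tmulHom ?_ ?_
    · rfl
    · exact (Category.comp_id _).trans (MonoidalCategory.id_tensorHom_id _ _)

theorem Z_blockC (σ τ : Word C D) (hσ : σ.AllLeft) (hτ : τ.AllLeft)
    (f : σ.eval.fst ⟶ τ.eval.fst) : (NCDiagram.blockC σ τ hσ hτ f).Z =
      (σ.leftIso hσ).hom ≫ (boxL C D).map f ≫ (τ.leftIso hτ).inv :=
  congrArg₂ Box.tmulHom (show f = 𝟙 _ ≫ f ≫ 𝟙 _ by simp)
    (show (σ.unitRight hσ).hom ≫ (τ.unitRight hτ).inv =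
      (σ.unitRight hσ).hom ≫ 𝟙 _ ≫ (τ.unitRight hτ).inv by simp)

theorem Z_blockD (σ τ : Word C D) (hσ : σ.AllRight) (hτ : τ.AllRight)
    (f : σ.eval.snd ⟶ τ.eval.snd) : (NCDiagram.blockD σ τ hσ hτ f).Z =
      (σ.rightIso hσ).hom ≫ (boxR C D).map f ≫ (τ.rightIso hτ).inv :=
  congrArg₂ Box.tmulHom
    (show (σ.unitLeft hσ).hom ≫ (τ.unitLeft hτ).inv =
      (σ.unitLeft hσ).hom ≫ 𝟙 _ ≫ (τ.unitLeft hτ).inv by simp)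
    (show f = 𝟙 _ ≫ f ≫ 𝟙 _ by simp)

/-- Induction on the diagram. A block is handled by `act_map`, since all its letters act through the
category of its label; stacking, juxtaposition and rebracketing are formal properties of `Carries`.
-/
theorem carries_Z : ∀ {σ τ : Word C D} (T : NCDiagram σ τ),
    Carries (σ.act A A') (τ.act A A') T.Z
  | _, _, .blockC σ τ hσ hτ f => by
    rw [act_of_allLeft A A' τ hτ, Z_blockC, act_of_allLeft A A' σ hσ]
    exact A.act_map _ _ f
  | _, _, .blockD σ τ hσ hτ f => by
    rw [act_of_allRight A A' τ hτ, Z_blockD, act_of_allRight A A' σ hσ]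
    exact A'.act_map _ _ f
  | _, _, .strings σ => Carries.id _
  | _, _, .stack S T => (carries_Z S).comp (carries_Z T)
  | _, _, .juxtapose S T => (carries_Z S).tensor (carries_Z T)
  | _, _, .assoc σ τ κ => carries_associator_hom _ _ _
  | _, _, .assocInv σ τ κ => carries_associator_inv _ _ _
  | _, _, .unitL σ => carries_leftUnitor_hom _
  | _, _, .unitLInv σ => carries_leftUnitor_inv _
  | _, _, .unitR σ => carries_rightUnitor_hom _
  | _, _, .unitRInv σ => carries_rightUnitor_inv _

theorem carries_of_mem_ncpHom {σ τ : Word C D} {f : σ.eval ⟶ τ.eval} (hf : f ∈ ncpHom σ τ) :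
    Carries (σ.act A A') (τ.act A A') f := by
  have : ncpHom σ τ ≤ carriesSub (σ.act A A') (τ.act A A') := by
    refine Submodule.span_le.2 ?_
    rintro _ ⟨T, rfl⟩
    exact carries_Z A A' T
  exact this hf

end Word

/-! ### Schur's lemma with unitaries in a rigid C*-tensor category. -/

section Schur

variable {C : Type u} [Category.{v} C] [Preadditive C] [Linear ℂ C] [MonoidalCategory C]
  [DaggerMonoidal C]

theorem dag_zero (X Y : C) : (0 : X ⟶ Y)† = 0 := map_zero (dagₛₗ X Y)

theorem eq_zero_of_comp_dag (h : IsCStarCategory C) {X Y : C} {f : X ⟶ Y} (hf : f ≫ f† = 0) :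
    f = 0 := by
  obtain ⟨N, h1, -, h3, -, -, h6, -⟩ := h
  apply h1
  have : N X X (f ≫ f†) = 0 := by
    rw [hf]
    have := h3 X X 0 0
    simpa using this
  rw [h6] at this
  exact pow_eq_zero_iff two_ne_zero |>.1 this

/-- Positivity gives `f ≫ f† = g ≫ g†` with `g : X ⟶ X`, which is a scalar `z` as `X` is simple. So
`f ≫ f†` is `|z|²`, and the C*-identity excludes `z = 0`. -/
theorem IsSimpleObj.comp_dag (h : IsCStarCategory C) {X Y : C} (hX : IsSimpleObj X) (f : X ⟶ Y)
    (hf : f ≠ 0) : ∃ r : ℝ, 0 < r ∧ f ≫ f† = (r : ℂ) • 𝟙 X := by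
  obtain ⟨N, h1, h2, h3, h4, h5, h6, h7⟩ := id h
  obtain ⟨g, hg⟩ := h7 X Y f
  obtain ⟨z, rfl⟩ := hX.2 g
  have e : f ≫ f† = ((Complex.normSq z : ℝ) : ℂ) • 𝟙 X := by
    rw [hg, DaggerMonoidal.dag_smul, dag_id, Linear.smul_comp, Linear.comp_smul, smul_smul,
      Category.comp_id, Complex.mul_conj]
  refine ⟨_, lt_of_le_of_ne (Complex.normSq_nonneg z) fun h0 => hf ?_, e⟩
  apply eq_zero_of_comp_dag h
  rw [e, ← h0]
  simp

/-- A unitary morphism. -/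
structure IsUnitary {X Y : C} (u : X ⟶ Y) : Prop where
  comp_dag : u ≫ u† = 𝟙 X
  dag_comp : u† ≫ u = 𝟙 Y

theorem IsUnitary.id (X : C) : IsUnitary (𝟙 X) := ⟨by simp [dag_id], by simp [dag_id]⟩

theorem IsUnitary.dag {X Y : C} {u : X ⟶ Y} (hu : IsUnitary u) : IsUnitary u† :=
  ⟨by rw [DaggerMonoidal.dag_dag]; exact hu.2, by rw [DaggerMonoidal.dag_dag]; exact hu.1⟩

theorem IsUnitary.comp {X Y Z : C} {u : X ⟶ Y} {v : Y ⟶ Z} (hu : IsUnitary u)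
    (hv : IsUnitary v) : IsUnitary (u ≫ v) := by
  constructor
  · rw [DaggerMonoidal.dag_comp, Category.assoc, ← Category.assoc v, hv.1, Category.id_comp, hu.1]
  · rw [DaggerMonoidal.dag_comp, Category.assoc, ← Category.assoc u†, hu.2, Category.id_comp, hv.2]

theorem IsUnitary.tensor {X Y X' Y' : C} {u : X ⟶ Y} {v : X' ⟶ Y'} (hu : IsUnitary u)
    (hv : IsUnitary v) : IsUnitary (u ⊗ₘ v) := by
  constructor
  · rw [DaggerMonoidal.dag_tensor, tensorHom_comp_tensorHom, hu.1, hv.1, id_tensorHom_id]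
  · rw [DaggerMonoidal.dag_tensor, tensorHom_comp_tensorHom, hu.2, hv.2, id_tensorHom_id]

theorem isUnitary_associator (X Y Z : C) : IsUnitary (α_ X Y Z).hom :=
  ⟨by rw [DaggerMonoidal.dag_associator, Iso.hom_inv_id],
   by rw [DaggerMonoidal.dag_associator, Iso.inv_hom_id]⟩

theorem isUnitary_leftUnitor (X : C) : IsUnitary (λ_ X).hom :=
  ⟨by rw [DaggerMonoidal.dag_leftUnitor, Iso.hom_inv_id],
   by rw [DaggerMonoidal.dag_leftUnitor, Iso.inv_hom_id]⟩

theorem isUnitary_rightUnitor (X : C) : IsUnitary (ρ_ X).hom :=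
  ⟨by rw [DaggerMonoidal.dag_rightUnitor, Iso.hom_inv_id],
   by rw [DaggerMonoidal.dag_rightUnitor, Iso.inv_hom_id]⟩

/-- Both `f ≫ f†` and `f† ≫ f` are scalars, in fact the same positive scalar `r`; dividing `f` by
`√r` makes it unitary. -/
theorem exists_isUnitary_of_ne_zero (h : IsCStarCategory C) {X Y : C} (hX : IsSimpleObj X)
    (hY : IsSimpleObj Y) {f : X ⟶ Y} (hf : f ≠ 0) : ∃ u : X ⟶ Y, IsUnitary u := by
  obtain ⟨r, hr, e⟩ := hX.comp_dag h f hf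
  obtain ⟨c, hc⟩ := hY.2 (f† ≫ f)
  have h1 : f ≫ f† ≫ f = (r : ℂ) • f := by
    rw [← Category.assoc, e, Linear.smul_comp, Category.id_comp]
  have h2 : f ≫ f† ≫ f = c • f := by
    rw [hc, Linear.comp_smul, Category.comp_id]
  -- Both scalars describe the multiplication of `f ≠ 0` in `f ≫ f† ≫ f`.
  have h3 : c = r := by
    by_contra hne
    apply hf
    have : (c - r) • f = 0 := by rw [sub_smul, ← h1, ← h2, sub_self]
    exact (smul_eq_zero.1 this).resolve_left (sub_ne_zero.2 hne)
  subst h3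
  have hz : ((Real.sqrt r)⁻¹ : ℂ) * conj ((Real.sqrt r)⁻¹ : ℂ) * r = 1 := by
    rw [map_inv₀, Complex.conj_ofReal, ← mul_inv, ← Complex.ofReal_mul,
      Real.mul_self_sqrt hr.le, inv_mul_cancel₀]
    exact_mod_cast hr.ne'
  refine ⟨((Real.sqrt r)⁻¹ : ℂ) • f, ?_, ?_⟩
  · rw [DaggerMonoidal.dag_smul, Linear.smul_comp, Linear.comp_smul, e, smul_smul, smul_smul, hz,
      one_smul]
  · rw [DaggerMonoidal.dag_smul, Linear.smul_comp, Linear.comp_smul, hc, smul_smul, smul_smul,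
      mul_comm (conj _), hz, one_smul]

theorem IsUnitary.nonempty_iso {X Y : C} {u : X ⟶ Y} (hu : IsUnitary u) : Nonempty (X ≅ Y) :=
  ⟨⟨u, u†, hu.1, hu.2⟩⟩

/-- The simple objects in `I`, together with the tensor unit. -/
def irrOrUnit (I : Set C) : Option I → C
  | none => 𝟙_ C
  | some x => x.1

theorem irrOrUnit_simple {I : Set C} (hC : IsRigidCStarTensor C) (hI : IsNonunitIrr I) :
    ∀ p, IsSimpleObj (irrOrUnit I p)
  | none => hC.simple_unit
  | some x => hI.simple x.1 x.2

theorem irrOrUnit_hom_eq_zero {I : Set C} (hC : IsRigidCStarTensor C) (hI : IsNonunitIrr I)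
    (p p' : Option I) (f : irrOrUnit I p ⟶ irrOrUnit I p') (hp : p ≠ p') : f = 0 := by
  by_contra hf
  obtain ⟨u, hu⟩ := exists_isUnitary_of_ne_zero hC.cstar (irrOrUnit_simple hC hI p)
    (irrOrUnit_simple hC hI p') hf
  obtain ⟨e⟩ := hu.nonempty_iso
  match p, p', e, hp with
  | none, none, _, hp => exact hp rfl
  | none, some x, e, _ => exact (hI.nonunit x.1 x.2).false e.symm
  | some x, none, e, _ => exact (hI.nonunit x.1 x.2).false e
  | some x, some y, e, hp => exact hp (congrArg some (Subtype.ext (hI.unique _ x.2 _ y.2 ⟨e⟩)))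

theorem exists_irrOrUnit_isUnitary {I : Set C} (hC : IsRigidCStarTensor C) (hI : IsNonunitIrr I)
    {X : C} (hX : IsSimpleObj X) : ∃ (p : Option I) (u : irrOrUnit I p ⟶ X), IsUnitary u := by
  have key : ∀ p : Option I, Nonempty (irrOrUnit I p ≅ X) →
      ∃ u : irrOrUnit I p ⟶ X, IsUnitary u := by
    rintro p ⟨e⟩
    refine exists_isUnitary_of_ne_zero hC.cstar (irrOrUnit_simple hC hI p) hX (f := e.hom) ?_
    intro h0
    apply (irrOrUnit_simple hC hI p).1
    rw [← e.hom_inv_id, h0, Limits.zero_comp]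
  by_cases h : Nonempty (X ≅ 𝟙_ C)
  · exact ⟨none, key none ⟨h.some.symm⟩⟩
  · obtain ⟨a, ha, ⟨e⟩⟩ := hI.exhaust X hX (not_nonempty_iff.1 h)
    exact ⟨some ⟨a, ha⟩, key (some ⟨a, ha⟩) ⟨e.symm⟩⟩

theorem exists_orthonormal_irrOrUnit {I : Set C} (hC : IsRigidCStarTensor C)
    (hI : IsNonunitIrr I) (X : C) : ∃ (n : ℕ) (p : Fin n → Option I)
    (s : ∀ i, irrOrUnit I (p i) ⟶ X), (∀ i, s i ≫ (s i)† = 𝟙 _) ∧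
      (∀ i j, i ≠ j → s i ≫ (s j)† = 0) ∧ ∑ i, (s i)† ≫ s i = 𝟙 X := by
  obtain ⟨n, S, s, h1, h2, h3, h4⟩ := hC.semisimple.decomp X
  choose p u hu using fun i => exists_irrOrUnit_isUnitary hC hI (h1 i)
  refine ⟨n, p, fun i => u i ≫ s i, fun i => ?_, fun i j hij => ?_, ?_⟩
  · rw [DaggerMonoidal.dag_comp, Category.assoc, ← Category.assoc (s i), h2, Category.id_comp,
      (hu i).1]
  · rw [DaggerMonoidal.dag_comp, Category.assoc, ← Category.assoc (s i), h3 i j hij,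
      Limits.zero_comp, Limits.comp_zero]
  · rw [← h4]
    refine Finset.sum_congr rfl fun i _ => ?_
    rw [DaggerMonoidal.dag_comp, Category.assoc, ← Category.assoc (u i)†, (hu i).2,
      Category.id_comp]

end Schur

/-! ## Fusion of alternating words -/

section Fusion

variable {A : Type*} {A' : Type*}

/-- The letter `x` times the word `w` can have `w'` as a summand. -/
def FusesLetter (x : A ⊕ A') (w w' : List (A ⊕ A')) : Prop :=
  w' = x :: w ∨ ∃ y v, w = y :: v ∧ y.isLeft = x.isLeft ∧
    (w' = v ∨ ∃ z : A ⊕ A', z.isLeft = x.isLeft ∧ w' = z :: v)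

/-- The letters of the word `l`, applied one after the other to `u`, can lead to `w`. -/
def Fuses : List (A ⊕ A') → List (A ⊕ A') → List (A ⊕ A') → Prop
  | [], u, w => w = u
  | x :: l, u, w => ∃ w', Fuses l u w' ∧ FusesLetter x w' w

/-- The letters of a word come alternatingly from the two sets. -/
abbrev IsAlt (l : List (A ⊕ A')) : Prop := l.IsChain fun s t => s.isLeft ≠ t.isLeft

theorem Fuses.length_le {l u w : List (A ⊕ A')} (h : Fuses l u w) :
    w.length ≤ l.length + u.length := by
  induction l generalizing w with
  | nil => cases h; simp
  | cons x l ih =>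
    obtain ⟨w', h', h⟩ := h
    have := ih h'
    rcases h with rfl | ⟨y, v, rfl, -, rfl | ⟨z, -, rfl⟩⟩ <;> simp at this ⊢ <;> omega

/-- Either the first letter of the result has the type of the first letter applied, or all letters
have cancelled. -/
theorem Fuses.head {l u w : List (A ⊕ A')} (hl : IsAlt l) (h : Fuses l u w) :
    (∃ x l' z v, l = x :: l' ∧ w = z :: v ∧ z.isLeft = x.isLeft) ∨
      w.length + l.length = u.length := by
  induction l generalizing w with
  | nil => cases h; simp
  | cons x l ih =>
    obtain ⟨w', h', h⟩ := h
    rcases ih hl.tail h' with ⟨y, l', z, v, rfl, rfl, e⟩ | e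
    · have hxy : x.isLeft ≠ y.isLeft := (List.isChain_cons_cons.1 hl).1
      rcases h with rfl | ⟨y, v, h, e', -⟩
      · exact Or.inl ⟨_, _, _, _, rfl, rfl, rfl⟩
      · cases h
        exact absurd (e'.symm.trans e) hxy
    · rcases h with rfl | ⟨y, v, rfl, e', rfl | ⟨z, e'', rfl⟩⟩
      · exact Or.inl ⟨_, _, _, _, rfl, rfl, rfl⟩
      · right; simp at e ⊢; omega
      · exact Or.inl ⟨_, _, _, _, rfl, rfl, e''⟩

/-- Either the last letter keeps its type, or the word is cancelled. -/
theorem Fuses.last {l u w : List (A ⊕ A')} (hl : IsAlt l) (h : Fuses l u w) :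
    (w ≠ [] ∧ w.getLast?.map Sum.isLeft = u.getLast?.map Sum.isLeft) ∨
      w.length + u.length = l.length := by
  induction l generalizing w with
  | nil =>
    cases h
    cases u <;> simp
  | cons x l ih =>
    obtain ⟨w', h', h⟩ := h
    rcases ih hl.tail h' with ⟨hw', e⟩ | e
    · obtain ⟨y, v, rfl⟩ := List.exists_cons_of_ne_nil hw'
      rcases h with rfl | ⟨y, v, h, e', h''⟩
      · left
        simpa [List.getLast?_cons_cons] using e
      · cases h
        cases v with
        | cons a v =>
          left
          rcases h'' with rfl | ⟨z, -, rfl⟩ <;> simpa [List.getLast?_cons_cons] using e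
        | nil =>
          rcases h'' with rfl | ⟨z, hz, rfl⟩
          -- The last remaining letter is cancelled by `x`. By `Fuses.head` all other letters of `l`
          -- have cancelled before, which fixes the lengths.
          · right
            rcases h'.head hl.tail with ⟨x', l', z, v, rfl, h, e''⟩ | e''
            · cases h
              exact absurd (e'.symm.trans e'') (List.isChain_cons_cons.1 hl).1
            · simp at e'' ⊢; omega
          · left
            simp [hz, ← e', ← e]
    · rcases h with rfl | ⟨y, v, rfl, e', h''⟩
      · right; simp; omega
      -- The intermediate word begins with `y` of the type of `x`, so `Fuses.head` can only give the
      -- second length equation, and the two equations together force that word to be empty.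
      · exfalso
        rcases h'.head hl.tail with ⟨x', l', z, v, rfl, h, e''⟩ | e''
        · cases h
          exact absurd (e'.symm.trans e'') (List.isChain_cons_cons.1 hl).1
        · simp at e e''; omega

end Fusion

/-! ## Families with one member -/

section HomFamily

variable {B : Type u₁} [Category.{v₁} B] [Preadditive B] [Linear ℂ B] [MonoidalCategory B]
    [MonoidalPreadditive B] [MonoidalLinear ℂ B] {W : Type w} {obj : W → B}

/-- The multiples of `s : obj w₁ ⟶ X`, as a family of subspaces. -/
def singleSpan {X : B} {w₁ : W} (s : obj w₁ ⟶ X) (w' : W) : Submodule ℂ (obj w' ⟶ X) :=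
  Submodule.span ℂ {r | ∃ h : w' = w₁, r = eqToHom (congrArg obj h) ≫ s}

theorem mem_singleSpan {X : B} {w₁ : W} (s : obj w₁ ⟶ X) : s ∈ singleSpan s w₁ :=
  Submodule.subset_span ⟨rfl, by simp⟩

theorem unitSpan_le (w w' : W) : unitSpan obj w w' ≤ singleSpan (λ_ (obj w)).inv w' := le_rfl

theorem eq_zero_of_mem_singleSpan {X : B} {w₁ w' : W} {s : obj w₁ ⟶ X} {r : obj w' ⟶ X}
    (hr : r ∈ singleSpan s w') (h : w' ≠ w₁) : r = 0 := by
  have : singleSpan s w' ≤ ⊥ := Submodule.span_le.2 (by rintro _ ⟨h', -⟩; exact absurd h' h)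
  exact (Submodule.mem_bot ℂ).1 (this hr)

theorem exists_smul_of_mem_singleSpan {X : B} {w₁ : W} {s : obj w₁ ⟶ X} {r : obj w₁ ⟶ X}
    (hr : r ∈ singleSpan s w₁) : ∃ c : ℂ, r = c • s := by
  have : singleSpan s w₁ ≤ Submodule.span ℂ {s} := Submodule.span_mono (by
    rintro _ ⟨h', rfl⟩; simp)
  obtain ⟨c, hc⟩ := Submodule.mem_span_singleton.1 (this hr)
  exact ⟨c, hc.symm⟩

/-- Multiplicity one is preserved by composition: from `w` the family `T` leads to `w₀` only, and
from there `S` leads to `w₁` only. -/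
theorem compSpan_le_singleSpan {X Y : B} {S : HomFamily obj X} {T : HomFamily obj Y}
    {w w₀ w₁ : W} (t₀ : obj w₀ ⟶ Y ⊗ obj w) (s₀ : obj w₁ ⟶ X ⊗ obj w₀)
    (hS : ∀ w', S w₀ w' ≤ singleSpan s₀ w') (hT : ∀ w', T w w' ≤ singleSpan t₀ w') (w' : W) :
    compSpan S T w w' ≤ singleSpan (s₀ ≫ X ◁ t₀ ≫ (α_ _ _ _).inv) w' := by
  refine Submodule.span_le.2 ?_
  rintro _ ⟨w₂, s, hs, t, ht, rfl⟩
  by_cases h : w₂ = w₀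
  · subst h
    obtain ⟨c, rfl⟩ := exists_smul_of_mem_singleSpan (hT _ ht)
    by_cases h' : w' = w₁
    · subst h'
      obtain ⟨d, rfl⟩ := exists_smul_of_mem_singleSpan (hS _ hs)
      have e : (d • s₀) ≫ X ◁ (c • t₀) ≫ (α_ _ _ _).inv =
        (d * c) • (s₀ ≫ X ◁ t₀ ≫ (α_ _ _ _).inv) := by simp [smul_smul, mul_comm]
      rw [e]
      exact Submodule.smul_mem _ _ (mem_singleSpan _)
    · rw [eq_zero_of_mem_singleSpan (hS _ hs) h', Limits.zero_comp]
      exact zero_mem _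
  · rw [eq_zero_of_mem_singleSpan (hT _ ht) h]
    simp

theorem le_singleSpan_of_eq {X : B} {w₁ : W} {s s' : obj w₁ ⟶ X} (h : s = s') {w' : W}
    {S : Submodule ℂ (obj w' ⟶ X)} (hS : S ≤ singleSpan s w') : S ≤ singleSpan s' w' := h ▸ hS

end HomFamily

/-! ## Morphisms between alternating words -/

section Words

variable {C : Type u₁} [Category.{v₁} C] [Preadditive C] [Linear ℂ C]
  [MonoidalCategory C] [MonoidalPreadditive C] [MonoidalLinear ℂ C] [DaggerMonoidal C]
  {D : Type u₂} [Category.{v₂} D] [Preadditive D] [Linear ℂ D]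
  [MonoidalCategory D] [MonoidalPreadditive D] [MonoidalLinear ℂ D] [DaggerMonoidal D]

/-- The word of the objects in a list. -/
abbrev listWord {I : Set C} {I' : Set D} (l : List (I ⊕ I')) : Word C D :=
  Word.ofList (l.map (Sum.map Subtype.val Subtype.val))

/-- The pair of objects given by an alternating word. -/
def altBox (I : Set C) (I' : Set D) (l : AltWord I I') : Box C D := (listWord l.1).eval

/-- Alternating words form a free module over `C`. -/
def actionL (hC : IsRigidCStarTensor C) {I : Set C} (hI : IsNonunitIrr I) (I' : Set D) :
    FreeAction.{max v₁ v₂, v₁, max u₁ u₂, u₁, u₁, max u₁ u₂, max u₁ u₂} (boxL C D)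
      (altBox I I') where
  P := Option I
  irr := irrOrUnit I
  -- A word splits uniquely into an optional first letter from `C` and a word that does not begin in
  -- `C`; the latter words are the free generators.
  Q := {q : AltWord I I' // ∀ y ∈ q.1.head?, (Sum.isLeft y) = false}
  base q := altBox I I' q.1
  cons p q := match p with
    | none => q.1
    | some x => ⟨Sum.inl x :: q.1.1, List.isChain_cons.2 ⟨fun y hy => by simp [q.2 y hy], q.1.2⟩⟩
  cons_inj := by
    rintro (_ | x) ⟨⟨q, hq⟩, h⟩ (_ | x') ⟨⟨q', hq'⟩, h'⟩ e
    · exact ⟨rfl, Subtype.ext e⟩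
    · cases e; simp at h
    · cases e; simp at h'
    · cases e; exact ⟨rfl, rfl⟩
  cons_surj := by
    rintro ⟨_ | ⟨(x | x), l⟩, h⟩
    · exact ⟨none, ⟨⟨[], h⟩, by simp⟩, rfl⟩
    · exact ⟨some x, ⟨⟨l, h.tail⟩, fun y hy => by simpa using (List.isChain_cons.1 h).1 y hy⟩, rfl⟩
    · exact ⟨none, ⟨⟨Sum.inr x :: l, h⟩, by simp⟩, rfl⟩
  κ p q := match p with
    | none => λ_ (altBox I I' q.1)
    | some x => Iso.refl _
  one := none
  oneIso := Iso.refl _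
  schur_ne := irrOrUnit_hom_eq_zero hC hI
  schur p := (irrOrUnit_simple hC hI p).2
  complete k := by
    obtain ⟨n, p, s, -, -, h⟩ := exists_orthonormal_irrOrUnit hC hI k
    exact ⟨n, p, s, fun i => (s i)†, h⟩

/-- Alternating words form a free module over `D`. -/
def actionR (hD : IsRigidCStarTensor D) (I : Set C) {I' : Set D} (hI' : IsNonunitIrr I') :
    FreeAction.{max v₁ v₂, v₂, max u₁ u₂, u₂, u₂, max u₁ u₂, max u₁ u₂} (boxR C D)
      (altBox I I') where
  P := Option I'
  irr := irrOrUnit I'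
  Q := {q : AltWord I I' // ∀ y ∈ q.1.head?, (Sum.isLeft y) = true}
  base q := altBox I I' q.1
  cons p q := match p with
    | none => q.1
    | some x => ⟨Sum.inr x :: q.1.1, List.isChain_cons.2 ⟨fun y hy => by simp [q.2 y hy], q.1.2⟩⟩
  cons_inj := by
    rintro (_ | x) ⟨⟨q, hq⟩, h⟩ (_ | x') ⟨⟨q', hq'⟩, h'⟩ e
    · exact ⟨rfl, Subtype.ext e⟩
    · cases e; simp at h
    · cases e; simp at h'
    · cases e; exact ⟨rfl, rfl⟩
  cons_surj := by
    rintro ⟨_ | ⟨(x | x), l⟩, h⟩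
    · exact ⟨none, ⟨⟨[], h⟩, by simp⟩, rfl⟩
    · exact ⟨none, ⟨⟨Sum.inl x :: l, h⟩, by simp⟩, rfl⟩
    · exact ⟨some x, ⟨⟨l, h.tail⟩, fun y hy => by simpa using (List.isChain_cons.1 h).1 y hy⟩, rfl⟩
  κ p q := match p with
    | none => λ_ (altBox I I' q.1)
    | some x => Iso.refl _
  one := none
  oneIso := Iso.refl _
  schur_ne := irrOrUnit_hom_eq_zero hD hI'
  schur p := (irrOrUnit_simple hD hI' p).2
  complete k := by
    obtain ⟨n, p, s, -, -, h⟩ := exists_orthonormal_irrOrUnit hD hI' k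
    exact ⟨n, p, s, fun i => (s i)†, h⟩

variable (hC : IsRigidCStarTensor C) (hD : IsRigidCStarTensor D)
  {I : Set C} (hI : IsNonunitIrr I) {I' : Set D} (hI' : IsNonunitIrr I')

/-- The morphisms between alternating words that come from the letters of `σ`. -/
def altAct (σ : Word C D) : HomFamily (altBox I I') σ.eval :=
  σ.act (actionL hC hI I') (actionR hD I hI')

/-- This is `genBase_rightUnitor`: the unit comparison of `boxL` is an identity, and the object of
the word `xq` is by definition the product of those of `x` and `q`. -/
theorem actionL_genOne (x : I) (q : (actionL hC hI I').Q) :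
    (actionL hC hI I').genOne (x := some x) (Iso.refl ((boxL C D).obj x.1)) q = 𝟙 _ := by
  have h := FreeAction.genBase_rightUnitor (F := boxL C D) x.1 (altBox I I' q.1)
  have e : Functor.OplaxMonoidal.η (boxL C D) ▷ altBox I I' q.1 ≫ (λ_ (altBox I I' q.1)).hom =
      (λ_ (altBox I I' q.1)).hom :=
    (congrArg (· ≫ (λ_ _).hom) (id_whiskerRight _ _)).trans (Category.id_comp _)
  have e' : (ρ_ x.1).inv ≫ x.1 ◁ (𝟙 (𝟙_ C)) = (ρ_ x.1).inv := by simp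
  rw [e] at h
  refine (Category.id_comp _).trans (Eq.trans ?_ h)
  exact congrArg (fun g => FreeAction.genBase (F := boxL C D) (Iso.refl ((boxL C D).obj x.1))
    (altBox I I' q.1) g ≫ (boxL C D).obj x.1 ◁ (λ_ (altBox I I' q.1)).hom) e'

theorem actionR_genOne (x : I') (q : (actionR hD I hI').Q) :
    (actionR hD I hI').genOne (x := some x) (Iso.refl ((boxR C D).obj x.1)) q = 𝟙 _ := by
  have h := FreeAction.genBase_rightUnitor (F := boxR C D) x.1 (altBox I I' q.1)
  have e : Functor.OplaxMonoidal.η (boxR C D) ▷ altBox I I' q.1 ≫ (λ_ (altBox I I' q.1)).hom =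
      (λ_ (altBox I I' q.1)).hom :=
    (congrArg (· ≫ (λ_ _).hom) (id_whiskerRight _ _)).trans (Category.id_comp _)
  have e' : (ρ_ x.1).inv ≫ x.1 ◁ (𝟙 (𝟙_ D)) = (ρ_ x.1).inv := by simp
  rw [e] at h
  refine (Category.id_comp _).trans (Eq.trans ?_ h)
  exact congrArg (fun g => FreeAction.genBase (F := boxR C D) (Iso.refl ((boxR C D).obj x.1))
    (altBox I I' q.1) g ≫ (boxR C D).obj x.1 ◁ (λ_ (altBox I I' q.1)).hom) e'

/-- A letter changes only the head of a word of its own type (`exists_of_act_ne_bot`); the cases are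
whether `w` and `w'` have such a head. -/
theorem fusesLetter_of_altAct_ne (x : I ⊕ I') {w w' : AltWord I I'}
    (h : altAct hC hD hI hI' (Word.letter (Sum.map Subtype.val Subtype.val x)) w w' ≠ ⊥) :
    FusesLetter x w.1 w'.1 := by
  rcases x with x | x
  · obtain ⟨p, p', q, rfl, rfl, e⟩ :=
      (actionL hC hI I').exists_of_act_ne_bot (x := some x) _ h
    rcases p with _ | y
    · cases e rfl
      exact Or.inl rfl
    · rcases p' with _ | z
      · exact Or.inr ⟨_, _, rfl, rfl, Or.inl rfl⟩
      · exact Or.inr ⟨_, _, rfl, rfl, Or.inr ⟨Sum.inl z, rfl, rfl⟩⟩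
  · obtain ⟨p, p', q, rfl, rfl, e⟩ :=
      (actionR hD I hI').exists_of_act_ne_bot (x := some x) _ h
    rcases p with _ | y
    · cases e rfl
      exact Or.inl rfl
    · rcases p' with _ | z
      · exact Or.inr ⟨_, _, rfl, rfl, Or.inl rfl⟩
      · exact Or.inr ⟨_, _, rfl, rfl, Or.inr ⟨Sum.inr z, rfl, rfl⟩⟩

/-- Multiplication by a letter of the other type leads to one word only. -/
theorem altAct_letter_le (x : I ⊕ I') (w : AltWord I I') (hx : IsAlt (x :: w.1))
    (w' : AltWord I I') :
    altAct hC hD hI hI' (Word.letter (Sum.map Subtype.val Subtype.val x)) w w' ≤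
      singleSpan (w₁ := ⟨x :: w.1, hx⟩) (𝟙 (altBox I I' ⟨x :: w.1, hx⟩)) w' := by
  rcases x with x | x
  · have h := (actionL hC hI I').act_one_le (x := some x) (Iso.refl ((boxL C D).obj x.1))
      ⟨w, fun y hy => by simpa using (List.isChain_cons.1 hx).1 y hy⟩ w'
    have e := actionL_genOne hC hI x
      (⟨w, fun y hy => by simpa using (List.isChain_cons.1 hx).1 y hy⟩ : (actionL hC hI I').Q)
    exact le_singleSpan_of_eq (obj := altBox I I') (w₁ := ⟨Sum.inl x :: w.1, hx⟩) e h
  · have h := (actionR hD I hI').act_one_le (x := some x) (Iso.refl ((boxR C D).obj x.1))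
      ⟨w, fun y hy => by simpa using (List.isChain_cons.1 hx).1 y hy⟩ w'
    have e := actionR_genOne hD hI' x
      (⟨w, fun y hy => by simpa using (List.isChain_cons.1 hx).1 y hy⟩ : (actionR hD I hI').Q)
    exact le_singleSpan_of_eq (obj := altBox I I') (w₁ := ⟨Sum.inr x :: w.1, hx⟩) e h

theorem id_mem_altAct_letter (x : I ⊕ I') (w : AltWord I I') (hx : IsAlt (x :: w.1)) :
    𝟙 (altBox I I' ⟨x :: w.1, hx⟩) ∈
      altAct hC hD hI hI' (Word.letter (Sum.map Subtype.val Subtype.val x)) w ⟨x :: w.1, hx⟩ := by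
  rcases x with x | x
  · have h := (actionL hC hI I').gen_mem (Iso.refl ((boxL C D).obj x.1)) none (some x)
      ⟨w, fun y hy => by simpa using (List.isChain_cons.1 hx).1 y hy⟩
      ((ρ_ x.1).inv ≫ x.1 ◁ (𝟙 (𝟙_ C)))
    have e := actionL_genOne hC hI x
      (⟨w, fun y hy => by simpa using (List.isChain_cons.1 hx).1 y hy⟩ : (actionL hC hI I').Q)
    exact e ▸ h
  · have h := (actionR hD I hI').gen_mem (Iso.refl ((boxR C D).obj x.1)) none (some x)
      ⟨w, fun y hy => by simpa using (List.isChain_cons.1 hx).1 y hy⟩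
      ((ρ_ x.1).inv ≫ x.1 ◁ (𝟙 (𝟙_ D)))
    have e := actionR_genOne hD hI' x
      (⟨w, fun y hy => by simpa using (List.isChain_cons.1 hx).1 y hy⟩ : (actionR hD I hI').Q)
    exact e ▸ h

/-- The empty word. -/
def AltWord.nil (I : Set C) (I' : Set D) : AltWord I I' := ⟨[], List.isChain_nil⟩

theorem rightUnitor_inv_cons (x : I ⊕ I') (l : List (I ⊕ I')) (hl : IsAlt (x :: l)) :
    𝟙 (altBox I I' ⟨x :: l, hl⟩) ≫ (Word.eval (Word.letter (Sum.map Subtype.val Subtype.val x))) ◁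
      (ρ_ (altBox I I' ⟨l, hl.tail⟩)).inv ≫ (α_ _ _ _).inv = (ρ_ (altBox I I' ⟨x :: l, hl⟩)).inv :=
  (Category.id_comp _).trans
    (rightUnitor_tensor_inv (Word.eval (Word.letter (Sum.map Subtype.val Subtype.val x)))
        (altBox I I' ⟨l, hl.tail⟩)).symm

/-- When the letters of an alternating word are applied from right to left to the empty word, each
one meets a first letter of the other type. Nothing fuses, so only `l` is reached, with multiplicity
one. -/
theorem altAct_word_le (l : List (I ⊕ I')) (hl : IsAlt l) (w' : AltWord I I') :
    altAct hC hD hI hI' (listWord l) (.nil I I') w' ≤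
      singleSpan (w₁ := ⟨l, hl⟩) (ρ_ (altBox I I' ⟨l, hl⟩)).inv w' := by
  induction l generalizing w' with
  | nil =>
    exact le_singleSpan_of_eq (obj := altBox I I') (w₁ := .nil I I')
      (unitors_inv_equal (C := Box C D)) (unitSpan_le (.nil I I') w')
  | cons x l ih =>
    exact le_singleSpan_of_eq (rightUnitor_inv_cons x l hl) (compSpan_le_singleSpan _ _
      (altAct_letter_le hC hD hI hI' x ⟨l, hl.tail⟩ hl) (ih hl.tail) w')

/-- The vector on which morphisms are tested: a morphism `f` of the free product out of `l` sends it
to `(ρ_ _).inv ≫ f ▷ 𝟙_`, from which `f` can be recovered. -/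
theorem rightUnitor_inv_mem_altAct (l : List (I ⊕ I')) (hl : IsAlt l) :
    (ρ_ (altBox I I' ⟨l, hl⟩)).inv ∈ altAct hC hD hI hI' (listWord l) (.nil I I') ⟨l, hl⟩ := by
  induction l with
  | nil =>
    have h := leftUnitor_inv_mem_unitSpan (obj := altBox I I') (.nil I I')
    have e : (λ_ (altBox I I' (.nil I I'))).inv = (ρ_ (altBox I I' (.nil I I'))).inv :=
      unitors_inv_equal (C := Box C D)
    rw [e] at h
    exact h
  | cons x l ih =>
    have h := comp_mem_compSpan (id_mem_altAct_letter hC hD hI hI' x ⟨l, hl.tail⟩ hl) (ih hl.tail)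
    rw [← rightUnitor_inv_cons x l hl]
    exact h

end Words

/-! ### Vanishing and proportionality deduced from families of subspaces. -/

section HomFamily

variable {B : Type u₁} [Category.{v₁} B] [Preadditive B] [Linear ℂ B] [MonoidalCategory B]
    [MonoidalPreadditive B] [MonoidalLinear ℂ B] {W : Type w} {obj : W → B}

theorem exists_of_compSpan_ne_bot {X Y : B} {S : HomFamily obj X} {T : HomFamily obj Y} {w w'' : W}
    (h : compSpan S T w w'' ≠ ⊥) : ∃ w', S w' w'' ≠ ⊥ ∧ T w w' ≠ ⊥ := by
  contrapose! h
  rw [eq_bot_iff]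
  refine Submodule.span_le.2 ?_
  rintro _ ⟨w', s, hs, t, ht, rfl⟩
  by_cases hS : S w' w'' = ⊥
  · rw [hS, Submodule.mem_bot] at hs
    rw [hs, Limits.zero_comp]
    exact zero_mem _
  · rw [h w' hS, Submodule.mem_bot] at ht
    rw [ht]
    simp

theorem eq_of_singleSpan_ne_bot {X : B} {w₁ w' : W} {s : obj w₁ ⟶ X} {S : Submodule ℂ (obj w' ⟶ X)}
    (hS : S ≤ singleSpan s w') (h : S ≠ ⊥) : w' = w₁ := by
  contrapose! h
  rw [eq_bot_iff]
  intro r hr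
  exact (Submodule.mem_bot ℂ).2 (eq_zero_of_mem_singleSpan (hS hr) h)

theorem eq_zero_of_mem_of_eq_bot {V : Type*} [AddCommGroup V] [Module ℂ V] {S : Submodule ℂ V}
    (hS : S = ⊥) {x : V} (hx : x ∈ S) : x = 0 := (Submodule.mem_bot ℂ).1 (hS ▸ hx)

theorem eq_zero_of_rightUnitor_inv_comp {X Y : B} {f : X ⟶ Y} (h : (ρ_ X).inv ≫ f ▷ 𝟙_ B = 0) :
    f = 0 := by
  have : f = ((ρ_ X).inv ≫ f ▷ 𝟙_ B) ≫ (ρ_ Y).hom := by simp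
  rw [this, h, Limits.zero_comp]

theorem eq_smul_of_rightUnitor_inv_comp {X : B} {f : X ⟶ X} {c : ℂ}
    (h : (ρ_ X).inv ≫ f ▷ 𝟙_ B = c • (ρ_ X).inv) : f = c • 𝟙 X := by
  have : f = ((ρ_ X).inv ≫ f ▷ 𝟙_ B) ≫ (ρ_ X).hom := by simp
  rw [this, h]
  simp

end HomFamily

/-! ### Schur's lemma and fusion rules of the free product. -/

section Words

variable {C : Type u₁} [Category.{v₁} C] [Preadditive C] [Linear ℂ C]
  [MonoidalCategory C] [MonoidalPreadditive C] [MonoidalLinear ℂ C] [DaggerMonoidal C]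
  {D : Type u₂} [Category.{v₂} D] [Preadditive D] [Linear ℂ D]
  [MonoidalCategory D] [MonoidalPreadditive D] [MonoidalLinear ℂ D] [DaggerMonoidal D]
  (hC : IsRigidCStarTensor C) (hD : IsRigidCStarTensor D)
  {I : Set C} (hI : IsNonunitIrr I) {I' : Set D} (hI' : IsNonunitIrr I')

theorem fuses_of_altAct_ne (l : List (I ⊕ I')) {w w' : AltWord I I'}
    (h : altAct hC hD hI hI' (listWord l) w w' ≠ ⊥) : Fuses l w.1 w'.1 := by
  induction l generalizing w' with
  | nil =>
    have h' : w' = w := eq_of_singleSpan_ne_bot (obj := altBox I I') (unitSpan_le w w') h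
    exact congrArg Subtype.val h'
  | cons x l ih =>
    obtain ⟨w₁, h₁, h₂⟩ := exists_of_compSpan_ne_bot (obj := altBox I I')
      (S := altAct hC hD hI hI' (Word.letter (Sum.map Subtype.val Subtype.val x)))
      (T := altAct hC hD hI hI' (listWord l)) h
    exact ⟨w₁.1, ih h₂, fusesLetter_of_altAct_ne hC hD hI hI' x h₁⟩

/-- The morphism of pairs underlying a morphism of the free product. -/
theorem mem_altAct (w : AltWord I I') (X : FreeProduct C D) (f : irrObj I I' w ⟶ X) :
    (ρ_ (altBox I I' w)).inv ≫ (show altBox I I' w ⟶ X.obj.word.eval from f.1.1) ▷ 𝟙_ (Box C D) ∈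
      altAct hC hD hI hI' X.obj.word (.nil I I') w :=
  Word.carries_of_mem_ncpHom (actionL hC hI I') (actionR hD I hI') f.1.2 _ _ _
    (rightUnitor_inv_mem_altAct hC hD hI hI' w.1 w.2)

theorem altAct_ne_bot {w : AltWord I I'} {X : FreeProduct C D} {f : irrObj I I' w ⟶ X}
    (hf : f ≠ 0) : altAct hC hD hI hI' X.obj.word (.nil I I') w ≠ ⊥ := by
  contrapose! hf
  have h := mem_altAct hC hD hI hI' w X f
  exact Subtype.ext (Subtype.ext
    (eq_zero_of_rightUnitor_inv_comp (eq_zero_of_mem_of_eq_bot hf h)))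


/-- A nonzero `f` would give a nonzero vector by which the letters of `v` lead from the empty word
to `w`, but they lead to `v` only. -/
theorem irrObj_hom_eq_zero (hC : IsRigidCStarTensor C) (hD : IsRigidCStarTensor D)
    {I : Set C} (hI : IsNonunitIrr I) {I' : Set D} (hI' : IsNonunitIrr I')
    {w v : AltWord I I'} (h : w ≠ v) (f : irrObj I I' w ⟶ irrObj I I' v) :
    f = 0 := by
  by_contra hf
  exact h (eq_of_singleSpan_ne_bot (obj := altBox I I') (altAct_word_le hC hD hI hI' v.1 v.2 w)
    (altAct_ne_bot hC hD hI hI' hf))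

theorem irrObj_hom_eq_smul (hC : IsRigidCStarTensor C) (hD : IsRigidCStarTensor D)
    {I : Set C} (hI : IsNonunitIrr I) {I' : Set D} (hI' : IsNonunitIrr I')
    {w : AltWord I I'} (f : irrObj I I' w ⟶ irrObj I I' w) :
    ∃ c : ℂ, f = c • 𝟙 _ := by
  obtain ⟨c, hc⟩ := exists_smul_of_mem_singleSpan (obj := altBox I I')
    (altAct_word_le hC hD hI hI' w.1 w.2 w (mem_altAct hC hD hI hI' w _ f))
  exact ⟨c, Subtype.ext (Subtype.ext (eq_smul_of_rightUnitor_inv_comp hc))⟩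

/-- The word of `u ⊗ v` acts on the empty word first by `v`, which leads to `v` only, and then by
the letters of `u`. -/
theorem fuses_of_hom_ne_zero (hC : IsRigidCStarTensor C) (hD : IsRigidCStarTensor D)
    {I : Set C} (hI : IsNonunitIrr I) {I' : Set D} (hI' : IsNonunitIrr I')
    {u v w : AltWord I I'}
    {f : irrObj I I' w ⟶ irrObj I I' u ⊗ irrObj I I' v} (hf : f ≠ 0) : Fuses u.1 v.1 w.1 := by
  obtain ⟨w₁, h₁, h₂⟩ := exists_of_compSpan_ne_bot (obj := altBox I I')
    (S := altAct hC hD hI hI' (listWord u.1)) (T := altAct hC hD hI hI' (listWord v.1))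
    (altAct_ne_bot hC hD hI hI' hf)
  have h₃ : w₁ = v := eq_of_singleSpan_ne_bot (obj := altBox I I')
    (altAct_word_le hC hD hI hI' v.1 v.2 w₁) h₂
  subst h₃
  exact fuses_of_altAct_ne hC hD hI hI' u.1 h₁

end Words

/-! ## Solutions of the duality equations -/

section Conjugates

variable {E : Type u} [Category.{v} E] [Preadditive E] [Linear ℂ E] [MonoidalCategory E]
  [MonoidalPreadditive E] [MonoidalLinear ℂ E] [DaggerMonoidal E]

/-- A solution of the duality equations is an exact pairing. -/
abbrev IsConjugateSolution.exactPairing {X Y : E} {R : 𝟙_ E ⟶ Y ⊗ X} {Rbar : 𝟙_ E ⟶ X ⊗ Y}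
    (h : IsConjugateSolution X Y R Rbar) : ExactPairing X Y where
  coevaluation' := Rbar
  evaluation' := R†
  coevaluation_evaluation' := by
    rw [← cancel_mono (λ_ Y).hom, ← cancel_epi (ρ_ Y).inv]
    simpa using h.right
  evaluation_coevaluation' := by
    rw [← cancel_mono (ρ_ X).hom, ← cancel_epi (λ_ X).inv]
    simpa using h.left

theorem isConjugateSolution_of_exactPairing (X Y : E) [ExactPairing X Y] :
    IsConjugateSolution X Y (ε_ X Y)† (η_ X Y) := by
  constructor
  · rw [DaggerMonoidal.dag_dag]; simp
  · rw [DaggerMonoidal.dag_dag]; simp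

/-- There is an exact pairing for which the two loops are equal, and different from `0`. -/
def NormConj (X Y : E) : Prop := ∃ (_ : ExactPairing X Y) (d : ℂ), d ≠ 0 ∧
  η_ X Y ≫ (η_ X Y)† = d • 𝟙 _ ∧ (ε_ X Y)† ≫ ε_ X Y = d • 𝟙 _

theorem NormConj.unit : NormConj (𝟙_ E) (𝟙_ E) := by
  refine ⟨inferInstance, 1, one_ne_zero, ?_, ?_⟩
  · change (ρ_ (𝟙_ E)).inv ≫ (ρ_ (𝟙_ E)).inv† = _
    rw [dag_rightUnitor_inv]
    simp
  · change (ρ_ (𝟙_ E)).hom† ≫ (ρ_ (𝟙_ E)).hom = _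
    rw [DaggerMonoidal.dag_rightUnitor]
    simp

theorem dag_whiskerLeft (X : E) {Y Z : E} (f : Y ⟶ Z) : (X ◁ f)† = X ◁ f† := by
  rw [← id_tensorHom, DaggerMonoidal.dag_tensor, dag_id, id_tensorHom]

theorem dag_whiskerRight {Y Z : E} (f : Y ⟶ Z) (X : E) : (f ▷ X)† = f† ▷ X := by
  rw [← tensorHom_id, DaggerMonoidal.dag_tensor, dag_id, tensorHom_id]

/-- The duality morphisms of a product are nested. The inner loop is a scalar, which is pulled out,
and then the outer loop closes; both loops of the product are `d₁ d₂`. -/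
theorem NormConj.tensor {X₁ X₂ Y₁ Y₂ : E} (h₁ : NormConj X₁ Y₁) (h₂ : NormConj X₂ Y₂) :
    NormConj (X₁ ⊗ X₂) (Y₂ ⊗ Y₁) := by
  obtain ⟨_, d₁, hd₁, e₁, e₁'⟩ := h₁
  obtain ⟨_, d₂, hd₂, e₂, e₂'⟩ := h₂
  refine ⟨ExactPairing.tensor, d₁ * d₂, mul_ne_zero hd₁ hd₂, ?_, ?_⟩
  · have h : η_ (X₁ ⊗ X₂) (Y₂ ⊗ Y₁) = η_ X₁ Y₁ ≫ X₁ ◁ (λ_ _).inv ≫ X₁ ◁ (η_ X₂ Y₂ ▷ Y₁) ≫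
        X₁ ◁ (α_ _ _ _).hom ≫ (α_ _ _ _).inv := by
      rw [ExactPairing.tensor_coevaluation]
      monoidal
    have h2 : (λ_ Y₁).inv ≫ η_ X₂ Y₂ ▷ Y₁ ≫ (η_ X₂ Y₂)† ▷ Y₁ ≫ (λ_ Y₁).hom = d₂ • 𝟙 Y₁ := by
      rw [← comp_whiskerRight_assoc, e₂]
      simp
    have h3 : X₁ ◁ (λ_ Y₁).inv ≫ X₁ ◁ η_ X₂ Y₂ ▷ Y₁ ≫ X₁ ◁ (η_ X₂ Y₂)† ▷ Y₁ ≫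
        X₁ ◁ (λ_ Y₁).hom = d₂ • 𝟙 _ := by
      simp only [← MonoidalCategory.whiskerLeft_comp, h2]
      simp
    rw [h]
    simp only [DaggerMonoidal.dag_comp, dag_whiskerLeft, dag_whiskerRight, dag_associator_inv,
      DaggerMonoidal.dag_associator, dag_leftUnitor_inv, Category.assoc, Iso.inv_hom_id_assoc,
      whiskerLeft_hom_inv_assoc]
    rw [reassoc_of% h3]
    simp [e₁, smul_smul, mul_comm]
  · have h : ε_ (X₁ ⊗ X₂) (Y₂ ⊗ Y₁) = (α_ _ _ _).hom ≫ Y₂ ◁ (α_ _ _ _).inv ≫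
        Y₂ ◁ (ε_ X₁ Y₁ ▷ X₂) ≫ Y₂ ◁ (λ_ _).hom ≫ ε_ X₂ Y₂ := by
      rw [ExactPairing.tensor_evaluation]
      monoidal
    have h2 : (λ_ X₂).inv ≫ (ε_ X₁ Y₁)† ▷ X₂ ≫ (ε_ X₁ Y₁) ▷ X₂ ≫ (λ_ X₂).hom = d₁ • 𝟙 X₂ := by
      rw [← comp_whiskerRight_assoc, e₁']
      simp
    have h3 : Y₂ ◁ (λ_ X₂).inv ≫ Y₂ ◁ (ε_ X₁ Y₁)† ▷ X₂ ≫ Y₂ ◁ (ε_ X₁ Y₁) ▷ X₂ ≫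
        Y₂ ◁ (λ_ X₂).hom = d₁ • 𝟙 _ := by
      simp only [← MonoidalCategory.whiskerLeft_comp, h2]
      simp
    rw [h]
    simp only [DaggerMonoidal.dag_comp, dag_whiskerLeft, dag_whiskerRight, dag_associator_inv,
      DaggerMonoidal.dag_associator, DaggerMonoidal.dag_leftUnitor, Category.assoc,
      Iso.inv_hom_id_assoc, whiskerLeft_hom_inv_assoc]
    rw [reassoc_of% h3]
    simp [e₂', smul_smul]

theorem NormConj.congr {X X' Y Y' : E} (h : NormConj X' Y') {f : X ⟶ X'} (hf : IsUnitary f)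
    {g : Y ⟶ Y'} (hg : IsUnitary g) : NormConj X Y := by
  obtain ⟨_, d, hd, e, e'⟩ := h
  let i : X ≅ X' := ⟨f, f†, hf.1, hf.2⟩
  let j : Y ≅ Y' := ⟨g, g†, hg.1, hg.2⟩
  refine ⟨exactPairingCongr i j, d, hd, ?_, ?_⟩
  · change ((η_ X' Y' ≫ X' ◁ g†) ≫ f† ▷ Y) ≫ ((η_ X' Y' ≫ X' ◁ g†) ≫ f† ▷ Y)† = _
    simp only [DaggerMonoidal.dag_comp, dag_whiskerLeft, dag_whiskerRight,
      DaggerMonoidal.dag_dag, Category.assoc]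
    rw [← comp_whiskerRight_assoc, hf.2, id_whiskerRight, Category.id_comp,
      ← MonoidalCategory.whiskerLeft_comp_assoc, hg.2, MonoidalCategory.whiskerLeft_id,
      Category.id_comp, e]
  · change (Y ◁ f ≫ g ▷ X' ≫ ε_ X' Y')† ≫ Y ◁ f ≫ g ▷ X' ≫ ε_ X' Y' = _
    simp only [DaggerMonoidal.dag_comp, dag_whiskerLeft, dag_whiskerRight, Category.assoc]
    rw [← MonoidalCategory.whiskerLeft_comp_assoc, hf.2, MonoidalCategory.whiskerLeft_id,
      Category.id_comp, ← comp_whiskerRight_assoc, hg.2, id_whiskerRight, Category.id_comp, e']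

theorem IsConjugateSolution.smul {X Y : E} {R : 𝟙_ E ⟶ Y ⊗ X} {Rbar : 𝟙_ E ⟶ X ⊗ Y}
    (h : IsConjugateSolution X Y R Rbar) (c c' : ℂ) (hc : conj c * c' = 1) :
    IsConjugateSolution X Y (c • R) (c' • Rbar) := by
  constructor
  · rw [DaggerMonoidal.dag_smul]
    simp [smul_smul, hc, h.left]
  · rw [DaggerMonoidal.dag_smul]
    simp [smul_smul, hc, mul_comm c', h.right]

theorem tensorLeftHomEquiv_smul {X Y Y' Z : E} [ExactPairing Y Y'] (c : ℂ) (f : Y' ⊗ X ⟶ Z) :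
    tensorLeftHomEquiv X Y Y' Z (c • f) = c • tensorLeftHomEquiv X Y Y' Z f := by
  simp [tensorLeftHomEquiv]

theorem tensorRightHomEquiv_symm_smul {X Y Y' Z : E} [ExactPairing Y Y'] (c : ℂ)
    (f : X ⟶ Z ⊗ Y') :
    (tensorRightHomEquiv X Y Y' Z).symm (c • f) = c • (tensorRightHomEquiv X Y Y' Z).symm f := by
  simp [tensorRightHomEquiv]

/-- The left dual of a simple object is simple. -/
theorem IsSimpleObj.dual {X Y : E} [ExactPairing X Y] (hX : IsSimpleObj X) : IsSimpleObj Y := by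
  -- Taking mates on both sides is an injection of the endomorphisms of `Y` into those of `X`,
  -- homogeneous for scalars, that maps the identity to the identity.
  let φ : (Y ⟶ Y) → (X ⟶ X) := fun f => (λ_ X).inv ≫ (tensorRightHomEquiv (𝟙_ E) X Y X).symm
    (tensorLeftHomEquiv (𝟙_ E) X Y Y ((ρ_ Y).hom ≫ f))
  have hφ : Function.Injective φ := by
    intro f g h
    have h := (cancel_epi _).1 h
    exact (cancel_epi _).1 ((tensorLeftHomEquiv _ _ _ _).injective
      ((tensorRightHomEquiv _ _ _ _).symm.injective h))
  have hs : ∀ (c : ℂ) f, φ (c • f) = c • φ f := by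
    intro c f
    simp only [φ, Linear.comp_smul, tensorLeftHomEquiv_smul, tensorRightHomEquiv_symm_smul]
  have h0 : φ 0 = 0 := by simpa using hs 0 0
  have h1 : φ (𝟙 Y) = 𝟙 X := by
    simp only [φ, Category.comp_id]
    simp [tensorRightHomEquiv, tensorLeftHomEquiv]
  constructor
  · intro h
    apply hX.1
    rw [← h1, h, h0]
  · intro f
    obtain ⟨c, hc⟩ := hX.2 (φ f)
    refine ⟨c, hφ ?_⟩
    rw [hs, h1, hc]

/-- A simple object of a rigid C*-tensor category has a conjugate, with equal loops. -/
theorem IsRigidCStarTensor.exists_normConj (hE : IsRigidCStarTensor E) {X : E}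
    (hX : IsSimpleObj X) : ∃ Y, IsSimpleObj Y ∧ NormConj X Y := by
  obtain ⟨Y, R, Rbar, h⟩ := hE.duals X
  have hR : R ≠ 0 := by
    rintro rfl
    apply hX.1
    rw [← h.left, dag_zero]
    simp
  have hRbar : Rbar ≠ 0 := by
    rintro rfl
    apply hX.1
    rw [← h.left]
    simp
  obtain ⟨r, hr, er⟩ := hE.simple_unit.comp_dag hE.cstar R hR
  obtain ⟨s, hs, es⟩ := hE.simple_unit.comp_dag hE.cstar Rbar hRbar
  -- Scaling `R` by `t` and `Rbar` by `t⁻¹` keeps the duality equations. The loops become `t² r` and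
  -- `t⁻² s`, which agree for `t⁴ = s / r`.
  let t : ℝ := (s / r) ^ (1 / 4 : ℝ)
  have ht : 0 < t := Real.rpow_pos_of_pos (div_pos hs hr) _
  have ht4 : t ^ 4 = s / r := by
    rw [← Real.rpow_natCast, ← Real.rpow_mul (div_pos hs hr).le]
    norm_num
  have ht' : t * t * r = t⁻¹ * t⁻¹ * s := by
    field_simp at ht4 ⊢
    nlinarith
  have h' := h.smul (t : ℂ) (t⁻¹ : ℂ)
    (by rw [Complex.conj_ofReal, mul_inv_cancel₀]; exact_mod_cast ht.ne')
  let := h'.exactPairing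
  refine ⟨Y, hX.dual, h'.exactPairing, ((t * t * r : ℝ) : ℂ), ?_, ?_, ?_⟩
  · exact_mod_cast (by positivity : t * t * r ≠ 0)
  · change ((t⁻¹ : ℂ) • Rbar) ≫ ((t⁻¹ : ℂ) • Rbar)† = _
    rw [DaggerMonoidal.dag_smul, Linear.smul_comp, Linear.comp_smul, es, smul_smul, smul_smul,
      map_inv₀, Complex.conj_ofReal, ht']
    push_cast
    rfl
  · change ((t : ℂ) • R)†† ≫ ((t : ℂ) • R)† = _
    rw [DaggerMonoidal.dag_dag, DaggerMonoidal.dag_smul, Linear.smul_comp, Linear.comp_smul, er,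
      smul_smul, smul_smul, Complex.conj_ofReal]
    push_cast
    rfl

end Conjugates

/-! ## Orthogonal decompositions -/

section Decompositions

variable {E : Type u} [Category.{v} E] [Preadditive E] [Linear ℂ E] [MonoidalCategory E]
  [MonoidalPreadditive E] [MonoidalLinear ℂ E] [DaggerMonoidal E]

/-- `X` is the orthogonal direct sum of the `Y j` through the isometries `s j`. -/
structure IsOrthDecomp {J : Type*} [Fintype J] {Y : J → E} {X : E} (s : ∀ j, Y j ⟶ X) : Prop where
  norm : ∀ i, s i ≫ (s i)† = 𝟙 (Y i)
  orth : ∀ i j, i ≠ j → s i ≫ (s j)† = 0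
  complete : ∑ i, (s i)† ≫ s i = 𝟙 X

/-- `X` is an orthogonal direct sum of objects in the family `irr`. -/
def Decomposes {ι : Type w} (irr : ι → E) (X : E) : Prop :=
  ∃ (J : Type) (_ : Fintype J) (p : J → ι) (s : ∀ j, irr (p j) ⟶ X), IsOrthDecomp s

theorem Decomposes.irr {ι : Type w} (irr : ι → E) (a : ι) : Decomposes irr (irr a) :=
  ⟨Unit, inferInstance, fun _ => a, fun _ => 𝟙 _, by simp [dag_id], by simp, by simp [dag_id]⟩

theorem IsOrthDecomp.decomposes {ι : Type w} {irr : ι → E} {J : Type} [Fintype J] {Y : J → E}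
    {X : E} {s : ∀ j, Y j ⟶ X} (hs : IsOrthDecomp s) (h : ∀ j, Decomposes irr (Y j)) :
    Decomposes irr X := by
  choose K hK p t ht using h
  refine ⟨Σ j, K j, inferInstance, fun x => p x.1 x.2, fun x => t x.1 x.2 ≫ s x.1, ?_, ?_, ?_⟩
  · rintro ⟨j, k⟩
    dsimp only
    rw [DaggerMonoidal.dag_comp, Category.assoc, ← Category.assoc (s j), hs.norm, Category.id_comp,
      (ht j).norm]
  · rintro ⟨j, k⟩ ⟨j', k'⟩ hne
    dsimp only
    rw [DaggerMonoidal.dag_comp, Category.assoc, ← Category.assoc (s j)]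
    by_cases hj : j = j'
    · subst hj
      rw [hs.norm, Category.id_comp, (ht j).orth _ _ (by rintro rfl; exact hne rfl)]
    · rw [hs.orth _ _ hj, Limits.zero_comp, Limits.comp_zero]
  · rw [Fintype.sum_sigma, ← hs.complete]
    refine Finset.sum_congr rfl fun j _ => ?_
    have h : (s j)† ≫ (∑ k, (t j k)† ≫ t j k) ≫ s j = (s j)† ≫ s j := by
      rw [(ht j).complete, Category.id_comp]
    rw [← h]
    simp [Preadditive.sum_comp, Preadditive.comp_sum, DaggerMonoidal.dag_comp]

theorem IsUnitary.isOrthDecomp {X Y : E} {u : Y ⟶ X} (hu : IsUnitary u) :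
    IsOrthDecomp (J := Unit) (Y := fun _ => Y) fun _ => u :=
  ⟨fun _ => hu.1, by simp, by simp [hu.2]⟩

theorem IsUnitary.decomposes {ι : Type w} {irr : ι → E} {X Y : E} {u : Y ⟶ X} (hu : IsUnitary u)
    (h : Decomposes irr Y) : Decomposes irr X :=
  hu.isOrthDecomp.decomposes fun _ => h

theorem IsOrthDecomp.whiskerLeft {J : Type} [Fintype J] {Y : J → E} {X : E} {s : ∀ j, Y j ⟶ X}
    (hs : IsOrthDecomp s) (Z : E) : IsOrthDecomp fun j => Z ◁ s j := by
  refine ⟨fun i => ?_, fun i j hij => ?_, ?_⟩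
  · rw [dag_whiskerLeft, ← MonoidalCategory.whiskerLeft_comp, hs.norm,
      MonoidalCategory.whiskerLeft_id]
  · rw [dag_whiskerLeft, ← MonoidalCategory.whiskerLeft_comp, hs.orth i j hij,
      MonoidalPreadditive.whiskerLeft_zero]
  · simp only [dag_whiskerLeft, ← MonoidalCategory.whiskerLeft_comp]
    rw [← whiskerLeft_sum, hs.complete, MonoidalCategory.whiskerLeft_id]

theorem IsOrthDecomp.whiskerRight {J : Type} [Fintype J] {Y : J → E} {X : E} {s : ∀ j, Y j ⟶ X}
    (hs : IsOrthDecomp s) (Z : E) : IsOrthDecomp fun j => s j ▷ Z := by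
  refine ⟨fun i => ?_, fun i j hij => ?_, ?_⟩
  · rw [dag_whiskerRight, ← comp_whiskerRight, hs.norm, id_whiskerRight]
  · rw [dag_whiskerRight, ← comp_whiskerRight, hs.orth i j hij,
      MonoidalPreadditive.zero_whiskerRight]
  · simp only [dag_whiskerRight, ← comp_whiskerRight]
    rw [← sum_whiskerRight, hs.complete, id_whiskerRight]

/-- There is a unitary morphism from `X` to `Y`. -/
def UEquiv (X Y : E) : Prop := ∃ u : X ⟶ Y, IsUnitary u

theorem UEquiv.refl (X : E) : UEquiv X X := ⟨_, .id X⟩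

theorem UEquiv.symm {X Y : E} : UEquiv X Y → UEquiv Y X := fun ⟨_, h⟩ => ⟨_, h.dag⟩

theorem UEquiv.trans {X Y Z : E} : UEquiv X Y → UEquiv Y Z → UEquiv X Z :=
  fun ⟨_, h⟩ ⟨_, h'⟩ => ⟨_, h.comp h'⟩

theorem UEquiv.tensor {X Y X' Y' : E} : UEquiv X Y → UEquiv X' Y' → UEquiv (X ⊗ X') (Y ⊗ Y') :=
  fun ⟨_, h⟩ ⟨_, h'⟩ => ⟨_, h.tensor h'⟩

theorem UEquiv.assoc (X Y Z : E) : UEquiv ((X ⊗ Y) ⊗ Z) (X ⊗ Y ⊗ Z) := ⟨_, isUnitary_associator X Y Z⟩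

theorem UEquiv.unitL (X : E) : UEquiv (𝟙_ E ⊗ X) X := ⟨_, isUnitary_leftUnitor X⟩

theorem UEquiv.unitR (X : E) : UEquiv (X ⊗ 𝟙_ E) X := ⟨_, isUnitary_rightUnitor X⟩

theorem UEquiv.decomposes {ι : Type w} {irr : ι → E} {X Y : E} :
    UEquiv X Y → Decomposes irr Y → Decomposes irr X := fun ⟨_, h⟩ => h.dag.decomposes

theorem UEquiv.normConj {X X' Y Y' : E} : UEquiv X X' → UEquiv Y Y' → NormConj X' Y' →
    NormConj X Y := fun ⟨_, h⟩ ⟨_, h'⟩ h₀ => h₀.congr h h'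

/-- The chosen nontrivial simple objects are closed under conjugation. -/
theorem IsNonunitIrr.exists_normConj (hE : IsRigidCStarTensor E) {I : Set E}
    (hI : IsNonunitIrr I) (x : I) : ∃ y : I, NormConj x.1 y.1 := by
  obtain ⟨Y, hY, h⟩ := hE.exists_normConj (hI.simple x.1 x.2)
  obtain ⟨p, u, hu⟩ := exists_irrOrUnit_isUnitary hE hI hY
  rcases p with _ | y
  -- If the conjugate were trivial, the coevaluation would be a nonzero morphism from the unit to `x
  -- ⊗ 𝟙`, and so `x` would be isomorphic to the unit.
  · exfalso
    obtain ⟨_, d, hd, e, -⟩ : NormConj x.1 (𝟙_ E) := h.congr (.id x.1) hu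
    have hne : η_ x.1 (𝟙_ E) ≫ (ρ_ x.1).hom ≠ 0 := by
      intro h0
      have h1 : η_ x.1 (𝟙_ E) = 0 := by
        rw [← cancel_mono (ρ_ x.1).hom, h0, Limits.zero_comp]
      have h2 : d • 𝟙 (𝟙_ E) = 0 := by
        rw [← e]
        exact (congrArg (· ≫ _) h1).trans Limits.zero_comp
      exact (smul_ne_zero hd hE.simple_unit.1) h2
    obtain ⟨u, hu⟩ := exists_isUnitary_of_ne_zero hE.cstar hE.simple_unit (hI.simple x.1 x.2) hne
    exact (hI.nonunit x.1 x.2).false hu.nonempty_iso.some.symm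
  · exact ⟨y, h.congr (.id _) hu⟩

end Decompositions

/-! ## Objects of the projection category with trivial projection -/

section OfObj

variable {E : Type u} [Category.{v} E] [Preadditive E] [Linear ℂ E] [MonoidalCategory E]
  [MonoidalPreadditive E] [MonoidalLinear ℂ E] [DaggerMonoidal E]

/-- The object `X` with the projection `1`. -/
def ProjCat.ofObj (X : E) : ProjCat E := ⟨X, 𝟙 X, Category.id_comp _, dag_id _⟩

/-- A morphism between objects with trivial projection. -/
def ProjCat.ofHom {X Y : E} (f : X ⟶ Y) : ofObj X ⟶ ofObj Y :=
  ⟨f, by change 𝟙 _ ≫ f ≫ 𝟙 _ = f; simp⟩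

theorem ProjCat.ofHom_isUnitary {X Y : E} {f : X ⟶ Y} (h : IsUnitary f) : IsUnitary (ofHom f) :=
  ⟨Subtype.ext h.1, Subtype.ext h.2⟩

theorem UEquiv.ofObj {X Y : E} : UEquiv X Y → UEquiv (ProjCat.ofObj X) (ProjCat.ofObj Y) :=
  fun ⟨_, h⟩ => ⟨_, ProjCat.ofHom_isUnitary h⟩

/-- The projection of the tensor product is `𝟙 ⊗ 𝟙`, which equals `𝟙` but not by definition, so the
two objects are connected by a unitary. -/
theorem ProjCat.uEquiv_tensor (X Y : E) : UEquiv (ofObj X ⊗ ofObj Y) (ofObj (X ⊗ Y)) := by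
  have hp : (ofObj X ⊗ ofObj Y).p = 𝟙 (X ⊗ Y) := id_tensorHom_id X Y
  refine ⟨⟨𝟙 (X ⊗ Y), ?_⟩, ?_, ?_⟩
  · refine mem_homSub_of ?_ ?_
    · rw [hp]; exact Category.id_comp _
    · exact Category.comp_id _
  · exact Subtype.ext (((congrArg (𝟙 (X ⊗ Y) ≫ ·) (dag_id _)).trans (Category.comp_id _)).trans
      hp.symm)
  · exact Subtype.ext ((congrArg (· ≫ 𝟙 (X ⊗ Y)) (dag_id _)).trans (Category.comp_id _))

theorem IsOrthDecomp.ofHom {J : Type} [Fintype J] {Y : J → E} {X : E} {s : ∀ j, Y j ⟶ X}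
    (hs : IsOrthDecomp s) : IsOrthDecomp fun j => ProjCat.ofHom (s j) := by
  refine ⟨fun i => Subtype.ext (hs.norm i), fun i j h => Subtype.ext (hs.orth i j h),
    Subtype.ext ?_⟩
  have : ∀ f : J → (ProjCat.ofObj X ⟶ ProjCat.ofObj X), (∑ j, f j).1 = ∑ j, (f j).1 :=
    fun f => map_sum (Submodule.subtype (ProjCat.homSub (ProjCat.ofObj X) (ProjCat.ofObj X))) f _
  rw [this]
  exact hs.complete

/-- Exact pairings pass to the projection category. -/
theorem NormConj.ofObj {X Y : E} (h : NormConj X Y) :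
    NormConj (ProjCat.ofObj X) (ProjCat.ofObj Y) := by
  obtain ⟨_, d, hd, e, e'⟩ := h
  have hp : ∀ X Y : E, (ProjCat.ofObj X ⊗ ProjCat.ofObj Y).p = 𝟙 (X ⊗ Y) := id_tensorHom_id
  refine ⟨⟨⟨η_ X Y, ProjCat.mem_homSub_of (Category.id_comp _)
      ((congrArg (η_ X Y ≫ ·) (hp X Y)).trans (Category.comp_id _))⟩,
    ⟨ε_ X Y, ProjCat.mem_homSub_of ((congrArg (· ≫ ε_ X Y) (hp Y X)).trans (Category.id_comp _))
      (Category.comp_id _)⟩, Subtype.ext ?_, Subtype.ext ?_⟩,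
    d, hd, Subtype.ext e, Subtype.ext e'⟩
  · change (𝟙 Y ⊗ₘ η_ X Y) ≫ ((α_ _ _ _).inv ≫ ((𝟙 Y ⊗ₘ 𝟙 X) ⊗ₘ 𝟙 Y)) ≫ (ε_ X Y ⊗ₘ 𝟙 Y) =
      ((𝟙 Y ⊗ₘ 𝟙 (𝟙_ E)) ≫ (ρ_ Y).hom) ≫ (λ_ Y).inv ≫ (𝟙 (𝟙_ E) ⊗ₘ 𝟙 Y)
    simp
  · change (η_ X Y ⊗ₘ 𝟙 X) ≫ (((𝟙 X ⊗ₘ 𝟙 Y) ⊗ₘ 𝟙 X) ≫ (α_ _ _ _).hom) ≫ (𝟙 X ⊗ₘ ε_ X Y) =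
      ((𝟙 (𝟙_ E) ⊗ₘ 𝟙 X) ≫ (λ_ X).hom) ≫ (ρ_ X).inv ≫ (𝟙 X ⊗ₘ 𝟙 (𝟙_ E))
    simp

end OfObj

/-! ### Blocks as morphisms: decompositions and conjugates of words. -/

section Letters

variable {C : Type u₁} [Category.{v₁} C] [Preadditive C] [Linear ℂ C]
  [MonoidalCategory C] [MonoidalPreadditive C] [MonoidalLinear ℂ C] [DaggerMonoidal C]
  {D : Type u₂} [Category.{v₂} D] [Preadditive D] [Linear ℂ D]
  [MonoidalCategory D] [MonoidalPreadditive D] [MonoidalLinear ℂ D] [DaggerMonoidal D]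

namespace NCPCat

/-! ### Single blocks -/

/-- The morphism of a block with label `f` from `C`. -/
def blockHomC {σ τ : Word C D} (hσ : σ.AllLeft) (hτ : τ.AllLeft) (f : σ.eval.fst ⟶ τ.eval.fst) :
    (⟨σ⟩ : NCPCat C D) ⟶ ⟨τ⟩ :=
  ⟨_, ncpHom_Z (NCDiagram.blockC σ τ hσ hτ f)⟩

/-- The morphism of a block with label `f` from `D`. -/
def blockHomD {σ τ : Word C D} (hσ : σ.AllRight) (hτ : τ.AllRight) (f : σ.eval.snd ⟶ τ.eval.snd) :
    (⟨σ⟩ : NCPCat C D) ⟶ ⟨τ⟩ :=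
  ⟨_, ncpHom_Z (NCDiagram.blockD σ τ hσ hτ f)⟩

section

variable {σ τ κ : Word C D}

theorem blockHomC_comp (hσ : σ.AllLeft) (hτ : τ.AllLeft) (hκ : κ.AllLeft)
    (f : σ.eval.fst ⟶ τ.eval.fst) (g : τ.eval.fst ⟶ κ.eval.fst) :
    blockHomC hσ hτ f ≫ blockHomC hτ hκ g = blockHomC hσ hκ (f ≫ g) :=
  Subtype.ext (congrArg (Box.tmulHom (f ≫ g)) (by simp))

theorem blockHomD_comp (hσ : σ.AllRight) (hτ : τ.AllRight) (hκ : κ.AllRight)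
    (f : σ.eval.snd ⟶ τ.eval.snd) (g : τ.eval.snd ⟶ κ.eval.snd) :
    blockHomD hσ hτ f ≫ blockHomD hτ hκ g = blockHomD hσ hκ (f ≫ g) :=
  Subtype.ext (congrArg (fun h => Box.tmulHom h (f ≫ g))
    (show ((σ.unitLeft hσ).hom ≫ (τ.unitLeft hτ).inv) ≫
      ((τ.unitLeft hτ).hom ≫ (κ.unitLeft hκ).inv) = _ by simp))

theorem blockHomC_dag (hσ : σ.AllLeft) (hτ : τ.AllLeft) (f : σ.eval.fst ⟶ τ.eval.fst) :
    (blockHomC hσ hτ f)† = blockHomC hτ hσ f† :=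
  Subtype.ext (NCDiagram.Z_reflect (NCDiagram.blockC σ τ hσ hτ f)).symm

theorem blockHomD_dag (hσ : σ.AllRight) (hτ : τ.AllRight) (f : σ.eval.snd ⟶ τ.eval.snd) :
    (blockHomD hσ hτ f)† = blockHomD hτ hσ f† :=
  Subtype.ext (NCDiagram.Z_reflect (NCDiagram.blockD σ τ hσ hτ f)).symm

theorem blockHomC_id (hσ : σ.AllLeft) : blockHomC hσ hσ (𝟙 _) = 𝟙 _ :=
  Subtype.ext (congrArg (Box.tmulHom (𝟙 σ.eval.fst)) (by simp))

theorem blockHomD_id (hσ : σ.AllRight) : blockHomD hσ hσ (𝟙 _) = 𝟙 _ :=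
  Subtype.ext (congrArg (fun h => Box.tmulHom h (𝟙 σ.eval.snd))
    (show (σ.unitLeft hσ).hom ≫ (σ.unitLeft hσ).inv = 𝟙 _ by simp))

/-- A block as a linear function of its label. -/
def blockHomCₗ (hσ : σ.AllLeft) (hτ : τ.AllLeft) :
    (σ.eval.fst ⟶ τ.eval.fst) →ₗ[ℂ] ((⟨σ⟩ : NCPCat C D) ⟶ ⟨τ⟩) where
  toFun := blockHomC hσ hτ
  map_add' f g := Subtype.ext (TensorProduct.add_tmul f g _)
  map_smul' c f := Subtype.ext (TensorProduct.smul_tmul' c f _)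

/-- A block as a linear function of its label. -/
def blockHomDₗ (hσ : σ.AllRight) (hτ : τ.AllRight) :
    (σ.eval.snd ⟶ τ.eval.snd) →ₗ[ℂ] ((⟨σ⟩ : NCPCat C D) ⟶ ⟨τ⟩) where
  toFun := blockHomD hσ hτ
  map_add' f g := Subtype.ext (TensorProduct.tmul_add _ f g)
  map_smul' c f := Subtype.ext ((TensorProduct.mk ℂ (σ.eval.fst ⟶ τ.eval.fst)
    (σ.eval.snd ⟶ τ.eval.snd) _).map_smul c f)

theorem blockHomC_isUnitary (hσ : σ.AllLeft) (hτ : τ.AllLeft) {f : σ.eval.fst ⟶ τ.eval.fst}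
    (hf : IsUnitary f) : IsUnitary (blockHomC hσ hτ f) :=
  ⟨by rw [blockHomC_dag, blockHomC_comp, hf.1, blockHomC_id],
   by rw [blockHomC_dag, blockHomC_comp, hf.2, blockHomC_id]⟩

theorem blockHomD_isUnitary (hσ : σ.AllRight) (hτ : τ.AllRight) {f : σ.eval.snd ⟶ τ.eval.snd}
    (hf : IsUnitary f) : IsUnitary (blockHomD hσ hτ f) :=
  ⟨by rw [blockHomD_dag, blockHomD_comp, hf.1, blockHomD_id],
   by rw [blockHomD_dag, blockHomD_comp, hf.2, blockHomD_id]⟩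

end

/-! ### Letters -/

/-- A word with one letter. -/
def letter (x : C ⊕ D) : NCPCat C D := ⟨Word.letter x⟩

/-- A single block labelled by an identity, with two strings below and one above. -/
theorem uEquiv_letter_inl (a b : C) : UEquiv (letter (.inl a) ⊗ letter (.inl b) : NCPCat C D)
    (letter (.inl (a ⊗ b))) :=
  ⟨_, blockHomC_isUnitary (σ := (Word.letter (.inl a)).append (Word.letter (.inl b)))
    (τ := Word.letter (.inl (a ⊗ b))) ⟨rfl, rfl⟩ rfl (.id (a ⊗ b))⟩

theorem uEquiv_letter_inr (a b : D) : UEquiv (letter (.inr a) ⊗ letter (.inr b) : NCPCat C D)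
    (letter (.inr (a ⊗ b))) :=
  ⟨_, blockHomD_isUnitary (σ := (Word.letter (.inr a)).append (Word.letter (.inr b)))
    (τ := Word.letter (.inr (a ⊗ b))) ⟨rfl, rfl⟩ rfl (.id (a ⊗ b))⟩

theorem uEquiv_letter_inl_unit : UEquiv (letter (.inl (𝟙_ C)) : NCPCat C D) (𝟙_ (NCPCat C D)) :=
  ⟨_, blockHomC_isUnitary (σ := Word.letter (.inl (𝟙_ C)))
    (τ := Word.empty) rfl trivial (.id (𝟙_ C))⟩

theorem uEquiv_letter_inr_unit : UEquiv (letter (.inr (𝟙_ D)) : NCPCat C D) (𝟙_ (NCPCat C D)) :=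
  ⟨_, blockHomD_isUnitary (σ := Word.letter (.inr (𝟙_ D)))
    (τ := Word.empty) rfl trivial (.id (𝟙_ D))⟩

/-- A morphism of `C` as a morphism between letters. -/
def letterHomC {X Y : C} (f : X ⟶ Y) : (letter (.inl X) : NCPCat C D) ⟶ letter (.inl Y) :=
  blockHomC (σ := .letter (.inl X)) (τ := .letter (.inl Y)) rfl rfl f

theorem letterHomC_comp_dag {X Y Z : C} (f : X ⟶ Y) (g : Z ⟶ Y) :
    (letterHomC f ≫ (letterHomC g)† : (letter (.inl X) : NCPCat C D) ⟶ _) =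
      letterHomC (f ≫ g†) :=
  (congrArg (letterHomC f ≫ ·) (blockHomC_dag _ _ _)).trans (blockHomC_comp _ _ _ _ _)

theorem letterHomC_dag_comp {X Y Z : C} (f : X ⟶ Y) (g : X ⟶ Z) :
    ((letterHomC f)† ≫ letterHomC g : (letter (.inl Y) : NCPCat C D) ⟶ _) =
      letterHomC (f† ≫ g) :=
  (congrArg (· ≫ letterHomC g) (blockHomC_dag _ _ _)).trans (blockHomC_comp _ _ _ _ _)

theorem letterHomC_id (X : C) : letterHomC (𝟙 X) = 𝟙 (letter (.inl X) : NCPCat C D) :=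
  blockHomC_id _

theorem letterHomC_zero (X Y : C) :
    (letterHomC (0 : X ⟶ Y) : (letter (.inl X) : NCPCat C D) ⟶ _) = 0 :=
  (blockHomCₗ (σ := .letter (.inl X)) (τ := .letter (.inl Y)) rfl rfl).map_zero

theorem letterHomC_sum {J : Type} [Fintype J] {X Y : C} (f : J → (X ⟶ Y)) :
    (letterHomC (∑ j, f j) : (letter (.inl X) : NCPCat C D) ⟶ _) = ∑ j, letterHomC (f j) :=
  map_sum (blockHomCₗ (σ := .letter (.inl X)) (τ := .letter (.inl Y)) rfl rfl) f _

theorem orthDecomp_inl {J : Type} [Fintype J] {Y : J → C} {X : C} {s : ∀ j, Y j ⟶ X}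
    (hs : IsOrthDecomp s) : IsOrthDecomp (E := NCPCat C D) fun j => letterHomC (s j) :=
  ⟨fun i => by rw [letterHomC_comp_dag, hs.norm, letterHomC_id],
    fun i j h => by rw [letterHomC_comp_dag, hs.orth i j h, letterHomC_zero],
    by simp only [letterHomC_dag_comp]; rw [← letterHomC_sum, hs.complete, letterHomC_id]⟩

/-- A morphism of `D` as a morphism between letters. -/
def letterHomD {X Y : D} (f : X ⟶ Y) : (letter (.inr X) : NCPCat C D) ⟶ letter (.inr Y) :=
  blockHomD (σ := .letter (.inr X)) (τ := .letter (.inr Y)) rfl rfl f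

theorem letterHomD_comp_dag {X Y Z : D} (f : X ⟶ Y) (g : Z ⟶ Y) :
    (letterHomD f ≫ (letterHomD g)† : (letter (.inr X) : NCPCat C D) ⟶ _) =
      letterHomD (f ≫ g†) :=
  (congrArg (letterHomD f ≫ ·) (blockHomD_dag _ _ _)).trans (blockHomD_comp _ _ _ _ _)

theorem letterHomD_dag_comp {X Y Z : D} (f : X ⟶ Y) (g : X ⟶ Z) :
    ((letterHomD f)† ≫ letterHomD g : (letter (.inr Y) : NCPCat C D) ⟶ _) =
      letterHomD (f† ≫ g) :=
  (congrArg (· ≫ letterHomD g) (blockHomD_dag _ _ _)).trans (blockHomD_comp _ _ _ _ _)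

theorem letterHomD_id (X : D) : letterHomD (𝟙 X) = 𝟙 (letter (.inr X) : NCPCat C D) :=
  blockHomD_id _

theorem letterHomD_zero (X Y : D) :
    (letterHomD (0 : X ⟶ Y) : (letter (.inr X) : NCPCat C D) ⟶ _) = 0 :=
  (blockHomDₗ (σ := .letter (.inr X)) (τ := .letter (.inr Y)) rfl rfl).map_zero

theorem letterHomD_sum {J : Type} [Fintype J] {X Y : D} (f : J → (X ⟶ Y)) :
    (letterHomD (∑ j, f j) : (letter (.inr X) : NCPCat C D) ⟶ _) = ∑ j, letterHomD (f j) :=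
  map_sum (blockHomDₗ (σ := .letter (.inr X)) (τ := .letter (.inr Y)) rfl rfl) f _

theorem orthDecomp_inr {J : Type} [Fintype J] {Y : J → D} {X : D} {s : ∀ j, Y j ⟶ X}
    (hs : IsOrthDecomp s) : IsOrthDecomp (E := NCPCat C D) fun j => letterHomD (s j) :=
  ⟨fun i => by rw [letterHomD_comp_dag, hs.norm, letterHomD_id],
    fun i j h => by rw [letterHomD_comp_dag, hs.orth i j h, letterHomD_zero],
    by simp only [letterHomD_dag_comp]; rw [← letterHomD_sum, hs.complete, letterHomD_id]⟩

/-- In the component of the other category the duality morphisms of a letter consist of unitors of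
the unit, so the zigzag equation there is coherence. -/
theorem coev_unit {E : Type u} [Category.{v} E] [MonoidalCategory E] :
    (𝟙 (𝟙_ E) ⊗ₘ 𝟙 (𝟙_ E) ≫ (λ_ (𝟙_ E)).inv ≫ (𝟙 (𝟙_ E) ⊗ₘ 𝟙 (𝟙_ E))) ≫ (α_ _ _ _).inv ≫
      (((𝟙 (𝟙_ E) ⊗ₘ 𝟙 (𝟙_ E)) ≫ (λ_ (𝟙_ E)).hom) ≫ 𝟙 (𝟙_ E) ⊗ₘ 𝟙 (𝟙_ E)) =
      (ρ_ (𝟙_ E)).hom ≫ (λ_ (𝟙_ E)).inv := by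
  simp only [id_tensorHom_id, Category.comp_id, Category.id_comp, tensorHom_id, id_tensorHom]
  monoidal_coherence

theorem eval_unit {E : Type u} [Category.{v} E] [MonoidalCategory E] :
    (𝟙 (𝟙_ E) ≫ (λ_ (𝟙_ E)).inv ≫ (𝟙 (𝟙_ E) ⊗ₘ 𝟙 (𝟙_ E)) ⊗ₘ 𝟙 (𝟙_ E)) ≫ (α_ _ _ _).hom ≫
      (𝟙 (𝟙_ E) ⊗ₘ ((𝟙 (𝟙_ E) ⊗ₘ 𝟙 (𝟙_ E)) ≫ (λ_ (𝟙_ E)).hom) ≫ 𝟙 (𝟙_ E)) =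
      (λ_ (𝟙_ E)).hom ≫ (ρ_ (𝟙_ E)).inv := by
  simp only [id_tensorHom_id, Category.comp_id, Category.id_comp, tensorHom_id, id_tensorHom]
  monoidal_coherence

theorem normConj_inl {x y : C} (h : NormConj x y) :
    NormConj (letter (.inl x) : NCPCat C D) (letter (.inl y)) := by
  obtain ⟨_, d, hd, e, e'⟩ := h
  refine ⟨⟨blockHomC (σ := .empty) (τ := (Word.letter (.inl x)).append (Word.letter (.inl y)))
    trivial ⟨rfl, rfl⟩ (η_ x y), blockHomC
      (σ := (Word.letter (.inl y)).append (Word.letter (.inl x))) (τ := .empty)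
    ⟨rfl, rfl⟩ trivial (ε_ x y), Subtype.ext (congrArg₂ Box.tmulHom ?_ ?_),
    Subtype.ext (congrArg₂ Box.tmulHom ?_ ?_)⟩, d, hd, ?_, ?_⟩
  · change (𝟙 y ⊗ₘ η_ x y) ≫ (α_ _ _ _).inv ≫ (ε_ x y ⊗ₘ 𝟙 y) = (ρ_ y).hom ≫ (λ_ y).inv
    rw [id_tensorHom, tensorHom_id]
    exact ExactPairing.coevaluation_evaluation x y
  · exact coev_unit
  · change (η_ x y ⊗ₘ 𝟙 x) ≫ (α_ _ _ _).hom ≫ (𝟙 x ⊗ₘ ε_ x y) = (λ_ x).hom ≫ (ρ_ x).inv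
    rw [id_tensorHom, tensorHom_id]
    exact ExactPairing.evaluation_coevaluation x y
  · exact eval_unit
  · exact (congrArg (_ ≫ ·) (blockHomC_dag _ _ _)).trans ((blockHomC_comp _ _ _ _ _).trans
      ((congrArg (blockHomC _ _) e).trans (((blockHomCₗ _ _).map_smul d _).trans
        (congrArg (d • ·) (blockHomC_id _)))))
  · exact (congrArg (· ≫ _) (blockHomC_dag _ _ _)).trans ((blockHomC_comp _ _ _ _ _).trans
      ((congrArg (blockHomC _ _) e').trans (((blockHomCₗ _ _).map_smul d _).trans
        (congrArg (d • ·) (blockHomC_id _)))))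

theorem normConj_inr {x y : D} (h : NormConj x y) :
    NormConj (letter (.inr x) : NCPCat C D) (letter (.inr y)) := by
  obtain ⟨_, d, hd, e, e'⟩ := h
  refine ⟨⟨blockHomD (σ := .empty) (τ := (Word.letter (.inr x)).append (Word.letter (.inr y)))
    trivial ⟨rfl, rfl⟩ (η_ x y), blockHomD
      (σ := (Word.letter (.inr y)).append (Word.letter (.inr x))) (τ := .empty)
    ⟨rfl, rfl⟩ trivial (ε_ x y), Subtype.ext (congrArg₂ Box.tmulHom ?_ ?_),
    Subtype.ext (congrArg₂ Box.tmulHom ?_ ?_)⟩, d, hd, ?_, ?_⟩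
  · exact coev_unit
  · change (𝟙 y ⊗ₘ η_ x y) ≫ (α_ _ _ _).inv ≫ (ε_ x y ⊗ₘ 𝟙 y) = (ρ_ y).hom ≫ (λ_ y).inv
    rw [id_tensorHom, tensorHom_id]
    exact ExactPairing.coevaluation_evaluation x y
  · exact eval_unit
  · change (η_ x y ⊗ₘ 𝟙 x) ≫ (α_ _ _ _).hom ≫ (𝟙 x ⊗ₘ ε_ x y) = (λ_ x).hom ≫ (ρ_ x).inv
    rw [id_tensorHom, tensorHom_id]
    exact ExactPairing.evaluation_coevaluation x y
  · exact (congrArg (_ ≫ ·) (blockHomD_dag _ _ _)).trans ((blockHomD_comp _ _ _ _ _).trans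
      ((congrArg (blockHomD _ _) e).trans (((blockHomDₗ _ _).map_smul d _).trans
        (congrArg (d • ·) (blockHomD_id _)))))
  · exact (congrArg (· ≫ _) (blockHomD_dag _ _ _)).trans ((blockHomD_comp _ _ _ _ _).trans
      ((congrArg (blockHomD _ _) e').trans (((blockHomDₗ _ _).map_smul d _).trans
        (congrArg (d • ·) (blockHomD_id _)))))

/-! ### Words -/

section Words

variable (I : Set C) (I' : Set D)

/-- The word of an alternating list. -/
def altw (l : AltWord I I') : NCPCat C D := ⟨listWord l.1⟩

variable {I I'}

/-- The word of a list. -/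
def wrd (l : List (I ⊕ I')) : NCPCat C D := ⟨listWord l⟩

/-- The object of a letter. -/
abbrev val (x : I ⊕ I') : C ⊕ D := Sum.map Subtype.val Subtype.val x

theorem uEquiv_wrd_append (u v : List (I ⊕ I')) : UEquiv (wrd u ⊗ wrd v) (wrd (u ++ v)) := by
  induction u with
  | nil => exact UEquiv.unitL (wrd v)
  | cons x u ih => exact (UEquiv.assoc (letter (val x)) (wrd u) (wrd v)).trans ((UEquiv.refl _).tensor ih)

theorem uEquiv_wrd_singleton (x : I ⊕ I') : UEquiv (wrd [x]) (letter (val x)) :=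
  UEquiv.unitR (letter (val x))

/-- Decompose `k` in `C`. A trivial summand leaves `q`, and a nontrivial summand `z` gives the word
`zq`, which is alternating as `q` does not begin in `C`. -/
theorem decomposes_letter_inl (hC : IsRigidCStarTensor C) (hI : IsNonunitIrr I) (k : C)
    (q : AltWord I I') (hq : ∀ y ∈ q.1.head?, (Sum.isLeft y) = false) :
    Decomposes (altw I I') (letter (.inl k) ⊗ altw I I' q) := by
  obtain ⟨n, p, s, h1, h2, h3⟩ := exists_orthonormal_irrOrUnit hC hI k
  have hs : IsOrthDecomp s := ⟨h1, h2, h3⟩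
  refine ((orthDecomp_inl hs).whiskerRight _).decomposes fun j => ?_
  cases hp : p j with
  | none => exact ((uEquiv_letter_inl_unit.tensor (.refl _)).trans (.unitL _)).decomposes (.irr _ q)
  | some z =>
    exact Decomposes.irr (altw I I') ⟨Sum.inl z :: q.1,
      List.isChain_cons.2 ⟨fun y hy => by simp [hq y hy], q.2⟩⟩

theorem decomposes_letter_inr (hD : IsRigidCStarTensor D) (hI' : IsNonunitIrr I') (k : D)
    (q : AltWord I I') (hq : ∀ y ∈ q.1.head?, (Sum.isLeft y) = true) :
    Decomposes (altw I I') (letter (.inr k) ⊗ altw I I' q) := by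
  obtain ⟨n, p, s, h1, h2, h3⟩ := exists_orthonormal_irrOrUnit hD hI' k
  have hs : IsOrthDecomp s := ⟨h1, h2, h3⟩
  refine ((orthDecomp_inr hs).whiskerRight _).decomposes fun j => ?_
  cases hp : p j with
  | none => exact ((uEquiv_letter_inr_unit.tensor (.refl _)).trans (.unitL _)).decomposes (.irr _ q)
  | some z =>
    exact Decomposes.irr (altw I I') ⟨Sum.inr z :: q.1,
      List.isChain_cons.2 ⟨fun y hy => by simp [hq y hy], q.2⟩⟩

variable (hC : IsRigidCStarTensor C) (hD : IsRigidCStarTensor D)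
  (hI : IsNonunitIrr I) (hI' : IsNonunitIrr I')

/-- If `w` begins with a letter `y` of the type of `x`, a block merges the two into the single
letter `x ⊗ y` in front of the tail of `w`; otherwise `x` itself plays this role. -/
theorem decomposes_letter (hC : IsRigidCStarTensor C) (hD : IsRigidCStarTensor D)
    (hI : IsNonunitIrr I) (hI' : IsNonunitIrr I') (x : I ⊕ I') (w : AltWord I I') :
    Decomposes (altw I I') (letter (val x) ⊗ altw I I' w) := by
  rcases x with x | x
  · rcases w with ⟨_ | ⟨y | y, t⟩, hw⟩
    · exact decomposes_letter_inl hC hI x.1 _ (by simp)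
    · refine UEquiv.decomposes ((UEquiv.assoc (letter (.inl x.1)) (letter (.inl y.1))
        (altw I I' ⟨t, hw.tail⟩)).symm.trans ((uEquiv_letter_inl x.1 y.1).tensor (.refl _))) ?_
      exact decomposes_letter_inl hC hI _ _
        (fun y hy => by simpa using (List.isChain_cons.1 hw).1 y hy)
    · exact decomposes_letter_inl hC hI x.1 _ (by simp)
  · rcases w with ⟨_ | ⟨y | y, t⟩, hw⟩
    · exact decomposes_letter_inr hD hI' x.1 _ (by simp)
    · exact decomposes_letter_inr hD hI' x.1 _ (by simp)
    · refine UEquiv.decomposes ((UEquiv.assoc (letter (.inr x.1)) (letter (.inr y.1))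
        (altw I I' ⟨t, hw.tail⟩)).symm.trans ((uEquiv_letter_inr x.1 y.1).tensor (.refl _))) ?_
      exact decomposes_letter_inr hD hI' _ _
        (fun y hy => by simpa using (List.isChain_cons.1 hw).1 y hy)

theorem decomposes_wrd (hC : IsRigidCStarTensor C) (hD : IsRigidCStarTensor D)
    (hI : IsNonunitIrr I) (hI' : IsNonunitIrr I') (u : List (I ⊕ I')) (v : AltWord I I') :
    Decomposes (altw I I') (wrd u ⊗ altw I I' v) := by
  induction u with
  | nil => exact (UEquiv.unitL _).decomposes (.irr _ v)
  | cons x u ih =>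
    obtain ⟨J, _, p, s, hs⟩ := ih
    exact (UEquiv.assoc (letter (val x)) (wrd u) (altw I I' v)).decomposes
      ((hs.whiskerLeft _).decomposes fun j => decomposes_letter hC hD hI hI' x (p j))

/-- Conjugate letter by letter and reverse the order. The conjugate of a letter is a nontrivial
simple object of the same category, so the result is alternating again. -/
theorem exists_normConj_wrd (hC : IsRigidCStarTensor C) (hD : IsRigidCStarTensor D)
    (hI : IsNonunitIrr I) (hI' : IsNonunitIrr I') (u : AltWord I I') :
    ∃ v, NormConj (altw I I' u) (altw I I' v) := by
  have h : ∀ x : I ⊕ I', ∃ y : I ⊕ I', y.isLeft = x.isLeft ∧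
      NormConj (letter (val x) : NCPCat C D) (letter (val y)) := by
    rintro (x | x)
    · obtain ⟨y, hy⟩ := hI.exists_normConj hC x
      exact ⟨.inl y, rfl, normConj_inl hy⟩
    · obtain ⟨y, hy⟩ := hI'.exists_normConj hD x
      exact ⟨.inr y, rfl, normConj_inr hy⟩
  choose b hb hb' using h
  have key : ∀ l : List (I ⊕ I'), NormConj (wrd l) (wrd (l.map b).reverse) := by
    intro l
    induction l with
    | nil => exact .unit
    | cons x l ih =>
      rw [List.map_cons, List.reverse_cons]
      exact UEquiv.normConj (.refl _) ((uEquiv_wrd_append _ _).symm.trans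
        ((UEquiv.refl _).tensor (uEquiv_wrd_singleton _))) ((hb' x).tensor ih)
  refine ⟨⟨(u.1.map b).reverse, ?_⟩, key u.1⟩
  rw [List.isChain_reverse, List.isChain_map]
  refine u.2.imp fun x y h => ?_
  simp only [flip, hb]
  exact h.symm

end Words

end NCPCat

/-! ### Transfer to the projection category. -/

section FreeProduct

variable {I : Set C} {I' : Set D}

theorem uEquiv_irrObj_append {u v w : AltWord I I'} (h : w.1 = u.1 ++ v.1) :
    UEquiv (irrObj I I' u ⊗ irrObj I I' v) (irrObj I I' w) := by
  obtain ⟨w, hw⟩ := w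
  cases h
  exact (ProjCat.uEquiv_tensor (NCPCat.wrd u.1) (NCPCat.wrd v.1)).trans
    (NCPCat.uEquiv_wrd_append u.1 v.1).ofObj

theorem decomposes_irrObj (hC : IsRigidCStarTensor C) (hD : IsRigidCStarTensor D)
    (hI : IsNonunitIrr I) (hI' : IsNonunitIrr I') (u v : AltWord I I') :
    Decomposes (irrObj I I') (irrObj I I' u ⊗ irrObj I I' v) := by
  refine (ProjCat.uEquiv_tensor (NCPCat.wrd u.1) (NCPCat.wrd v.1)).decomposes ?_
  obtain ⟨J, _, p, s, hs⟩ := NCPCat.decomposes_wrd hC hD hI hI' u.1 v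
  exact ⟨J, _, p, _, hs.ofHom⟩

theorem exists_normConj_irrObj (hC : IsRigidCStarTensor C) (hD : IsRigidCStarTensor D)
    (hI : IsNonunitIrr I) (hI' : IsNonunitIrr I') (u : AltWord I I') :
    ∃ v, NormConj (irrObj I I' u) (irrObj I I' v) := by
  obtain ⟨v, hv⟩ := NCPCat.exists_normConj_wrd hC hD hI hI' u
  exact ⟨v, hv.ofObj⟩

/-- The tensor product of two nonzero vectors is nonzero, as functionals that do not vanish on the
factors detect. -/
theorem irrObj_unit_ne_zero (hC : IsRigidCStarTensor C) (hD : IsRigidCStarTensor D) :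
    𝟙 (𝟙_ (FreeProduct C D)) ≠ 0 := by
  intro h
  have h' : 𝟙 (𝟙_ C) ⊗ₜ[ℂ] 𝟙 (𝟙_ D) = 0 := congrArg (fun f => f.1.1) h
  refine hC.simple_unit.1 ((Module.forall_dual_apply_eq_zero_iff ℂ _).1 fun f => ?_)
  by_contra hf
  refine hD.simple_unit.1 ((Module.forall_dual_apply_eq_zero_iff ℂ _).1 fun g => ?_)
  have h'' := congrArg (LinearMap.mul' ℂ ℂ ∘ₗ TensorProduct.map f g) h'
  simpa [hf] using h''

/-- Otherwise the coevaluation of `u` would vanish, although its loop is a nonzero multiple of the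
identity of the unit. -/
theorem id_irrObj_ne_zero (hC : IsRigidCStarTensor C) (hD : IsRigidCStarTensor D)
    (hI : IsNonunitIrr I) (hI' : IsNonunitIrr I') (u : AltWord I I') :
    𝟙 (irrObj I I' u) ≠ 0 := by
  intro h
  obtain ⟨v, _, d, hd, e, -⟩ := exists_normConj_irrObj hC hD hI hI' u
  have h1 : η_ (irrObj I I' u) (irrObj I I' v) = 0 := by
    rw [← Category.comp_id (η_ _ _), ← id_whiskerRight, h]
    simp
  rw [h1, Limits.zero_comp] at e
  exact smul_ne_zero hd (irrObj_unit_ne_zero hC hD) e.symm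

end FreeProduct

end Letters

/-! ## Annular algebras of a category with finite decompositions -/

section Annular

variable {E : Type u} [Category.{v} E] [Preadditive E] [Linear ℂ E] [MonoidalCategory E]
  [MonoidalPreadditive E] [MonoidalLinear ℂ E] [DaggerMonoidal E] {ι : Type w}

/-- The objects `irr a` are simple and mutually disjoint, and their products decompose. -/
structure IsIrrFamily (irr : ι → E) : Prop where
  schur_ne : ∀ {a b : ι}, a ≠ b → ∀ f : irr a ⟶ irr b, f = 0
  schur : ∀ {a : ι} (f : irr a ⟶ irr a), ∃ c : ℂ, f = c • 𝟙 _
  ne_zero : ∀ a : ι, 𝟙 (irr a) ≠ 0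
  decomposes : ∀ a b : ι, Decomposes irr (irr a ⊗ irr b)

variable {irr : ι → E}

/-- Expand `f = ∑ (f ≫ s_j†) ≫ s_j`; by Schur's lemma the coefficients are scalars, or zero when the
indices differ. -/
theorem IsOrthDecomp.mem_span (h : IsIrrFamily irr) {J : Type} [Fintype J] {p : J → ι} {X : E}
    {s : ∀ j, irr (p j) ⟶ X} (hs : IsOrthDecomp s) {e : ι} (f : irr e ⟶ X) :
    f ∈ Submodule.span ℂ {t : irr e ⟶ X | ∃ j, (⟨p j, s j⟩ : Σ a, irr a ⟶ X) = ⟨e, t⟩} := by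
  have hf : f = ∑ j, (f ≫ (s j)†) ≫ s j := by
    conv_lhs => rw [← Category.comp_id f, ← hs.complete]
    simp [Preadditive.comp_sum]
  rw [hf]
  refine Submodule.sum_mem _ fun j _ => ?_
  by_cases hj : p j = e
  · have key : ∀ (a : ι) (t : irr a ⟶ X) (g : irr e ⟶ irr a), a = e →
        g ≫ t ∈ Submodule.span ℂ {t' : irr e ⟶ X | (⟨a, t⟩ : Σ a, irr a ⟶ X) = ⟨e, t'⟩} := by
      rintro a t g rfl
      obtain ⟨c, rfl⟩ := h.schur g
      rw [Linear.smul_comp, Category.id_comp]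
      exact Submodule.smul_mem _ _ (Submodule.subset_span rfl)
    refine Submodule.span_mono ?_ (key (p j) (s j) (f ≫ (s j)†) hj)
    intro t ht
    exact ⟨j, ht⟩
  · rw [h.schur_ne (Ne.symm hj) (f ≫ (s j)†), Limits.zero_comp]
    exact zero_mem _

theorem exists_annularChoice (h : IsIrrFamily irr)
    (hconj : ∀ a, ∃ b, NormConj (irr a) (irr b)) : Nonempty (AnnularChoice irr) := by
  classical
  choose J hJ p s hs using h.decomposes
  choose b hb d _ e e' using hconj
  refine ⟨⟨fun a₁ a₂ => Finset.univ.image fun j => ⟨p a₁ a₂ j, s a₁ a₂ j⟩, ?_, ?_, ?_, b,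
    fun a => (ε_ (irr a) (irr (b a)))†, fun a => η_ (irr a) (irr (b a)),
    fun a => isConjugateSolution_of_exactPairing _ _, fun a => ?_⟩⟩
  · intro a₁ a₂ x t ht
    obtain ⟨j, -, hj⟩ := Finset.mem_image.1 ht
    obtain ⟨rfl, hj⟩ := Sigma.mk.inj_iff.1 hj
    cases hj
    exact (hs a₁ a₂).norm j
  · intro a₁ a₂ x t t' ht ht' hne
    obtain ⟨j, -, hj⟩ := Finset.mem_image.1 ht
    obtain ⟨k, -, hk⟩ := Finset.mem_image.1 ht'
    have hjk : j ≠ k := by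
      rintro rfl
      have := hj.symm.trans hk
      simp only [Sigma.mk.injEq, heq_eq_eq, true_and] at this
      exact hne this
    -- Stated for arbitrary pairs, so that the equalities of dependent pairs can be eliminated.
    have key : ∀ (a a' : ι) (r : irr a ⟶ irr a₁ ⊗ irr a₂) (r' : irr a' ⟶ irr a₁ ⊗ irr a₂),
        (⟨a, r⟩ : Σ a, irr a ⟶ irr a₁ ⊗ irr a₂) = ⟨x, t⟩ →
        (⟨a', r'⟩ : Σ a, irr a ⟶ irr a₁ ⊗ irr a₂) = ⟨x, t'⟩ → r ≫ r'† = 0 → t ≫ t'† = 0 := by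
      rintro a a' r r' h h' h0
      cases h
      cases h'
      exact h0
    exact key _ _ _ _ hj hk ((hs a₁ a₂).orth j k hjk)
  · intro a₁ a₂ x
    rw [eq_top_iff]
    intro f _
    refine Submodule.span_mono ?_ ((hs a₁ a₂).mem_span h f)
    rintro t ⟨j, hj⟩
    exact Finset.mem_image.2 ⟨j, Finset.mem_univ _, hj⟩
  · rw [DaggerMonoidal.dag_dag, e, e']

/-- The chosen orthonormal bases give orthogonal decompositions. -/
theorem AnnularChoice.isOrthDecomp (h : IsIrrFamily irr) (T : AnnularChoice irr) (a₁ a₂ : ι) :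
    (∀ s ∈ T.onb a₁ a₂, s.2 ≫ s.2† = 𝟙 _) ∧
    (∀ s ∈ T.onb a₁ a₂, ∀ t ∈ T.onb a₁ a₂, s ≠ t → s.2 ≫ t.2† = 0) ∧
    ∑ s ∈ T.onb a₁ a₂, s.2† ≫ s.2 = 𝟙 (irr a₁ ⊗ irr a₂) := by
  have h1 : ∀ s ∈ T.onb a₁ a₂, s.2 ≫ s.2† = 𝟙 _ := fun ⟨e, s⟩ hs => T.onb_norm a₁ a₂ e s hs
  have h2 : ∀ s ∈ T.onb a₁ a₂, ∀ t ∈ T.onb a₁ a₂, s ≠ t → s.2 ≫ t.2† = 0 := by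
    rintro ⟨e, s⟩ hs ⟨e', t⟩ ht hne
    by_cases he : e = e'
    · subst he
      exact T.onb_orth a₁ a₂ e s t hs ht (by rintro rfl; exact hne rfl)
    · exact h.schur_ne he _
  refine ⟨h1, h2, ?_⟩
  -- The sum acts as the identity on each morphism out of a simple object. These morphisms include
  -- the isometries of a decomposition of `irr a₁ ⊗ irr a₂`, so the sum is the identity.
  have h3 : ∀ (e : ι) (f : irr e ⟶ irr a₁ ⊗ irr a₂),
      f ≫ ∑ s ∈ T.onb a₁ a₂, s.2† ≫ s.2 = f := by
    intro e f
    have hf : f ∈ Submodule.span ℂ {s : irr e ⟶ irr a₁ ⊗ irr a₂ | ⟨e, s⟩ ∈ T.onb a₁ a₂} := by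
      rw [T.onb_span]
      trivial
    induction hf using Submodule.span_induction with
    | zero => simp
    | add x y _ _ hx hy => rw [Preadditive.add_comp, hx, hy]
    | smul c x _ hx => rw [Linear.smul_comp, hx]
    | mem s hs =>
      rw [Preadditive.comp_sum, Finset.sum_eq_single_of_mem _ hs]
      · rw [← Category.assoc, h1 _ hs, Category.id_comp]
      · intro t ht hne
        rw [← Category.assoc, h2 _ hs t ht hne.symm, Limits.zero_comp]
  obtain ⟨J, _, p, t, ht⟩ := h.decomposes a₁ a₂
  rw [← Category.id_comp (∑ s ∈ T.onb a₁ a₂, s.2† ≫ s.2), ← ht.complete, Preadditive.sum_comp]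
  refine Finset.sum_congr rfl fun j _ => ?_
  rw [Category.assoc, h3]

end Annular

theorem isIrrFamily_irrObj {C : Type u₁} [Category.{v₁} C] [Preadditive C] [Linear ℂ C]
    [MonoidalCategory C] [MonoidalPreadditive C] [MonoidalLinear ℂ C] [DaggerMonoidal C]
    {D : Type u₂} [Category.{v₂} D] [Preadditive D] [Linear ℂ D]
    [MonoidalCategory D] [MonoidalPreadditive D] [MonoidalLinear ℂ D] [DaggerMonoidal D]
    (hC : IsRigidCStarTensor C) (hD : IsRigidCStarTensor D)
    {I : Set C} (hI : IsNonunitIrr I) {I' : Set D} (hI' : IsNonunitIrr I') :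
    IsIrrFamily (irrObj I I') where
  schur_ne h f := irrObj_hom_eq_zero hC hD hI hI' h f
  schur f := irrObj_hom_eq_smul hC hD hI hI' f
  ne_zero := id_irrObj_ne_zero hC hD hI hI'
  decomposes := decomposes_irrObj hC hD hI hI'

/-! ## The trace of an endomorphism of an annulus -/

section Trace

variable {E : Type u} [Category.{v} E] [Preadditive E] [Linear ℂ E] [MonoidalCategory E]
  [MonoidalPreadditive E] [MonoidalLinear ℂ E] [DaggerMonoidal E] {ι : Type w} [DecidableEq ι]
  {irr : ι → E}

/-- The compression of `f` to `Y`, for `s : Y ⟶ X`. -/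
def compress {X Y b c : E} (f : X ⊗ b ⟶ c ⊗ X) (s : Y ⟶ X) : Y ⊗ b ⟶ c ⊗ Y :=
  s ▷ b ≫ f ≫ c ◁ s†

/-- The inclusion of a summand of `TubeHom irr b c`. -/
abbrev tubeOf (irr : ι → E) (b c : E) (a : ι) : (irr a ⊗ b ⟶ c ⊗ irr a) →ₗ[ℂ] TubeHom irr b c :=
  DirectSum.lof ℂ ι (fun a => (irr a ⊗ b ⟶ c ⊗ irr a)) a

/-- The class of `f : X ⊗ b ⟶ c ⊗ X` in `TubeHom irr b c`, computed from a decomposition of `X`. -/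
def tubeTrace {J : Type*} [Fintype J] {p : J → ι} {X b c : E} (s : ∀ j, irr (p j) ⟶ X)
    (f : X ⊗ b ⟶ c ⊗ X) : TubeHom irr b c :=
  ∑ j, tubeOf irr b c (p j) (compress f (s j))

theorem tubeTrace_smul {J : Type*} [Fintype J] {p : J → ι} {X b c : E} (s : ∀ j, irr (p j) ⟶ X)
    (z : ℂ) (f : X ⊗ b ⟶ c ⊗ X) : tubeTrace s (z • f) = z • tubeTrace s f := by
  simp only [tubeTrace, compress, Linear.smul_comp, Linear.comp_smul, map_smul, Finset.smul_sum]

/-- By Schur's lemma `m` is a scalar, or zero if the summands differ. -/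
theorem tubeOf_comm (h : IsIrrFamily irr) {b c : E} {a a' : ι} (m : irr a ⟶ irr a')
    (f : irr a' ⊗ b ⟶ c ⊗ irr a) :
    tubeOf irr b c a (m ▷ b ≫ f) = tubeOf irr b c a' (f ≫ c ◁ m) := by
  by_cases ha : a = a'
  · subst ha
    obtain ⟨z, rfl⟩ := h.schur m
    simp
  · rw [h.schur_ne ha m]
    simp

/-- The trace property. -/
theorem tubeTrace_comm (h : IsIrrFamily irr) {J K : Type*} [Fintype J] [Fintype K] {p : J → ι}
    {q : K → ι} {X Y b c : E} {s : ∀ j, irr (p j) ⟶ X} {t : ∀ k, irr (q k) ⟶ Y}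
    (hs : IsOrthDecomp s) (ht : IsOrthDecomp t) (g : X ⟶ Y) (f : Y ⊗ b ⟶ c ⊗ X) :
    tubeTrace s (g ▷ b ≫ f) = tubeTrace t (f ≫ c ◁ g) := by
  -- Inserting the resolutions of the identity of `Y` here and of `X` below leaves the matrix
  -- coefficients `s_j ≫ g ≫ t_k†` between simple objects, for which `tubeOf_comm` applies.
  have h1 : ∀ j, compress (g ▷ b ≫ f) (s j) =
      ∑ k, (s j ≫ g ≫ (t k)†) ▷ b ≫ (t k) ▷ b ≫ f ≫ c ◁ (s j)† := by
    intro j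
    have : (s j ≫ g) ▷ b = ∑ k, (s j ≫ g ≫ (t k)†) ▷ b ≫ t k ▷ b := by
      conv_lhs => rw [← Category.comp_id g, ← ht.complete]
      simp [Preadditive.comp_sum, sum_whiskerRight]
    simp only [compress, Category.assoc]
    rw [← comp_whiskerRight_assoc, this]
    simp [Preadditive.sum_comp]
  have h2 : ∀ k, compress (f ≫ c ◁ g) (t k) =
      ∑ j, ((t k) ▷ b ≫ f ≫ c ◁ (s j)†) ≫ c ◁ (s j ≫ g ≫ (t k)†) := by
    intro k
    have : c ◁ (g ≫ (t k)†) = ∑ j, c ◁ (s j)† ≫ c ◁ (s j ≫ g ≫ (t k)†) := by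
      conv_lhs => rw [← Category.id_comp g, ← hs.complete]
      simp [Preadditive.sum_comp, whiskerLeft_sum]
    simp only [compress, Category.assoc]
    rw [← MonoidalCategory.whiskerLeft_comp, this]
    simp [Preadditive.comp_sum]
  unfold tubeTrace
  simp only [h1, h2, map_sum]
  rw [Finset.sum_comm]
  refine Finset.sum_congr rfl fun k _ => Finset.sum_congr rfl fun j _ => ?_
  exact tubeOf_comm h _ _

/-- The trace property for `g = 𝟙`, with one decomposition on each side. -/
theorem tubeTrace_eq (h : IsIrrFamily irr) {J K : Type*} [Fintype J] [Fintype K] {p : J → ι}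
    {q : K → ι} {X b c : E} {s : ∀ j, irr (p j) ⟶ X} {t : ∀ k, irr (q k) ⟶ X}
    (hs : IsOrthDecomp s) (ht : IsOrthDecomp t) (f : X ⊗ b ⟶ c ⊗ X) :
    tubeTrace s f = tubeTrace t f := by
  simpa using tubeTrace_comm h hs ht (𝟙 X) f

theorem tubeTrace_id (a : ι) {b c : E} (f : irr a ⊗ b ⟶ c ⊗ irr a) :
    tubeTrace (J := Unit) (p := fun _ => a) (fun _ => 𝟙 (irr a)) f = tubeOf irr b c a f := by
  simp [tubeTrace, compress, dag_id]

theorem isOrthDecomp_id (X : E) : IsOrthDecomp (J := Unit) (Y := fun _ => X) fun _ => 𝟙 X :=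
  (IsUnitary.id X).isOrthDecomp

/-- `f` on top of `g`. -/
def annStack {a₁ a₂ b c d : E} (f : a₁ ⊗ c ⟶ d ⊗ a₁) (g : a₂ ⊗ b ⟶ c ⊗ a₂) :
    (a₁ ⊗ a₂) ⊗ b ⟶ d ⊗ (a₁ ⊗ a₂) :=
  (α_ a₁ a₂ b).hom ≫ a₁ ◁ g ≫ (α_ a₁ c a₂).inv ≫ f ▷ a₂ ≫ (α_ d a₁ a₂).hom

theorem compress_annStack {a₁ a₂ b c d x₁ x₂ : E} (f : a₁ ⊗ c ⟶ d ⊗ a₁) (g : a₂ ⊗ b ⟶ c ⊗ a₂)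
    (s₁ : x₁ ⟶ a₁) (s₂ : x₂ ⟶ a₂) : compress (annStack f g) (s₁ ⊗ₘ s₂) =
      annStack (compress f s₁) (compress g s₂) := by
  calc _ = (α_ _ _ _).hom ≫ s₁ ▷ (x₂ ⊗ b) ≫ a₁ ◁ (s₂ ▷ b ≫ g) ≫ (α_ _ _ _).inv ≫
        (f ▷ a₂ ≫ (d ⊗ a₁) ◁ s₂†) ≫ (α_ _ _ _).hom ≫ d ◁ (s₁† ▷ x₂) := by
        simp only [compress, annStack, DaggerMonoidal.dag_tensor]
        rw [MonoidalCategory.tensorHom_def s₁ s₂, MonoidalCategory.tensorHom_def' s₁†]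
        monoidal
    _ = (α_ _ _ _).hom ≫ (s₁ ▷ (x₂ ⊗ b) ≫ a₁ ◁ (s₂ ▷ b ≫ g ≫ c ◁ s₂†)) ≫ (α_ _ _ _).inv ≫
        f ▷ x₂ ≫ (α_ _ _ _).hom ≫ d ◁ (s₁† ▷ x₂) := by
        rw [← whisker_exchange]
        monoidal
    _ = _ := by
        rw [← whisker_exchange]
        simp only [compress, annStack]
        monoidal

theorem compress_compress {a x y b c : E} (f : a ⊗ b ⟶ c ⊗ a) (s : x ⟶ a) (t : y ⟶ x) :
    compress (compress f s) t = compress f (t ≫ s) := by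
  simp [compress, DaggerMonoidal.dag_comp]

variable (T : AnnularChoice irr)

theorem AnnularChoice.prodTerm_eq {a₁ a₂ e b c d : E} (f : a₁ ⊗ c ⟶ d ⊗ a₁)
    (g : a₂ ⊗ b ⟶ c ⊗ a₂) (s : e ⟶ a₁ ⊗ a₂) :
    AnnularChoice.prodTerm f g s = compress (annStack f g) s := by
  simp [AnnularChoice.prodTerm, compress, annStack]

theorem AnnularChoice.compₗ_tubeOf (a₁ a₂ : ι) (b c d : E) (f : irr a₁ ⊗ c ⟶ d ⊗ irr a₁)
    (g : irr a₂ ⊗ b ⟶ c ⊗ irr a₂) :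
    T.compₗ b c d (tubeOf irr c d a₁ f) (tubeOf irr b c a₂ g) =
      tubeTrace (fun s : T.onb a₁ a₂ => s.1.2) (annStack f g) := by
  have : T.compₗ b c d (tubeOf irr c d a₁ f) (tubeOf irr b c a₂ g) = T.prodₗ a₁ a₂ b c d f g := by
    simp [AnnularChoice.compₗ, tubeOf]
  rw [this]
  simp only [AnnularChoice.prodₗ, LinearMap.mk₂_apply, AnnularChoice.prodTerm_eq, tubeTrace]
  exact (Finset.sum_coe_sort (T.onb a₁ a₂) fun s =>
    tubeOf irr b d s.1 (compress (annStack f g) s.2)).symm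

theorem AnnularChoice.isOrthDecomp_onb (h : IsIrrFamily irr) (a₁ a₂ : ι) :
    IsOrthDecomp fun s : T.onb a₁ a₂ => s.1.2 := by
  obtain ⟨h1, h2, h3⟩ := T.isOrthDecomp h a₁ a₂
  refine ⟨fun s => h1 s.1 s.2, fun s t hst => h2 s.1 s.2 t.1 t.2 fun e => hst (Subtype.ext e), ?_⟩
  rw [← h3]
  exact Finset.sum_coe_sort (T.onb a₁ a₂) fun s => s.2† ≫ s.2

/-- The product in terms of arbitrary decompositions. -/
theorem AnnularChoice.compₗ_tubeTrace (h : IsIrrFamily irr) {J K L : Type*} [Fintype J] [Fintype K]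
    [Fintype L] {p : J → ι} {q : K → ι} {r : L → ι} {X Y b c d : E} {s : ∀ j, irr (p j) ⟶ X}
    {t : ∀ k, irr (q k) ⟶ Y} {u : ∀ l, irr (r l) ⟶ X ⊗ Y}
    (hs : IsOrthDecomp s) (ht : IsOrthDecomp t) (hu : IsOrthDecomp u) (f : X ⊗ c ⟶ d ⊗ X)
    (g : Y ⊗ b ⟶ c ⊗ Y) :
    T.compₗ b c d (tubeTrace s f) (tubeTrace t g) = tubeTrace u (annStack f g) := by
  -- A decomposition of `X ⊗ Y` adapted to the definition of the product: split `X` and `Y`, and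
  -- then each `irr (p j) ⊗ irr (q k)` by the chosen orthonormal basis.
  let w : ∀ x : Σ j, Σ k, T.onb (p j) (q k), irr x.2.2.1.1 ⟶ X ⊗ Y :=
    fun x => x.2.2.1.2 ≫ (s x.1 ⊗ₘ t x.2.1)
  have hw : IsOrthDecomp w := by
    refine ⟨?_, ?_, ?_⟩
    · rintro ⟨j, k, x⟩
      simp only [w, DaggerMonoidal.dag_comp, DaggerMonoidal.dag_tensor, Category.assoc]
      rw [tensorHom_comp_tensorHom_assoc, hs.norm, ht.norm, id_tensorHom_id, Category.id_comp]
      exact (T.isOrthDecomp_onb h _ _).norm x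
    · rintro ⟨j, k, x⟩ ⟨j', k', x'⟩ hne
      simp only [w, DaggerMonoidal.dag_comp, DaggerMonoidal.dag_tensor, Category.assoc]
      rw [tensorHom_comp_tensorHom_assoc]
      by_cases hj : j = j'
      · subst hj
        by_cases hk : k = k'
        · subst hk
          rw [hs.norm, ht.norm, id_tensorHom_id, Category.id_comp]
          exact (T.isOrthDecomp_onb h _ _).orth x x' fun e => hne (by rw [e])
        · rw [ht.orth _ _ hk]
          simp
      · rw [hs.orth _ _ hj]
        simp
    · have key : ∀ j k, ∑ x : T.onb (p j) (q k), (x.1.2 ≫ (s j ⊗ₘ t k))† ≫ x.1.2 ≫ (s j ⊗ₘ t k) =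
          ((s j)† ≫ s j) ⊗ₘ ((t k)† ≫ t k) := by
        intro j k
        have := (T.isOrthDecomp_onb h (p j) (q k)).complete
        calc _ = (s j ⊗ₘ t k)† ≫ (∑ x : T.onb (p j) (q k), x.1.2† ≫ x.1.2) ≫ (s j ⊗ₘ t k) := by
              simp [Preadditive.sum_comp, Preadditive.comp_sum, DaggerMonoidal.dag_comp]
          _ = _ := by
            rw [this, Category.id_comp, DaggerMonoidal.dag_tensor, tensorHom_comp_tensorHom]
      rw [Fintype.sum_sigma]
      simp only [Fintype.sum_sigma, w, key]
      simp only [← tensor_sum, ← sum_tensor, hs.complete, ht.complete, id_tensorHom_id]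
  rw [tubeTrace_eq h hu hw]
  simp only [tubeTrace, map_sum, LinearMap.sum_apply, Fintype.sum_sigma]
  rw [Finset.sum_comm]
  refine Finset.sum_congr rfl fun j _ => Finset.sum_congr rfl fun k _ => ?_
  rw [T.compₗ_tubeOf]
  refine Finset.sum_congr rfl fun x _ => ?_
  rw [← compress_annStack, compress_compress]

end Trace

/-! ## Units, associativity and the involution -/

section Sharp

variable {E : Type u} [Category.{v} E] [Preadditive E] [Linear ℂ E] [MonoidalCategory E]
  [MonoidalPreadditive E] [MonoidalLinear ℂ E] [DaggerMonoidal E]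

/-- The map `f ↦ f^#` for given duality morphisms. -/
def sharpOf {X Y b c : E} (R : 𝟙_ E ⟶ Y ⊗ X) (Rbar : 𝟙_ E ⟶ X ⊗ Y) (f : X ⊗ b ⟶ c ⊗ X) :
    Y ⊗ c ⟶ b ⊗ Y :=
  (ρ_ (Y ⊗ c)).inv ≫ (Y ⊗ c) ◁ Rbar ≫ (α_ Y c (X ⊗ Y)).hom ≫ Y ◁ (α_ c X Y).inv ≫
    Y ◁ (f† ▷ Y) ≫ Y ◁ (α_ X b Y).hom ≫ (α_ Y X (b ⊗ Y)).inv ≫ R† ▷ (b ⊗ Y) ≫ (λ_ (b ⊗ Y)).hom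

variable {X Y b c : E} {R : 𝟙_ E ⟶ Y ⊗ X} {Rbar : 𝟙_ E ⟶ X ⊗ Y}

theorem IsConjugateSolution.zigzag (h : IsConjugateSolution X Y R Rbar) :
    Rbar ▷ X ⊗≫ X ◁ R† = ⊗𝟙.hom := by
  have := h.left
  calc Rbar ▷ X ⊗≫ X ◁ R† = (λ_ X).hom ≫ ((λ_ X).inv ≫ Rbar ▷ X ≫ (α_ X Y X).hom ≫ X ◁ R† ≫
        (ρ_ X).hom) ≫ (ρ_ X).inv := by monoidal
    _ = _ := by rw [this]; monoidal

theorem IsConjugateSolution.symm (h : IsConjugateSolution X Y R Rbar) :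
    IsConjugateSolution Y X Rbar R := by
  constructor
  · have := congrArg DaggerMonoidal.dag h.right
    simpa [DaggerMonoidal.dag_comp, dag_whiskerLeft, dag_whiskerRight, DaggerMonoidal.dag_dag,
      dag_associator_inv, DaggerMonoidal.dag_leftUnitor, dag_rightUnitor_inv, dag_id] using this
  · have := congrArg DaggerMonoidal.dag h.left
    simpa [DaggerMonoidal.dag_comp, dag_whiskerLeft, dag_whiskerRight, DaggerMonoidal.dag_dag,
      DaggerMonoidal.dag_associator, dag_leftUnitor_inv, DaggerMonoidal.dag_rightUnitor, dag_id]
      using this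

theorem IsConjugateSolution.zigzag' (h : IsConjugateSolution X Y R Rbar) :
    X ◁ R ⊗≫ Rbar† ▷ X = ⊗𝟙.hom := by
  have := h.symm.right
  calc X ◁ R ⊗≫ Rbar† ▷ X = (ρ_ X).hom ≫ ((ρ_ X).inv ≫ X ◁ R ≫ (α_ X Y X).inv ≫ Rbar† ▷ X ≫
        (λ_ X).hom) ≫ (λ_ X).inv := by monoidal
    _ = _ := by rw [this]; monoidal

theorem dag_sharpOf (f : X ⊗ b ⟶ c ⊗ X) : (sharpOf R Rbar f)† =
    𝟙 _ ⊗≫ R ▷ (b ⊗ Y) ⊗≫ Y ◁ (f ▷ Y) ⊗≫ (Y ⊗ c) ◁ Rbar† ⊗≫ 𝟙 _ := by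
  simp only [sharpOf, DaggerMonoidal.dag_comp, dag_whiskerLeft, dag_whiskerRight,
    DaggerMonoidal.dag_dag, dag_associator_inv, DaggerMonoidal.dag_leftUnitor, dag_rightUnitor_inv,
    DaggerMonoidal.dag_associator]
  monoidal

/-- In pictures, applying `#` twice leaves `f` with one zigzag on either side; both are
straightened. -/
theorem sharpOf_sharpOf (h : IsConjugateSolution X Y R Rbar) (f : X ⊗ b ⟶ c ⊗ X) :
    sharpOf Rbar R (sharpOf R Rbar f) = f := by
  have z := h.zigzag'
  unfold sharpOf
  change _ ≫ _ ≫ _ ≫ _ ≫ X ◁ ((sharpOf R Rbar f)† ▷ X) ≫ _ = f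
  rw [dag_sharpOf]
  generalize Rbar† = q at *
  calc _ = 𝟙 _ ⊗≫ X ◁ (𝟙_ E ◁ (b ◁ R) ≫ R ▷ (b ⊗ (Y ⊗ X))) ⊗≫ (X ⊗ Y) ◁ f ▷ (Y ⊗ X) ⊗≫
        (X ⊗ Y) ◁ c ◁ q ▷ X ⊗≫ q ▷ (c ⊗ X) ⊗≫ 𝟙 _ := by monoidal
    _ = 𝟙 _ ⊗≫ X ◁ R ▷ b ⊗≫ (X ⊗ Y) ◁ ((X ⊗ b) ◁ R ≫ f ▷ (Y ⊗ X)) ⊗≫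
        (X ⊗ Y) ◁ c ◁ q ▷ X ⊗≫ q ▷ (c ⊗ X) ⊗≫ 𝟙 _ := by
      rw [whisker_exchange]
      monoidal
    _ = 𝟙 _ ⊗≫ X ◁ R ▷ b ⊗≫ (X ⊗ Y) ◁ f ⊗≫ (X ⊗ Y) ◁ c ◁ (X ◁ R ⊗≫ q ▷ X) ⊗≫
        q ▷ (c ⊗ X) ⊗≫ 𝟙 _ := by
      rw [whisker_exchange]
      monoidal
    _ = 𝟙 _ ⊗≫ X ◁ R ▷ b ⊗≫ ((X ⊗ Y) ◁ f ≫ q ▷ (c ⊗ X)) ⊗≫ 𝟙 _ := by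
      rw [z]
      monoidal
    _ = 𝟙 _ ⊗≫ (X ◁ R ⊗≫ q ▷ X) ▷ b ⊗≫ f ⊗≫ 𝟙 _ := by
      rw [whisker_exchange]
      monoidal
    _ = f := by
      rw [z]
      monoidal

/-- Attaching the cup `Rbar` straightens one zigzag of `f^#` and leaves `f†`. For unitary `f` this
evaluates the stack of `f` and `f^#` on the trivial summand of `X ⊗ Y`. -/
theorem whiskerRight_comp_sharpOf (h : IsConjugateSolution X Y R Rbar) (f : X ⊗ b ⟶ c ⊗ X) :
    Rbar ▷ c ≫ (α_ X Y c).hom ≫ X ◁ sharpOf R Rbar f =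
      (λ_ c).hom ≫ (ρ_ c).inv ≫ c ◁ Rbar ≫ (α_ c X Y).inv ≫ f† ▷ Y ≫ (α_ X b Y).hom := by
  have z := h.zigzag
  unfold sharpOf
  generalize f† = g
  generalize R† = q at *
  calc _ = 𝟙 _ ⊗≫ (Rbar ▷ c ≫ (X ⊗ Y) ◁ ((ρ_ c).inv ≫ c ◁ Rbar ≫ (α_ c X Y).inv ≫ g ▷ Y)) ⊗≫
        X ◁ q ▷ (b ⊗ Y) ⊗≫ 𝟙 _ := by monoidal
    _ = 𝟙 _ ⊗≫ c ◁ Rbar ⊗≫ g ▷ Y ⊗≫ (Rbar ▷ X ⊗≫ X ◁ q) ▷ (b ⊗ Y) ⊗≫ 𝟙 _ := by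
      rw [← whisker_exchange]
      monoidal
    _ = _ := by
      rw [z]
      monoidal

/-- The counterpart with the cap `R†`, used for the product of `f^#` and `f` in the other order. -/
theorem sharpOf_whiskerRight_comp (h : IsConjugateSolution X Y R Rbar) (f : X ⊗ b ⟶ c ⊗ X) :
    sharpOf R Rbar f ▷ X ≫ (α_ b Y X).hom ≫ b ◁ R† =
      (α_ Y c X).hom ≫ Y ◁ f† ≫ (α_ Y X b).inv ≫ R† ▷ b ≫ (λ_ b).hom ≫ (ρ_ b).inv := by
  have z := h.zigzag
  unfold sharpOf
  generalize f† = g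
  generalize R† = q at *
  calc _ = 𝟙 _ ⊗≫ Y ◁ c ◁ Rbar ▷ X ⊗≫ Y ◁ g ▷ (Y ⊗ X) ⊗≫
        (q ▷ (b ⊗ (Y ⊗ X)) ≫ 𝟙_ E ◁ (b ◁ q)) ⊗≫ 𝟙 _ := by monoidal
    _ = 𝟙 _ ⊗≫ Y ◁ c ◁ Rbar ▷ X ⊗≫ Y ◁ (g ▷ (Y ⊗ X) ≫ (X ⊗ b) ◁ q) ⊗≫ q ▷ b ⊗≫ 𝟙 _ := by
      rw [← whisker_exchange]
      monoidal
    _ = 𝟙 _ ⊗≫ Y ◁ c ◁ (Rbar ▷ X ⊗≫ X ◁ q) ⊗≫ Y ◁ g ⊗≫ q ▷ b ⊗≫ 𝟙 _ := by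
      rw [← whisker_exchange]
      monoidal
    _ = _ := by
      rw [z]
      monoidal

/-- Frobenius reciprocity identifies the morphisms `𝟙 ⟶ X ⊗ Y` with the endomorphisms of `X`, which
are scalars; `Rbar` corresponds to the identity. -/
theorem eq_smul_of_unit_hom (h : IsConjugateSolution X Y R Rbar)
    (hX : ∀ f : X ⟶ X, ∃ z : ℂ, f = z • 𝟙 X) (g : 𝟙_ E ⟶ X ⊗ Y) : ∃ z : ℂ, g = z • Rbar := by
  let := h.exactPairing
  obtain ⟨z, hz⟩ := hX ((λ_ X).inv ≫ (tensorRightHomEquiv (𝟙_ E) X Y X).symm g)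
  refine ⟨z, (tensorRightHomEquiv (𝟙_ E) X Y X).symm.injective ?_⟩
  rw [← cancel_epi (λ_ X).inv, hz, tensorRightHomEquiv_symm_smul, Linear.comp_smul]
  congr 1
  exact h.left.symm

theorem IsConjugateSolution.ne_zero (h : IsConjugateSolution X Y R Rbar) (hX : 𝟙 X ≠ 0) :
    Rbar ≠ 0 := by
  rintro rfl
  apply hX
  rw [← h.left]
  simp

theorem annStack_assoc {a₁ a₂ a₃ b c d e : E} (f : a₁ ⊗ d ⟶ e ⊗ a₁) (g : a₂ ⊗ c ⟶ d ⊗ a₂)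
    (k : a₃ ⊗ b ⟶ c ⊗ a₃) : annStack (annStack f g) k =
      (α_ a₁ a₂ a₃).hom ▷ b ≫ annStack f (annStack g k) ≫ e ◁ (α_ a₁ a₂ a₃).inv := by
  simp only [annStack]
  monoidal

theorem annStack_unit_left {a b c : E} (f : a ⊗ b ⟶ c ⊗ a) :
    annStack ((λ_ c).hom ≫ (ρ_ c).inv) f = (λ_ a).hom ▷ b ≫ f ≫ c ◁ (λ_ a).inv := by
  simp only [annStack]
  monoidal

theorem annStack_unit_right {a b c : E} (f : a ⊗ b ⟶ c ⊗ a) :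
    annStack f ((λ_ b).hom ≫ (ρ_ b).inv) = (ρ_ a).hom ▷ b ≫ f ≫ c ◁ (ρ_ a).inv := by
  simp only [annStack]
  monoidal

end Sharp

/-! ### Composition of tube spaces, and inverses of unitary annuli. -/

section Tube

variable {E : Type u} [Category.{v} E] [Preadditive E] [Linear ℂ E] [MonoidalCategory E]
  [MonoidalPreadditive E] [MonoidalLinear ℂ E] [DaggerMonoidal E] {ι : Type w} [DecidableEq ι]
  {irr : ι → E}

theorem tube_induction {b c : E} {P : TubeHom irr b c → Prop} (x : TubeHom irr b c) (zero : P 0)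
    (of : ∀ a f, P (tubeOf irr b c a f)) (add : ∀ x y, P x → P y → P (x + y)) : P x :=
  DirectSum.induction_on x zero of add

/-- The unit element with weight `b`. -/
def tubeOne {e₀ : ι} (u₀ : irr e₀ ⟶ 𝟙_ E) (b : E) : TubeHom irr b b :=
  tubeTrace (J := Unit) (p := fun _ => e₀) (fun _ => u₀) ((λ_ b).hom ≫ (ρ_ b).inv)

namespace AnnularChoice

variable (T : AnnularChoice irr) {e₀ : ι} {u₀ : irr e₀ ⟶ 𝟙_ E}

/-- Both sides are traces of a stack of three annuli, over two bracketings of the product of the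
annular objects. The stacks differ by conjugation with the associator, and the trace does not notice
it. -/
theorem compₗ_assoc (h : IsIrrFamily irr) {b c d e : E} (x : TubeHom irr d e)
    (y : TubeHom irr c d) (z : TubeHom irr b c) :
    T.compₗ b c e (T.compₗ c d e x y) z = T.compₗ b d e x (T.compₗ b c d y z) := by
  induction x using tube_induction with
  | zero => simp
  | add x x' hx hx' => simp only [map_add, LinearMap.add_apply, hx, hx']
  | of a₁ f =>
  induction y using tube_induction with
  | zero => simp
  | add x x' hx hx' => simp only [map_add, LinearMap.add_apply, hx, hx']
  | of a₂ g =>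
  induction z using tube_induction with
  | zero => simp
  | add x x' hx hx' => simp only [map_add, hx, hx']
  | of a₃ k =>
  obtain ⟨J, _, p, s, hs⟩ : Decomposes irr ((irr a₁ ⊗ irr a₂) ⊗ irr a₃) :=
    (h.decomposes a₁ a₂).elim fun J ⟨_, p, s, hs⟩ =>
      (hs.whiskerRight (irr a₃)).decomposes fun j => h.decomposes _ _
  have hs' : IsOrthDecomp fun j => s j ≫ (α_ (irr a₁) (irr a₂) (irr a₃)).hom := by
    refine ⟨fun i => ?_, fun i j hij => ?_, ?_⟩
    · rw [DaggerMonoidal.dag_comp, DaggerMonoidal.dag_associator, Category.assoc,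
        Iso.hom_inv_id_assoc, hs.norm]
    · rw [DaggerMonoidal.dag_comp, DaggerMonoidal.dag_associator, Category.assoc,
        Iso.hom_inv_id_assoc, hs.orth i j hij]
    · have : ∀ j, (s j ≫ (α_ (irr a₁) (irr a₂) (irr a₃)).hom)† ≫ s j ≫
          (α_ (irr a₁) (irr a₂) (irr a₃)).hom = (α_ _ _ _).inv ≫ ((s j)† ≫ s j) ≫ (α_ _ _ _).hom := by
        intro j
        simp [DaggerMonoidal.dag_comp, DaggerMonoidal.dag_associator]
      simp only [this]
      rw [← Preadditive.comp_sum, ← Preadditive.sum_comp, hs.complete]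
      simp
  rw [T.compₗ_tubeOf a₁ a₂, T.compₗ_tubeOf a₂ a₃, ← tubeTrace_id a₃ k, ← tubeTrace_id a₁ f,
    T.compₗ_tubeTrace h (T.isOrthDecomp_onb h a₁ a₂) (isOrthDecomp_id _) hs,
    T.compₗ_tubeTrace h (isOrthDecomp_id _) (T.isOrthDecomp_onb h a₂ a₃) hs',
    annStack_assoc, tubeTrace_comm h hs hs']
  simp

/-- Stacking with the unit annulus conjugates `f` by a unitor, and the trace property removes it. -/
theorem tubeOne_comp (h : IsIrrFamily irr) (hu₀ : IsUnitary u₀) {b c : E} (x : TubeHom irr b c) :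
    T.compₗ b c c (tubeOne u₀ c) x = x := by
  induction x using tube_induction with
  | zero => simp
  | add x x' hx hx' => rw [map_add, hx, hx']
  | of a f =>
    have hs : IsOrthDecomp (J := Unit) (Y := fun _ => irr a) fun _ => (λ_ (irr a)).inv :=
      IsUnitary.isOrthDecomp (by
        rw [← DaggerMonoidal.dag_leftUnitor]; exact (isUnitary_leftUnitor _).dag)
    rw [← tubeTrace_id a f, tubeOne,
      T.compₗ_tubeTrace h hu₀.isOrthDecomp (isOrthDecomp_id _) hs, annStack_unit_left,
      tubeTrace_comm h hs (isOrthDecomp_id (irr a)) (λ_ (irr a)).hom]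
    simp

theorem comp_tubeOne (h : IsIrrFamily irr) (hu₀ : IsUnitary u₀) {b c : E} (x : TubeHom irr b c) :
    T.compₗ b b c x (tubeOne u₀ b) = x := by
  induction x using tube_induction with
  | zero => simp
  | add x x' hx hx' => simp only [map_add, LinearMap.add_apply, hx, hx']
  | of a f =>
    have hs : IsOrthDecomp (J := Unit) (Y := fun _ => irr a) fun _ => (ρ_ (irr a)).inv :=
      IsUnitary.isOrthDecomp (by
        rw [← DaggerMonoidal.dag_rightUnitor]; exact (isUnitary_rightUnitor _).dag)
    rw [← tubeTrace_id a f, tubeOne,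
      T.compₗ_tubeTrace h (isOrthDecomp_id _) hu₀.isOrthDecomp hs, annStack_unit_right,
      tubeTrace_comm h hs (isOrthDecomp_id (irr a)) (ρ_ (irr a)).hom]
    simp

end AnnularChoice

theorem IsUnitary.whiskerLeft {X Y : E} {f : X ⟶ Y} (hf : IsUnitary f) (Z : E) :
    IsUnitary (Z ◁ f) := by
  rw [← id_tensorHom]; exact (IsUnitary.id Z).tensor hf

theorem IsUnitary.whiskerRight {X Y : E} {f : X ⟶ Y} (hf : IsUnitary f) (Z : E) :
    IsUnitary (f ▷ Z) := by
  rw [← tensorHom_id]; exact hf.tensor (IsUnitary.id Z)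

theorem isUnitary_associator_inv (X Y Z : E) : IsUnitary (α_ X Y Z).inv := by
  rw [← DaggerMonoidal.dag_associator]; exact (isUnitary_associator X Y Z).dag

theorem IsUnitary.annStack {a₁ a₂ b c d : E} {f : a₁ ⊗ c ⟶ d ⊗ a₁} {g : a₂ ⊗ b ⟶ c ⊗ a₂}
    (hf : IsUnitary f) (hg : IsUnitary g) : IsUnitary (annStack f g) :=
  (isUnitary_associator _ _ _).comp ((hg.whiskerLeft _).comp ((isUnitary_associator_inv _ _ _).comp
    ((hf.whiskerRight _).comp (isUnitary_associator _ _ _))))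

theorem IsUnitary.compress {X Y b c : E} {f : X ⊗ b ⟶ c ⊗ X} (hf : IsUnitary f) {s : Y ⟶ X}
    (hs : IsUnitary s) : IsUnitary (compress f s) :=
  (hs.whiskerRight _).comp (hf.comp (hs.dag.whiskerLeft _))

namespace AnnularChoice

variable (T : AnnularChoice irr)

/-- If the product of two simple objects is simple, then so is the product of unitaries. -/
theorem exists_comp_eq_tubeOf (h : IsIrrFamily irr) {a a' a'' : ι} {b c d : E}
    (hm : UEquiv (irr a'') (irr a ⊗ irr a')) {f : irr a ⊗ c ⟶ d ⊗ irr a} (hf : IsUnitary f)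
    {g : irr a' ⊗ b ⟶ c ⊗ irr a'} (hg : IsUnitary g) :
    ∃ k : irr a'' ⊗ b ⟶ d ⊗ irr a'', IsUnitary k ∧
      T.compₗ b c d (tubeOf irr c d a f) (tubeOf irr b c a' g) = tubeOf irr b d a'' k := by
  obtain ⟨m, hm⟩ := hm
  refine ⟨compress (annStack f g) m, (hf.annStack hg).compress hm, ?_⟩
  rw [← tubeTrace_id a f, ← tubeTrace_id a' g,
    T.compₗ_tubeTrace h (isOrthDecomp_id _) (isOrthDecomp_id _) hm.isOrthDecomp]
  simp [tubeTrace]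

theorem sharpHom_tubeOf (b c : E) (a : ι) (f : irr a ⊗ b ⟶ c ⊗ irr a) :
    T.sharpHom b c (tubeOf irr b c a f) =
      tubeOf irr c b (T.bar a) (sharpOf (T.R a) (T.Rbar a) f) := by
  simp only [sharpHom, tubeOf, DirectSum.lof_eq_of, DirectSum.toAddMonoid_of]
  rfl

theorem sharpHom_smul (b c : E) (z : ℂ) (x : TubeHom irr b c) :
    T.sharpHom b c (z • x) = conj z • T.sharpHom b c x := by
  induction x using tube_induction with
  | zero => simp
  | add x x' hx hx' => simp only [smul_add, map_add, hx, hx']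
  | of a f =>
    rw [← map_smul, sharpHom_tubeOf, sharpHom_tubeOf, ← map_smul]
    congr 1
    simp [sharpOf, DaggerMonoidal.dag_smul]

/-- Duals are unique up to isomorphism, and different members of the family are not isomorphic. -/
theorem bar_unique (h : IsIrrFamily irr) {a b : ι} {R : 𝟙_ E ⟶ irr b ⊗ irr a}
    {Rbar : 𝟙_ E ⟶ irr a ⊗ irr b} (hR : IsConjugateSolution (irr a) (irr b) R Rbar) :
    T.bar a = b := by
  by_contra hne
  have i := rightDualIso (T.conj_eq a).exactPairing hR.exactPairing
  apply h.ne_zero b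
  rw [← i.inv_hom_id, h.schur_ne hne i.hom, Limits.comp_zero]

theorem bar_bar (h : IsIrrFamily irr) (a : ι) : T.bar (T.bar a) = a :=
  T.bar_unique h (T.conj_eq a).symm

/-- The solution chosen for `bar a` need not be the reversed solution for `a`, but its morphisms are
multiples `z`, `w` of the reversed ones. The duality equations force `w * conj z = 1`, and this is
the factor that enters `f^##`. -/
theorem sharpHom_sharpHom (h : IsIrrFamily irr) {b c : E} (x : TubeHom irr b c) :
    T.sharpHom c b (T.sharpHom b c x) = x := by
  induction x using tube_induction with
  | zero => simp
  | add x x' hx hx' => simp only [map_add, hx, hx']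
  | of a f =>
    rw [sharpHom_tubeOf, sharpHom_tubeOf]
    -- The index is generalized because `bar (bar a)` is equal to `a` only by a theorem, and the
    -- types of the duality morphisms depend on it.
    have key : ∀ (a' : ι) (R' : 𝟙_ E ⟶ irr a' ⊗ irr (T.bar a))
        (Rbar' : 𝟙_ E ⟶ irr (T.bar a) ⊗ irr a'), a' = a →
        IsConjugateSolution (irr (T.bar a)) (irr a') R' Rbar' →
        tubeOf irr b c a' (sharpOf R' Rbar' (sharpOf (T.R a) (T.Rbar a) f)) =
          tubeOf irr b c a f := by
      rintro a' R' Rbar' rfl h'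
      obtain ⟨z, rfl⟩ := eq_smul_of_unit_hom (T.conj_eq a') (fun f => h.schur f) R'
      obtain ⟨w, rfl⟩ := eq_smul_of_unit_hom (T.conj_eq a').symm (fun f => h.schur f) Rbar'
      have hzw : w * conj z = 1 := by
        have e := h'.left
        rw [DaggerMonoidal.dag_smul] at e
        simp only [MonoidalLinear.smul_whiskerRight, MonoidalLinear.whiskerLeft_smul,
          Linear.smul_comp, Linear.comp_smul, smul_smul, (T.conj_eq a').symm.left] at e
        have e' : (conj z * w - 1) • 𝟙 (irr (T.bar a')) = 0 := by
          rw [sub_smul, one_smul, sub_eq_zero]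
          simpa [mul_comm] using e
        have := (smul_eq_zero.1 e').resolve_right (h.ne_zero _)
        rw [mul_comm]
        exact sub_eq_zero.1 this
      congr 1
      have e : ∀ g, sharpOf (b := c) (c := b) (z • T.Rbar a') (w • T.R a') g =
          (w * conj z) • sharpOf (T.Rbar a') (T.R a') g := by
        intro g
        simp [sharpOf, DaggerMonoidal.dag_smul, smul_smul, mul_comm]
      rw [e, hzw, one_smul, sharpOf_sharpOf (T.conj_eq a')]
    exact key _ _ _ (T.bar_bar h a) (T.conj_eq (T.bar a))

end AnnularChoice

/-! ### Inverses -/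

/-- No norm is needed: since `Rbar ≠ 0`, the unit is a summand of `irr a ⊗ irr b` through an
isometry. By Frobenius reciprocity that isometry is `z • Rbar`, so `|z|²` times the loop is the
identity. -/
theorem exists_loop (h : IsIrrFamily irr) {e₀ : ι} {u₀ : irr e₀ ⟶ 𝟙_ E} (hu₀ : IsUnitary u₀)
    {a b : ι} {R : 𝟙_ E ⟶ irr b ⊗ irr a} {Rbar : 𝟙_ E ⟶ irr a ⊗ irr b}
    (hR : IsConjugateSolution (irr a) (irr b) R Rbar) :
    ∃ d : ℂ, d ≠ 0 ∧ Rbar ≫ Rbar† = d • 𝟙 _ := by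
  obtain ⟨J, _, p, s, hs⟩ := h.decomposes a b
  have hne : Rbar ≠ 0 := hR.ne_zero (h.ne_zero a)
  -- Some summand of the decomposition receives a nonzero component of `Rbar`; by Schur's lemma it
  -- is the trivial one.
  obtain ⟨j, hj⟩ : ∃ j, u₀ ≫ Rbar ≫ (s j)† ≠ 0 := by
    by_contra! hall
    apply hne
    have : u₀ ≫ Rbar = 0 := by
      rw [← Category.comp_id Rbar, ← hs.complete, Preadditive.comp_sum, Preadditive.comp_sum]
      refine Finset.sum_eq_zero fun j _ => ?_
      have := congrArg (· ≫ s j) (hall j)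
      simpa using this
    rw [← Category.id_comp Rbar, ← hu₀.2, Category.assoc, this, Limits.comp_zero]
  have hpj : e₀ = p j := by
    by_contra hp
    exact hj (h.schur_ne hp _)
  have key : ∀ (e : ι) (t : irr e ⟶ irr a ⊗ irr b), e₀ = e → t ≫ t† = 𝟙 _ →
      ∃ d : ℂ, d ≠ 0 ∧ Rbar ≫ Rbar† = d • 𝟙 _ := by
    rintro e t rfl ht
    obtain ⟨z, hz⟩ := eq_smul_of_unit_hom hR (fun f => h.schur f) (u₀† ≫ t)
    have h1 : (z * conj z) • (Rbar ≫ Rbar†) = 𝟙 _ := by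
      have : (u₀† ≫ t) ≫ (u₀† ≫ t)† = 𝟙 _ := by
        rw [DaggerMonoidal.dag_comp, DaggerMonoidal.dag_dag, Category.assoc, ← Category.assoc t,
          ht, Category.id_comp, hu₀.2]
      rw [hz, DaggerMonoidal.dag_smul] at this
      simpa [smul_smul, mul_comm] using this
    have h2 : z * conj z ≠ 0 := by
      intro h0
      rw [h0, zero_smul] at h1
      apply h.ne_zero e₀
      rw [← hu₀.1, ← Category.id_comp u₀†, ← h1, Limits.zero_comp, Limits.comp_zero]
    exact ⟨(z * conj z)⁻¹, inv_ne_zero h2, by rw [← h1, smul_smul, inv_mul_cancel₀ h2, one_smul]⟩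
  exact key _ _ hpj (hs.norm j)

/-- By `hv` only the trivial summand of `irr a ⊗ irr b` contributes, and there `Rbar† ≫ Rbar` is
multiplication by the loop value `d`. The trace property for `Rbar` moves the computation to the
tensor unit, where `hF` evaluates it. -/
theorem tubeTrace_eq_tubeOne (h : IsIrrFamily irr) {e₀ : ι} {u₀ : irr e₀ ⟶ 𝟙_ E}
    (hu₀ : IsUnitary u₀) {a b : ι} {c : E} {R : 𝟙_ E ⟶ irr b ⊗ irr a}
    {Rbar : 𝟙_ E ⟶ irr a ⊗ irr b} (hR : IsConjugateSolution (irr a) (irr b) R Rbar)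
    {J : Type*} [Fintype J] {p : J → ι} {s : ∀ j, irr (p j) ⟶ irr a ⊗ irr b}
    (hs : IsOrthDecomp s) (F : (irr a ⊗ irr b) ⊗ c ⟶ c ⊗ (irr a ⊗ irr b))
    (hv : ∀ e, e ≠ e₀ → (∃ t : irr e ⟶ irr a ⊗ irr b, t ≠ 0) →
      ∀ g : irr e ⊗ c ⟶ c ⊗ irr e, g = 0)
    (hF : Rbar ▷ c ≫ F ≫ c ◁ Rbar† = (λ_ c).hom ≫ (ρ_ c).inv ≫ c ◁ (Rbar ≫ Rbar†)) :
    tubeTrace s F = tubeOne u₀ c := by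
  obtain ⟨d, hd, e⟩ := exists_loop h hu₀ hR
  have h1 : tubeTrace s (F ≫ c ◁ Rbar† ≫ c ◁ Rbar) = d • tubeTrace s F := by
    unfold tubeTrace
    rw [Finset.smul_sum]
    refine Finset.sum_congr rfl fun j _ => ?_
    rw [← map_smul]
    congr 1
    by_cases hj : p j = e₀
    -- A trivial summand is embedded by a multiple of `Rbar`, by Frobenius reciprocity.
    · have key : ∀ (x : ι) (t : irr x ⟶ irr a ⊗ irr b), x = e₀ →
          Rbar† ≫ Rbar ≫ t† = d • t† := by
        rintro x t rfl
        obtain ⟨z, hz⟩ := eq_smul_of_unit_hom hR (fun f => h.schur f) (u₀† ≫ t)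
        have ht : t = z • (u₀ ≫ Rbar) := by
          rw [← Linear.comp_smul, ← hz, ← Category.assoc, hu₀.1, Category.id_comp]
        rw [ht, DaggerMonoidal.dag_smul, DaggerMonoidal.dag_comp]
        simp only [Linear.comp_smul]
        rw [reassoc_of% e]
        simp [smul_smul, mul_comm]
      simp only [compress, Category.assoc, ← MonoidalCategory.whiskerLeft_comp,
        key _ (s j) hj, MonoidalLinear.whiskerLeft_smul, Linear.comp_smul]
    · have hne : ∃ t : irr (p j) ⟶ irr a ⊗ irr b, t ≠ 0 := by
        refine ⟨s j, fun h0 => h.ne_zero (p j) ?_⟩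
        rw [← hs.norm j, h0, Limits.zero_comp]
      rw [hv _ hj hne (compress _ _), hv _ hj hne (compress F (s j)), smul_zero]
  have h2 := tubeTrace_comm h hu₀.isOrthDecomp hs Rbar (F ≫ c ◁ Rbar†)
  rw [hF, e, Category.assoc, h1] at h2
  have h3 : (λ_ c).hom ≫ (ρ_ c).inv ≫ c ◁ (d • 𝟙 (𝟙_ E)) = d • ((λ_ c).hom ≫ (ρ_ c).inv) := by
    simp
  rw [h3, tubeTrace_smul] at h2
  exact ((smul_right_injective _ hd) h2).symm

namespace AnnularChoice

variable (T : AnnularChoice irr)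

theorem comp_sharp_self (h : IsIrrFamily irr) {e₀ : ι} {u₀ : irr e₀ ⟶ 𝟙_ E} (hu₀ : IsUnitary u₀)
    {a : ι} {b c : E} {x : irr a ⊗ b ⟶ c ⊗ irr a} (hx : IsUnitary x)
    (hv : ∀ e, e ≠ e₀ → (∃ t : irr e ⟶ irr a ⊗ irr (T.bar a), t ≠ 0) →
      ∀ g : irr e ⊗ c ⟶ c ⊗ irr e, g = 0) :
    T.compₗ c b c (tubeOf irr b c a x) (T.sharpHom b c (tubeOf irr b c a x)) = tubeOne u₀ c := by
  rw [sharpHom_tubeOf, compₗ_tubeOf]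
  refine tubeTrace_eq_tubeOne h hu₀ (T.conj_eq a) (T.isOrthDecomp_onb h _ _) _ hv ?_
  have e := whiskerRight_comp_sharpOf (T.conj_eq a) x
  simp only [annStack, Category.assoc]
  rw [reassoc_of% e, Iso.hom_inv_id_assoc, ← comp_whiskerRight_assoc, hx.2, id_whiskerRight,
    Category.id_comp, Iso.inv_hom_id_assoc, ← MonoidalCategory.whiskerLeft_comp]

theorem sharp_self_comp (h : IsIrrFamily irr) {e₀ : ι} {u₀ : irr e₀ ⟶ 𝟙_ E} (hu₀ : IsUnitary u₀)
    {a : ι} {b c : E} {x : irr a ⊗ b ⟶ c ⊗ irr a} (hx : IsUnitary x)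
    (hv : ∀ e, e ≠ e₀ → (∃ t : irr e ⟶ irr (T.bar a) ⊗ irr a, t ≠ 0) →
      ∀ g : irr e ⊗ b ⟶ b ⊗ irr e, g = 0) :
    T.compₗ b c b (T.sharpHom b c (tubeOf irr b c a x)) (tubeOf irr b c a x) = tubeOne u₀ b := by
  rw [sharpHom_tubeOf, compₗ_tubeOf]
  refine tubeTrace_eq_tubeOne h hu₀ (T.conj_eq a).symm (T.isOrthDecomp_onb h _ _) _ hv ?_
  have e := sharpOf_whiskerRight_comp (T.conj_eq a) x
  obtain ⟨d, -, hd⟩ := exists_loop h hu₀ (T.conj_eq a).symm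
  simp only [annStack, Category.assoc]
  rw [e, Iso.inv_hom_id_assoc, ← MonoidalCategory.whiskerLeft_comp_assoc, hx.1,
    MonoidalCategory.whiskerLeft_id, Category.id_comp, Iso.hom_inv_id_assoc,
    ← comp_whiskerRight_assoc, hd]
  simp

end AnnularChoice

end Tube

/-! ## Types of the letters of words -/

section Lists

variable {A : Type*} {A' : Type*}

theorem Fuses.le_length {l u w : List (A ⊕ A')} (h : Fuses l u w) :
    u.length ≤ l.length + w.length := by
  induction l generalizing w with
  | nil => cases h; simp
  | cons x l ih =>
    obtain ⟨w', h', h⟩ := h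
    have := ih h'
    rcases h with rfl | ⟨y, v, rfl, -, rfl | ⟨z, -, rfl⟩⟩ <;> simp at this ⊢ <;> omega

/-- Each letter shortens the word by at most one. If the total loss is the number of letters, every
letter cancels, and letters cancel only against letters of the same type. -/
theorem Fuses.map_isLeft {l u w : List (A ⊕ A')} (h : Fuses l u w)
    (e : w.length + l.length = u.length) :
    u.map Sum.isLeft = (l.map Sum.isLeft).reverse ++ w.map Sum.isLeft := by
  induction l generalizing w with
  | nil => cases h; simp
  | cons x l ih =>
    obtain ⟨w', h', h⟩ := h
    have hl := h'.le_length
    rcases h with rfl | ⟨y, v, rfl, hy, rfl | ⟨z, -, rfl⟩⟩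
    · simp at e; omega
    · rw [ih h' (by simp at e ⊢; omega)]
      simp [hy]
    · simp at e hl; omega

/-- If `l` and `u` can cancel each other, then the types of `u` are those of `l` in the reverse
order. -/
theorem Fuses.map_isLeft_of_nil {l u : List (A ⊕ A')} (hl : IsAlt l) (h : Fuses l u []) :
    u.map Sum.isLeft = (l.map Sum.isLeft).reverse := by
  rcases h.head hl with ⟨_, _, _, _, _, h', _⟩ | e
  · cases h'
  · simpa using h.map_isLeft e

/-- The type of the first letter. -/
def headType (l : List (A ⊕ A')) : Option Bool := (l.map Sum.isLeft).head?

/-- The type of the last letter. -/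
def lastType (l : List (A ⊕ A')) : Option Bool := (l.map Sum.isLeft).getLast?

theorem headType_cons (x : A ⊕ A') (l : List (A ⊕ A')) : headType (x :: l) = some x.isLeft := rfl

theorem headType_append {u : List (A ⊕ A')} (v : List (A ⊕ A')) (hu : u ≠ []) :
    headType (u ++ v) = headType u := by
  obtain ⟨x, u, rfl⟩ := List.exists_cons_of_ne_nil hu
  rfl

theorem lastType_append (u : List (A ⊕ A')) {v : List (A ⊕ A')} (hv : v ≠ []) :
    lastType (u ++ v) = lastType v := by
  obtain ⟨v, x, rfl⟩ := List.eq_nil_or_concat v |>.resolve_left hv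
  simp [lastType, ← List.append_assoc]

theorem isAlt_append {u v : List (A ⊕ A')} (hu : IsAlt u) (hv : IsAlt v)
    (h : ∀ x ∈ lastType u, ∀ y ∈ headType v, x ≠ y) : IsAlt (u ++ v) := by
  refine List.isChain_append.2 ⟨hu, hv, fun x hx y hy => h _ ?_ _ ?_⟩
  · simp only [lastType, List.getLast?_map]
    exact Option.mem_map_of_mem _ hx
  · simp only [headType, List.head?_map]
    exact Option.mem_map_of_mem _ hy

theorem lastType_eq {x : A ⊕ A'} {l : List (A ⊕ A')} (hl : IsAlt (x :: l)) :
    lastType (x :: l) = some (x.isLeft ^^ decide (Even (l.length + 1))) := by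
  induction l generalizing x with
  | nil => simp [lastType]
  | cons y l ih =>
    have h := ih hl.tail
    have hxy : x.isLeft ≠ y.isLeft := (List.isChain_cons_cons.1 hl).1
    have e : lastType (x :: y :: l) = lastType (y :: l) := by
      simp [lastType]
    rw [e, h]
    simp only [List.length_cons, Nat.even_add_one (n := l.length + 1)]
    revert hxy
    by_cases h' : Even (l.length + 1) <;> cases x.isLeft <;> cases y.isLeft <;> simp [h']

end Lists

/-! ### Weights described by the types of their end letters. -/

section Weights

variable {C : Type u₁} {D : Type u₂} {I : Set C} {I' : Set D}

/-- In an alternating word that begins in `C`, even length means that the last letter is from `D`.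
Conjugation and concatenation act simply on the end types, so this is the form in which `W` is used.
-/
theorem mem_weightW_iff {a : AltWord I I'} :
    a ∈ weightW I I' ↔ headType a.1 = some true ∧ lastType a.1 = some false := by
  change (Even a.1.length ∧ ∃ (x : I) (t : List (I ⊕ I')), a.1 = Sum.inl x :: t) ↔ _
  obtain ⟨_ | ⟨x, l⟩, ha⟩ := a
  · simp [headType]
  · rw [lastType_eq ha]
    rcases x with x | x <;> simp [headType]

theorem ne_nil_of_mem_weightW {a : AltWord I I'} (ha : a ∈ weightW I I') : a.1 ≠ [] := by
  obtain ⟨-, x, t, h⟩ := ha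
  simp [h]

theorem two_le_length_of_mem_weightW {a : AltWord I I'} (ha : a ∈ weightW I I') :
    2 ≤ a.1.length := by
  obtain ⟨⟨k, hk⟩, x, t, h⟩ := ha
  have : 0 < a.1.length := by simp [h]
  omega

theorem length_le_one_of_mem_weightΛ {a : AltWord I I'} (ha : a ∈ weightΛ I I')
    (h : a ∉ weightW I I') : a.1.length ≤ 1 := by
  rcases ha with (h' | h') | h'
  · simp [h']
  · exact h'.le
  · exact absurd h' h

theorem isAlt_append_of_lastType_ne {a b : AltWord I I'} (ha : lastType a.1 ≠ some true)
    (hb : headType b.1 = some true) : IsAlt (a.1 ++ b.1) := by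
  refine isAlt_append a.2 b.2 fun x hx y hy => ?_
  rw [hb] at hy
  cases hy
  rintro rfl
  exact ha hx

theorem isAlt_append_of_headType_ne {a b : AltWord I I'} (ha : lastType a.1 = some false)
    (hb : headType b.1 ≠ some false) : IsAlt (a.1 ++ b.1) := by
  refine isAlt_append a.2 b.2 fun x hx y hy => ?_
  rw [ha] at hx
  cases hx
  rintro rfl
  exact hb hy

theorem lastType_eq_false {a : AltWord I I'} (h : lastType a.1 ≠ some true) (ha : a.1 ≠ []) :
    lastType a.1 = some false := by
  obtain ⟨l, x, h'⟩ := List.eq_nil_or_concat a.1 |>.resolve_left ha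
  rw [h', List.concat_eq_append, lastType_append _ (by simp), lastType] at h ⊢
  rcases x with x | x <;> simp_all

/-- The alternative in `Fuses.head` and `Fuses.last` is total cancellation, which for words of equal
length leaves the empty word. -/
theorem headType_lastType_of_fuses {a b e : AltWord I I'} (h : Fuses a.1 b.1 e.1)
    (he : e ≠ AltWord.nil I I') (hab : a.1.length = b.1.length) :
    headType e.1 = headType a.1 ∧ lastType e.1 = lastType b.1 := by
  have hne : e.1.length ≠ 0 := fun h' => he (Subtype.ext (List.length_eq_zero_iff.1 h'))
  constructor
  · rcases h.head a.2 with ⟨x, l', z, v, h₁, h₂, h₃⟩ | h'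
    · rw [h₁, h₂, headType_cons, headType_cons, h₃]
    · omega
  · rcases h.last a.2 with ⟨-, h'⟩ | h'
    · simpa only [lastType, List.getLast?_map] using h'
    · omega

end Weights

/-! ## Morphisms of annuli between words -/

section Vanishing

variable {C : Type u₁} [Category.{v₁} C] [Preadditive C] [Linear ℂ C]
  [MonoidalCategory C] [MonoidalPreadditive C] [MonoidalLinear ℂ C] [DaggerMonoidal C]
  {D : Type u₂} [Category.{v₂} D] [Preadditive D] [Linear ℂ D]
  [MonoidalCategory D] [MonoidalPreadditive D] [MonoidalLinear ℂ D] [DaggerMonoidal D]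

/-- The standing assumptions: `I` and `I'` represent the nontrivial simple objects of two rigid
C*-tensor categories. -/
structure IsFreeData (I : Set C) (I' : Set D) : Prop where
  hC : IsRigidCStarTensor C
  hD : IsRigidCStarTensor D
  hI : IsNonunitIrr I
  hI' : IsNonunitIrr I'

variable {I : Set C} {I' : Set D}

theorem IsFreeData.isIrrFamily (F : IsFreeData I I') : IsIrrFamily (irrObj I I') :=
  isIrrFamily_irrObj F.hC F.hD F.hI F.hI'

theorem IsFreeData.fuses (F : IsFreeData I I') {u v w : AltWord I I'}
    {f : irrObj I I' w ⟶ irrObj I I' u ⊗ irrObj I I' v} (hf : f ≠ 0) : Fuses u.1 v.1 w.1 :=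
  fuses_of_hom_ne_zero F.hC F.hD F.hI F.hI' hf

theorem comp_ne_zero {E : Type u} [Category.{v} E] [Preadditive E] [Linear ℂ E]
    [MonoidalCategory E] [DaggerMonoidal E] {X Y Z : E} {s : X ⟶ Y} (hs : IsUnitary s)
    {f : Y ⟶ Z} (hf : f ≠ 0) : s ≫ f ≠ 0 := by
  intro h
  apply hf
  rw [← Category.id_comp f, ← hs.2, Category.assoc, h, Limits.comp_zero]

theorem comp_ne_zero' {E : Type u} [Category.{v} E] [Preadditive E] [Linear ℂ E]
    [MonoidalCategory E] [DaggerMonoidal E] {X Y Z : E} {s : Y ⟶ Z} (hs : IsUnitary s)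
    {f : X ⟶ Y} (hf : f ≠ 0) : f ≫ s ≠ 0 := by
  intro h
  apply hf
  rw [← Category.comp_id f, ← hs.1, ← Category.assoc, h, Limits.zero_comp]

theorem sharpOf_zero {E : Type u} [Category.{v} E] [Preadditive E] [Linear ℂ E]
    [MonoidalCategory E] [MonoidalPreadditive E] [MonoidalLinear ℂ E] [DaggerMonoidal E]
    {X Xbar b c : E} (R : 𝟙_ E ⟶ Xbar ⊗ X) (Rbar : 𝟙_ E ⟶ X ⊗ Xbar) :
    sharpOf R Rbar (0 : X ⊗ b ⟶ c ⊗ X) = 0 := by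
  simp [sharpOf, dag_zero]

theorem dag_ne_zero {E : Type u} [Category.{v} E] [Preadditive E] [Linear ℂ E]
    [MonoidalCategory E] [DaggerMonoidal E] {X Y : E} {f : X ⟶ Y} (hf : f ≠ 0) : f† ≠ 0 := by
  intro h
  apply hf
  rw [← DaggerMonoidal.dag_dag f, h, dag_zero]

theorem IsFreeData.fuses_append (F : IsFreeData I I') {a b c d : AltWord I I'}
    (hab : IsAlt (a.1 ++ b.1))
    {f : irrObj I I' a ⊗ irrObj I I' b ⟶ irrObj I I' c ⊗ irrObj I I' d} (hf : f ≠ 0) :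
    Fuses c.1 d.1 (a.1 ++ b.1) := by
  obtain ⟨s, hs⟩ := (uEquiv_irrObj_append (w := ⟨a.1 ++ b.1, hab⟩) (u := a) (v := b) rfl).symm
  exact F.fuses (w := ⟨a.1 ++ b.1, hab⟩) (comp_ne_zero hs hf)

/-- The case in which the annulus does not cancel the inner weight. -/
theorem IsFreeData.append_eq (F : IsFreeData I I') {a b c : AltWord I I'}
    (hab : IsAlt (a.1 ++ b.1)) (hb : 2 ≤ b.1.length) (hc : c ∈ weightΛ I I')
    {f : irrObj I I' a ⊗ irrObj I I' b ⟶ irrObj I I' c ⊗ irrObj I I' a} (hf : f ≠ 0) :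
    c ∈ weightW I I' ∧ (a.1 = [] ∨ headType a.1 = some true) := by
  -- The simple object `ab` is a summand of `c ⊗ a`. Hence `b` is not longer than `c`, and unless
  -- everything cancels, `ab` begins with the type of the first letter of `c`.
  have h := F.fuses_append hab hf
  have hle := h.length_le
  have hc' : c ∈ weightW I I' := by
    by_contra hc'
    have := length_le_one_of_mem_weightΛ hc hc'
    simp at hle
    omega
  refine ⟨hc', ?_⟩
  rcases h.head c.2 with ⟨x, l', z, v, h₁, h₂, h₃⟩ | h'
  · by_cases ha : a.1 = []
    · exact .inl ha
    · right
      rw [← headType_append b.1 ha, h₂, headType_cons, h₃, ← headType_cons x l', ← h₁]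
      exact (mem_weightW_iff.1 hc').1
  · simp at h'
    have := two_le_length_of_mem_weightW hc'
    omega

/-- `Rbar` exhibits the empty word as a summand of `a ⊗ ā`, so the two words cancel completely. -/
theorem IsFreeData.bar (F : IsFreeData I I') (T : AnnularChoice (irrObj I I')) (a : AltWord I I') :
    (T.bar a).1.map Sum.isLeft = (a.1.map Sum.isLeft).reverse := by
  refine Fuses.map_isLeft_of_nil a.2 (F.fuses (w := AltWord.nil I I') (f := T.Rbar a) ?_)
  exact (T.conj_eq a).ne_zero (id_irrObj_ne_zero F.hC F.hD F.hI F.hI' a)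

theorem IsFreeData.length_bar (F : IsFreeData I I') (T : AnnularChoice (irrObj I I'))
    (a : AltWord I I') : (T.bar a).1.length = a.1.length := by
  simpa using congrArg List.length (F.bar T a)

theorem IsFreeData.headType_bar (F : IsFreeData I I') (T : AnnularChoice (irrObj I I'))
    (a : AltWord I I') : headType (T.bar a).1 = lastType a.1 := by
  simp only [headType, lastType, F.bar T a, List.head?_reverse]

theorem IsFreeData.lastType_bar (F : IsFreeData I I') (T : AnnularChoice (irrObj I I'))
    (a : AltWord I I') : lastType (T.bar a).1 = headType a.1 := by
  simp only [headType, lastType, F.bar T a, List.getLast?_reverse]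

theorem sharp_ne_zero (T : AnnularChoice (irrObj I I')) {a b c : AltWord I I'}
    {f : irrObj I I' a ⊗ irrObj I I' b ⟶ irrObj I I' c ⊗ irrObj I I' a} (hf : f ≠ 0) :
    T.sharp a _ _ f ≠ 0 := by
  intro h
  apply hf
  have h₁ := sharpOf_sharpOf (T.conj_eq a) f
  have h₂ : sharpOf (T.R a) (T.Rbar a) f = 0 := h
  rw [h₂] at h₁
  rw [← h₁]
  exact sharpOf_zero _ _

/-- If `a` also began in `C`, the word `ca` would be alternating and, by `f†`, a summand of `a ⊗ b`.
It would then end like `b`, in `D`, although it ends like `a`, in `C`; total cancellation is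
excluded by the length of `c`. -/
theorem IsFreeData.headType_ne (F : IsFreeData I I') {a b c : AltWord I I'}
    (hb : b ∈ weightW I I') (hc : c ∈ weightW I I') (ha : lastType a.1 = some true)
    {f : irrObj I I' a ⊗ irrObj I I' b ⟶ irrObj I I' c ⊗ irrObj I I' a} (hf : f ≠ 0) :
    headType a.1 ≠ some true := by
  intro h
  have hab := F.fuses_append
    (isAlt_append_of_headType_ne (mem_weightW_iff.1 hc).2 (by simp [h])) (dag_ne_zero hf)
  have hne : a.1 ≠ [] := by
    intro h'
    simp [h', lastType] at ha
  rcases hab.last a.2 with ⟨-, h'⟩ | h'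
  · have h₁ : lastType (c.1 ++ a.1) = lastType b.1 := by
      simpa only [lastType, List.getLast?_map] using h'
    rw [lastType_append _ hne, ha, (mem_weightW_iff.1 hb).2] at h₁
    cases h₁
  · have := two_le_length_of_mem_weightW hc
    simp at h'
    omega

/-- As `b` begins in `C`, the word `ab` is alternating. By `append_eq`, `a` is empty or begins in
`C`, so `ca` is alternating too, and a nonzero morphism between the two simple objects makes them
equal. -/
theorem IsFreeData.append_eq_append (F : IsFreeData I I') {a b c : AltWord I I'}
    (hb : b ∈ weightW I I') (hc : c ∈ weightW I I') (ha : lastType a.1 ≠ some true)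
    {f : irrObj I I' a ⊗ irrObj I I' b ⟶ irrObj I I' c ⊗ irrObj I I' a} (hf : f ≠ 0) :
    (a.1 = [] ∨ a ∈ weightW I I') ∧ a.1 ++ b.1 = c.1 ++ a.1 := by
  have hab := isAlt_append_of_lastType_ne ha (mem_weightW_iff.1 hb).1
  have ha' := (F.append_eq hab (two_le_length_of_mem_weightW hb) (weightW_subset hc) hf).2
  have hca : IsAlt (c.1 ++ a.1) := by
    refine isAlt_append_of_headType_ne (mem_weightW_iff.1 hc).2 ?_
    rcases ha' with h | h
    · simp [h, headType]
    · rw [h]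
      simp
  refine ⟨ha'.imp_right fun h => mem_weightW_iff.2 ⟨h, lastType_eq_false ha fun h' => ?_⟩, ?_⟩
  · simp [h', headType] at h
  · by_contra hne
    obtain ⟨s, hs⟩ := (uEquiv_irrObj_append (w := ⟨a.1 ++ b.1, hab⟩) (u := a) (v := b) rfl).symm
    obtain ⟨t, ht⟩ := uEquiv_irrObj_append (w := ⟨c.1 ++ a.1, hca⟩) (u := c) (v := a) rfl
    exact comp_ne_zero hs (comp_ne_zero' ht hf)
      (F.isIrrFamily.schur_ne (fun h => hne (congrArg Subtype.val h)) _)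

theorem IsFreeData.hom_eq_zero (F : IsFreeData I I') (T : AnnularChoice (irrObj I I'))
    {a b c : AltWord I I'} (hb : b ∈ weightW I I') (hc : c ∈ weightΛ I I')
    (hc' : c ∉ weightW I I')
    (f : irrObj I I' a ⊗ irrObj I I' b ⟶ irrObj I I' c ⊗ irrObj I I' a) : f = 0 := by
  by_contra hf
  have hb' := two_le_length_of_mem_weightW hb
  by_cases ha : lastType a.1 = some true
  -- The morphism `(f^#)†` goes from `b ⊗ ā` to `ā ⊗ c`, and `ā` begins in `C`. So the word `bā` is
  -- simple, and its length bounds that of `b` by that of `c`, which is at most one.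
  · have h := F.fuses_append (a := b) (b := T.bar a) (isAlt_append_of_headType_ne
      (mem_weightW_iff.1 hb).2 (by simp [F.headType_bar T, ha])) (dag_ne_zero (sharp_ne_zero T hf))
    have hle := h.length_le
    have := length_le_one_of_mem_weightΛ hc hc'
    simp only [List.length_append] at hle
    omega
  · exact hc' (F.append_eq (isAlt_append_of_lastType_ne ha (mem_weightW_iff.1 hb).1) hb' hc hf).1

/-- The map `#` is injective and exchanges the weights. -/
theorem IsFreeData.hom_eq_zero' (F : IsFreeData I I') (T : AnnularChoice (irrObj I I'))
    {a b c : AltWord I I'} (hb : b ∈ weightΛ I I') (hb' : b ∉ weightW I I')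
    (hc : c ∈ weightW I I')
    (f : irrObj I I' a ⊗ irrObj I I' b ⟶ irrObj I I' c ⊗ irrObj I I' a) : f = 0 := by
  by_contra hf
  exact sharp_ne_zero T hf (F.hom_eq_zero T hc hb hb' _)

/-- A nontrivial summand of `a ⊗ ā` begins like `a` and ends like `ā`, both times in `C`, which
`headType_ne` forbids for a nonzero annulus. -/
theorem IsFreeData.loop_eq_zero (F : IsFreeData I I') (T : AnnularChoice (irrObj I I'))
    {a c : AltWord I I'} (ha : a ∈ weightW I I') (hc : c ∈ weightW I I')
    (e : AltWord I I') (he : e ≠ AltWord.nil I I')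
    (ht : ∃ t : irrObj I I' e ⟶ irrObj I I' a ⊗ irrObj I I' (T.bar a), t ≠ 0)
    (g : irrObj I I' e ⊗ irrObj I I' c ⟶ irrObj I I' c ⊗ irrObj I I' e) : g = 0 := by
  obtain ⟨t, ht⟩ := ht
  obtain ⟨h₁, h₂⟩ := headType_lastType_of_fuses (F.fuses ht) he (F.length_bar T a).symm
  rw [F.lastType_bar T, (mem_weightW_iff.1 ha).1] at h₂
  rw [(mem_weightW_iff.1 ha).1] at h₁
  by_contra hg
  exact F.headType_ne hc hc h₂ hg h₁

/-- A nontrivial summand of `ā ⊗ a` begins and ends in `D`. By `append_eq_append` it would have to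
be in `W`, whose words begin in `C`. -/
theorem IsFreeData.loop_eq_zero' (F : IsFreeData I I') (T : AnnularChoice (irrObj I I'))
    {a c : AltWord I I'} (ha : a ∈ weightW I I') (hc : c ∈ weightW I I')
    (e : AltWord I I') (he : e ≠ AltWord.nil I I')
    (ht : ∃ t : irrObj I I' e ⟶ irrObj I I' (T.bar a) ⊗ irrObj I I' a, t ≠ 0)
    (g : irrObj I I' e ⊗ irrObj I I' c ⟶ irrObj I I' c ⊗ irrObj I I' e) : g = 0 := by
  obtain ⟨t, ht⟩ := ht
  obtain ⟨h₁, h₂⟩ := headType_lastType_of_fuses (F.fuses ht) he (F.length_bar T a)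
  rw [F.headType_bar T, (mem_weightW_iff.1 ha).2] at h₁
  rw [(mem_weightW_iff.1 ha).2] at h₂
  by_contra hg
  have h := (F.append_eq_append hc hc (by simp [h₂]) hg).1
  rcases h with h | h
  · exact he (Subtype.ext h)
  · rw [(mem_weightW_iff.1 h).1] at h₁
    cases h₁

end Vanishing

/-! ## Calculus in annular algebras -/

namespace Annular

variable {E : Type u} [Category.{v} E] [Preadditive E] [Linear ℂ E] [MonoidalCategory E]
  [MonoidalPreadditive E] [MonoidalLinear ℂ E] [DaggerMonoidal E] {ι : Type w} {irr : ι → E}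
  {κ : Type w'} {T : AnnularChoice irr} {wt : κ → E}

open scoped Classical in
theorem block_induction {P : Annular T wt → Prop} (x : Annular T wt) (zero : P 0)
    (of : ∀ b c f, P (block T wt b c f)) (add : ∀ x y, P x → P y → P (x + y)) : P x :=
  DirectSum.induction_on x zero (fun p f => of p.1 p.2 f) add

theorem add_mul' (x y z : Annular T wt) : (x + y) * z = x * z + y * z :=
  (mulₗ T wt).map_add₂ x y z

theorem mul_add' (x y z : Annular T wt) : x * (y + z) = x * y + x * z :=
  (mulₗ T wt x).map_add y z

theorem zero_mul' (z : Annular T wt) : 0 * z = 0 := (mulₗ T wt).map_zero₂ z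

theorem mul_zero' (x : Annular T wt) : x * 0 = 0 := (mulₗ T wt x).map_zero

theorem star_zero' : star (0 : Annular T wt) = 0 := (starHom T wt).map_zero

theorem star_add' (x y : Annular T wt) : star (x + y) = star x + star y :=
  (starHom T wt).map_add x y

theorem toModule_flip_lof {N : Type*} {J : Type*} [DecidableEq J] {M : J → Type*}
    [AddCommGroup N] [Module ℂ N] [∀ j, AddCommGroup (M j)] [∀ j, Module ℂ (M j)]
    (B : ∀ i j, M i →ₗ[ℂ] M j →ₗ[ℂ] N) (i j : J) (x : M i) (y : M j) :
    DirectSum.toModule ℂ J (DirectSum J M →ₗ[ℂ] N)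
      (fun i => (DirectSum.toModule ℂ J (M i →ₗ[ℂ] N) fun j => (B i j).flip).flip)
      (DirectSum.lof ℂ J M i x) (DirectSum.lof ℂ J M j y) = B i j x y := by
  simp

theorem block_mul (b c c' d : κ) (x : TubeHom irr (wt c') (wt d)) (y : TubeHom irr (wt b) (wt c)) :
    block T wt c' d x * block T wt b c y = blockMulₗ T wt b c c' d x y := by
  classical
  exact toModule_flip_lof (J := κ × κ) (M := fun p => TubeHom irr (wt p.1) (wt p.2))
    (fun p q => blockMulₗ T wt q.1 q.2 p.1 p.2) (c', d) (b, c) x y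

open scoped Classical in
theorem block_mul_block (b c d : κ) (x : TubeHom irr (wt c) (wt d))
    (y : TubeHom irr (wt b) (wt c)) :
    block T wt c d x * block T wt b c y = block T wt b d (T.compₗ (wt b) (wt c) (wt d) x y) := by
  rw [block_mul, blockMulₗ, dif_pos rfl]
  rfl

theorem block_mul_block_of_ne {b c c' d : κ} (h : c ≠ c') (x : TubeHom irr (wt c') (wt d))
    (y : TubeHom irr (wt b) (wt c)) : block T wt c' d x * block T wt b c y = 0 := by
  rw [block_mul, blockMulₗ, dif_neg h]
  rfl

open scoped Classical in
theorem star_block (b c : κ) (x : TubeHom irr (wt b) (wt c)) :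
    star (block T wt b c x) = block T wt c b (T.sharpHom (wt b) (wt c) x) :=
  DirectSum.toAddMonoid_of (β := fun p : κ × κ => TubeHom irr (wt p.1) (wt p.2))
    (fun p => (block T wt p.2 p.1).toAddMonoidHom.comp (T.sharpHom (wt p.1) (wt p.2))) (b, c) x

theorem star_smul' (z : ℂ) (x : Annular T wt) : star (z • x) = conj z • star x := by
  classical
  induction x using block_induction with
  | zero => simp [star_zero']
  | add x y hx hy => simp only [smul_add, star_add', hx, hy]
  | of b c f => rw [← map_smul, star_block, star_block, T.sharpHom_smul, map_smul]

theorem mul_assoc' (h : IsIrrFamily irr) (x y z : Annular T wt) : x * y * z = x * (y * z) := by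
  classical
  induction x using block_induction with
  | zero => simp only [zero_mul']
  | add x x' hx hx' => simp only [add_mul', hx, hx']
  | of c d f =>
  induction y using block_induction with
  | zero => simp only [zero_mul', mul_zero']
  | add x x' hx hx' => simp only [add_mul', mul_add', hx, hx']
  | of b c' g =>
  induction z using block_induction with
  | zero => simp only [mul_zero']
  | add x x' hx hx' => simp only [mul_add', hx, hx']
  | of a b' k =>
    by_cases h₁ : c' = c
    · subst h₁
      by_cases h₂ : b' = b
      · subst h₂
        rw [block_mul_block, block_mul_block, block_mul_block, block_mul_block, T.compₗ_assoc h]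
      · rw [block_mul_block, block_mul_block_of_ne h₂, block_mul_block_of_ne h₂, mul_zero']
    · rw [block_mul_block_of_ne h₁, zero_mul']
      by_cases h₂ : b' = b
      · subst h₂
        rw [block_mul_block, block_mul_block_of_ne h₁]
      · rw [block_mul_block_of_ne h₂, mul_zero']

/-! ### Inclusions of weight sets -/

variable {κ' : Type w'} {φ : κ' → κ}

/-- The component with weights `p.1` and `p.2`. -/
def comp (T : AnnularChoice irr) (wt : κ → E) (p : κ × κ) :
    Annular T wt →ₗ[ℂ] TubeHom irr (wt p.1) (wt p.2) :=
  DirectSum.component ℂ (κ × κ) _ p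

theorem comp_block (b c : κ) (x : TubeHom irr (wt b) (wt c)) :
    comp T wt (b, c) (block T wt b c x) = x := by
  classical
  exact DirectSum.component.lof_self _ _ _

theorem comp_block_of_ne {b c : κ} {p : κ × κ} (h : (b, c) ≠ p)
    (x : TubeHom irr (wt b) (wt c)) : comp T wt p (block T wt b c x) = 0 := by
  classical
  exact (DirectSum.component.of ℂ (M := fun p : κ × κ => TubeHom irr (wt p.1) (wt p.2))
    p (b, c) x).trans (dif_neg h)

theorem eq_zero_of_comp {x : Annular T wt} (h : ∀ p, comp T wt p x = 0) : x = 0 :=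
  DirectSum.ext_component ℂ fun p => (h p).trans (map_zero _).symm

theorem incl_block (b c : κ') (x : TubeHom irr (wt (φ b)) (wt (φ c))) :
    incl T wt φ (block T (fun k => wt (φ k)) b c x) = block T wt (φ b) (φ c) x := by
  classical
  exact DirectSum.toModule_lof _ _ _

theorem incl_mul (hφ : Function.Injective φ) (x y : Annular T fun k => wt (φ k)) :
    incl T wt φ (x * y) = incl T wt φ x * incl T wt φ y := by
  induction x using block_induction with
  | zero => simp only [zero_mul', map_zero]
  | add x x' hx hx' => simp only [add_mul', map_add, hx, hx']
  | of c d f =>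
  induction y using block_induction with
  | zero => simp only [mul_zero', map_zero]
  | add x x' hx hx' => simp only [mul_add', map_add, hx, hx']
  | of b c' g =>
    by_cases h : c' = c
    · subst h
      rw [block_mul_block, incl_block, incl_block, incl_block, block_mul_block]
    · rw [block_mul_block_of_ne h, incl_block, incl_block,
        block_mul_block_of_ne fun h' => h (hφ h'), map_zero]

theorem incl_star (x : Annular T fun k => wt (φ k)) :
    incl T wt φ (star x) = star (incl T wt φ x) := by
  induction x using block_induction with
  | zero => simp only [star_zero', map_zero]
  | add x x' hx hx' => simp only [star_add', map_add, hx, hx']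
  | of b c f => rw [star_block, incl_block, incl_block, star_block]

theorem comp_incl (hφ : Function.Injective φ) (b c : κ') (x : Annular T fun k => wt (φ k)) :
    comp T wt (φ b, φ c) (incl T wt φ x) = comp T (fun k => wt (φ k)) (b, c) x := by
  induction x using block_induction with
  | zero => simp only [map_zero]
  | add x y hx hy => simp only [map_add, hx, hy]
  | of b' c' f =>
    rw [incl_block]
    by_cases h : (b', c') = (b, c)
    · cases h
      rw [comp_block, comp_block]
    · rw [comp_block_of_ne h, comp_block_of_ne fun h' => h ?_]
      rw [Prod.mk.injEq] at h' ⊢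
      exact ⟨hφ h'.1, hφ h'.2⟩

theorem comp_incl_of_notMem {p : κ × κ} (hp : p.1 ∉ Set.range φ)
    (x : Annular T fun k => wt (φ k)) : comp T wt p (incl T wt φ x) = 0 := by
  induction x using block_induction with
  | zero => simp only [map_zero]
  | add x y hx hy => simp only [map_add, hx, hy, add_zero]
  | of b c f =>
    rw [incl_block, comp_block_of_ne]
    rintro rfl
    exact hp ⟨b, rfl⟩

/-- The span of the spaces `A_{b,c}` with `b` and `c` outside of the range of `φ`. -/
def complement (T : AnnularChoice irr) (wt : κ → E) (φ : κ' → κ) :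
    Submodule ℂ (Annular T wt) :=
  Submodule.span ℂ {x | ∃ b c f, b ∉ Set.range φ ∧ c ∉ Set.range φ ∧ x = block T wt b c f}

theorem block_mem_complement {b c : κ} (hb : b ∉ Set.range φ) (hc : c ∉ Set.range φ)
    (f : TubeHom irr (wt b) (wt c)) : block T wt b c f ∈ complement T wt φ :=
  Submodule.subset_span ⟨b, c, f, hb, hc, rfl⟩

theorem complement_induction {P : Annular T wt → Prop} {x : Annular T wt}
    (hx : x ∈ complement T wt φ) (zero : P 0)
    (of : ∀ b c f, b ∉ Set.range φ → c ∉ Set.range φ → P (block T wt b c f))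
    (add : ∀ x y, P x → P y → P (x + y)) : P x := by
  refine Submodule.closure_induction (p := fun x _ => P x) zero (fun x y _ _ => add x y) ?_ hx
  rintro r _ ⟨b, c, f, hb, hc, rfl⟩
  rw [← map_smul]
  exact of b c _ hb hc

theorem comp_eq_zero_of_mem_complement {x : Annular T wt} (hx : x ∈ complement T wt φ)
    {p : κ × κ} (hp : p.1 ∈ Set.range φ) : comp T wt p x = 0 := by
  refine complement_induction (P := fun x => comp T wt p x = 0) hx (map_zero _)
    (fun b c f hb hc => comp_block_of_ne ?_ f)
    fun x y hx hy => by rw [map_add, hx, hy, add_zero]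
  rintro rfl
  exact hb hp

/-- If there are no nonzero annular morphisms between the weights in the range of `φ` and the other
weights, then the inclusion is that of a direct summand. -/
theorem isDirectSummand_incl (hφ : Function.Injective φ)
    (h₁ : ∀ b ∈ Set.range φ, ∀ c ∉ Set.range φ, ∀ f : TubeHom irr (wt b) (wt c), f = 0)
    (h₂ : ∀ b ∉ Set.range φ, ∀ c ∈ Set.range φ, ∀ f : TubeHom irr (wt b) (wt c), f = 0) :
    IsDirectSummand (incl T wt φ) where
  injective := by
    refine (injective_iff_map_eq_zero _).2 fun x hx => eq_zero_of_comp fun p => ?_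
    rw [← comp_incl hφ, hx, map_zero]
  map_mul := incl_mul hφ
  map_star := incl_star
  mul_mem_range x y := by
    induction x using block_induction with
    | zero => simp only [map_zero, zero_mul', mul_zero', Submodule.zero_mem, and_self]
    | add x x' hx hx' =>
      simp only [map_add, add_mul', mul_add']
      exact ⟨Submodule.add_mem _ hx.1 hx'.1, Submodule.add_mem _ hx.2 hx'.2⟩
    | of c d f =>
    induction y using block_induction with
    | zero => simp only [zero_mul', mul_zero', Submodule.zero_mem, and_self]
    | add x x' hx hx' =>
      simp only [add_mul', mul_add']
      exact ⟨Submodule.add_mem _ hx.1 hx'.1, Submodule.add_mem _ hx.2 hx'.2⟩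
    | of b b' g =>
      rw [incl_block]
      constructor
      · by_cases e : b' = φ c
        · subst e
          by_cases hb : b ∈ Set.range φ
          · obtain ⟨b, rfl⟩ := hb
            rw [block_mul_block, ← incl_block]
            exact ⟨_, rfl⟩
          · rw [h₂ b hb _ ⟨c, rfl⟩ g, map_zero, mul_zero']
            exact Submodule.zero_mem _
        · rw [block_mul_block_of_ne e]
          exact Submodule.zero_mem _
      · by_cases e : φ d = b
        · subst e
          by_cases hb : b' ∈ Set.range φ
          · obtain ⟨b', rfl⟩ := hb
            rw [block_mul_block, ← incl_block]
            exact ⟨_, rfl⟩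
          · rw [h₁ _ ⟨d, rfl⟩ _ hb g, map_zero, zero_mul']
            exact Submodule.zero_mem _
        · rw [block_mul_block_of_ne e]
          exact Submodule.zero_mem _
  exists_compl := by
    refine ⟨complement T wt φ, ⟨?_, ?_⟩, fun x hx y => ?_, fun x hx => ?_⟩
    · rw [Submodule.disjoint_def]
      rintro _ ⟨x, rfl⟩ hx
      refine eq_zero_of_comp fun p => ?_
      by_cases hp : p.1 ∈ Set.range φ
      · exact comp_eq_zero_of_mem_complement hx hp
      · exact comp_incl_of_notMem hp x
    · rw [codisjoint_iff, eq_top_iff]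
      rintro x -
      induction x using block_induction with
      | zero => exact Submodule.zero_mem _
      | add x y hx hy => exact Submodule.add_mem _ hx hy
      | of b c f =>
        by_cases hb : b ∈ Set.range φ
        · by_cases hc : c ∈ Set.range φ
          · obtain ⟨b, rfl⟩ := hb
            obtain ⟨c, rfl⟩ := hc
            exact Submodule.mem_sup_left ⟨_, incl_block b c f⟩
          · rw [h₁ b hb c hc f, map_zero]
            exact Submodule.zero_mem _
        · by_cases hc : c ∈ Set.range φ
          · rw [h₂ b hb c hc f, map_zero]
            exact Submodule.zero_mem _
          · exact Submodule.mem_sup_right (block_mem_complement hb hc f)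
    · refine complement_induction (P := fun x => x * y ∈ _ ∧ y * x ∈ _) hx ?_ ?_ ?_
      · simp only [zero_mul', mul_zero', Submodule.zero_mem, and_self]
      · intro c d f hc hd
        induction y using block_induction with
        | zero => simp only [zero_mul', mul_zero', Submodule.zero_mem, and_self]
        | add x x' hx hx' =>
          simp only [add_mul', mul_add']
          exact ⟨Submodule.add_mem _ hx.1 hx'.1, Submodule.add_mem _ hx.2 hx'.2⟩
        | of b b' g =>
          constructor
          · by_cases e : b' = c
            · subst e
              by_cases hb : b ∈ Set.range φ
              · rw [h₁ b hb _ hc g, map_zero, mul_zero']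
                exact Submodule.zero_mem _
              · rw [block_mul_block]
                exact block_mem_complement hb hd _
            · rw [block_mul_block_of_ne e]
              exact Submodule.zero_mem _
          · by_cases e : d = b
            · subst e
              by_cases hb : b' ∈ Set.range φ
              · rw [h₂ d hd _ hb g, map_zero, zero_mul']
                exact Submodule.zero_mem _
              · rw [block_mul_block]
                exact block_mem_complement hc hb _
            · rw [block_mul_block_of_ne e]
              exact Submodule.zero_mem _
      · intro x x' hx hx'
        simp only [add_mul', mul_add']
        exact ⟨Submodule.add_mem _ hx.1 hx'.1, Submodule.add_mem _ hx.2 hx'.2⟩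
    · refine complement_induction (P := fun x => star x ∈ _) hx ?_ ?_ ?_
      · rw [star_zero']
        exact Submodule.zero_mem _
      · intro b c f hb hc
        rw [star_block]
        exact block_mem_complement hc hb _
      · intro x y hx hy
        rw [star_add']
        exact Submodule.add_mem _ hx hy

end Annular

/-! ### The direct summand given by `W`. -/

section

variable {C : Type u₁} [Category.{v₁} C] [Preadditive C] [Linear ℂ C]
  [MonoidalCategory C] [MonoidalPreadditive C] [MonoidalLinear ℂ C] [DaggerMonoidal C]
  {D : Type u₂} [Category.{v₂} D] [Preadditive D] [Linear ℂ D]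
  [MonoidalCategory D] [MonoidalPreadditive D] [MonoidalLinear ℂ D] [DaggerMonoidal D]
  {I : Set C} {I' : Set D}

theorem tubeHom_eq_zero {E : Type u} [Category.{v} E] [Preadditive E] [Linear ℂ E]
    [MonoidalCategory E] [MonoidalPreadditive E] [MonoidalLinear ℂ E] [DaggerMonoidal E]
    {ι : Type w} {irr : ι → E} {b c : E} (h : ∀ a (f : irr a ⊗ b ⟶ c ⊗ irr a), f = 0)
    (x : TubeHom irr b c) : x = 0 := by
  classical
  induction x using tube_induction with
  | zero => rfl
  | add x y hx hy => rw [hx, hy, add_zero]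
  | of a f => rw [h a f, map_zero]

theorem IsFreeData.isDirectSummand (F : IsFreeData I I') (T : AnnularChoice (irrObj I I')) :
    IsDirectSummand (inclW T) := by
  have key : ∀ b : weightΛ I I', b ∈ Set.range (Set.inclusion (weightW_subset (I := I) (I' := I')))
      ↔ b.1 ∈ weightW I I' := by
    rintro ⟨b, hb⟩
    rw [Set.range_inclusion]
    rfl
  refine Annular.isDirectSummand_incl (Set.inclusion_injective weightW_subset) ?_ ?_
  · intro b hb c hc
    exact tubeHom_eq_zero fun a =>
      F.hom_eq_zero T ((key b).1 hb) c.2 fun h => hc ((key c).2 h)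
  · intro b hb c hc
    exact tubeHom_eq_zero fun a =>
      F.hom_eq_zero' T b.2 (fun h => hb ((key b).2 h)) ((key c).1 hc)

end

/-! ## Matrix units -/

namespace MatZSum

variable {J : Type w} (n : J → ℕ)

/-- The multiplication as a bilinear map. -/
def mulₗ : MatZSum n →ₗ[ℂ] MatZSum n →ₗ[ℂ] MatZSum n :=
  LinearMap.mk₂ ℂ (fun x y => x * y)
    (fun _ _ _ => DFinsupp.ext fun _ => add_mul _ _ _)
    (fun _ _ _ => DFinsupp.ext fun _ => smul_mul_assoc _ _ _)
    (fun _ _ _ => DFinsupp.ext fun _ => mul_add _ _ _)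
    (fun _ _ _ => DFinsupp.ext fun _ => mul_smul_comm _ _ _)

/-- The involution as a conjugate linear map. -/
def starₛₗ : MatZSum n →ₛₗ[starRingEnd ℂ] MatZSum n where
  toFun x := star x
  map_add' _ _ := DFinsupp.ext fun _ => star_add _ _
  map_smul' _ _ := DFinsupp.ext fun _ => star_smul _ _

open scoped Classical in
/-- The basis of the elements `E_{pq} ⊗ t^m`. -/
def basis : Module.Basis (Σ j : J, (Fin (n j) × Fin (n j)) × Multiplicative ℤ) ℂ (MatZSum n) :=
  DFinsupp.basis fun j => (Matrix.stdBasis ℂ (Fin (n j)) (Fin (n j))).tensorProduct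
    (MonoidAlgebra.basis (Multiplicative ℤ) ℂ)

variable {n}

/-- The element `E_{pq} ⊗ t^m`. -/
def unit {n : ℕ} (p q : Fin n) (m : ℤ) : MatZ n :=
  Matrix.single p q 1 ⊗ₜ MonoidAlgebra.single (Multiplicative.ofAdd m) 1

theorem unit_mul_unit {n : ℕ} (p q p' q' : Fin n) (m m' : ℤ) :
    unit p q m * unit p' q' m' = if q = p' then unit p q' (m + m') else 0 := by
  rw [unit, unit, Algebra.TensorProduct.tmul_mul_tmul]
  split_ifs with h
  · subst h
    simp [unit, MonoidAlgebra.single_mul_single]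
  · rw [Matrix.single_mul_single_of_ne _ _ _ _ h, TensorProduct.zero_tmul]

theorem star_unit {n : ℕ} (p q : Fin n) (m : ℤ) : star (unit p q m) = unit q p (-m) := by
  rw [unit, TensorProduct.star_tmul, Matrix.star_eq_conjTranspose, Matrix.conjTranspose_single,
    star_one]
  congr 1
  apply MonoidAlgebra.ext
  change Finsupp.equivMapDomain _ (Finsupp.mapRange _ _ (Finsupp.single _ _)) = Finsupp.single _ _
  simp

theorem dfinsupp_basis_apply [DecidableEq J] {M : J → Type*} [∀ j, AddCommGroup (M j)]
    [∀ j, Module ℂ (M j)] {η : J → Type*} (b : ∀ j, Module.Basis (η j) ℂ (M j)) (j : J)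
    (k : η j) : DFinsupp.basis b ⟨j, k⟩ = DFinsupp.single j (b j k) := by
  classical
  apply (DFinsupp.basis b).repr.injective
  rw [Module.Basis.repr_self]
  ext ⟨j', k'⟩
  change _ = ((sigmaFinsuppLequivDFinsupp ℂ).symm (DFinsupp.mapRange (fun i => (b i).repr)
    (fun i => map_zero _) _)) _
  rw [DFinsupp.mapRange_single]
  by_cases h : j = j'
  · subst h
    simp [Finsupp.single_apply, sigmaFinsuppEquivDFinsupp]
  · simp [Finsupp.single_apply, sigmaFinsuppEquivDFinsupp, h, DFinsupp.single_apply]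

open scoped Classical in
theorem basis_apply (j : J) (p q : Fin (n j)) (m : ℤ) :
    basis n ⟨j, (p, q), Multiplicative.ofAdd m⟩ =
      DFinsupp.single (β := fun j => MatZ (n j)) j (unit p q m) := by
  rw [unit, ← Matrix.stdBasis_eq_single, ← MonoidAlgebra.basis_apply,
    ← Module.Basis.tensorProduct_apply]
  exact dfinsupp_basis_apply _ _ _

theorem basis_mul_basis (j : J) (p q p' q' : Fin (n j)) (m m' : ℤ) :
    basis n ⟨j, (p, q), Multiplicative.ofAdd m⟩ * basis n ⟨j, (p', q'), Multiplicative.ofAdd m'⟩ =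
      if q = p' then basis n ⟨j, (p, q'), Multiplicative.ofAdd (m + m')⟩ else 0 := by
  classical
  rw [basis_apply, basis_apply]
  refine (DFinsupp.zipWith_single_single _ _ _ _).trans ?_
  rw [unit_mul_unit]
  split_ifs with h
  · rw [basis_apply]
  · exact DFinsupp.single_zero _

theorem basis_mul_basis_of_ne {j j' : J} (hj : j ≠ j') (p q : Fin (n j)) (p' q' : Fin (n j'))
    (m m' : ℤ) : basis n ⟨j, (p, q), Multiplicative.ofAdd m⟩ *
      basis n ⟨j', (p', q'), Multiplicative.ofAdd m'⟩ = 0 := by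
  classical
  rw [basis_apply, basis_apply]
  refine DFinsupp.ext fun i => ?_
  change DFinsupp.single (β := fun j => MatZ (n j)) j (unit p q m) i *
    DFinsupp.single (β := fun j => MatZ (n j)) j' (unit p' q' m') i = 0
  by_cases hi : j = i
  · subst hi
    rw [DFinsupp.single_eq_of_ne hj, mul_zero]
  · rw [DFinsupp.single_eq_of_ne (fun h => hi h.symm), zero_mul]

theorem star_basis (j : J) (p q : Fin (n j)) (m : ℤ) :
    star (basis n ⟨j, (p, q), Multiplicative.ofAdd m⟩) =
      basis n ⟨j, (q, p), Multiplicative.ofAdd (-m)⟩ := by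
  classical
  rw [basis_apply, basis_apply, ← star_unit]
  exact DFinsupp.mapRange_single

end MatZSum

/-! ## Algebras with a basis of partial isometries between the points of periodic orbits -/

section Orbits

variable {W : Type*} (L : Equiv.Perm W) {J : Type w} {n : J → ℕ} {c₀ : J → W}

/-- `t^m E_{pq}` corresponds to the arrow from `L^q c_j` to `L^p c_j` that winds around the orbit
`m` times. -/
def arrow (n : J → ℕ) (c₀ : J → W)
    (i : Σ j : J, (Fin (n j) × Fin (n j)) × Multiplicative ℤ) : ℤ × W :=
  (i.2.1.1 - i.2.1.2 + n i.1 * i.2.2.toAdd, (L ^ (i.2.1.2 : ℤ)) (c₀ i.1))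

theorem fin_eq_of_modEq {n : ℕ} {p q : Fin n} (h : (p : ℤ) ≡ q [ZMOD n]) : p = q := by
  have h₁ := Int.emod_eq_of_lt (a := (p : ℤ)) (b := n) (by omega) (by omega)
  have h₂ := Int.emod_eq_of_lt (a := (q : ℤ)) (b := n) (by omega) (by omega)
  rw [Int.ModEq, h₁, h₂] at h
  omega

/-- The inverse is two divisions with remainder by the period `n_j`: for an arrow of length `k` that
starts at `L^a c_j`, the remainder of `a` is `q`, and the remainder and the quotient of `k + q` are
`p` and the winding number. -/
theorem arrow_bijective (hn : ∀ j, 0 < n j)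
    (hc₀ : ∀ j j' (a b : ℤ), (L ^ a) (c₀ j) = (L ^ b) (c₀ j') ↔ j = j' ∧ a ≡ b [ZMOD n j])
    (hs : ∀ c, ∃ j, ∃ a : ℤ, c = (L ^ a) (c₀ j)) : Function.Bijective (arrow L n c₀) := by
  constructor
  · rintro ⟨j, ⟨p, q⟩, m⟩ ⟨j', ⟨p', q'⟩, m'⟩ h
    simp only [arrow, Prod.mk.injEq, hc₀] at h
    obtain ⟨h, rfl, h'⟩ := h
    obtain rfl := fin_eq_of_modEq h'
    have h₁ : (p : ℤ) + n j * m.toAdd = p' + n j * m'.toAdd := by linarith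
    obtain rfl : p = p' := by
      apply fin_eq_of_modEq
      have := congrArg (· % (n j : ℤ)) h₁
      simpa [Int.ModEq] using this
    obtain rfl : m = m' := by
      have h₂ := mul_left_cancel₀ (by exact_mod_cast (hn j).ne') (add_left_cancel h₁)
      exact Multiplicative.toAdd.injective h₂
    rfl
  · rintro ⟨k, c⟩
    obtain ⟨j, a, rfl⟩ := hs c
    have hj : (0 : ℤ) < n j := by exact_mod_cast hn j
    have lift : ∀ x : ℤ, ∃ p : Fin (n j), (p : ℤ) = x % n j := by
      intro x
      have h₁ := Int.emod_nonneg x hj.ne'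
      have h₂ := Int.emod_lt_of_pos x hj
      exact ⟨⟨(x % n j).toNat, by omega⟩, by simp [h₁]⟩
    obtain ⟨q, hq⟩ := lift a
    obtain ⟨p, hp⟩ := lift (k + q)
    refine ⟨⟨j, ⟨p, q⟩, Multiplicative.ofAdd ((k + q) / n j)⟩, ?_⟩
    simp only [arrow, Prod.mk.injEq, hc₀, true_and, toAdd_ofAdd]
    constructor
    · have := Int.emod_add_mul_ediv (k + q) (n j)
      rw [hp]
      linarith
    · rw [hq]
      exact Int.mod_modEq _ _

variable {A : Type*} [AddCommGroup A] [Module ℂ A] [Mul A] [Star A]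

-- Matrix units correspond to arrows, and the multiplication tables and involutions agree on them.
-- Products are compared as bilinear maps on bases and involutions as conjugate linear maps, so no
-- further axioms for `A` are needed.
open scoped Classical in
theorem nonempty_starAlgEquiv_matZSum (hn : ∀ j, 0 < n j)
    (hc₀ : ∀ j j' (a b : ℤ), (L ^ a) (c₀ j) = (L ^ b) (c₀ j') ↔ j = j' ∧ a ≡ b [ZMOD n j])
    (hs : ∀ c, ∃ j, ∃ a : ℤ, c = (L ^ a) (c₀ j))
    (m : A →ₗ[ℂ] A →ₗ[ℂ] A) (hm : ∀ x y, x * y = m x y)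
    (s : A →ₛₗ[starRingEnd ℂ] A) (hstar : ∀ x, star x = s x)
    (b : Module.Basis (ℤ × W) ℂ A)
    (hb : ∀ k l c d, b (k, d) * b (l, c) = if d = (L ^ l) c then b (k + l, c) else 0)
    (hb' : ∀ k c, star (b (k, c)) = b (-k, (L ^ k) c)) :
    Nonempty (A ≃⋆ₐ[ℂ] MatZSum n) := by
  let e : MatZSum n ≃ₗ[ℂ] A :=
    (MatZSum.basis n).equiv b (Equiv.ofBijective _ (arrow_bijective L hn hc₀ hs))
  have he : ∀ i, e (MatZSum.basis n i) = b (arrow L n c₀ i) := fun i =>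
    Module.Basis.equiv_apply _ _ _ _
  have hmul : ∀ x y, e (x * y) = e x * e y := by
    intro x y
    rw [hm]
    refine LinearMap.congr_fun₂ (f := (MatZSum.mulₗ n).compr₂ e.toLinearMap)
      (g := m.compl₁₂ e.toLinearMap e.toLinearMap) ?_ x y
    refine LinearMap.ext_basis (MatZSum.basis n) (MatZSum.basis n) ?_
    rintro ⟨j, ⟨p, q⟩, t⟩ ⟨j', ⟨p', q'⟩, t'⟩
    change e (_ * _) = m (e _) (e _)
    rw [← hm, he, he, arrow, arrow, hb]
    have key : (L ^ (q : ℤ)) (c₀ j) = (L ^ ((p' : ℤ) - q' + n j' * t'.toAdd))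
        ((L ^ (q' : ℤ)) (c₀ j')) ↔ j = j' ∧ (q : ℤ) ≡ p' + n j' * t'.toAdd [ZMOD n j] := by
      rw [← Equiv.Perm.mul_apply, ← zpow_add, hc₀]
      have e₁ : (p' : ℤ) - q' + n j' * t'.toAdd + q' = p' + n j' * t'.toAdd := by ring
      rw [e₁]
    by_cases hj : j = j'
    · subst hj
      -- Windings do not move the end point, so two arrows in one orbit are composable exactly if
      -- the inner matrix indices agree.
      have key' : j = j ∧ (q : ℤ) ≡ p' + n j * t'.toAdd [ZMOD n j] ↔ q = p' := by
        constructor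
        · rintro ⟨-, h⟩
          exact fin_eq_of_modEq (h.trans (by simp [Int.ModEq]))
        · rintro rfl
          simp [Int.ModEq]
      refine (congrArg e (MatZSum.basis_mul_basis j p q p' q' t.toAdd t'.toAdd)).trans ?_
      dsimp only
      by_cases h : q = p'
      · rw [if_pos h, if_pos (key.2 (key'.2 h)), he]
        subst h
        refine congrArg b (Prod.ext ?_ rfl)
        simp only [arrow, toAdd_ofAdd]
        ring
      · rw [if_neg h, if_neg fun h' => h (key'.1 (key.1 h')), map_zero]
    · refine (congrArg e
        (MatZSum.basis_mul_basis_of_ne hj p q p' q' t.toAdd t'.toAdd)).trans ?_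
      dsimp only
      rw [if_neg fun h' => hj (key.1 h').1, map_zero]
  have hst : ∀ x, e (star x) = star (e x) := by
    intro x
    rw [hstar]
    refine LinearMap.congr_fun (f := e.toLinearMap.comp (MatZSum.starₛₗ n))
      (g := s.comp e.toLinearMap) ?_ x
    refine Module.Basis.ext (MatZSum.basis n) ?_
    rintro ⟨j, ⟨p, q⟩, t⟩
    change e (star _) = s (e _)
    rw [← hstar, he, arrow, hb']
    refine (congrArg e (MatZSum.star_basis j p q t.toAdd)).trans ?_
    rw [he]
    refine congrArg b (Prod.ext ?_ ?_)
    · simp only [arrow, toAdd_ofAdd]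
      ring
    · simp only [arrow, toAdd_ofAdd]
      rw [← Equiv.Perm.mul_apply, ← zpow_add, hc₀]
      refine ⟨rfl, ?_⟩
      have e₁ : (p : ℤ) - q + n j * t.toAdd + q = p + n j * t.toAdd := by ring
      simp [e₁, Int.ModEq]
  refine ⟨StarAlgEquiv.mk (StarRingEquiv.mk (RingEquiv.mk e.symm.toEquiv ?_ ?_) ?_) ?_⟩
  · intro x y
    apply e.injective
    refine (e.apply_symm_apply _).trans ((hmul _ _).trans ?_).symm
    exact congrArg₂ _ (e.apply_symm_apply _) (e.apply_symm_apply _)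
  · exact e.symm.map_add
  · intro x
    apply e.injective
    refine (e.apply_symm_apply _).trans ((hst _).trans ?_).symm
    exact congrArg _ (e.apply_symm_apply _)
  · exact e.symm.map_smul

/-- One point is chosen in every class. The class is the orbit of that point under the powers of
`L`, so its cardinality is the minimal period, and powers agree on the point exactly modulo this
period. -/
theorem exists_orbit_representatives (r : Setoid W) (hr : ∀ c d, r c d ↔ ∃ k : ℤ, d = (L ^ k) c)
    (hfin : ∀ c, ∃ k : ℕ, 0 < k ∧ (L ^ k) c = c) :
    ∃ c₀ : Quotient r → W, (∀ j, 0 < Nat.card {x // Quotient.mk r x = j}) ∧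
      (∀ j j' (a b : ℤ), (L ^ a) (c₀ j) = (L ^ b) (c₀ j') ↔
        j = j' ∧ a ≡ b [ZMOD (Nat.card {x // Quotient.mk r x = j} : ℕ)]) ∧
      ∀ c, ∃ j, ∃ a : ℤ, c = (L ^ a) (c₀ j) := by
  have hp : ∀ c, 0 < Function.minimalPeriod (L • ·) c := fun c => by
    obtain ⟨k, hk, h⟩ := hfin c
    refine Function.IsPeriodicPt.minimalPeriod_pos hk ?_
    rw [Function.IsPeriodicPt, Function.IsFixedPt, smul_iterate_apply]
    exact h
  have hcard : ∀ j : Quotient r, Nat.card {x // Quotient.mk r x = j} =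
      Function.minimalPeriod (L • ·) j.out := by
    intro j
    have e : ∀ x, Quotient.mk r x = j ↔ x ∈ MulAction.orbit (Subgroup.zpowers L) j.out := by
      intro x
      constructor
      · rintro rfl
        obtain ⟨k, hk⟩ := (hr _ _).1 (Quotient.mk_out x)
        exact ⟨⟨L ^ k, k, rfl⟩, hk.symm⟩
      · rintro ⟨⟨_, k, rfl⟩, rfl⟩
        refine Eq.trans ?_ (Quotient.out_eq j)
        exact (Quotient.sound ((hr _ _).2 ⟨k, rfl⟩)).symm
    rw [Nat.card_congr ((Equiv.subtypeEquivRight e).trans (MulAction.orbitZPowersEquiv L j.out)),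
      Nat.card_zmod]
  refine ⟨Quotient.out, fun j => by rw [hcard]; exact hp _, fun j j' a b => ?_, fun c => ?_⟩
  · have h₁ : (L ^ a) j.out = (L ^ b) j'.out ↔ j'.out = (L ^ (a - b)) j.out := by
      rw [sub_eq_neg_add, zpow_add, zpow_neg, Equiv.Perm.mul_apply, Equiv.Perm.eq_inv_iff_eq,
        eq_comm]
    rw [h₁, hcard]
    constructor
    · intro h
      obtain rfl : j = j' := by
        rw [← Quotient.out_eq j, ← Quotient.out_eq j']
        exact Quotient.sound ((hr _ _).2 ⟨_, h⟩)
      exact ⟨rfl, (Int.modEq_iff_dvd.2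
        (MulAction.zpow_smul_eq_iff_minimalPeriod_dvd.1 h.symm)).symm⟩
    · rintro ⟨rfl, h⟩
      exact (MulAction.zpow_smul_eq_iff_minimalPeriod_dvd.2 (Int.modEq_iff_dvd.1 h.symm)).symm
  · exact ⟨Quotient.mk r c, (hr _ _).1 (Quotient.mk_out c)⟩

end Orbits

/-! ## Integer powers of a shift of the weights -/

namespace Annular

variable {E : Type u} [Category.{v} E] [Preadditive E] [Linear ℂ E] [MonoidalCategory E]
  [MonoidalPreadditive E] [MonoidalLinear ℂ E] [DaggerMonoidal E] {ι : Type w} {irr : ι → E}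
  {κ : Type w'} (T : AnnularChoice irr) (wt : κ → E) {e₀ : ι} (u₀ : irr e₀ ⟶ 𝟙_ E)

open scoped Classical in
/-- The unit of `A_{c,c}`. -/
def one (c : κ) : Annular T wt := block T wt c c (tubeOne u₀ (wt c))

variable {T wt u₀}

theorem one_mul_block (h : IsIrrFamily irr) (hu₀ : IsUnitary u₀) (b c : κ)
    (x : TubeHom irr (wt b) (wt c)) : one T wt u₀ c * block T wt b c x = block T wt b c x := by
  classical
  rw [one, block_mul_block, T.tubeOne_comp h hu₀]

theorem block_mul_one (h : IsIrrFamily irr) (hu₀ : IsUnitary u₀) (b c : κ)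
    (x : TubeHom irr (wt b) (wt c)) : block T wt b c x * one T wt u₀ b = block T wt b c x := by
  classical
  rw [one, block_mul_block, T.comp_tubeOne h hu₀]

theorem one_mul_block_of_ne {b c d : κ} (hd : c ≠ d) (x : TubeHom irr (wt b) (wt c)) :
    one T wt u₀ d * block T wt b c x = 0 :=
  block_mul_block_of_ne hd _ _

open scoped Classical in
/-- Left multiplication by the formal sum of the elements `u d`. -/
def leftMul (u : κ → Annular T wt) : Annular T wt →ₗ[ℂ] Annular T wt :=
  DirectSum.toModule ℂ (κ × κ) _ fun p => (mulₗ T wt (u p.2)).comp (block T wt p.1 p.2)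

theorem leftMul_block (u : κ → Annular T wt) (c d : κ) (y : TubeHom irr (wt c) (wt d)) :
    leftMul u (block T wt c d y) = u d * block T wt c d y := by
  classical
  exact DirectSum.toModule_lof (M := fun p : κ × κ => TubeHom irr (wt p.1) (wt p.2)) ℂ (c, d) y

theorem leftMul_mul (h : IsIrrFamily irr) (u : κ → Annular T wt) (x y : Annular T wt) :
    leftMul u (x * y) = leftMul u x * y := by
  induction x using block_induction with
  | zero => rw [zero_mul', map_zero, zero_mul']
  | add x x' hx hx' => simp only [add_mul', map_add, hx, hx']
  | of c d f =>
  induction y using block_induction with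
  | zero => simp only [mul_zero', map_zero]
  | add x x' hx hx' => simp only [mul_add', map_add, hx, hx']
  | of b c' g =>
    rw [leftMul_block, mul_assoc' h]
    by_cases e : c' = c
    · subst e
      rw [block_mul_block, leftMul_block]
    · rw [block_mul_block_of_ne e, map_zero, mul_zero']

/-- Elements `u d` with weights `d` and `L d` that have the inverses `u' d`. -/
structure IsShift (u₀ : irr e₀ ⟶ 𝟙_ E) (L : Equiv.Perm κ) (u u' : κ → Annular T wt) : Prop where
  fwd : ∀ d, ∃ y, u d = block T wt d (L d) y
  bwd : ∀ d, ∃ y, u' d = block T wt (L d) d y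
  mul_inv : ∀ d, u d * u' d = one T wt u₀ (L d)
  inv_mul : ∀ d, u' d * u d = one T wt u₀ d

namespace IsShift

variable {L : Equiv.Perm κ} {u u' : κ → Annular T wt}

/-- Left multiplication by the formal sum of the elements `u d` is invertible. -/
def equiv (S : IsShift u₀ L u u') (h : IsIrrFamily irr) (hu₀ : IsUnitary u₀) :
    Annular T wt ≃ₗ[ℂ] Annular T wt :=
  LinearEquiv.ofLinearMap (leftMul u) (leftMul fun d => u' (L.symm d))
    (by
      refine LinearMap.ext fun x => ?_
      rw [LinearMap.comp_apply, LinearMap.id_apply]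
      induction x using block_induction with
      | zero => simp only [map_zero]
      | add x y hx hy => simp only [map_add, hx, hy]
      | of c d f =>
        obtain ⟨d, rfl⟩ := L.surjective d
        obtain ⟨y, hy⟩ := S.bwd d
        rw [leftMul_block, L.symm_apply_apply, leftMul_mul h, hy, leftMul_block, ← hy,
          S.mul_inv, one_mul_block h hu₀])
    (by
      refine LinearMap.ext fun x => ?_
      rw [LinearMap.comp_apply, LinearMap.id_apply]
      induction x using block_induction with
      | zero => simp only [map_zero]
      | add x y hx hy => simp only [map_add, hx, hy]
      | of c d f =>
        obtain ⟨y, hy⟩ := S.fwd d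
        rw [leftMul_block, leftMul_mul h, hy, leftMul_block, ← hy, L.symm_apply_apply,
          S.inv_mul, one_mul_block h hu₀])

variable (S : IsShift u₀ L u u') (h : IsIrrFamily irr) (hu₀ : IsUnitary u₀)

/-- Left multiplication commutes with right multiplications, and so does its inverse. -/
theorem equiv_zpow_mul (k : ℤ) (x y : Annular T wt) :
    (S.equiv h hu₀ ^ k) (x * y) = (S.equiv h hu₀ ^ k) x * y := by
  have h₁ : ∀ x, S.equiv h hu₀ (x * y) = S.equiv h hu₀ x * y := fun x => leftMul_mul h u x y
  induction k generalizing x with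
  | zero => rfl
  | succ k ih =>
    rw [add_comm, zpow_add, zpow_one, LinearEquiv.mul_apply, ih, h₁]
    rfl
  | pred k ih =>
    rw [sub_eq_neg_add, zpow_add, zpow_neg_one, LinearEquiv.mul_apply, ih]
    apply (S.equiv h hu₀).injective
    rw [h₁]
    change _ = (S.equiv h hu₀) ((S.equiv h hu₀).symm _) * y
    rw [LinearEquiv.apply_symm_apply]
    exact (S.equiv h hu₀).apply_symm_apply _

theorem equiv_block (c d : κ) (y : TubeHom irr (wt c) (wt d)) :
    ∃ z, S.equiv h hu₀ (block T wt c d y) = block T wt c (L d) z := by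
  classical
  obtain ⟨x, hx⟩ := S.fwd d
  have e := leftMul_block u c d y
  rw [hx, block_mul_block] at e
  exact ⟨_, e⟩

theorem equiv_symm_block (c d : κ) (y : TubeHom irr (wt c) (wt d)) :
    ∃ d' z, d = L d' ∧ (S.equiv h hu₀).symm (block T wt c d y) = block T wt c d' z := by
  classical
  obtain ⟨d, rfl⟩ := L.surjective d
  obtain ⟨x, hx⟩ := S.bwd d
  have e := leftMul_block (fun d => u' (L.symm d)) c (L d) y
  rw [L.symm_apply_apply, hx, block_mul_block] at e
  exact ⟨d, _, rfl, e⟩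

theorem equiv_zpow_block (k : ℤ) (c d : κ) (y : TubeHom irr (wt c) (wt d)) :
    ∃ d' z, d' = (L ^ k) d ∧
      (S.equiv h hu₀ ^ k) (block T wt c d y) = block T wt c d' z := by
  induction k with
  | zero => exact ⟨d, y, rfl, rfl⟩
  | succ k ih =>
    obtain ⟨d', z, hd', hz⟩ := ih
    obtain ⟨z', hz'⟩ := S.equiv_block h hu₀ c d' z
    refine ⟨L d', z', ?_, ?_⟩
    · rw [add_comm, zpow_add, zpow_one, Equiv.Perm.mul_apply, hd']
    · rw [add_comm, zpow_add, zpow_one, LinearEquiv.mul_apply, hz, hz']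
  | pred k ih =>
    obtain ⟨d', z, hd', hz⟩ := ih
    obtain ⟨d'', z', hd'', hz'⟩ := S.equiv_symm_block h hu₀ c d' z
    refine ⟨d'', z', ?_, ?_⟩
    · rw [sub_eq_neg_add, zpow_add, zpow_neg_one, Equiv.Perm.mul_apply, ← hd', hd'']
      exact (L.symm_apply_apply d'').symm
    · rw [sub_eq_neg_add, zpow_add, zpow_neg_one, LinearEquiv.mul_apply, hz]
      exact hz'

/-- The product of `|k|` of the elements `u` or `u'` that starts at `c`. -/
def power (k : ℤ) (c : κ) : Annular T wt := (S.equiv h hu₀ ^ k) (one T wt u₀ c)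

-- With `U` the invertible left multiplication, `U^k(1_d) · U^l(1_c) = U^k(1_d · U^l(1_c))`. The
-- inner product is `U^l(1_c)` or zero, according to its end point. Working with powers of `U`
-- treats all signs of `k` and `l` at once.
open scoped Classical in
theorem power_mul_power (k l : ℤ) (c d : κ) :
    S.power h hu₀ k d * S.power h hu₀ l c =
      if d = (L ^ l) c then S.power h hu₀ (k + l) c else 0 := by
  obtain ⟨d', z, hd', hz⟩ := S.equiv_zpow_block h hu₀ l c c (tubeOne u₀ (wt c))
  have hz' : S.power h hu₀ l c = block T wt c d' z := hz
  rw [power, ← equiv_zpow_mul, hz', ← hd']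
  split_ifs with hd
  · rw [hd, one_mul_block h hu₀, ← hz', power, power, zpow_add, LinearEquiv.mul_apply]
  · rw [one_mul_block_of_ne (Ne.symm hd), map_zero]

theorem power_one (c : κ) : S.power h hu₀ 1 c = u c := by
  obtain ⟨y, hy⟩ := S.fwd c
  refine (leftMul_block u c c _).trans ?_
  rw [hy]
  exact block_mul_one h hu₀ _ _ _

end IsShift

end Annular

/-! ## Rotations of words -/

section Words

/-- If `a` is a suffix of `a ++ b`, then it is determined by `b` and by its length. -/
theorem eq_of_append_eq_append {A : Type*} {b : List A} (hb : b ≠ []) :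
    ∀ {a a' c c' : List A}, a ++ b = c ++ a → a' ++ b = c' ++ a' → a.length = a'.length → a = a' := by
  have key : ∀ (n : ℕ) {a a' c c' : List A}, a.length = n → a ++ b = c ++ a →
      a' ++ b = c' ++ a' → a.length = a'.length → a = a' := by
    intro n
    induction n using Nat.strong_induction_on with
    | _ n ih =>
    intro a a' c c' hn h h' e
    rcases le_total a.length b.length with hle | hle
    -- A word `a` with `a b = c a` is a suffix of `a b`; if it is not longer than `b`, it is the
    -- suffix of `b` of its length.
    · have h₁ := congrArg List.reverse h
      have h₂ := congrArg List.reverse h'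
      simp only [List.reverse_append] at h₁ h₂
      have h₃ := congrArg (List.take a.length) h₁
      have h₄ := congrArg (List.take a.length) h₂
      rw [List.take_append_of_le_length (by simpa using hle),
        List.take_left' (by simp)] at h₃
      rw [List.take_append_of_le_length (by simpa using hle),
        List.take_left' (by simp [e])] at h₄
      exact List.reverse_injective (h₃.symm.trans h₄)
    -- Otherwise `a = r b`, and `r` satisfies an equation of the same form. As `b` is not empty, `r`
    -- is shorter than `a`.
    · have suffix : ∀ {a c : List A}, a ++ b = c ++ a → b.length ≤ a.length →
          ∃ r, a = r ++ b ∧ r ++ b = c ++ r := by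
        intro a c h hle
        rcases List.append_eq_append_iff.1 h with ⟨r, h₁, h₂⟩ | ⟨r, h₁, h₂⟩
        · have : r = [] := by
            have := congrArg List.length h₂
            simp at this
            exact List.length_eq_zero_iff.1 (by omega)
          subst this
          exact ⟨[], by simpa using h₂.symm, by simpa using by simpa [h₁] using h₂⟩
        · exact ⟨r, h₂, by rw [← h₂, h₁]⟩
      obtain ⟨r, rfl, hr⟩ := suffix h hle
      obtain ⟨r', rfl, hr'⟩ := suffix h' (e ▸ hle)
      have hb' := List.length_pos_iff.2 hb
      simp only [List.length_append] at hn e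
      rw [ih r.length (by omega) rfl hr hr' (by omega)]
  intro a a' c c'
  exact key _ rfl

variable {C : Type u₁} {D : Type u₂} {I : Set C} {I' : Set D}

/-- Two words of positive even length that begin with a letter from `I` can be joined. -/
theorem exists_append {a b : AltWord I I'} (ha : a ∈ weightW I I') (hb : b ∈ weightW I I') :
    ∃ c ∈ weightW I I', c.1 = a.1 ++ b.1 := by
  have ha' := mem_weightW_iff.1 ha
  have hb' := mem_weightW_iff.1 hb
  have h : IsAlt (a.1 ++ b.1) :=
    isAlt_append_of_headType_ne ha'.2 (by rw [hb'.1]; simp)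
  refine ⟨⟨a.1 ++ b.1, h⟩, mem_weightW_iff.2 ⟨?_, ?_⟩, rfl⟩
  · rw [headType_append _ (ne_nil_of_mem_weightW ha), ha'.1]
  · rw [lastType_append _ (ne_nil_of_mem_weightW hb), hb'.2]

theorem even_length_iff {l : List (I ⊕ I')} (hl : IsAlt l) (h : headType l = some true) :
    Even l.length ↔ lastType l = some false := by
  obtain _ | ⟨x, l⟩ := l
  · cases h
  · rw [lastType_eq hl]
    rw [headType_cons, Option.some.injEq] at h
    simp [h]

/-- Cutting a word in two parts of even lengths. -/
theorem mem_weightW_of_append {s t : List (I ⊕ I')} {c : AltWord I I'} (hc : c ∈ weightW I I')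
    (h : c.1 = s ++ t) (hs : Even s.length) (hs' : s ≠ []) (ht : t ≠ []) :
    ∃ a ∈ weightW I I', ∃ b ∈ weightW I I', a.1 = s ∧ b.1 = t := by
  have hc' := mem_weightW_iff.1 hc
  have alt := c.2
  rw [h] at hc' alt
  obtain ⟨h₁, h₂, h₃⟩ := List.isChain_append.1 alt
  rw [headType_append _ hs', lastType_append _ ht] at hc'
  have hl := (even_length_iff h₁ hc'.1).1 hs
  refine ⟨⟨s, h₁⟩, mem_weightW_iff.2 ⟨hc'.1, hl⟩, ⟨t, h₂⟩, mem_weightW_iff.2 ⟨?_, hc'.2⟩, rfl, rfl⟩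
  obtain ⟨x, s, rfl⟩ := (List.eq_nil_or_concat' s).resolve_left hs'
  obtain ⟨y, t, rfl⟩ := List.exists_cons_of_ne_nil ht
  have := h₃ s (by simp) y (by simp)
  simp [lastType] at hl
  simp [headType_cons]
  rcases s with s | s <;> rcases y with y | y <;> simp_all

theorem rotate_mem_weightW {c : AltWord I I'} (hc : c ∈ weightW I I') {s t : List (I ⊕ I')}
    (h : c.1 = s ++ t) (hs : Even s.length) : ∃ d ∈ weightW I I', d.1 = t ++ s := by
  by_cases hs' : s = []
  · subst hs'
    exact ⟨c, hc, by simpa using h⟩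
  by_cases ht : t = []
  · subst ht
    exact ⟨c, hc, by simpa using h⟩
  obtain ⟨a, ha, b, hb, rfl, rfl⟩ := mem_weightW_of_append hc h hs hs' ht
  exact exists_append hb ha

theorem exists_rotate_two (c : weightW I I') : ∃ d : weightW I I', d.1.1 = c.1.1.rotate 2 := by
  have hc := two_le_length_of_mem_weightW c.2
  obtain ⟨d, hd, e⟩ := rotate_mem_weightW c.2 (List.take_append_drop 2 c.1.1).symm
    (by rw [List.length_take, min_eq_left hc]; exact even_two)
  exact ⟨⟨d, hd⟩, by rw [List.rotate_eq_drop_append_take hc]; exact e⟩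

/-- Moving the first two letters to the end. -/
def rotateTwo (c : weightW I I') : weightW I I' := (exists_rotate_two c).choose

theorem rotateTwo_val (c : weightW I I') : (rotateTwo c).1.1 = c.1.1.rotate 2 :=
  (exists_rotate_two c).choose_spec

theorem iterate_rotateTwo_val (k : ℕ) (c : weightW I I') :
    (rotateTwo^[k] c).1.1 = c.1.1.rotate (2 * k) := by
  induction k with
  | zero => simp
  | succ k ih => rw [Function.iterate_succ_apply', rotateTwo_val, ih, List.rotate_rotate, mul_add]

theorem iterate_rotateTwo_length (c : weightW I I') : rotateTwo^[c.1.1.length] c = c := by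
  refine Subtype.ext (Subtype.ext ?_)
  rw [iterate_rotateTwo_val, mul_comm, ← List.rotate_mod, Nat.mul_mod_right, List.rotate_zero]

/-- Every word returns to itself after as many steps as it has letters, so the last step but one is
a preimage. -/
theorem rotateTwo_bijective : Function.Bijective (rotateTwo (I := I) (I' := I')) := by
  constructor
  · intro c d h
    have h' := congrArg (fun x : weightW I I' => x.1.1) h
    simp only [rotateTwo_val] at h'
    exact Subtype.ext (Subtype.ext (List.rotate_injective 2 h'))
  · intro c
    have h := iterate_rotateTwo_length c
    obtain ⟨n, hn⟩ := Nat.exists_eq_succ_of_ne_zero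
      (by have := two_le_length_of_mem_weightW c.2; omega : c.1.1.length ≠ 0)
    rw [hn, Function.iterate_succ_apply'] at h
    exact ⟨_, h⟩

variable (I I') in
/-- The permutation that moves the last two letters to the beginning. -/
def rotPerm : Equiv.Perm (weightW I I') := (Equiv.ofBijective _ rotateTwo_bijective)⁻¹

theorem rotateTwo_rotPerm (c : weightW I I') : rotateTwo (rotPerm I I' c) = c :=
  (Equiv.ofBijective _ rotateTwo_bijective).apply_symm_apply c

theorem rotPerm_pow_rotateTwo (k : ℕ) (c : weightW I I') :
    (rotPerm I I' ^ k) (rotateTwo^[k] c) = c := by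
  induction k generalizing c with
  | zero => rfl
  | succ k ih =>
    rw [pow_succ', Equiv.Perm.mul_apply, Function.iterate_succ_apply, ih]
    exact (Equiv.ofBijective _ rotateTwo_bijective).symm_apply_apply c

theorem exists_rotPerm_pow_eq (c : weightW I I') : ∃ k : ℕ, 0 < k ∧ (rotPerm I I' ^ k) c = c := by
  -- This many steps rotate by twice the length. Half as many would do, but only finiteness of the
  -- orbit matters.
  refine ⟨c.1.1.length, by have := two_le_length_of_mem_weightW c.2; omega, ?_⟩
  conv_lhs => rw [← iterate_rotateTwo_length c]
  rw [iterate_rotateTwo_length]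
  have := rotPerm_pow_rotateTwo c.1.1.length c
  rwa [iterate_rotateTwo_length] at this

/-- The first two letters of `rotPerm c` are the last two letters of `c`. -/
theorem exists_rotPerm_eq (c : weightW I I') : ∃ (a : AltWord I I') (r : List (I ⊕ I')),
    a ∈ weightW I I' ∧ a.1.length = 2 ∧ (rotPerm I I' c).1.1 = a.1 ++ r ∧ c.1.1 = r ++ a.1 := by
  set d := rotPerm I I' c with hd
  have h2 := two_le_length_of_mem_weightW d.2
  have hc : c.1.1 = d.1.1.drop 2 ++ d.1.1.take 2 := by
    rw [← List.rotate_eq_drop_append_take h2, ← rotateTwo_val, hd, rotateTwo_rotPerm]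
  have hl : (d.1.1.take 2).length = 2 := by rw [List.length_take, min_eq_left h2]
  by_cases ht : d.1.1.drop 2 = []
  · refine ⟨d.1, [], d.2, ?_, by simp, ?_⟩
    · have := List.drop_eq_nil_iff.1 ht
      omega
    · rw [hc, ht]
      have := List.take_append_drop 2 d.1.1
      rw [ht, List.append_nil] at this
      rw [this]
  · obtain ⟨a, ha, b, -, h₁, -⟩ := mem_weightW_of_append d.2 (List.take_append_drop 2 d.1.1).symm
      (by rw [hl]; exact even_two) (by intro h; simp [h] at hl) ht
    exact ⟨a, d.1.1.drop 2, ha, by rw [h₁, hl], by rw [h₁, List.take_append_drop],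
      by rw [h₁, hc]⟩

/-- Cyclic equivalence allows rotations by any number of letters, but only even ones keep the first
letter in `C`, and those are the powers of the rotation by two. -/
theorem cyclicSetoid_iff (c d : weightW I I') :
    cyclicSetoid I I' c d ↔ ∃ k : ℤ, d = (rotPerm I I' ^ k) c := by
  constructor
  · rintro ⟨s, t, h₁, h₂⟩
    -- `s` is the beginning of `c` and the end of `d`, so unless empty it begins in `C` and ends in
    -- `D`.
    have hs : Even s.length := by
      by_cases hs' : s = []
      · simp [hs']
      · have hc' := mem_weightW_iff.1 c.2
        have hd' := mem_weightW_iff.1 d.2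
        have alt := c.1.2
        rw [h₁] at hc' alt
        rw [h₂, lastType_append _ hs'] at hd'
        rw [headType_append _ hs'] at hc'
        exact (even_length_iff (List.isChain_append.1 alt).1 hc'.1).2 hd'.2
    obtain ⟨k, hk⟩ := hs
    have e : d = rotateTwo^[k] c := by
      refine Subtype.ext (Subtype.ext ?_)
      rw [iterate_rotateTwo_val, h₂, h₁, two_mul, ← hk, List.rotate_append_length_eq]
    refine ⟨-k, ?_⟩
    rw [zpow_neg, zpow_natCast, Equiv.Perm.eq_inv_iff_eq, e, rotPerm_pow_rotateTwo]
  · have h : ∀ c, cyclicSetoid I I' c (rotPerm I I' c) := fun c => by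
      obtain ⟨a, r, -, -, h₁, h₂⟩ := exists_rotPerm_eq c
      exact ⟨r, a.1, h₂, h₁⟩
    rintro ⟨k, rfl⟩
    induction k with
    | zero => exact Setoid.refl' _ c
    | succ k ih =>
      rw [add_comm, zpow_add, zpow_one, Equiv.Perm.mul_apply]
      exact Setoid.trans' _ ih (h _)
    | pred k ih =>
      refine Setoid.trans' _ ih (Setoid.symm' _ ?_)
      convert h _ using 1
      rw [sub_eq_neg_add, zpow_add, zpow_neg_one, Equiv.Perm.mul_apply]
      exact ((rotPerm I I').apply_symm_apply _).symm

end Words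

/-! ## The annular algebra of the words in `W` -/

section

variable {C : Type u₁} [Category.{v₁} C] [Preadditive C] [Linear ℂ C]
  [MonoidalCategory C] [MonoidalPreadditive C] [MonoidalLinear ℂ C] [DaggerMonoidal C]
  {D : Type u₂} [Category.{v₂} D] [Preadditive D] [Linear ℂ D]
  [MonoidalCategory D] [MonoidalPreadditive D] [MonoidalLinear ℂ D] [DaggerMonoidal D]
  {I : Set C} {I' : Set D}

variable (I I') in
/-- The identification of the empty word with the tensor unit. -/
def nilHom : irrObj I I' (AltWord.nil I I') ⟶ 𝟙_ (FreeProduct C D) := 𝟙 (𝟙_ (FreeProduct C D))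

theorem isUnitary_nilHom : IsUnitary (nilHom I I') := IsUnitary.id _

open scoped Classical in
/-- The elements of `A_{c,d}` that are given by a unitary `a ⊗ c → d ⊗ a`, for a word `a` of
length `2n` that is empty or in `W`. -/
def IsArrow (T : AnnularChoice (irrObj I I')) (n : ℕ) (c d : weightW I I')
    (v : AnnularW T) : Prop :=
  ∃ (a : AltWord I I') (x : irrObj I I' a ⊗ irrObj I I' c.1 ⟶ irrObj I I' d.1 ⊗ irrObj I I' a),
    (a.1 = [] ∨ a ∈ weightW I I') ∧ a.1.length = 2 * n ∧ IsUnitary x ∧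
    v = Annular.block T _ c d (tubeOf (irrObj I I') _ _ a x)

variable {T : AnnularChoice (irrObj I I')}

/-- The unit of `A_{c,c}`. -/
abbrev oneW (T : AnnularChoice (irrObj I I')) (c : weightW I I') : AnnularW T :=
  Annular.one T _ (nilHom I I') c

theorem isArrow_oneW (c : weightW I I') : IsArrow T 0 c c (oneW T c) := by
  classical
  refine ⟨AltWord.nil I I', _, .inl rfl, rfl,
    IsUnitary.compress (s := nilHom I I')
      (f := (λ_ (irrObj I I' c.1)).hom ≫ (ρ_ (irrObj I I' c.1)).inv) ?_ isUnitary_nilHom, ?_⟩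
  · refine (isUnitary_leftUnitor _).comp ?_
    rw [← DaggerMonoidal.dag_rightUnitor]
    exact (isUnitary_rightUnitor _).dag
  · simp [oneW, Annular.one, tubeOne, tubeTrace]

theorem IsArrow.mul (F : IsFreeData I I') {m n : ℕ} {c d e : weightW I I'} {v w : AnnularW T}
    (hv : IsArrow T m d e v) (hw : IsArrow T n c d w) : IsArrow T (m + n) c e (v * w) := by
  classical
  obtain ⟨a, x, ha, hla, hx, rfl⟩ := hv
  obtain ⟨b, y, hb, hlb, hy, rfl⟩ := hw
  have hab : ∃ ab : AltWord I I', (ab.1 = [] ∨ ab ∈ weightW I I') ∧ ab.1 = a.1 ++ b.1 := by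
    rcases ha with ha | ha
    · exact ⟨b, hb, by simp [ha]⟩
    · rcases hb with hb | hb
      · exact ⟨a, .inr ha, by simp [hb]⟩
      · obtain ⟨ab, h, e⟩ := exists_append ha hb
        exact ⟨ab, .inr h, e⟩
  obtain ⟨ab, h, e⟩ := hab
  obtain ⟨z, hz, hz'⟩ := T.exists_comp_eq_tubeOf F.isIrrFamily (uEquiv_irrObj_append e).symm hx hy
  refine ⟨ab, z, h, by rw [e, List.length_append, hla, hlb]; ring, hz, ?_⟩
  rw [Annular.block_mul_block, hz']

/-- If `c = r a` with two letters in `a`, the rotated word is `a r`. Then `a` followed by `c` and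
the rotated word followed by `a` are both `a r a`, so the two products are unitarily equivalent. -/
theorem exists_isArrow_rotPerm (c : weightW I I') :
    ∃ v : AnnularW T, IsArrow T 1 c (rotPerm I I' c) v := by
  obtain ⟨a, r, ha, hl, h₁, h₂⟩ := exists_rotPerm_eq c
  obtain ⟨ac, -, e⟩ := exists_append ha c.2
  have e' : ac.1 = (rotPerm I I' c).1.1 ++ a.1 := by
    rw [e, h₁, h₂, List.append_assoc]
  obtain ⟨x, hx⟩ := (uEquiv_irrObj_append e).trans (uEquiv_irrObj_append e').symm
  exact ⟨_, a, x, .inr ha, hl, hx, rfl⟩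

/-- The nontrivial summands of `a ⊗ ā` carry no annuli by `loop_eq_zero`; for empty `a` there are no
such summands, for reasons of length. -/
theorem IsArrow.mul_star (F : IsFreeData I I') {n : ℕ} {c d : weightW I I'} {v : AnnularW T}
    (hv : IsArrow T n c d v) : v * star v = oneW T d := by
  classical
  obtain ⟨a, x, ha, -, hx, rfl⟩ := hv
  rw [Annular.star_block, Annular.block_mul_block,
    T.comp_sharp_self F.isIrrFamily isUnitary_nilHom hx]
  · rfl
  · intro e he ht
    rcases ha with ha | ha
    · obtain ⟨t, ht⟩ := ht
      have := (F.fuses ht).length_le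
      rw [F.length_bar T, ha] at this
      exact absurd (Subtype.ext (List.length_eq_zero_iff.1 (by simpa using this))) he
    · exact F.loop_eq_zero T ha d.2 e he ht

theorem IsArrow.star_mul (F : IsFreeData I I') {n : ℕ} {c d : weightW I I'} {v : AnnularW T}
    (hv : IsArrow T n c d v) : star v * v = oneW T c := by
  classical
  obtain ⟨a, x, ha, -, hx, rfl⟩ := hv
  rw [Annular.star_block, Annular.block_mul_block,
    T.sharp_self_comp F.isIrrFamily isUnitary_nilHom hx]
  · rfl
  · intro e he ht
    rcases ha with ha | ha
    · obtain ⟨t, ht⟩ := ht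
      have := (F.fuses ht).length_le
      rw [F.length_bar T, ha] at this
      exact absurd (Subtype.ext (List.length_eq_zero_iff.1 (by simpa using this))) he
    · exact F.loop_eq_zero' T ha c.2 e he ht

theorem star_star_annular (F : IsFreeData I I') (x : AnnularW T) : star (star x) = x := by
  classical
  induction x using Annular.block_induction with
  | zero => rw [Annular.star_zero', Annular.star_zero']
  | add x y hx hy => simp only [Annular.star_add', hx, hy]
  | of b c f => rw [Annular.star_block, Annular.star_block, T.sharpHom_sharpHom F.isIrrFamily]

variable (T) in
/-- The arrow from `c` to `rotPerm c`. -/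
def step (c : weightW I I') : AnnularW T := (exists_isArrow_rotPerm (T := T) c).choose

theorem isArrow_step (c : weightW I I') : IsArrow T 1 c (rotPerm I I' c) (step T c) :=
  (exists_isArrow_rotPerm (T := T) c).choose_spec

theorem isShift_step (F : IsFreeData I I') :
    Annular.IsShift (nilHom I I') (rotPerm I I') (step T) fun c => star (step T c) where
  fwd c := by
    obtain ⟨a, x, -, -, -, h⟩ := isArrow_step (T := T) c
    exact ⟨_, h⟩
  bwd c := by
    classical
    obtain ⟨a, x, -, -, -, h⟩ := isArrow_step (T := T) c
    refine ⟨_, (congrArg star h).trans (Annular.star_block _ _ _)⟩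
  mul_inv c := (isArrow_step c).mul_star F
  inv_mul c := (isArrow_step c).star_mul F

/-- The arrow from `c` to `rotPerm ^ k c`. -/
def arrowW (F : IsFreeData I I') (T : AnnularChoice (irrObj I I')) (k : ℤ) (c : weightW I I') :
    AnnularW T :=
  (isShift_step (T := T) F).power F.isIrrFamily isUnitary_nilHom k c

variable (F : IsFreeData I I')

open scoped Classical in
theorem arrowW_mul_arrowW (k l : ℤ) (c d : weightW I I') : arrowW F T k d * arrowW F T l c =
    if d = (rotPerm I I' ^ l) c then arrowW F T (k + l) c else 0 := by
  refine ((isShift_step F).power_mul_power F.isIrrFamily isUnitary_nilHom k l c d).trans ?_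
  congr 1

theorem isArrow_arrowW (n : ℕ) (c : weightW I I') :
    IsArrow T n c ((rotPerm I I' ^ n) c) (arrowW F T n c) := by
  classical
  induction n with
  | zero => exact isArrow_oneW c
  | succ n ih =>
    have h := (isArrow_step (T := T) ((rotPerm I I' ^ n) c)).mul F ih
    have e : step T ((rotPerm I I' ^ n) c) = arrowW F T 1 ((rotPerm I I' ^ n) c) :=
      ((isShift_step F).power_one _ _ _).symm
    rw [e, arrowW_mul_arrowW, zpow_natCast, if_pos rfl, add_comm 1 n, add_comm (1 : ℤ) n] at h
    rw [pow_succ', Equiv.Perm.mul_apply]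
    exact_mod_cast h

/-- Inverses are unique: the image under `#` is inverse to the arrow `(n, c)` by `IsArrow.mul_star`,
and the arrow of length `-n` is inverse to it by the multiplication rule. -/
theorem star_arrowW_natCast (n : ℕ) (c : weightW I I') :
    star (arrowW F T n c) = arrowW F T (-n) ((rotPerm I I' ^ n) c) := by
  classical
  have h := isArrow_arrowW (T := T) F n c
  have e₁ : oneW T c = arrowW F T (-n) ((rotPerm I I' ^ n) c) * arrowW F T n c := by
    rw [arrowW_mul_arrowW, zpow_natCast, if_pos rfl, neg_add_cancel]
    rfl
  have e₂ : arrowW F T (-n) ((rotPerm I I' ^ n) c) =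
      arrowW F T (-n) ((rotPerm I I' ^ n) c) * oneW T ((rotPerm I I' ^ n) c) := by
    change _ = _ * arrowW F T 0 ((rotPerm I I' ^ n) c)
    rw [arrowW_mul_arrowW, zpow_zero, Equiv.Perm.one_apply, if_pos rfl, add_zero]
  have e₃ : oneW T c * star (arrowW F T n c) = star (arrowW F T n c) := by
    obtain ⟨a, x, -, -, -, hx⟩ := h
    rw [hx, Annular.star_block]
    exact Annular.one_mul_block F.isIrrFamily isUnitary_nilHom _ _ _
  rw [← e₃, e₁, Annular.mul_assoc' F.isIrrFamily, h.mul_star F, ← e₂]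

/-- A negative arrow is the image under `#` of a positive one, and `#` is involutive. -/
theorem star_arrowW (k : ℤ) (c : weightW I I') :
    star (arrowW F T k c) = arrowW F T (-k) ((rotPerm I I' ^ k) c) := by
  obtain ⟨n, rfl | rfl⟩ := k.eq_nat_or_neg
  · rw [star_arrowW_natCast, zpow_natCast]
  · have h := star_arrowW_natCast (T := T) F n ((rotPerm I I' ^ (-n : ℤ)) c)
    have e : (rotPerm I I' ^ n) ((rotPerm I I' ^ (-n : ℤ)) c) = c := by
      rw [zpow_neg, zpow_natCast]
      exact (rotPerm I I' ^ n).apply_symm_apply c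
    rw [e] at h
    rw [← h, star_star_annular F, neg_neg]

end

/-! ## The arrows form a basis -/

namespace Annular

variable {E : Type u} [Category.{v} E] [Preadditive E] [Linear ℂ E] [MonoidalCategory E]
  [MonoidalPreadditive E] [MonoidalLinear ℂ E] [DaggerMonoidal E] {ι : Type w} {irr : ι → E}
  {κ : Type w'} {T : AnnularChoice irr} {wt : κ → E}

/-- The component in `E(irr a ⊗ wt p.1, wt p.2 ⊗ irr a)`. -/
def coord (T : AnnularChoice irr) (wt : κ → E) (p : κ × κ) (a : ι) :
    Annular T wt →ₗ[ℂ] (irr a ⊗ wt p.1 ⟶ wt p.2 ⊗ irr a) :=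
  (DirectSum.component ℂ ι (fun a => (irr a ⊗ wt p.1 ⟶ wt p.2 ⊗ irr a)) a).comp (comp T wt p)

open scoped Classical in
theorem coord_block (b c : κ) (a : ι) (x : irr a ⊗ wt b ⟶ wt c ⊗ irr a) :
    coord T wt (b, c) a (block T wt b c (tubeOf irr _ _ a x)) = x := by
  rw [coord, LinearMap.comp_apply, comp_block]
  exact DirectSum.component.lof_self _ _ _

open scoped Classical in
theorem coord_block_of_ne {b c : κ} {p : κ × κ} {a a' : ι} (h : (b, c) = p → a' ≠ a)
    (x : irr a' ⊗ wt b ⟶ wt c ⊗ irr a') :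
    coord T wt p a (block T wt b c (tubeOf irr _ _ a' x)) = 0 := by
  rw [coord, LinearMap.comp_apply]
  by_cases hp : (b, c) = p
  · subst hp
    rw [comp_block]
    exact (DirectSum.component.of ℂ (M := fun a => (irr a ⊗ wt b ⟶ wt c ⊗ irr a))
      a a' x).trans (dif_neg (h rfl))
  · rw [comp_block_of_ne hp, map_zero]

-- Members with the same source lie over different annular words, so different members lie in
-- different direct summands.
open scoped Classical in
theorem linearIndependent_of_coord {X : Type*} (b c : X → κ) (a : X → ι)
    (x : ∀ i, irr (a i) ⊗ wt (b i) ⟶ wt (c i) ⊗ irr (a i)) (hx : ∀ i, x i ≠ 0)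
    (inj : ∀ i j, b i = b j → a i = a j → i = j) :
    LinearIndependent ℂ fun i => block T wt (b i) (c i) (tubeOf irr _ _ (a i) (x i)) := by
  rw [linearIndependent_iff']
  intro s g hg i hi
  have h := congrArg (coord T wt (b i, c i) (a i)) hg
  rw [map_sum, map_zero, Finset.sum_eq_single i, map_smul, coord_block] at h
  · exact (smul_eq_zero.1 h).resolve_right (hx i)
  · intro j _ hj
    rw [map_smul, coord_block_of_ne, smul_zero]
    intro h₁ h₂
    rw [Prod.mk.injEq] at h₁
    exact hj (inj j i h₁.1 h₂)
  · exact fun h => absurd hi h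

end Annular

section

variable {C : Type u₁} [Category.{v₁} C] [Preadditive C] [Linear ℂ C]
  [MonoidalCategory C] [MonoidalPreadditive C] [MonoidalLinear ℂ C] [DaggerMonoidal C]
  {D : Type u₂} [Category.{v₂} D] [Preadditive D] [Linear ℂ D]
  [MonoidalCategory D] [MonoidalPreadditive D] [MonoidalLinear ℂ D] [DaggerMonoidal D]
  {I : Set C} {I' : Set D} {T : AnnularChoice (irrObj I I')}

theorem exists_append_of_nil_or_mem {a b : AltWord I I'} (ha : a.1 = [] ∨ a ∈ weightW I I')
    (hb : b ∈ weightW I I') : ∃ c : AltWord I I', c.1 = a.1 ++ b.1 := by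
  rcases ha with ha | ha
  · exact ⟨b, by simp [ha]⟩
  · obtain ⟨c, -, h⟩ := exists_append ha hb
    exact ⟨c, h⟩

theorem lastType_ne_of_nil_or_mem {a : AltWord I I'} (ha : a.1 = [] ∨ a ∈ weightW I I') :
    lastType a.1 ≠ some true := by
  rcases ha with ha | ha
  · simp [ha, lastType]
  · rw [(mem_weightW_iff.1 ha).2]
    simp

theorem IsIrrFamily.isUnitary_ne_zero {E : Type u} [Category.{v} E] [Preadditive E] [Linear ℂ E]
    [MonoidalCategory E] [MonoidalPreadditive E] [MonoidalLinear ℂ E] [DaggerMonoidal E]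
    {ι : Type w} {irr : ι → E} (h : IsIrrFamily irr) {i : ι} {X Y : E} (e : UEquiv X (irr i))
    {x : X ⟶ Y} (hx : IsUnitary x) : x ≠ 0 := by
  obtain ⟨s, hs⟩ := e
  rintro rfl
  apply h.ne_zero i
  have h₁ := hx.1
  rw [Limits.zero_comp] at h₁
  rw [← hs.2, ← Category.id_comp s, ← h₁, Limits.zero_comp, Limits.comp_zero]

theorem IsIrrFamily.eq_smul_of_isUnitary {E : Type u} [Category.{v} E] [Preadditive E]
    [Linear ℂ E] [MonoidalCategory E] [MonoidalPreadditive E] [MonoidalLinear ℂ E]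
    [DaggerMonoidal E] {ι : Type w} {irr : ι → E} (h : IsIrrFamily irr) {i : ι} {X Y : E}
    (e : UEquiv X (irr i)) {x : X ⟶ Y} (hx : IsUnitary x) (f : X ⟶ Y) : ∃ z : ℂ, f = z • x := by
  obtain ⟨s, hs⟩ := e
  obtain ⟨z, hz⟩ := h.schur (s† ≫ f ≫ x† ≫ s)
  refine ⟨z, ?_⟩
  calc f = (s ≫ s†) ≫ f ≫ x† ≫ (s ≫ s†) ≫ x := by
        rw [hs.1, Category.id_comp, Category.id_comp, hx.2, Category.comp_id]
    _ = s ≫ (s† ≫ f ≫ x† ≫ s) ≫ s† ≫ x := by simp only [Category.assoc]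
    _ = z • x := by
        rw [hz, Linear.smul_comp, Category.id_comp, Linear.comp_smul, ← Category.assoc, hs.1,
          Category.id_comp]

-- The integer `k` can be read off from the annular word `a`: its length is `2 |k|`, and it begins
-- in `D` exactly for negative `k`, since it is then conjugate to a word in `W`.
open scoped Classical in
theorem exists_arrowW_eq (F : IsFreeData I I') (k : ℤ) (c : weightW I I') :
    ∃ (d : weightW I I') (a : AltWord I I')
      (x : irrObj I I' a ⊗ irrObj I I' c.1 ⟶ irrObj I I' d.1 ⊗ irrObj I I' a),
      arrowW F T k c = Annular.block T _ c d (tubeOf (irrObj I I') _ _ a x) ∧ x ≠ 0 ∧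
      a.1.length = 2 * k.natAbs ∧ (k < 0 ↔ headType a.1 = some false) := by
  by_cases hk : 0 ≤ k
  · lift k to ℕ using hk
    obtain ⟨a, x, ha, hl, hx, h⟩ := isArrow_arrowW (T := T) F k c
    obtain ⟨ac, e⟩ := exists_append_of_nil_or_mem ha c.2
    refine ⟨_, a, x, h, F.isIrrFamily.isUnitary_ne_zero (uEquiv_irrObj_append e) hx, hl, ?_⟩
    rcases ha with ha | ha
    · simp [ha, headType]
    · simp [(mem_weightW_iff.1 ha).1]
  · obtain ⟨n, rfl⟩ : ∃ n : ℕ, k = -n := ⟨k.natAbs, by omega⟩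
    have hs := star_arrowW_natCast (T := T) F n ((rotPerm I I' ^ (-n : ℤ)) c)
    have e : (rotPerm I I' ^ n) ((rotPerm I I' ^ (-n : ℤ)) c) = c := by
      rw [zpow_neg, zpow_natCast]
      exact (rotPerm I I' ^ n).apply_symm_apply c
    rw [e] at hs
    obtain ⟨a, x, ha, hl, hx, h⟩ := isArrow_arrowW (T := T) F n ((rotPerm I I' ^ (-n : ℤ)) c)
    obtain ⟨ac, e'⟩ := exists_append_of_nil_or_mem ha ((rotPerm I I' ^ (-n : ℤ)) c).2
    have hx' := F.isIrrFamily.isUnitary_ne_zero (uEquiv_irrObj_append e') hx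
    -- The weight `c` occurs in the type of `x` as the end point of an arrow that starts at its
    -- inverse rotation, so it is rewritten with `x` generalized.
    revert x
    rw [e]
    intro x hx h hx'
    refine ⟨_, T.bar a, T.sharp a _ _ x, ?_, sharp_ne_zero T hx', ?_, ?_⟩
    · rw [← hs, h, Annular.star_block, T.sharpHom_tubeOf]
      rfl
    · rw [F.length_bar T, hl]
      simp
    · have ha' := ha.resolve_left (by intro h'; rw [h'] at hl; simp at hl; omega)
      rw [F.headType_bar T, (mem_weightW_iff.1 ha').2]
      simp only [iff_true]
      omega

theorem linearIndependent_arrowW (F : IsFreeData I I') :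
    LinearIndependent ℂ fun i : ℤ × weightW I I' => arrowW F T i.1 i.2 := by
  classical
  choose d a x h hx hl hh using fun i : ℤ × weightW I I' => exists_arrowW_eq (T := T) F i.1 i.2
  have inj : ∀ i j : ℤ × weightW I I', i.2 = j.2 → a i = a j → i = j := by
    intro i j h₁ h₂
    refine Prod.ext ?_ h₁
    have h₃ := hl i
    have h₄ := hh i
    rw [h₂, hl j] at h₃
    rw [h₂, ← hh j] at h₄
    omega
  have key := Annular.linearIndependent_of_coord (T := T)
    (wt := fun l : weightW I I' => irrObj I I' l.1) (fun i : ℤ × weightW I I' => i.2) d a x hx inj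
  have e : (fun i : ℤ × weightW I I' => arrowW F T i.1 i.2) = _ := funext h
  rw [e]
  exact key

-- By `ab = ca` the word `a` has the same length and satisfies the same kind of equation as the
-- annular word of the arrow from `b` of length half that of `a`. So the words agree, hence also the
-- weights, and the morphism space is spanned by the unitary of the arrow.
open scoped Classical in
theorem block_mem_span (F : IsFreeData I I') {b c : weightW I I'} {a : AltWord I I'}
    (f : irrObj I I' a ⊗ irrObj I I' b.1 ⟶ irrObj I I' c.1 ⊗ irrObj I I' a)
    (ha : lastType a.1 ≠ some true) (hf : f ≠ 0) :
    Annular.block T (fun l : weightW I I' => irrObj I I' l.1) b c (tubeOf (irrObj I I') _ _ a f) ∈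
      Submodule.span ℂ (Set.range fun i : ℤ × weightW I I' => arrowW F T i.1 i.2) := by
  obtain ⟨ha', e⟩ := F.append_eq_append b.2 c.2 ha hf
  have hn : Even a.1.length := by
    rcases ha' with ha' | ha'
    · simp [ha']
    · exact ha'.1
  obtain ⟨n, hn⟩ := hn
  obtain ⟨a', x, hx₁, hl, hx, h⟩ := isArrow_arrowW (T := T) F n b
  obtain ⟨ab, e₁⟩ := exists_append_of_nil_or_mem hx₁ b.2
  have hx' := F.isIrrFamily.isUnitary_ne_zero (uEquiv_irrObj_append e₁) hx
  have e' := (F.append_eq_append b.2 (Subtype.mem _) (lastType_ne_of_nil_or_mem hx₁) hx').2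
  obtain rfl : a = a' := Subtype.ext
    (eq_of_append_eq_append (ne_nil_of_mem_weightW b.2) e e' (by rw [hn, hl, two_mul]))
  obtain rfl : c = (rotPerm I I' ^ n) b :=
    Subtype.ext (Subtype.ext (List.append_cancel_right (e.symm.trans e')))
  obtain ⟨z, rfl⟩ := F.isIrrFamily.eq_smul_of_isUnitary (uEquiv_irrObj_append e₁) hx f
  rw [map_smul, map_smul, ← h]
  exact Submodule.smul_mem _ _ (Submodule.subset_span ⟨(n, b), rfl⟩)

theorem star_mem_span (F : IsFreeData I I') {x : AnnularW T}
    (hx : x ∈ Submodule.span ℂ (Set.range fun i : ℤ × weightW I I' => arrowW F T i.1 i.2)) :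
    star x ∈ Submodule.span ℂ (Set.range fun i : ℤ × weightW I I' => arrowW F T i.1 i.2) := by
  induction hx using Submodule.span_induction with
  | mem x hx =>
    obtain ⟨i, rfl⟩ := hx
    exact Submodule.subset_span ⟨(_, _), (star_arrowW F i.1 i.2).symm⟩
  | zero => rw [Annular.star_zero']; exact Submodule.zero_mem _
  | add x y _ _ hx hy => rw [Annular.star_add']; exact Submodule.add_mem _ hx hy
  | smul z x _ hx => rw [Annular.star_smul']; exact Submodule.smul_mem _ _ hx

theorem span_arrowW (F : IsFreeData I I') :
    ⊤ ≤ Submodule.span ℂ (Set.range fun i : ℤ × weightW I I' => arrowW F T i.1 i.2) := by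
  classical
  rintro x -
  induction x using Annular.block_induction with
  | zero => exact Submodule.zero_mem _
  | add x y hx hy => exact Submodule.add_mem _ hx hy
  | of b c f =>
  induction f using tube_induction with
  | zero => rw [map_zero]; exact Submodule.zero_mem _
  | add x y hx hy => rw [map_add]; exact Submodule.add_mem _ hx hy
  | of a f =>
    by_cases hf : f = 0
    · rw [hf, map_zero, map_zero]
      exact Submodule.zero_mem _
    by_cases ha : lastType a.1 = some true
    -- If `a` ends in `C`, pass to `f^#`: its word ends with the type of the first letter of `a`,
    -- which is not `C` by `headType_ne`.
    · rw [← star_star_annular F (Annular.block T _ b c _), Annular.star_block, T.sharpHom_tubeOf]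
      refine star_mem_span F (block_mem_span F (T.sharp a _ _ f) ?_ (sharp_ne_zero T hf))
      rw [F.lastType_bar T]
      exact F.headType_ne b.2 c.2 ha hf
    · exact block_mem_span F f ha hf

/-- The arrows as a basis of the annular algebra. -/
def basisW (F : IsFreeData I I') (T : AnnularChoice (irrObj I I')) :
    Module.Basis (ℤ × weightW I I') ℂ (AnnularW T) :=
  Module.Basis.mk (linearIndependent_arrowW F) (span_arrowW F)

theorem basisW_apply (F : IsFreeData I I') (k : ℤ) (c : weightW I I') :
    basisW F T (k, c) = arrowW F T k c := by
  rw [basisW, Module.Basis.mk_apply]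

/-- The involution as a conjugate linear map. -/
def Annular.starₛₗ {E : Type u} [Category.{v} E] [Preadditive E] [Linear ℂ E] [MonoidalCategory E]
    [MonoidalPreadditive E] [MonoidalLinear ℂ E] [DaggerMonoidal E] {ι : Type w} {irr : ι → E}
    {κ : Type w'} (T : AnnularChoice irr) (wt : κ → E) :
    Annular T wt →ₛₗ[starRingEnd ℂ] Annular T wt where
  toFun x := star x
  map_add' := Annular.star_add'
  map_smul' := Annular.star_smul'

theorem IsFreeData.nonempty_starAlgEquiv (F : IsFreeData I I')
    (T : AnnularChoice (irrObj I I')) :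
    Nonempty (AnnularW T ≃⋆ₐ[ℂ] MatZSum (classCard (I := I) (I' := I'))) := by
  classical
  obtain ⟨c₀, h₁, h₂, h₃⟩ := exists_orbit_representatives (rotPerm I I') (cyclicSetoid I I')
    cyclicSetoid_iff exists_rotPerm_pow_eq
  refine nonempty_starAlgEquiv_matZSum (rotPerm I I') h₁ h₂ h₃ (Annular.mulₗ T _)
    (fun _ _ => rfl) (Annular.starₛₗ T _) (fun _ => rfl) (basisW F T) ?_ ?_
  · intro k l c d
    rw [basisW_apply, basisW_apply, basisW_apply, arrowW_mul_arrowW]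
    congr 1
  · intro k c
    rw [basisW_apply, basisW_apply, star_arrowW]

end

end FreeTube

end

theorem mainTheorem6
    {C : Type u₁} [Category.{v₁} C] [Preadditive C] [Linear ℂ C] [MonoidalCategory C]
    [MonoidalPreadditive C] [MonoidalLinear ℂ C] [FreeTube.DaggerMonoidal C]
    {D : Type u₂} [Category.{v₂} D] [Preadditive D] [Linear ℂ D] [MonoidalCategory D]
    [MonoidalPreadditive D] [MonoidalLinear ℂ D] [FreeTube.DaggerMonoidal D]
    (hC : FreeTube.IsRigidCStarTensor C) (hD : FreeTube.IsRigidCStarTensor D)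
    (I : Set C) (hI : FreeTube.IsNonunitIrr I) (I' : Set D) (hI' : FreeTube.IsNonunitIrr I') :
    Nonempty (FreeTube.AnnularChoice (FreeTube.irrObj I I')) ∧
    ∀ T : FreeTube.AnnularChoice (FreeTube.irrObj I I'),
      FreeTube.IsDirectSummand (FreeTube.inclW T) ∧
      Nonempty (FreeTube.AnnularW T ≃⋆ₐ[ℂ]
        FreeTube.MatZSum (FreeTube.classCard (I := I) (I' := I'))) := by
  have F : FreeTube.IsFreeData I I' := ⟨hC, hD, hI, hI'⟩
  exact ⟨FreeTube.exists_annularChoice F.isIrrFamily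
    (FreeTube.exists_normConj_irrObj hC hD hI hI'),
    fun T => ⟨F.isDirectSummand T, F.nonempty_starAlgEquiv T⟩⟩
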